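/- **Problem.** There are $M\ge 1$ clients. Client $m$ has sample objectives $f^{(m)}(x,y;\xi)$, $\xi\sim\mathcal D_f^{(m)}$, and $g^{(m)}(x,y;\xi)$, $\xi\sim\mathcal D_g^{(m)}$, on $\mathbb R^p\times\mathbb R^d$, measurable and integrable in $\xi$. Put $f^{(m)}=\mathbb E f^{(m)}(\cdot;\xi)$, $g^{(m)}=\mathbb E g^{(m)}(\cdot;\xi)$, $y^{(m)}_x=\arg\min_y g^{(m)}(x,y)$ and $$h(x)=\frac1M\sum_{m=1}^M f^{(m)}(x,y_x^{(m)}).$$ **Assumptions.** 1. Every $f^{(m)}(\cdot;\xi)$ is $C^1$ and $L$-smooth with $\|\nabla f^{(m)}(\cdot;\xi)\|\le C_f$. 2. Every $g^{(m)}(\cdot;\xi)$ is $C^2$, $L$-smooth, $\mu$-strongly convex in $y$ ($0<\mu\le L$), and $\nabla_{xy}g^{(m)}(\cdot;\xi)$, $\nabla_{y^2}g^{(m)}(\cdot;\xi)$ are Lipschitz with constants $L_{xy}$, $L_{y^2}$. 3. $\nabla f^{(m)}(z;\xi)$, $\nabla g^{(m)}(z;\xi)$, $\nabla_{y^2}g^{(m)}(z;\xi)$,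 $\nabla_{xy}g^{(m)}(z;\xi)$ are unbiased for the corresponding derivatives of $f^{(m)},g^{(m)}$, with variance at most $\sigma^2$, $\sigma>0$. 4. For all clients $m,j$ and all $z=(x,y)$: $\|\nabla f^{(m)}(z)-\nabla f^{(j)}(z)\|\le\zeta_f$, $\|\nabla_{xy}g^{(m)}(z)-\nabla_{xy}g^{(j)}(z)\|\le\zeta_{g,xy}$, $\|\nabla_{y^2}g^{(m)}(z)-\nabla_{y^2}g^{(j)}(z)\|\le\zeta_{g,yy}$ and $\|y_x^{(m)}-y_x^{(j)}\|\le\zeta_{g^*}$. Let $\kappa=L/\mu$. **Algorithm (FedBiOAcc-Local).** For $\xi_x=(\xi_f,\xi_g,\xi_1,\dots,\xi_Q)$ with independent entries, $\xi_f\sim\mathcal D^{(m)}_f$ and the others $\sim\mathcal D^{(m)}_g$, the hypergradient estimator is $$\Phi^{(m)}(x,y;\xi_x)=\nabla_xf^{(m)}(x,y;\xi_f)-\tau\nabla_{xy}g^{(m)}(x,y;\xi_g)\sum_{q=-1}^{Q-1}\prod_{j=Q-q}^{Q}\bigl(\mathrm{Id}-\tau\nabla_{y^2}g^{(m)}(x,y;\xi_j)\bigr)\nabla_yf^{(m)}(x,y;\xi_f),$$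 and $\Phi^{(m)}(\cdot;\mathcal B)$, $\nabla_yg^{(m)}(\cdot;\mathcal B)$ are minibatch means. All samples are independent over time, clients and batch elements. Start with $x^{(m)}_1=x_1$, $y^{(m)}_1=y_1$, $\omega_1^{(m)}=\nabla_yg^{(m)}(x_1,y_1;\mathcal B_y)$, $\nu_1^{(m)}=\frac1M\sum_{j}\Phi^{(j)}(x_1,y_1;\mathcal B_x^{(j)})$. For $t=1,2,\dots$ put $y^{(m)}_{t+1}=y^{(m)}_t-\gamma\alpha_t\omega^{(m)}_t$, $\hat x^{(m)}_{t+1}=x^{(m)}_t-\eta\alpha_t\nu_t^{(m)}$, and $x^{(m)}_{t+1}=\frac1M\sum_j\hat x^{(j)}_{t+1}$ if $I\mid t$, $x^{(m)}_{t+1}=\hat x^{(m)}_{t+1}$ otherwise; then, with fresh batches, $$\omega^{(m)}_{t+1}=\nabla_yg^{(m)}(x^{(m)}_{t+1},y^{(m)}_{t+1};\mathcal B_y)+(1-c_\omega\alpha_t^2)\bigl(\omega^{(m)}_t-\nabla_yg^{(m)}(x^{(m)}_t,y^{(m)}_t;\mathcal B_y)\bigr),$$ $$\hat\nu^{(m)}_{t+1}=\Phi^{(m)}(x^{(m)}_{t+1},y^{(m)}_{t+1};\mathcal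 B_x)+(1-c_\nu\alpha_t^2)\bigl(\nu^{(m)}_t-\Phi^{(m)}(x^{(m)}_t,y^{(m)}_t;\mathcal B_x)\bigr),$$ and $\nu^{(m)}_{t+1}=\frac1M\sum_j\hat\nu^{(j)}_{t+1}$ if $I\mid t$, $\nu^{(m)}_{t+1}=\hat\nu^{(m)}_{t+1}$ otherwise. Let $\bar x_t=\frac1M\sum_mx_t^{(m)}$. The batch sizes are $|\mathcal B_x|=b\ge1$, $|\mathcal B_y|=bM$, except for the first batches, which have sizes $b_1$ and $b_1M$ with $b_1\ge\kappa^{7/3}bI^{3/2}$. **Parameters.** $\hat L=\max\bigl(1,\;L+\frac{L^2}{\mu}+\frac{L_{xy}C_f}{\mu}+\frac{LL_{y^2}C_f}{\mu^2}\bigr)$, $\bar L=(1+\kappa)\hat L$, $c_\nu=\frac{32}{9bM}+\frac{\hat L}{24Ib^2M^2}$, $c_\omega=\frac{144L^2}{bM\mu^2}+\frac{\hat L}{24Ib^2M^2}$, $\bar u=\max\bigl(2,16^3I^{9/2}\hat L,c_\nu^{3/2},c_\omega^{3/2}\bigr)$, $u=(bM\sigma)^2\bar u$, $\delta=(bM\sigma)^{2/3}/\hat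 L^{2/3}$, $\alpha_t=\delta/(u+\sigma^2t)^{1/3}$, $C_1=\frac{\kappa^2}{64}+\frac{648\kappa^2\hat L^2}{\mu^2\gamma^2}+18\hat L^2$, $$\eta_{\max}=\min\Bigl(\frac{\mu\gamma}{144\kappa\hat L},\frac{\hat L^2}{\kappa c_\nu},\frac{\hat L^2}{C_1^{1/2}c_\nu},\frac1{C_1^{1/2}},\frac{\hat L}{C_1^{1/2}},\frac1{2\bar L},1\Bigr).$$ For a fixed $c\in(0,1)$ the step sizes satisfy $\frac{c}{2L}\le\gamma\le\frac1{2L}$ and $c\,\eta_{\max}\le\eta<\eta_{\max}$, and $0<\tau<1/L$. Let $G_1=\kappa(1-\tau\mu)^{Q+1}C_f$. The initial point satisfies $h(x_1)-\inf h\le\Delta$ and $\frac1M\sum_m\|y_1-y^{(m)}_{x_1}\|^2\le\Delta_y/\kappa$. **Theorem.** Below, "constant" means a number that depends only on $c$, $L$, $C_f$, $L_{xy}$, $L_{y^2}$, $\sigma$, $\zeta_f$, $\zeta_{g,xy}$, $\zeta_{g,yy}$, $\zeta_{g^*}$, $\Delta$, $\Delta_y$ (and, in (ii), on $A$). (i)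 $h$ is differentiable, every $\|\nabla h(\bar x_t)\|^2$ is integrable, and there is a constant $C$ such that for all $T\ge1$ $$\frac1T\sum_{t=1}^{T-1}\mathbb E\|\nabla h(\bar x_t)\|^2\le C\Bigl(\log(T+1)\Bigl(\frac{\kappa^{19/3}I^{3/2}}{T}+\frac{\kappa^{16/3}}{(bMT)^{2/3}}\Bigr)+\kappa^3b^2M^2I^{9/2}G_1^2\Bigr).$$ (ii) For every $A>0$ there is a constant $C$ such that for every $\varepsilon>0$ with $bM\varepsilon\le\frac12$: if $\tau\ge c/L$, $1\le I\le A\,\kappa^{10/9}(bM)^{-2/3}\varepsilon^{-1/3}$, $Q\ge C\kappa\log\frac{\kappa}{bM\varepsilon}$ and $T\ge C\kappa^8(bM)^{-1}\varepsilon^{-3/2}\bigl(\log\frac\kappa\varepsilon\bigr)^{3/2}$, then $\frac1T\sum_{t=1}^{T-1}\mathbb E\|\nabla h(\bar x_t)\|^2\le\varepsilon$. So, up to the logarithmic factor in $T$, an $\varepsilon$-stationary point is reached with $T=O(\kappa^8(bM)^{-1}\varepsilon^{-3/2})$, $I=O(\kappa^{10/9}(bM)^{-2/3}\varepsilon^{-1/3})$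 and $Q=O(\kappa\log\frac\kappa{bM\varepsilon})$. -/

import Mathlib

open MeasureTheory ProbabilityTheory

namespace FedBiOAccLocal

noncomputable section

/-- `ℝⁿ` with the Euclidean norm. -/
abbrev E (n : ℕ) := EuclideanSpace ℝ (Fin n)

/-! ### Differential calculus of functions of two vector variables -/

/-- The point `(x, y)` of `ℝᵖ × ℝᵈ` with the Euclidean norm. -/
def pair {p d : ℕ} (x : E p) (y : E d) : WithLp 2 (E p × E d) := WithLp.toLp 2 (x, y)

/-- `∇ₓ φ(x, y)`. -/
def gradX {p d : ℕ} (φ : E p → E d → ℝ) (x : E p) (y : E d) : E p :=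
  gradient (fun x' => φ x' y) x

/-- `∇_y φ(x, y)`. -/
def gradY {p d : ℕ} (φ : E p → E d → ℝ) (x : E p) (y : E d) : E d :=
  gradient (fun y' => φ x y') y

/-- The full gradient `∇φ(x, y) = (∇ₓ φ, ∇_y φ)`. -/
def fullGrad {p d : ℕ} (φ : E p → E d → ℝ) (x : E p) (y : E d) : WithLp 2 (E p × E d) :=
  pair (gradX φ x y) (gradY φ x y)

/-- `∇_{y²} φ(x, y)`, as an operator on `ℝᵈ`. -/
def hessYY {p d : ℕ} (φ : E p → E d → ℝ) (x : E p) (y : E d) : E d →L[ℝ] E d :=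
  fderiv ℝ (fun y' => gradY φ x y') y

/-- `∇_{xy} φ(x, y)`, the `p × d` matrix `(∂²φ / ∂xᵢ∂yⱼ)`, as an operator `ℝᵈ → ℝᵖ`. -/
def jacXY {p d : ℕ} (φ : E p → E d → ℝ) (x : E p) (y : E d) : E d →L[ℝ] E p :=
  fderiv ℝ (fun y' => gradX φ x y') y

/-- `A` is a Lipschitz function of `(x, y)` with constant `K`, for the Euclidean norm on pairs. -/
def PairLipschitz {p d : ℕ} {F : Type*} [NormedAddCommGroup F] (K : ℝ)
    (A : E p → E d → F) : Prop :=
  ∀ x y x' y', ‖A x y - A x' y'‖ ≤ K * ‖pair x y - pair x' y'‖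

/-- A global minimizer of `φ` (an arbitrary point if there is none). -/
def argminPt {d : ℕ} (φ : E d → ℝ) : E d := Classical.epsilon fun y => ∀ y', φ y ≤ φ y'

/-! ### The problem -/

/-- The constants that are not tracked in the rate: smoothness, gradient bound, Lipschitz constants
of `∇_{xy} g` and `∇_{y²} g`, noise level, the four heterogeneity constants (`ζstar` is the one for
the lower-level minimizers), the initial gap of `h` and the initial lower-level error. -/
structure Constants where
  (L Cf Lxy Lyy σ ζf ζxy ζyy ζstar Δ Δy : ℝ)

structure Constants.Valid (K : Constants) : Prop where
  L_pos : 0 < K.L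
  Cf_nonneg : 0 ≤ K.Cf
  Lxy_nonneg : 0 ≤ K.Lxy
  Lyy_nonneg : 0 ≤ K.Lyy
  σ_pos : 0 < K.σ

/-- The data of a federated bilevel problem with `M` clients and local lower-level problems:
for client `m` the sample objectives `f⁽ᵐ⁾(x, y; ξ)`, `g⁽ᵐ⁾(x, y; ξ)` and the distributions
of their samples. -/
structure Problem (p d M : ℕ) (Ξf Ξg : Type*) [MeasurableSpace Ξf] [MeasurableSpace Ξg] where
  F : Fin M → Ξf → E p → E d → ℝ
  G : Fin M → Ξg → E p → E d → ℝ
  Df : Fin M → Measure Ξf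
  Dg : Fin M → Measure Ξg

namespace Problem

variable {p d M : ℕ} {Ξf Ξg : Type*} [MeasurableSpace Ξf] [MeasurableSpace Ξg]

/-- `f⁽ᵐ⁾(x, y) = 𝔼 f⁽ᵐ⁾(x, y; ξ)`. -/
def f (P : Problem p d M Ξf Ξg) (m : Fin M) (x : E p) (y : E d) : ℝ := ∫ ξ, P.F m ξ x y ∂(P.Df m)

/-- `g⁽ᵐ⁾(x, y) = 𝔼 g⁽ᵐ⁾(x, y; ξ)`. -/
def g (P : Problem p d M Ξf Ξg) (m : Fin M) (x : E p) (y : E d) : ℝ := ∫ ξ, P.G m ξ x y ∂(P.Dg m)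

/-- `y_x⁽ᵐ⁾ = argmin_y g⁽ᵐ⁾(x, y)`. -/
def yStar (P : Problem p d M Ξf Ξg) (m : Fin M) (x : E p) : E d := argminPt (P.g m x)

/-- `h(x) = (1/M) ∑ₘ f⁽ᵐ⁾(x, y_x⁽ᵐ⁾)`. -/
def h (P : Problem p d M Ξf Ξg) (x : E p) : ℝ := (1 / (M : ℝ)) * ∑ m, P.f m x (P.yStar m x)

end Problem

/-! ### Assumptions -/

/-- `S` is an unbiased oracle for `s` under `D`, with variance at most `σ²`. -/
def UnbiasedOracle {Ξ : Type*} [MeasurableSpace Ξ] {F : Type*} [NormedAddCommGroup F]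
    [NormedSpace ℝ F] (D : Measure Ξ) (S : Ξ → F) (s : F) (σ : ℝ) : Prop :=
  Integrable S D ∧ ∫ ξ, S ξ ∂D = s ∧
    Integrable (fun ξ => ‖S ξ - s‖ ^ 2) D ∧ ∫ ξ, ‖S ξ - s‖ ^ 2 ∂D ≤ σ ^ 2

/-- An upper-level objective: `L`-smooth with gradient bounded by `C_f`. -/
structure UpperRegular {p d : ℕ} (K : Constants) (φ : E p → E d → ℝ) : Prop where
  contDiff : ContDiff ℝ 1 fun z : E p × E d => φ z.1 z.2
  smooth : PairLipschitz K.L (fullGrad φ)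
  grad_le : ∀ x y, ‖fullGrad φ x y‖ ≤ K.Cf

/-- A lower-level objective: `μ`-strongly convex in `y`, `L`-smooth, twice continuously
differentiable, with Lipschitz `∇_{xy}` and `∇_{y²}`. -/
structure LowerRegular {p d : ℕ} (K : Constants) (μ : ℝ) (φ : E p → E d → ℝ) : Prop where
  contDiff : ContDiff ℝ 2 fun z : E p × E d => φ z.1 z.2
  strongConvex : ∀ x, StrongConvexOn Set.univ μ (φ x)
  smooth : PairLipschitz K.L (fullGrad φ)
  lip_xy : PairLipschitz K.Lxy (jacXY φ)
  lip_yy : PairLipschitz K.Lyy (hessYY φ)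

/-- The standing assumptions on the problem. -/
structure Assumptions {p d M : ℕ} {Ξf Ξg : Type*} [MeasurableSpace Ξf] [MeasurableSpace Ξg]
    (K : Constants) (μ : ℝ) (P : Problem p d M Ξf Ξg) : Prop where
  probF : ∀ m, IsProbabilityMeasure (P.Df m)
  probG : ∀ m, IsProbabilityMeasure (P.Dg m)
  measF : ∀ m x y, Measurable fun ξ => P.F m ξ x y
  measG : ∀ m x y, Measurable fun ξ => P.G m ξ x y
  intF : ∀ m x y, Integrable (fun ξ => P.F m ξ x y) (P.Df m)
  intG : ∀ m x y, Integrable (fun ξ => P.G m ξ x y) (P.Dg m)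
  upper : ∀ m ξ, UpperRegular K (P.F m ξ)
  lower : ∀ m ξ, LowerRegular K μ (P.G m ξ)
  oracle_f : ∀ m x y,
    UnbiasedOracle (P.Df m) (fun ξ => fullGrad (P.F m ξ) x y) (fullGrad (P.f m) x y) K.σ
  oracle_g : ∀ m x y,
    UnbiasedOracle (P.Dg m) (fun ξ => fullGrad (P.G m ξ) x y) (fullGrad (P.g m) x y) K.σ
  oracle_yy : ∀ m x y,
    UnbiasedOracle (P.Dg m) (fun ξ => hessYY (P.G m ξ) x y) (hessYY (P.g m) x y) K.σ
  oracle_xy : ∀ m x y,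
    UnbiasedOracle (P.Dg m) (fun ξ => jacXY (P.G m ξ) x y) (jacXY (P.g m) x y) K.σ
  het_f : ∀ m j x y, ‖fullGrad (P.f m) x y - fullGrad (P.f j) x y‖ ≤ K.ζf
  het_xy : ∀ m j x y, ‖jacXY (P.g m) x y - jacXY (P.g j) x y‖ ≤ K.ζxy
  het_yy : ∀ m j x y, ‖hessYY (P.g m) x y - hessYY (P.g j) x y‖ ≤ K.ζyy
  het_star : ∀ m j x, ‖P.yStar m x - P.yStar j x‖ ≤ K.ζstar

/-! ### Parameters of the algorithm -/

/-- Number of clients `M`, minibatch size `b`, first batch size `b₁`, number of local steps `I`,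
length `Q` of the Neumann series; strong convexity modulus `μ`; step sizes `γ`, `η`; parameter `τ`
of the Neumann series. -/
structure Config where
  (M b b₁ I Q : ℕ)
  (μ γ η τ : ℝ)

/-- Condition number `κ = L / μ`. -/
def kappa (K : Constants) (s : Config) : ℝ := K.L / s.μ

/-- `L̂`, a Lipschitz constant of `Φ⁽ᵐ⁾` and of its stochastic estimator, of order `κ²`. -/
def Lhat (K : Constants) (s : Config) : ℝ :=
  max 1 (K.L + K.L ^ 2 / s.μ + K.Lxy * K.Cf / s.μ + K.L * K.Lyy * K.Cf / s.μ ^ 2)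

/-- `L̄`, a Lipschitz constant of `∇h`, of order `κ³`. -/
def Lbar (K : Constants) (s : Config) : ℝ := (1 + kappa K s) * Lhat K s

/-- `bM` as a real number. -/
def bM (s : Config) : ℝ := (s.b : ℝ) * (s.M : ℝ)

def cNu (K : Constants) (s : Config) : ℝ :=
  32 / (9 * bM s) + Lhat K s / (24 * (s.I : ℝ) * bM s ^ 2)

def cOmega (K : Constants) (s : Config) : ℝ :=
  144 * K.L ^ 2 / (bM s * s.μ ^ 2) + Lhat K s / (24 * (s.I : ℝ) * bM s ^ 2)

def uBar (K : Constants) (s : Config) : ℝ :=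
  max (max 2 (16 ^ 3 * (s.I : ℝ) ^ (9 / 2 : ℝ) * Lhat K s))
    (max (cNu K s ^ (3 / 2 : ℝ)) (cOmega K s ^ (3 / 2 : ℝ)))

def uConst (K : Constants) (s : Config) : ℝ := (bM s * K.σ) ^ 2 * uBar K s

def delta (K : Constants) (s : Config) : ℝ :=
  (bM s * K.σ) ^ (2 / 3 : ℝ) / Lhat K s ^ (2 / 3 : ℝ)

/-- The learning rate `α_t = δ / (u + σ² t)^{1/3}`. -/
def alpha (K : Constants) (s : Config) (t : ℕ) : ℝ :=
  delta K s / (uConst K s + K.σ ^ 2 * (t : ℝ)) ^ (1 / 3 : ℝ)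

def C1 (K : Constants) (s : Config) : ℝ :=
  kappa K s ^ 2 / 64 + 648 * kappa K s ^ 2 * Lhat K s ^ 2 / (s.μ ^ 2 * s.γ ^ 2)
    + 9 * Lhat K s ^ 2 + 9 * Lhat K s ^ 2

/-- The upper limit for the step size `η`. -/
def etaMax (K : Constants) (s : Config) : ℝ :=
  min (s.μ * s.γ / (144 * kappa K s * Lhat K s))
    (min (Lhat K s ^ 2 / (kappa K s * cNu K s))
      (min (Lhat K s ^ 2 / (Real.sqrt (C1 K s) * cNu K s))
        (min (1 / Real.sqrt (C1 K s))
          (min (Lhat K s / Real.sqrt (C1 K s))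
            (min (1 / (2 * Lbar K s)) 1)))))

/-- The bias bound `G₁ = κ (1 - τμ)^{Q+1} C_f` of the Neumann-series estimator. -/
def G1 (K : Constants) (s : Config) : ℝ := kappa K s * (1 - s.τ * s.μ) ^ (s.Q + 1) * K.Cf

/-- The admissible parameters. The number `c ∈ (0, 1)` says how far below their upper limits
the step sizes `γ` and `η` may be. -/
structure Config.Admissible (K : Constants) (c : ℝ) (s : Config) : Prop where
  M_pos : 1 ≤ s.M
  b_pos : 1 ≤ s.b
  I_pos : 1 ≤ s.I
  b₁_ge : kappa K s ^ (7 / 3 : ℝ) * (s.b : ℝ) * (s.I : ℝ) ^ (3 / 2 : ℝ) ≤ (s.b₁ : ℝ)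
  μ_pos : 0 < s.μ
  μ_le : s.μ ≤ K.L
  γ_ge : c * (1 / (2 * K.L)) ≤ s.γ
  γ_le : s.γ ≤ 1 / (2 * K.L)
  η_ge : c * etaMax K s ≤ s.η
  η_lt : s.η < etaMax K s
  τ_pos : 0 < s.τ
  τ_lt : s.τ < 1 / K.L

/-! ### The samples -/

/-- The samples of `g⁽ᵐ⁾` that are drawn: at time `t`, client `m`, batch element `i`, those for the
lower-level gradient, and those for `∇_{xy} g` and (for `j = 1, …, Q`) for `∇_{y²} g` in the
hypergradient estimator. -/
inductive GIndex (M : ℕ) where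
  | lower (t : ℕ) (m : Fin M) (i : ℕ)
  | jac (t : ℕ) (m : Fin M) (i : ℕ)
  | hess (t : ℕ) (m : Fin M) (i j : ℕ)

/-- The client that draws the sample. -/
def GIndex.client {M : ℕ} : GIndex M → Fin M
  | .lower _ m _ => m
  | .jac _ m _ => m
  | .hess _ m _ _ => m

/-- All samples are mutually independent, and those of client `m` have the laws `D_f⁽ᵐ⁾` and
`D_g⁽ᵐ⁾`. A sample of `f⁽ᵐ⁾` is indexed by time, client and batch element. -/
structure IsSampling {p d M : ℕ} {Ξf Ξg Ω : Type*} [MeasurableSpace Ξf] [MeasurableSpace Ξg]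
    [MeasurableSpace Ω] (P : Problem p d M Ξf Ξg) (Pr : Measure Ω)
    (ξf : ℕ × Fin M × ℕ → Ω → Ξf) (ξg : GIndex M → Ω → Ξg) : Prop where
  meas_f : ∀ i, Measurable (ξf i)
  meas_g : ∀ i, Measurable (ξg i)
  law_f : ∀ i, Measure.map (ξf i) Pr = P.Df i.2.1
  law_g : ∀ i, Measure.map (ξg i) Pr = P.Dg i.client
  indep_f : iIndepFun ξf Pr
  indep_g : iIndepFun ξg Pr
  indep_fg : IndepFun (fun ω i => ξf i ω) (fun ω i => ξg i ω) Pr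

/-! ### The algorithm -/

section Algorithm

variable {p d : ℕ} {Ξf Ξg : Type*} [MeasurableSpace Ξf] [MeasurableSpace Ξg]

/-- `∏_{j = Q-k+1}^{Q} (1 - τ ∇_{y²} g(x, y; ξ_j))` (`k` factors, `j` increasing from left to
right; the empty product is the identity). -/
def neumannProd (τ : ℝ) (Q : ℕ) (G : Ξg → E p → E d → ℝ) (ξH : ℕ → Ξg) (x : E p) (y : E d)
    (k : ℕ) : E d →L[ℝ] E d :=
  ((List.range k).map fun i => 1 - τ • hessYY (G (ξH (Q - k + 1 + i))) x y).prod

/-- The Neumann-series hypergradient estimator for one sample `ξ_x = (ξ_f, ξ_g, ξ_1, …, ξ_Q)`: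
`∇ₓ f(x, y; ξ_f) - τ ∇_{xy} g(x, y; ξ_g) ∑_{q=-1}^{Q-1} ∏_{j=Q-q}^{Q} (1 - τ ∇_{y²} g(x, y; ξ_j))
∇_y f(x, y; ξ_f)`, with `k = q + 1`. -/
def hyperEst (τ : ℝ) (Q : ℕ) (F : Ξf → E p → E d → ℝ) (G : Ξg → E p → E d → ℝ)
    (ξF : Ξf) (ξG : Ξg) (ξH : ℕ → Ξg) (x : E p) (y : E d) : E p :=
  gradX (F ξF) x y -
    τ • jacXY (G ξG) x y
      (∑ k ∈ Finset.range (Q + 1), neumannProd τ Q G ξH x y k (gradY (F ξF) x y))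

/-- Minibatch lower-level gradient `∇_y g⁽ᵐ⁾(x, y; 𝓑_y)` with `n` samples drawn at time `t`. -/
def lowerBatch (s : Config) (P : Problem p d s.M Ξf Ξg) (sg : GIndex s.M → Ξg)
    (n t : ℕ) (m : Fin s.M) (x : E p) (y : E d) : E d :=
  (1 / (n : ℝ)) • ∑ i ∈ Finset.range n, gradY (P.G m (sg (.lower t m i))) x y

/-- Minibatch hypergradient estimator `Φ⁽ᵐ⁾(x, y; 𝓑_x)` with `n` samples drawn at time `t`. -/
def hyperBatch (s : Config) (P : Problem p d s.M Ξf Ξg) (sf : ℕ × Fin s.M × ℕ → Ξf)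
    (sg : GIndex s.M → Ξg) (n t : ℕ) (m : Fin s.M) (x : E p) (y : E d) : E p :=
  (1 / (n : ℝ)) • ∑ i ∈ Finset.range n,
    hyperEst s.τ s.Q (P.F m) (P.G m) (sf (t, m, i)) (sg (.jac t m i))
      (fun j => sg (.hess t m i j)) x y

/-- The state `(x⁽ᵐ⁾, y⁽ᵐ⁾, ω⁽ᵐ⁾, ν⁽ᵐ⁾)` of all clients. -/
structure State (p d M : ℕ) where
  x : Fin M → E p
  y : Fin M → E d
  om : Fin M → E d
  nu : Fin M → E p

/-- Server average `(1/M) ∑ₘ vₘ`. -/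
def avg {M : ℕ} (v : Fin M → E p) : E p := (1 / (M : ℝ)) • ∑ m, v m

/-- FedBiOAcc-Local for one realization `sf`, `sg` of the samples. `run … n` is the state at time
`t = n + 1`. The batch sizes are `b` for the hypergradient and `b M` for the lower-level gradient,
except at time `1`, where they are `b₁` and `b₁ M`; the initial hypergradient momentum
is averaged over the clients. -/
def run (K : Constants) (s : Config) (P : Problem p d s.M Ξf Ξg)
    (sf : ℕ × Fin s.M × ℕ → Ξf) (sg : GIndex s.M → Ξg) (x₁ : E p) (y₁ : E d) :
    ℕ → State p d s.M
  | 0 =>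
    { x := fun _ => x₁
      y := fun _ => y₁
      om := fun m => lowerBatch s P sg (s.b₁ * s.M) 1 m x₁ y₁
      nu := fun _ => avg fun m => hyperBatch s P sf sg s.b₁ 1 m x₁ y₁ }
  | n + 1 =>
    let S := run K s P sf sg x₁ y₁ n
    let t := n + 1
    let a := alpha K s t
    let y' : Fin s.M → E d := fun m => S.y m - (s.γ * a) • S.om m
    let xh : Fin s.M → E p := fun m => S.x m - (s.η * a) • S.nu m
    let x' : Fin s.M → E p := fun m => if t % s.I = 0 then avg xh else xh m
    let om' : Fin s.M → E d := fun m =>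
      lowerBatch s P sg (s.b * s.M) (t + 1) m (x' m) (y' m) +
        (1 - cOmega K s * a ^ 2) •
          (S.om m - lowerBatch s P sg (s.b * s.M) (t + 1) m (S.x m) (S.y m))
    let nuh : Fin s.M → E p := fun m =>
      hyperBatch s P sf sg s.b (t + 1) m (x' m) (y' m) +
        (1 - cNu K s * a ^ 2) •
          (S.nu m - hyperBatch s P sf sg s.b (t + 1) m (S.x m) (S.y m))
    { x := x'
      y := y'
      om := om'
      nu := fun m => if t % s.I = 0 then avg nuh else nuh m }

/-- `‖∇h(x̄_t)‖²` at time `t = n + 1`, for one realization of the samples. -/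
def gradSq (K : Constants) (s : Config) (P : Problem p d s.M Ξf Ξg)
    (sf : ℕ × Fin s.M × ℕ → Ξf) (sg : GIndex s.M → Ξg) (x₁ : E p) (y₁ : E d) (n : ℕ) : ℝ :=
  ‖gradient P.h (avg (run K s P sf sg x₁ y₁ n).x)‖ ^ 2

/-- `(1/T) ∑_{t=1}^{T-1} 𝔼 ‖∇h(x̄_t)‖²`. -/
def avgGradSq {Ω : Type*} [MeasurableSpace Ω] (K : Constants) (s : Config)
    (P : Problem p d s.M Ξf Ξg) (Pr : Measure Ω) (ξf : ℕ × Fin s.M × ℕ → Ω → Ξf)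
    (ξg : GIndex s.M → Ω → Ξg) (x₁ : E p) (y₁ : E d) (T : ℕ) : ℝ :=
  (1 / (T : ℝ)) * ∑ n ∈ Finset.range (T - 1),
    ∫ ω, gradSq K s P (fun i => ξf i ω) (fun i => ξg i ω) x₁ y₁ n ∂Pr

/-- Initialization: `h(x₁) - inf h ≤ Δ`, and the initial lower-level error is `O(1/κ)`. -/
structure GoodInit (K : Constants) (s : Config) (P : Problem p d s.M Ξf Ξg)
    (x₁ : E p) (y₁ : E d) : Prop where
  gap : ∀ x, P.h x₁ - P.h x ≤ K.Δ
  lower : (1 / (s.M : ℝ)) * ∑ m, ‖y₁ - P.yStar m x₁‖ ^ 2 ≤ K.Δy / kappa K s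

end Algorithm

end

end FedBiOAccLocal

open FedBiOAccLocal

namespace FedBiOAccLocal

open scoped RealInnerProductSpace

/-! ### Partial gradients, Taylor bounds and second derivatives in two vector variables -/

section Calculus

variable {p d : ℕ}

/-! The gradient of `h` at `x` is the client average of the hypergradients `hypGrad` at the points
`(x, y_x⁽ᵐ⁾)`, and it is Lipschitz. The mean momentum `avg ν` differs from `∇h(x̄)` for three
reasons: the error `errNu` of the momentum; the use of wrong points, measured by the client drift
`devX` and the lower-level error `errY`; and the truncation of the Neumann series, which costs at
most `G1`. A descent step for `h` therefore gains `ηα/2 ‖∇h(x̄)‖²` and a multiple of `‖avg ν‖²`, up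
to these errors (`h_next_le`).

Each error obeys its own recursion. In the momentum updates the same batch is evaluated at two
consecutive points, so apart from a part of size `(cα²)²` the fresh noise is a difference whose
variance is controlled by the squared displacement. Independence over batches and clients divides it
by `bM`, and independence from the past removes all cross terms. The lower-level error contracts by
a factor `1 - γμα/4`. The drifts vanish at every synchronization and grow in between by factors `1 +
1/I`, so over one round they grow by a bounded factor.

All this is combined in one potential: the expectation of `h` plus weighted expectations of `errY`,
`errOm`, `errNu`, `devX` and `devNu`. The momentum errors are weighted by `1/α`. The drifts carry a
further weight which decreases geometrically within a round, so that its decrease pays for their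
growth. The weights are chosen so that every error charged by one inequality is paid by the decay of
another (`potential_step`). What remains is `-ηα/2 ‖∇h‖²`, the bias `3/2 ηα G1²` and a noise term of
order `ηα³`.

After summation, `α³ = O(1/t)` makes the noise logarithmic, and `∑ α ≤ 3/2 T α_T` means that
division by `T α_T` leaves the bias unamplified. The initial potential and the noise are of order
`κ⁴` after division by `η`, and `1/α_T` is at most of order `κ^{4/3} (κ I^{3/2} + T^{1/3}
(bM)^{-2/3})`. The product gives the exponents `19/3` and `16/3`. Part (ii) solves this rate for `T`
and lets `Q` make the bias small.

On the analytic side, no expectation is differentiated under the integral sign: Taylor and convexity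
inequalities are proved for the samples and then integrated. The map `x ↦ y_x` is not differentiated
either. It is only Lipschitz here, and expanding the equation `∇_y g(x, y_x) = 0` to first order
gives an expansion of `h` with quadratic remainder (`abs_value_taylor_le`), which suffices for its
gradient. -/

theorem norm_pair_sq (x : E p) (y : E d) : ‖pair x y‖ ^ 2 = ‖x‖ ^ 2 + ‖y‖ ^ 2 := by
  simp [pair, WithLp.prod_norm_sq_eq_of_L2]

theorem pair_sub_pair (x x' : E p) (y y' : E d) :
    pair x y - pair x' y' = pair (x - x') (y - y') := rfl

theorem norm_pair_sub_sq (x x' : E p) (y y' : E d) :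
    ‖pair x y - pair x' y'‖ ^ 2 = ‖x - x'‖ ^ 2 + ‖y - y'‖ ^ 2 := by
  rw [pair_sub_pair, norm_pair_sq]

theorem norm_le_norm_pair_left (x : E p) (y : E d) : ‖x‖ ≤ ‖pair x y‖ := by
  have := norm_pair_sq x y
  exact le_of_sq_le_sq (by nlinarith [sq_nonneg ‖y‖]) (norm_nonneg _)

theorem norm_le_norm_pair_right (x : E p) (y : E d) : ‖y‖ ≤ ‖pair x y‖ := by
  have := norm_pair_sq x y
  exact le_of_sq_le_sq (by nlinarith [sq_nonneg ‖x‖]) (norm_nonneg _)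

theorem inner_pair (x x' : E p) (y y' : E d) : ⟪pair x y, pair x' y'⟫ = ⟪x, x'⟫ + ⟪y, y'⟫ := by
  simp [pair, WithLp.prod_inner_apply]

theorem norm_pair_zero_right (x : E p) : ‖pair x (0 : E d)‖ = ‖x‖ := by
  have := norm_pair_sq x (0 : E d)
  rw [norm_zero, zero_pow two_ne_zero, add_zero] at this
  exact (pow_left_inj₀ (norm_nonneg _) (norm_nonneg _) two_ne_zero).1 this

theorem norm_pair_zero_left (y : E d) : ‖pair (0 : E p) y‖ = ‖y‖ := by
  have := norm_pair_sq (0 : E p) y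
  rw [norm_zero, zero_pow two_ne_zero, zero_add] at this
  exact (pow_left_inj₀ (norm_nonneg _) (norm_nonneg _) two_ne_zero).1 this

/-- First-order Taylor bound on `[0, 1]` for a curve with Lipschitz velocity. -/
theorem norm_sub_sub_le_of_deriv_lipschitz {F : Type*} [NormedAddCommGroup F] [NormedSpace ℝ F]
    {ψ ψ' : ℝ → F} {K : ℝ} (h : ∀ t, HasDerivAt ψ (ψ' t) t)
    (hK : ∀ t ∈ Set.Icc (0 : ℝ) 1, ‖ψ' t - ψ' 0‖ ≤ K * t) :
    ‖ψ 1 - ψ 0 - ψ' 0‖ ≤ K / 2 := by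
  have hf : ∀ t, HasDerivAt (fun t => ψ t - ψ 0 - t • ψ' 0) (ψ' t - ψ' 0) t := fun t => by
    simpa using ((h t).sub_const (ψ 0)).fun_sub ((hasDerivAt_id t).smul_const (ψ' 0))
  have hB : ∀ t, HasDerivAt (fun t : ℝ => K * t ^ 2 / 2) (K * t) t := fun t => by
    refine (((hasDerivAt_pow 2 t).const_mul K).div_const 2).congr_deriv ?_
    simp only [Nat.cast_ofNat, Nat.add_one_sub_one, pow_one]; ring
  have := image_norm_le_of_norm_deriv_right_le_deriv_boundary (a := (0 : ℝ)) (b := 1)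
    (f := fun t => ψ t - ψ 0 - t • ψ' 0) (f' := fun t => ψ' t - ψ' 0)
    (B := fun t => K * t ^ 2 / 2) (B' := fun t => K * t)
    (fun t _ => (hf t).continuousAt.continuousWithinAt) (fun t _ => (hf t).hasDerivWithinAt)
    (by simp) hB (fun t ht => hK t ⟨ht.1, ht.2.le⟩) (Set.right_mem_Icc.2 zero_le_one)
  simpa using this

variable {φ : E p → E d → ℝ}

/-- The plain product carries the sup norm, whereas Lipschitz constants are measured with `pair`.
Differentiability does not see the difference, so partial gradients can be read off from the total
derivative on the plain product. -/
theorem fderiv_apply_left (hφ : Differentiable ℝ fun z : E p × E d => φ z.1 z.2) (x : E p) (y : E d)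
    (v : E p) : fderiv ℝ (fun z : E p × E d => φ z.1 z.2) (x, y) (v, 0) = ⟪gradX φ x y, v⟫ := by
  have h1 : HasFDerivAt (fun x' => φ x' y)
      ((fderiv ℝ (fun z : E p × E d => φ z.1 z.2) (x, y)).comp
        ((ContinuousLinearMap.id ℝ (E p)).prod 0)) x :=
    ((hφ (x, y)).hasFDerivAt).comp (f := fun x' : E p => (x', y)) x
      ((hasFDerivAt_id x).prodMk (hasFDerivAt_const y x))
  rw [gradX, (hasFDerivAt_iff_hasGradientAt.1 h1).gradient, InnerProductSpace.toDual_symm_apply]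
  simp

theorem fderiv_apply_right (hφ : Differentiable ℝ fun z : E p × E d => φ z.1 z.2)
    (x : E p) (y : E d) (v : E d) :
    fderiv ℝ (fun z : E p × E d => φ z.1 z.2) (x, y) (0, v) = ⟪gradY φ x y, v⟫ := by
  have h1 : HasFDerivAt (fun y' => φ x y')
      ((fderiv ℝ (fun z : E p × E d => φ z.1 z.2) (x, y)).comp
        ((0 : E d →L[ℝ] E p).prod (ContinuousLinearMap.id ℝ (E d)))) y :=
    ((hφ (x, y)).hasFDerivAt).comp (f := fun y' : E d => (x, y')) y
      ((hasFDerivAt_const x y).prodMk (hasFDerivAt_id y))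
  rw [gradY, (hasFDerivAt_iff_hasGradientAt.1 h1).gradient, InnerProductSpace.toDual_symm_apply]
  simp

theorem hasDerivAt_line (x dx : E p) (y dy : E d) (t : ℝ) :
    HasDerivAt (fun t : ℝ => (x + t • dx, y + t • dy)) (dx, dy) t := by
  have h1 : HasDerivAt (fun t : ℝ => x + t • dx) dx t := by
    simpa using ((hasDerivAt_id t).smul_const dx).const_add x
  have h2 : HasDerivAt (fun t : ℝ => y + t • dy) dy t := by
    simpa using ((hasDerivAt_id t).smul_const dy).const_add y
  exact h1.prodMk h2

theorem hasDerivAt_along (hφ : Differentiable ℝ fun z : E p × E d => φ z.1 z.2)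
    (x dx : E p) (y dy : E d) (t : ℝ) :
    HasDerivAt (fun t : ℝ => φ (x + t • dx) (y + t • dy))
      (⟪gradX φ (x + t • dx) (y + t • dy), dx⟫ + ⟪gradY φ (x + t • dx) (y + t • dy), dy⟫) t := by
  refine (((hφ (x + t • dx, y + t • dy)).hasFDerivAt).comp_hasDerivAt t
    (hasDerivAt_line x dx y dy t)).congr_deriv ?_
  rw [← fderiv_apply_left hφ, ← fderiv_apply_right hφ, ← map_add]
  simp

/-- Quadratic remainder bound for a function with Lipschitz gradient. -/
theorem abs_taylor_one_le {L : ℝ} (hφ : Differentiable ℝ fun z : E p × E d => φ z.1 z.2)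
    (hL : PairLipschitz L (fullGrad φ)) (x x' : E p) (y y' : E d) :
    |φ x' y' - φ x y - (⟪gradX φ x y, x' - x⟫ + ⟪gradY φ x y, y' - y⟫)| ≤
      L / 2 * ‖pair x' y' - pair x y‖ ^ 2 := by
  have key := norm_sub_sub_le_of_deriv_lipschitz (K := L * ‖pair x' y' - pair x y‖ ^ 2)
    (hasDerivAt_along hφ x (x' - x) y (y' - y)) ?_
  · simp only [one_smul, add_sub_cancel, zero_smul, add_zero, Real.norm_eq_abs] at key
    linarith
  · intro t ht
    simp only [zero_smul, add_zero]
    have : ⟪gradX φ (x + t • (x' - x)) (y + t • (y' - y)), x' - x⟫ +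
        ⟪gradY φ (x + t • (x' - x)) (y + t • (y' - y)), y' - y⟫ -
        (⟪gradX φ x y, x' - x⟫ + ⟪gradY φ x y, y' - y⟫) =
        ⟪fullGrad φ (x + t • (x' - x)) (y + t • (y' - y)) - fullGrad φ x y,
          pair x' y' - pair x y⟫ := by
      rw [inner_sub_left, pair_sub_pair]; simp only [fullGrad, inner_pair]
    rw [this]
    refine (norm_inner_le_norm _ _).trans ?_
    have h1 := hL (x + t • (x' - x)) (y + t • (y' - y)) x y
    have h2 : ‖pair (x + t • (x' - x)) (y + t • (y' - y)) - pair x y‖ =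
        t * ‖pair x' y' - pair x y‖ := by
      rw [show pair (x + t • (x' - x)) (y + t • (y' - y)) - pair x y =
        t • (pair x' y' - pair x y) by
          rw [pair_sub_pair, pair_sub_pair, add_sub_cancel_left, add_sub_cancel_left]; rfl,
        norm_smul, Real.norm_eq_abs, abs_of_nonneg ht.1]
    rw [h2] at h1
    calc _ ≤ L * (t * ‖pair x' y' - pair x y‖) * ‖pair x' y' - pair x y‖ := by gcongr
      _ = _ := by ring

theorem PairLipschitz.gradX {L : ℝ} (hL : PairLipschitz L (fullGrad φ)) :
    PairLipschitz L (gradX φ) := fun x y x' y' => by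
  refine le_trans ?_ (hL x y x' y')
  exact norm_le_norm_pair_left _ _

theorem PairLipschitz.gradY {L : ℝ} (hL : PairLipschitz L (fullGrad φ)) :
    PairLipschitz L (gradY φ) := fun x y x' y' => by
  refine le_trans ?_ (hL x y x' y')
  exact norm_le_norm_pair_right _ _

theorem PairLipschitz.continuous {F : Type*} [NormedAddCommGroup F] {L : ℝ} {A : E p → E d → F}
    (hL : PairLipschitz L A) : Continuous fun z : E p × E d => A z.1 z.2 := by
  rw [continuous_iff_continuousAt]
  intro z
  rw [ContinuousAt, tendsto_iff_norm_sub_tendsto_zero]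
  have hc : Continuous fun w : E p × E d => L * ‖pair w.1 w.2 - pair z.1 z.2‖ := by
    unfold pair
    exact continuous_const.mul (((WithLp.prod_continuous_toLp 2 _ _).sub continuous_const).norm)
  refine squeeze_zero (fun _ => norm_nonneg _) (fun w => hL w.1 w.2 z.1 z.2) ?_
  simpa using hc.tendsto z

/-! Second derivatives. -/

theorem contDiff_gradX (hφ : ContDiff ℝ 2 fun z : E p × E d => φ z.1 z.2) :
    ContDiff ℝ 1 fun z : E p × E d => gradX φ z.1 z.2 := by
  have hd := hφ.differentiable two_ne_zero
  have : (fun z : E p × E d => gradX φ z.1 z.2) = fun z =>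
      (InnerProductSpace.toDual ℝ (E p)).symm
        ((fderiv ℝ (fun z : E p × E d => φ z.1 z.2) z).comp
          (ContinuousLinearMap.inl ℝ (E p) (E d))) := by
    ext1 z
    rw [LinearIsometryEquiv.eq_symm_apply]
    ext v
    simp [← fderiv_apply_left hd]
  rw [this]
  have h1 := hφ.fderiv_right (m := 1) (by norm_num)
  exact (InnerProductSpace.toDual ℝ (E p)).symm.contDiff.comp (h1.clm_comp contDiff_const)

theorem contDiff_gradY (hφ : ContDiff ℝ 2 fun z : E p × E d => φ z.1 z.2) :
    ContDiff ℝ 1 fun z : E p × E d => gradY φ z.1 z.2 := by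
  have hd := hφ.differentiable two_ne_zero
  have : (fun z : E p × E d => gradY φ z.1 z.2) = fun z =>
      (InnerProductSpace.toDual ℝ (E d)).symm
        ((fderiv ℝ (fun z : E p × E d => φ z.1 z.2) z).comp
          (ContinuousLinearMap.inr ℝ (E p) (E d))) := by
    ext1 z
    rw [LinearIsometryEquiv.eq_symm_apply]
    ext v
    simp [← fderiv_apply_right hd]
  rw [this]
  have h1 := hφ.fderiv_right (m := 1) (by norm_num)
  exact (InnerProductSpace.toDual ℝ (E d)).symm.contDiff.comp (h1.clm_comp contDiff_const)

theorem hasFDerivAt_slice_right {F : Type*} [NormedAddCommGroup F] [NormedSpace ℝ F]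
    {A : E p → E d → F} (hA : Differentiable ℝ fun z : E p × E d => A z.1 z.2) (x : E p) (y : E d) :
    HasFDerivAt (fun y' => A x y')
      ((fderiv ℝ (fun z : E p × E d => A z.1 z.2) (x, y)).comp
        ((0 : E d →L[ℝ] E p).prod (ContinuousLinearMap.id ℝ (E d)))) y :=
  ((hA (x, y)).hasFDerivAt).comp (f := fun y' : E d => (x, y')) y
      ((hasFDerivAt_const x y).prodMk (hasFDerivAt_id y))

theorem hasFDerivAt_jacXY (hφ : ContDiff ℝ 2 fun z : E p × E d => φ z.1 z.2) (x : E p) (y : E d) :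
    HasFDerivAt (fun y' => gradX φ x y') (jacXY φ x y) y :=
  (hasFDerivAt_slice_right ((contDiff_gradX hφ).differentiable one_ne_zero)
    x y).differentiableAt.hasFDerivAt

theorem hasFDerivAt_hessYY (hφ : ContDiff ℝ 2 fun z : E p × E d => φ z.1 z.2) (x : E p) (y : E d) :
    HasFDerivAt (fun y' => gradY φ x y') (hessYY φ x y) y :=
  (hasFDerivAt_slice_right ((contDiff_gradY hφ).differentiable one_ne_zero)
    x y).differentiableAt.hasFDerivAt

/-- Tested against a fixed vector, the derivative of a partial gradient becomes an entry of the
second derivative of `φ`, where symmetry is available. This turns the `x`-derivative of `∇_y φ` into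
the transpose of `jacXY`. -/
theorem inner_fderiv_gradY (hφ : ContDiff ℝ 2 fun z : E p × E d => φ z.1 z.2) (z v : E p × E d)
    (w : E d) : ⟪fderiv ℝ (fun z : E p × E d => gradY φ z.1 z.2) z v, w⟫ =
      fderiv ℝ (fderiv ℝ fun z : E p × E d => φ z.1 z.2) z v (0, w) := by
  have hd := hφ.differentiable two_ne_zero
  have h1 := ((contDiff_gradY hφ).differentiable one_ne_zero z).hasFDerivAt
  have h2 := ((hφ.fderiv_right (m := 1) (by norm_num)).differentiable one_ne_zero z).hasFDerivAt
  have h3 := (h1.inner ℝ (hasFDerivAt_const w z))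
  have h4 := h2.clm_apply (hasFDerivAt_const ((0 : E p), w) z)
  have he : (fun z : E p × E d => ⟪gradY φ z.1 z.2, w⟫) =
      fun z => fderiv ℝ (fun z : E p × E d => φ z.1 z.2) z (0, w) := by
    ext1 z; rw [← fderiv_apply_right hd]
  rw [he] at h3
  have := congrArg (fun T : E p × E d →L[ℝ] ℝ => T v) (h3.unique h4)
  simpa using this

theorem inner_fderiv_gradX (hφ : ContDiff ℝ 2 fun z : E p × E d => φ z.1 z.2) (z v : E p × E d)
    (w : E p) : ⟪fderiv ℝ (fun z : E p × E d => gradX φ z.1 z.2) z v, w⟫ =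
      fderiv ℝ (fderiv ℝ fun z : E p × E d => φ z.1 z.2) z v (w, 0) := by
  have hd := hφ.differentiable two_ne_zero
  have h1 := ((contDiff_gradX hφ).differentiable one_ne_zero z).hasFDerivAt
  have h2 := ((hφ.fderiv_right (m := 1) (by norm_num)).differentiable one_ne_zero z).hasFDerivAt
  have h3 := (h1.inner ℝ (hasFDerivAt_const w z))
  have h4 := h2.clm_apply (hasFDerivAt_const (w, (0 : E d)) z)
  have he : (fun z : E p × E d => ⟪gradX φ z.1 z.2, w⟫) =
      fun z => fderiv ℝ (fun z : E p × E d => φ z.1 z.2) z (w, 0) := by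
    ext1 z; rw [← fderiv_apply_left hd]
  rw [he] at h3
  have := congrArg (fun T : E p × E d →L[ℝ] ℝ => T v) (h3.unique h4)
  simpa using this

theorem hessYY_apply (hφ : ContDiff ℝ 2 fun z : E p × E d => φ z.1 z.2) (x : E p) (y v : E d) :
    hessYY φ x y v = fderiv ℝ (fun z : E p × E d => gradY φ z.1 z.2) (x, y) (0, v) := by
  rw [hessYY, (hasFDerivAt_slice_right
    ((contDiff_gradY hφ).differentiable one_ne_zero) x y).fderiv]
  simp

theorem jacXY_apply (hφ : ContDiff ℝ 2 fun z : E p × E d => φ z.1 z.2) (x : E p) (y v : E d) :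
    jacXY φ x y v = fderiv ℝ (fun z : E p × E d => gradX φ z.1 z.2) (x, y) (0, v) := by
  rw [jacXY, (hasFDerivAt_slice_right
    ((contDiff_gradX hφ).differentiable one_ne_zero) x y).fderiv]
  simp

theorem second_symm (hφ : ContDiff ℝ 2 fun z : E p × E d => φ z.1 z.2) (z v w : E p × E d) :
    fderiv ℝ (fderiv ℝ fun z : E p × E d => φ z.1 z.2) z v w =
      fderiv ℝ (fderiv ℝ fun z : E p × E d => φ z.1 z.2) z w v :=
  (hφ.contDiffAt.isSymmSndFDerivAt (by simp)) v w

theorem hessYY_symm (hφ : ContDiff ℝ 2 fun z : E p × E d => φ z.1 z.2) (x : E p) (y v w : E d) :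
    ⟪hessYY φ x y v, w⟫ = ⟪v, hessYY φ x y w⟫ := by
  rw [real_inner_comm _ v, hessYY_apply hφ, hessYY_apply hφ, inner_fderiv_gradY hφ,
    inner_fderiv_gradY hφ, second_symm hφ]

/-- The derivative of `∇_y φ`, tested against `w`, in terms of `∇_{xy} φ` and `∇_{y²} φ`. -/
theorem inner_fderiv_gradY_eq (hφ : ContDiff ℝ 2 fun z : E p × E d => φ z.1 z.2)
    (x dx : E p) (y dy w : E d) :
    ⟪fderiv ℝ (fun z : E p × E d => gradY φ z.1 z.2) (x, y) (dx, dy), w⟫ =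
      ⟪jacXY φ x y w, dx⟫ + ⟪hessYY φ x y dy, w⟫ := by
  rw [show ((dx, dy) : E p × E d) = (dx, 0) + (0, dy) by simp, map_add, inner_add_left,
    ← hessYY_apply hφ, inner_fderiv_gradY hφ, second_symm hφ, ← inner_fderiv_gradX hφ,
    ← jacXY_apply hφ]

/-- Second-order information enters the gradient of `h` only through this expansion. Testing against
`w` lets `jacXY` act on `w`, so no adjoint is needed, and leaves a scalar inequality that can be
integrated over the samples. -/
theorem abs_inner_gradY_taylor_le {K₁ K₂ : ℝ} (hK₁ : 0 ≤ K₁) (hK₂ : 0 ≤ K₂)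
    (hφ : ContDiff ℝ 2 fun z : E p × E d => φ z.1 z.2)
    (h₁ : PairLipschitz K₁ (jacXY φ)) (h₂ : PairLipschitz K₂ (hessYY φ))
    (x x' : E p) (y y' w : E d) :
    |⟪gradY φ x' y', w⟫ - ⟪gradY φ x y, w⟫ -
        (⟪jacXY φ x y w, x' - x⟫ + ⟪hessYY φ x y (y' - y), w⟫)| ≤
      (K₁ + K₂) * ‖pair x' y' - pair x y‖ ^ 2 * ‖w‖ / 2 := by
  have hd := (contDiff_gradY hφ).differentiable one_ne_zero
  have hder : ∀ t : ℝ, HasDerivAt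
      (fun t : ℝ => ⟪gradY φ (x + t • (x' - x)) (y + t • (y' - y)), w⟫)
      (⟪jacXY φ (x + t • (x' - x)) (y + t • (y' - y)) w, x' - x⟫ +
        ⟪hessYY φ (x + t • (x' - x)) (y + t • (y' - y)) (y' - y), w⟫) t := by
    intro t
    have h1 := ((hd (x + t • (x' - x), y + t • (y' - y))).hasFDerivAt).comp_hasDerivAt t
      (hasDerivAt_line x (x' - x) y (y' - y) t)
    have h2 := h1.inner ℝ (hasDerivAt_const t w)
    rw [inner_fderiv_gradY_eq hφ] at h2
    simpa using h2
  have key := norm_sub_sub_le_of_deriv_lipschitz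
    (K := (K₁ + K₂) * ‖pair x' y' - pair x y‖ ^ 2 * ‖w‖) hder ?_
  · simpa only [one_smul, add_sub_cancel, zero_smul, add_zero, Real.norm_eq_abs] using key
  · intro t ht
    simp only [zero_smul, add_zero]
    set D := ‖pair x' y' - pair x y‖ with hD
    have h2 : ‖pair (x + t • (x' - x)) (y + t • (y' - y)) - pair x y‖ = t * D := by
      rw [show pair (x + t • (x' - x)) (y + t • (y' - y)) - pair x y =
        t • (pair x' y' - pair x y) by
          rw [pair_sub_pair, pair_sub_pair, add_sub_cancel_left, add_sub_cancel_left]; rfl,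
        norm_smul, Real.norm_eq_abs, abs_of_nonneg ht.1]
    have e1 := h₁ (x + t • (x' - x)) (y + t • (y' - y)) x y
    have e2 := h₂ (x + t • (x' - x)) (y + t • (y' - y)) x y
    rw [h2] at e1 e2
    set J1 := jacXY φ (x + t • (x' - x)) (y + t • (y' - y))
    set J0 := jacXY φ x y
    set H1 := hessYY φ (x + t • (x' - x)) (y + t • (y' - y))
    set H0 := hessYY φ x y
    have hx : ‖x' - x‖ ≤ D := by rw [hD, pair_sub_pair]; exact norm_le_norm_pair_left _ _
    have hy : ‖y' - y‖ ≤ D := by rw [hD, pair_sub_pair]; exact norm_le_norm_pair_right _ _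
    have hD0 : 0 ≤ D := norm_nonneg _
    have ht0 := ht.1
    have : ⟪J1 w, x' - x⟫ + ⟪H1 (y' - y), w⟫ - (⟪J0 w, x' - x⟫ + ⟪H0 (y' - y), w⟫) =
        ⟪(J1 - J0) w, x' - x⟫ + ⟪(H1 - H0) (y' - y), w⟫ := by
      simp only [sub_apply, inner_sub_left]; ring
    rw [this]
    calc ‖⟪(J1 - J0) w, x' - x⟫ + ⟪(H1 - H0) (y' - y), w⟫‖
        ≤ ‖(J1 - J0) w‖ * ‖x' - x‖ + ‖(H1 - H0) (y' - y)‖ * ‖w‖ :=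
          (norm_add_le _ _).trans (add_le_add (norm_inner_le_norm _ _) (norm_inner_le_norm _ _))
      _ ≤ (K₁ * (t * D) * ‖w‖) * D + (K₂ * (t * D) * D) * ‖w‖ := by
          gcongr
          · exact (ContinuousLinearMap.le_opNorm _ _).trans (by gcongr)
          · exact (ContinuousLinearMap.le_opNorm _ _).trans (by gcongr)
      _ = _ := by ring

theorem norm_jacXY_le {L : ℝ} (hL0 : 0 ≤ L) (hL : PairLipschitz L (fullGrad φ)) (x : E p) (y : E d) :
    ‖jacXY φ x y‖ ≤ L := by
  refine norm_fderiv_le_of_lip' ℝ hL0 (Filter.Eventually.of_forall fun y' => ?_)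
  have := hL.gradX x y' x y
  rwa [pair_sub_pair, sub_self, norm_pair_zero_left] at this

theorem norm_hessYY_le {L : ℝ} (hL0 : 0 ≤ L) (hL : PairLipschitz L (fullGrad φ))
    (x : E p) (y : E d) : ‖hessYY φ x y‖ ≤ L := by
  refine norm_fderiv_le_of_lip' ℝ hL0 (Filter.Eventually.of_forall fun y' => ?_)
  have := hL.gradY x y' x y
  rwa [pair_sub_pair, sub_self, norm_pair_zero_left] at this

/-- The first-order lower bound for a strongly convex function. -/
theorem strongConvex_lower {μ : ℝ} (hd : Differentiable ℝ fun z : E p × E d => φ z.1 z.2) (x : E p)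
    (hc : StrongConvexOn Set.univ μ (φ x)) (y y' : E d) :
    φ x y + ⟪gradY φ x y, y' - y⟫ + μ / 2 * ‖y' - y‖ ^ 2 ≤ φ x y' := by
  have hder := hasDerivAt_along hd x 0 y (y' - y) 0
  simp only [smul_zero, add_zero, zero_smul, inner_zero_right, zero_add] at hder
  have hslope := hder.tendsto_slope_zero_right
  -- Divided by `t`, the convexity inequality bounds the difference quotient with modulus `(1 - t) μ
  -- / 2`; the limit `t ↓ 0` restores the full modulus.
  have hlim : Filter.Tendsto (fun t : ℝ => φ x y' - φ x y - (1 - t) * (μ / 2 * ‖y' - y‖ ^ 2))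
      (nhdsWithin 0 (Set.Ioi 0)) (nhds (φ x y' - φ x y - (1 - 0) * (μ / 2 * ‖y' - y‖ ^ 2))) := by
    refine (Continuous.tendsto ?_ 0).mono_left nhdsWithin_le_nhds
    fun_prop
  have hle := le_of_tendsto_of_tendsto hslope hlim ?_
  · linarith
  · have h1 : Set.Ioc (0 : ℝ) 1 ∈ nhdsWithin (0 : ℝ) (Set.Ioi 0) := Ioc_mem_nhdsGT one_pos
    filter_upwards [h1] with t ht
    have h2 := hc.2 (Set.mem_univ y) (Set.mem_univ y') (sub_nonneg.2 ht.2) ht.1.le (by ring)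
    have h3 : (1 - t) • y + t • y' = y + t • (y' - y) := by
      simp only [sub_smul, one_smul, smul_sub]; abel
    rw [h3, norm_sub_rev] at h2
    simp only [smul_eq_mul, zero_add, zero_smul, add_zero] at h2 ⊢
    rw [inv_mul_le_iff₀ ht.1]
    linarith

/-- Adding the first-order lower bounds at `y` and at `y + t w` gives strong monotonicity of the
gradient along `w`. The difference quotients of `⟪∇_y φ, w⟫` are thus at least `μ ‖w‖²`, and so is
their limit. -/
theorem inner_hessYY_ge {μ : ℝ} (hφ : ContDiff ℝ 2 fun z : E p × E d => φ z.1 z.2) (x : E p)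
    (hc : StrongConvexOn Set.univ μ (φ x)) (y w : E d) : μ * ‖w‖ ^ 2 ≤ ⟪hessYY φ x y w, w⟫ := by
  have hd := hφ.differentiable two_ne_zero
  have hl : HasDerivAt (fun t : ℝ => y + t • w) w 0 := by
    simpa using ((hasDerivAt_id (0 : ℝ)).smul_const w).const_add y
  have h0 := hasFDerivAt_hessYY hφ x y
  rw [show y = y + (0 : ℝ) • w by simp] at h0
  have hder := (h0.comp_hasDerivAt (0 : ℝ) hl).inner ℝ (hasDerivAt_const (0 : ℝ) w)
  have hslope := hder.tendsto_slope_zero_right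
  simp only [inner_zero_right, zero_smul, add_zero, zero_add] at hslope
  refine ge_of_tendsto hslope ?_
  filter_upwards [self_mem_nhdsWithin] with t ht
  have ht : 0 < t := ht
  have h1 := strongConvex_lower hd x hc y (y + t • w)
  have h2 := strongConvex_lower hd x hc (y + t • w) y
  simp only [add_sub_cancel_left, sub_add_cancel_left, inner_neg_right, norm_neg, norm_smul,
    inner_smul_right, mul_pow, Real.norm_eq_abs, sq_abs, Function.comp_apply] at h1 h2 ⊢
  simp only [zero_smul, add_zero, smul_eq_mul]
  rw [le_inv_mul_iff₀ ht]
  refine le_of_mul_le_mul_left ?_ ht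
  linarith

end Calculus

/-! ### Bounds inherited by expectations -/

section Oracle

variable {Ξ : Type*} [MeasurableSpace Ξ] {D : Measure Ξ}

theorem norm_integral_le_of_forall_norm_le [IsProbabilityMeasure D] {F : Type*}
    [NormedAddCommGroup F] [NormedSpace ℝ F] {u : Ξ → F} {c : ℝ} (h : ∀ ξ, ‖u ξ‖ ≤ c) :
    ‖∫ ξ, u ξ ∂D‖ ≤ c := by
  simpa using norm_integral_le_of_norm_le_const (μ := D) (Filter.Eventually.of_forall h)

variable {F : Type*} [NormedAddCommGroup F] [NormedSpace ℝ F] {S S' : Ξ → F} {s s' : F} {σ c : ℝ}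

theorem UnbiasedOracle.norm_le [IsProbabilityMeasure D] (h : UnbiasedOracle D S s σ)
    (hc : ∀ ξ, ‖S ξ‖ ≤ c) : ‖s‖ ≤ c := by
  rw [← h.2.1]; exact norm_integral_le_of_forall_norm_le hc

theorem UnbiasedOracle.norm_sub_le [IsProbabilityMeasure D] (h : UnbiasedOracle D S s σ)
    (h' : UnbiasedOracle D S' s' σ) (hc : ∀ ξ, ‖S ξ - S' ξ‖ ≤ c) : ‖s - s'‖ ≤ c := by
  rw [← h.2.1, ← h'.2.1, ← integral_sub h.1 h'.1]; exact norm_integral_le_of_forall_norm_le hc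

end Oracle

/-- What the averaged objectives `f`, `g` of one client inherit from the sample objectives. -/
structure MeanRegular {p d : ℕ} (K : Constants) (μ : ℝ) (f g : E p → E d → ℝ) : Prop where
  f_taylor : ∀ x x' y y', |f x' y' - f x y - (⟪gradX f x y, x' - x⟫ + ⟪gradY f x y, y' - y⟫)| ≤
    K.L / 2 * ‖pair x' y' - pair x y‖ ^ 2
  f_lip : PairLipschitz K.L (fullGrad f)
  f_bound : ∀ x y, ‖fullGrad f x y‖ ≤ K.Cf
  g_taylor : ∀ x x' y y', |g x' y' - g x y - (⟪gradX g x y, x' - x⟫ + ⟪gradY g x y, y' - y⟫)| ≤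
    K.L / 2 * ‖pair x' y' - pair x y‖ ^ 2
  g_lip : PairLipschitz K.L (fullGrad g)
  g_lower : ∀ x y y', g x y + ⟪gradY g x y, y' - y⟫ + μ / 2 * ‖y' - y‖ ^ 2 ≤ g x y'
  jac_lip : PairLipschitz K.Lxy (jacXY g)
  hess_lip : PairLipschitz K.Lyy (hessYY g)
  jac_bound : ∀ x y, ‖jacXY g x y‖ ≤ K.L
  hess_bound : ∀ x y, ‖hessYY g x y‖ ≤ K.L
  hess_symm : ∀ x y v w, ⟪hessYY g x y v, w⟫ = ⟪v, hessYY g x y w⟫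
  hess_coercive : ∀ x y w, μ * ‖w‖ ^ 2 ≤ ⟪hessYY g x y w, w⟫
  gradY_taylor : ∀ x x' y y' w, |⟪gradY g x' y', w⟫ - ⟪gradY g x y, w⟫ -
        (⟪jacXY g x y w, x' - x⟫ + ⟪hessYY g x y (y' - y), w⟫)| ≤
      (K.Lxy + K.Lyy) * ‖pair x' y' - pair x y‖ ^ 2 * ‖w‖ / 2

section Mean

variable {p d : ℕ} {Ξ : Type*} [MeasurableSpace Ξ] {D : Measure Ξ}

theorem inner_mean_fullGrad {φ : Ξ → E p → E d → ℝ} {f : E p → E d → ℝ} {σ : ℝ} {x : E p} {y : E d}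
    (h : UnbiasedOracle D (fun ξ => fullGrad (φ ξ) x y) (fullGrad f x y) σ) (v : E p) (w : E d) :
    Integrable (fun ξ => ⟪gradX (φ ξ) x y, v⟫ + ⟪gradY (φ ξ) x y, w⟫) D ∧
    ∫ ξ, (⟪gradX (φ ξ) x y, v⟫ + ⟪gradY (φ ξ) x y, w⟫) ∂D =
      ⟪gradX f x y, v⟫ + ⟪gradY f x y, w⟫ := by
  have e : ∀ ψ : E p → E d → ℝ, ⟪gradX ψ x y, v⟫ + ⟪gradY ψ x y, w⟫ =
      ⟪pair v w, fullGrad ψ x y⟫ := fun ψ => by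
    rw [real_inner_comm (fullGrad ψ x y), fullGrad, inner_pair]
  simp only [e]
  exact ⟨h.1.const_inner _, by rw [← h.2.1, ← integral_inner h.1]⟩

/-- Unbiasedness identifies the gradient of the mean with the mean of the sample gradients, so the
sample inequality can be integrated as it stands. Differentiability of the mean is not needed for
this; for `g` in `y` it is later deduced from this bound. -/
theorem mean_taylor [IsProbabilityMeasure D] {φ : Ξ → E p → E d → ℝ} {L σ : ℝ}
    (hint : ∀ x y, Integrable (fun ξ => φ ξ x y) D)
    (hd : ∀ ξ, Differentiable ℝ fun z : E p × E d => φ ξ z.1 z.2)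
    (hL : ∀ ξ, PairLipschitz L (fullGrad (φ ξ)))
    (ho : ∀ x y, UnbiasedOracle D (fun ξ => fullGrad (φ ξ) x y)
      (fullGrad (fun x y => ∫ ξ, φ ξ x y ∂D) x y) σ) (x x' : E p) (y y' : E d) :
    |(∫ ξ, φ ξ x' y' ∂D) - (∫ ξ, φ ξ x y ∂D) -
      (⟪gradX (fun x y => ∫ ξ, φ ξ x y ∂D) x y, x' - x⟫ +
        ⟪gradY (fun x y => ∫ ξ, φ ξ x y ∂D) x y, y' - y⟫)| ≤
    L / 2 * ‖pair x' y' - pair x y‖ ^ 2 := by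
  obtain ⟨h1, h2⟩ := inner_mean_fullGrad (ho x y) (x' - x) (y' - y)
  rw [← h2, ← integral_sub (hint _ _) (hint _ _),
    ← integral_sub (show Integrable (fun ξ => φ ξ x' y' - φ ξ x y) D from (hint _ _).sub (hint _ _)) h1]
  rw [← Real.norm_eq_abs]
  refine norm_integral_le_of_forall_norm_le fun ξ => ?_
  exact abs_taylor_one_le (hd ξ) (hL ξ) x x' y y'

theorem integral_inner_clm {F₁ F₂ : Type*} [NormedAddCommGroup F₁] [InnerProductSpace ℝ F₁]
    [NormedAddCommGroup F₂] [InnerProductSpace ℝ F₂] [CompleteSpace F₂]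
    {A : Ξ → F₁ →L[ℝ] F₂} {a : F₁ →L[ℝ] F₂} {σ : ℝ}
    (h : UnbiasedOracle D A a σ) (v : F₁) (w : F₂) :
    Integrable (fun ξ => ⟪A ξ v, w⟫) D ∧ ∫ ξ, ⟪A ξ v, w⟫ ∂D = ⟪a v, w⟫ := by
  have h1 : Integrable (fun ξ => A ξ v) D := h.1.apply_continuousLinearMap v
  refine ⟨h1.inner_const w, ?_⟩
  simp_rw [fun u : F₂ => real_inner_comm w u]
  rw [integral_inner h1, ← h.2.1, ContinuousLinearMap.integral_apply h.1]

variable {M : ℕ} {Ξf Ξg : Type*} [MeasurableSpace Ξf] [MeasurableSpace Ξg] {K : Constants} {μ : ℝ}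
  {P : Problem p d M Ξf Ξg}

/-- The mean of `g` is not known to be `C²`. Symmetry and coercivity of its Hessian and the
expansion of its `∇_y` are therefore averages of the sample versions, each linear in the objective
once it is tested against fixed vectors. -/
theorem Assumptions.meanRegular (hK : K.Valid) (hA : Assumptions K μ P) (m : Fin M) :
    MeanRegular K μ (P.f m) (P.g m) := by
  have := hA.probF m
  have := hA.probG m
  have hdF := fun ξ => (hA.upper m ξ).contDiff.differentiable one_ne_zero
  have hdG := fun ξ => (hA.lower m ξ).contDiff.differentiable two_ne_zero
  constructor
  · exact mean_taylor (hA.intF m) hdF (fun ξ => (hA.upper m ξ).smooth) (hA.oracle_f m)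
  · exact fun x y x' y' => (hA.oracle_f m x y).norm_sub_le (hA.oracle_f m x' y')
      fun ξ => (hA.upper m ξ).smooth x y x' y'
  · exact fun x y => (hA.oracle_f m x y).norm_le fun ξ => (hA.upper m ξ).grad_le x y
  · exact mean_taylor (hA.intG m) hdG (fun ξ => (hA.lower m ξ).smooth) (hA.oracle_g m)
  · exact fun x y x' y' => (hA.oracle_g m x y).norm_sub_le (hA.oracle_g m x' y')
      fun ξ => (hA.lower m ξ).smooth x y x' y'
  · intro x y y'
    obtain ⟨h1, h2⟩ := inner_mean_fullGrad (hA.oracle_g m x y) 0 (y' - y)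
    simp only [inner_zero_right, zero_add] at h1 h2
    rw [← h2]
    have h3 : P.g m x y + ∫ ξ, ⟪gradY (P.G m ξ) x y, y' - y⟫ ∂(P.Dg m) + μ / 2 * ‖y' - y‖ ^ 2 =
        ∫ ξ, (P.G m ξ x y + ⟪gradY (P.G m ξ) x y, y' - y⟫ + μ / 2 * ‖y' - y‖ ^ 2) ∂(P.Dg m) := by
      rw [integral_add ((hA.intG m x y).fun_add h1) (integrable_const _),
        integral_add (hA.intG m x y) h1]
      simp [Problem.g]
    rw [h3]
    exact integral_mono (((hA.intG m x y).add h1).add (integrable_const _)) (hA.intG m x y')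
      fun ξ => strongConvex_lower (hdG ξ) x ((hA.lower m ξ).strongConvex x) y y'
  · exact fun x y x' y' => (hA.oracle_xy m x y).norm_sub_le (hA.oracle_xy m x' y')
      fun ξ => (hA.lower m ξ).lip_xy x y x' y'
  · exact fun x y x' y' => (hA.oracle_yy m x y).norm_sub_le (hA.oracle_yy m x' y')
      fun ξ => (hA.lower m ξ).lip_yy x y x' y'
  · exact fun x y => (hA.oracle_xy m x y).norm_le fun ξ =>
      norm_jacXY_le hK.L_pos.le (hA.lower m ξ).smooth x y
  · exact fun x y => (hA.oracle_yy m x y).norm_le fun ξ =>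
      norm_hessYY_le hK.L_pos.le (hA.lower m ξ).smooth x y
  · intro x y v w
    rw [real_inner_comm _ v, ← (integral_inner_clm (hA.oracle_yy m x y) v w).2,
      ← (integral_inner_clm (hA.oracle_yy m x y) w v).2]
    congr 1; ext1 ξ
    rw [hessYY_symm (hA.lower m ξ).contDiff, real_inner_comm]
  · intro x y w
    obtain ⟨h1, h2⟩ := integral_inner_clm (hA.oracle_yy m x y) w w
    rw [← h2]
    have := integral_mono (integrable_const (μ * ‖w‖ ^ 2)) h1 fun ξ =>
      inner_hessYY_ge (hA.lower m ξ).contDiff x ((hA.lower m ξ).strongConvex x) y w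
    simpa using this
  · intro x x' y y' w
    obtain ⟨h1, e1⟩ := inner_mean_fullGrad (hA.oracle_g m x' y') 0 w
    obtain ⟨h2, e2⟩ := inner_mean_fullGrad (hA.oracle_g m x y) 0 w
    simp only [inner_zero_right, zero_add] at h1 h2 e1 e2
    obtain ⟨h3, e3⟩ := integral_inner_clm (hA.oracle_xy m x y) w (x' - x)
    obtain ⟨h4, e4⟩ := integral_inner_clm (hA.oracle_yy m x y) (y' - y) w
    rw [← e1, ← e2, ← e3, ← e4, ← integral_sub h1 h2, ← integral_add h3 h4,
      ← integral_sub (show Integrable (fun ξ => ⟪gradY (P.G m ξ) x' y', w⟫ -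
        ⟪gradY (P.G m ξ) x y, w⟫) _ from h1.sub h2) (h3.fun_add h4)]
    rw [← Real.norm_eq_abs]
    refine norm_integral_le_of_forall_norm_le fun ξ => ?_
    exact abs_inner_gradY_taylor_le
      hK.Lxy_nonneg hK.Lyy_nonneg (hA.lower m ξ).contDiff (hA.lower m ξ).lip_xy
      (hA.lower m ξ).lip_yy x x' y y' w

end Mean

/-! ### Neumann products: operator norms and Lipschitz bounds -/

section Neumann

/-- A symmetric operator `T` with `0 ≤ T ≤ c` has norm at most `c`. -/
theorem norm_le_of_symm_of_le {V : Type*} [NormedAddCommGroup V] [InnerProductSpace ℝ V]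
    {T : V →L[ℝ] V} {c : ℝ} (hc : 0 < c) (hs : ∀ v w, ⟪T v, w⟫ = ⟪v, T w⟫)
    (h0 : ∀ v, 0 ≤ ⟪T v, v⟫) (h1 : ∀ v, ⟪T v, v⟫ ≤ c * ‖v‖ ^ 2) : ‖T‖ ≤ c := by
  refine ContinuousLinearMap.opNorm_le_bound _ hc.le fun v => ?_
  have e1 := h1 (T v)
  -- Positivity at `c v - T v`, together with the upper bound at `T v`, gives `‖T v‖² ≤ c ⟪T v, v⟫`;
  -- no spectral theorem or square root of `T` is involved.
  have e2 := h0 (c • v - T v)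
  have e3 := h1 v
  have s1 := hs v (T v)
  have s2 := hs (T v) (T v)
  simp only [map_sub, map_smul, inner_sub_left, inner_sub_right, inner_smul_left,
    inner_smul_right, conj_trivial] at e2
  have e4 : ⟪T (T v), v⟫ = ‖T v‖ ^ 2 := by rw [hs, real_inner_self_eq_norm_sq]
  rw [e4, real_inner_self_eq_norm_sq] at e2
  have e5 : c * ‖T v‖ ^ 2 ≤ c * (c * ⟪T v, v⟫) := by nlinarith
  have e6 : ‖T v‖ ^ 2 ≤ c * ⟪T v, v⟫ := le_of_mul_le_mul_left e5 hc
  refine abs_le_of_sq_le_sq' ?_ (by positivity) |>.2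
  nlinarith

/-- The differentiated geometric series, in closed form. It sums the Lipschitz constants of the
Neumann products. The truncated exponent at `k = 0` is harmless because its coefficient vanishes. -/
theorem sum_natCast_mul_pow_le {ρ : ℝ} (h0 : 0 ≤ ρ) (h1 : ρ < 1) (n : ℕ) :
    ∑ k ∈ Finset.range n, (k : ℝ) * ρ ^ (k - 1) ≤ 1 / (1 - ρ) ^ 2 := by
  have key : (1 - ρ) ^ 2 * ∑ k ∈ Finset.range n, (k : ℝ) * ρ ^ (k - 1) =
      1 - ρ ^ n - n * ρ ^ (n - 1) * (1 - ρ) := by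
    induction n with
    | zero => simp
    | succ n ih =>
      rw [Finset.sum_range_succ, mul_add, ih]
      rcases n with _ | n
      · simp
      · simp only [Nat.add_sub_cancel]; push_cast; ring
  rw [le_div_iff₀ (by have := sub_pos.2 h1; positivity), mul_comm, key]
  have := sub_pos.2 h1
  have : 0 ≤ n * ρ ^ (n - 1) * (1 - ρ) := by positivity
  have : 0 ≤ ρ ^ n := by positivity
  linarith

theorem geom_sum_le_inv {ρ : ℝ} (h0 : 0 ≤ ρ) (h1 : ρ < 1) (n : ℕ) :
    ∑ k ∈ Finset.range n, ρ ^ k ≤ 1 / (1 - ρ) := by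
  have h2 := sub_pos.2 h1
  rw [le_div_iff₀ h2, geom_sum_mul_neg]
  have : 0 ≤ ρ ^ n := by positivity
  linarith

variable {p d : ℕ} {Ξf Ξg : Type*} {τ : ℝ} {Q : ℕ} {G : Ξg → E p → E d → ℝ}

theorem neumannProd_zero (ξH : ℕ → Ξg) (x : E p) (y : E d) : neumannProd τ Q G ξH x y 0 = 1 := by
  simp [neumannProd]

/-- The new leftmost factor has index `Q - k`, which does not occur in the shorter product; this is
what makes independence usable in the induction on `k`. The condition `k + 1 ≤ Q` keeps the
natural-number subtraction exact. -/
theorem neumannProd_succ (ξH : ℕ → Ξg) (x : E p) (y : E d) {k : ℕ} (hk : k + 1 ≤ Q) :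
    neumannProd τ Q G ξH x y (k + 1) =
      (1 - τ • hessYY (G (ξH (Q - k))) x y) * neumannProd τ Q G ξH x y k := by
  unfold neumannProd
  rw [List.range_succ_eq_map, List.map_cons, List.prod_cons, List.map_map]
  congr 3
  · rw [show Q - (k + 1) + 1 + 0 = Q - k by omega]
  · funext i
    simp only [Function.comp_apply, Nat.succ_eq_add_one]
    rw [show Q - (k + 1) + 1 + (i + 1) = Q - k + 1 + i by omega]

theorem neumannProd_const (g : E p → E d → ℝ) (ξH : ℕ → Ξg) (x : E p) (y : E d) (k : ℕ) :
    neumannProd τ Q (fun _ => g) ξH x y k = (1 - τ • hessYY g x y) ^ k := by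
  simp [neumannProd]

theorem norm_neumannProd_le {ρ : ℝ} (h0 : 0 ≤ ρ)
    (hG : ∀ ξ x y, ‖1 - τ • hessYY (G ξ) x y‖ ≤ ρ) (ξH : ℕ → Ξg) (x : E p) (y : E d)
    {k : ℕ} (hk : k ≤ Q) : ‖neumannProd τ Q G ξH x y k‖ ≤ ρ ^ k := by
  induction k with
  | zero => rw [neumannProd_zero, pow_zero]; exact ContinuousLinearMap.norm_id_le
  | succ k ih =>
    rw [neumannProd_succ _ _ _ hk, pow_succ']
    exact (norm_mul_le _ _).trans (mul_le_mul (hG _ _ _) (ih (by omega)) (norm_nonneg _) h0)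

/-- Discrete product rule: one of the `k` factors contributes its Lipschitz constant `τ Kyy`, the
other `k - 1` contribute `ρ` each. -/
theorem norm_neumannProd_sub_le {ρ Kyy : ℝ} (h0 : 0 ≤ ρ) (hτ : 0 ≤ τ)
    (hG : ∀ ξ x y, ‖1 - τ • hessYY (G ξ) x y‖ ≤ ρ) (hl : ∀ ξ, PairLipschitz Kyy (hessYY (G ξ)))
    (ξH : ℕ → Ξg) (x x' : E p) (y y' : E d) {k : ℕ} (hk : k ≤ Q) :
    ‖neumannProd τ Q G ξH x y k - neumannProd τ Q G ξH x' y' k‖ ≤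
      k * ρ ^ (k - 1) * (τ * Kyy * ‖pair x y - pair x' y'‖) := by
  induction k with
  | zero => simp [neumannProd_zero]
  | succ k ih =>
    rw [neumannProd_succ _ _ _ hk, neumannProd_succ _ _ _ hk]
    set T := 1 - τ • hessYY (G (ξH (Q - k))) x y
    set T' := 1 - τ • hessYY (G (ξH (Q - k))) x' y'
    set A := neumannProd τ Q G ξH x y k
    set A' := neumannProd τ Q G ξH x' y' k
    have e1 : T * A - T' * A' = T * (A - A') + (T - T') * A' := by
      rw [mul_sub, sub_mul T T', sub_add_sub_cancel]
    have e2 : ‖T - T'‖ ≤ τ * Kyy * ‖pair x y - pair x' y'‖ := by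
      have : T - T' = τ • (hessYY (G (ξH (Q - k))) x' y' - hessYY (G (ξH (Q - k))) x y) := by
        simp only [T, T', smul_sub]; abel
      rw [this, norm_smul, Real.norm_eq_abs, abs_of_nonneg hτ, mul_assoc, norm_sub_rev]
      exact mul_le_mul_of_nonneg_left (hl _ _ _ _ _) hτ
    have e3 : ‖A'‖ ≤ ρ ^ k := norm_neumannProd_le h0 hG ξH x' y' (by omega)
    have e4 := ih (by omega)
    rw [e1]
    calc _ ≤ ‖T‖ * ‖A - A'‖ + ‖T - T'‖ * ‖A'‖ :=
          (norm_add_le _ _).trans (add_le_add (norm_mul_le _ _) (norm_mul_le _ _))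
      _ ≤ ρ * (k * ρ ^ (k - 1) * (τ * Kyy * ‖pair x y - pair x' y'‖)) +
          (τ * Kyy * ‖pair x y - pair x' y'‖) * ρ ^ k := by
          refine add_le_add (mul_le_mul (hG _ _ _) e4 (norm_nonneg _) h0)
            (mul_le_mul e2 e3 (norm_nonneg _) ((norm_nonneg _).trans e2))
      _ = _ := by
          rcases k with _ | k
          · simp
          · simp only [Nat.add_sub_cancel]; push_cast; ring

/-- The regularity of an upper-level sample objective used by the hypergradient estimator. -/
structure UpperBounds (K : Constants) (f : E p → E d → ℝ) : Prop where
  lip : PairLipschitz K.L (fullGrad f)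
  bound : ∀ x y, ‖fullGrad f x y‖ ≤ K.Cf

/-- The regularity of a lower-level sample objective used by the hypergradient estimator. -/
structure LowerBounds (K : Constants) (μ τ : ℝ) (g : E p → E d → ℝ) : Prop where
  jac_lip : PairLipschitz K.Lxy (jacXY g)
  jac_bound : ∀ x y, ‖jacXY g x y‖ ≤ K.L
  hess_lip : PairLipschitz K.Lyy (hessYY g)
  contract : ∀ x y, ‖1 - τ • hessYY g x y‖ ≤ 1 - τ * μ

/-- Since `μ ≤ H ≤ L` as quadratic forms and `τ L < 1`, the symmetric operator `1 - τ H` lies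
between `0` and `1 - τ μ`. -/
theorem norm_one_sub_smul_le {V : Type*} [NormedAddCommGroup V] [InnerProductSpace ℝ V]
    {H : V →L[ℝ] V} {L μ τ : ℝ} (hL : 0 < L) (hμL : μ ≤ L) (hτ0 : 0 < τ) (hτ1 : τ < 1 / L)
    (hs : ∀ v w, ⟪H v, w⟫ = ⟪v, H w⟫) (hc : ∀ w, μ * ‖w‖ ^ 2 ≤ ⟪H w, w⟫) (hb : ‖H‖ ≤ L) :
    ‖1 - τ • H‖ ≤ 1 - τ * μ := by
  have hτL : τ * L < 1 := by rwa [lt_div_iff₀ hL] at hτ1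
  have hτμ : τ * μ < 1 := lt_of_le_of_lt (by gcongr) hτL
  refine norm_le_of_symm_of_le (sub_pos.2 hτμ) (fun v w => ?_) (fun v => ?_) (fun v => ?_)
  · simp [inner_sub_left, inner_sub_right, inner_smul_left, inner_smul_right, hs]
  · have h1 : ⟪H v, v⟫ ≤ L * ‖v‖ ^ 2 := by
      refine (real_inner_le_norm _ _).trans ?_
      rw [pow_two, ← mul_assoc]
      exact mul_le_mul_of_nonneg_right ((H.le_opNorm v).trans (by gcongr)) (norm_nonneg _)
    simp only [sub_apply, one_apply_eq_self, smul_apply, inner_sub_left,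
      inner_smul_left, conj_trivial, real_inner_self_eq_norm_sq]
    nlinarith [sq_nonneg ‖v‖, mul_le_mul_of_nonneg_left h1 hτ0.le]
  · simp only [sub_apply, one_apply_eq_self, smul_apply, inner_sub_left,
      inner_smul_left, conj_trivial, real_inner_self_eq_norm_sq]
    nlinarith [mul_le_mul_of_nonneg_left (hc v) hτ0.le]

theorem UpperBounds.normX {K : Constants} {f : E p → E d → ℝ} (h : UpperBounds K f) (x : E p)
    (y : E d) : ‖gradX f x y‖ ≤ K.Cf := (norm_le_norm_pair_left _ _).trans (h.bound x y)

theorem UpperBounds.normY {K : Constants} {f : E p → E d → ℝ} (h : UpperBounds K f) (x : E p)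
    (y : E d) : ‖gradY f x y‖ ≤ K.Cf := (norm_le_norm_pair_right _ _).trans (h.bound x y)

variable {F : Ξf → E p → E d → ℝ} {K : Constants} {μ : ℝ}

theorem norm_neumannSum_le (hτ0 : 0 < τ) (hμ : 0 < μ) (hτμ : τ * μ < 1)
    (hG : ∀ ξ, LowerBounds K μ τ (G ξ)) (ξH : ℕ → Ξg) (x : E p) (y : E d) :
    ‖∑ k ∈ Finset.range (Q + 1), neumannProd τ Q G ξH x y k‖ ≤ 1 / (τ * μ) := by
  refine (norm_sum_le _ _).trans ((Finset.sum_le_sum fun k hk =>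
    norm_neumannProd_le (sub_nonneg.2 hτμ.le) (fun ξ => (hG ξ).contract) ξH x y
      (Nat.lt_succ_iff.1 (Finset.mem_range.1 hk))).trans ?_)
  refine (geom_sum_le_inv (sub_nonneg.2 hτμ.le) (by nlinarith [mul_pos hτ0 hμ]) _).trans ?_
  rw [sub_sub_cancel]

theorem norm_neumannSum_sub_le (hτ0 : 0 < τ) (hμ : 0 < μ) (hτμ : τ * μ < 1)
    (hLyy : 0 ≤ K.Lyy)
    (hG : ∀ ξ, LowerBounds K μ τ (G ξ)) (ξH : ℕ → Ξg) (x x' : E p) (y y' : E d) :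
    ‖∑ k ∈ Finset.range (Q + 1), neumannProd τ Q G ξH x y k -
      ∑ k ∈ Finset.range (Q + 1), neumannProd τ Q G ξH x' y' k‖ ≤
      1 / (τ * μ) ^ 2 * (τ * K.Lyy * ‖pair x y - pair x' y'‖) := by
  rw [← Finset.sum_sub_distrib]
  refine (norm_sum_le _ _).trans ((Finset.sum_le_sum fun k hk =>
    norm_neumannProd_sub_le (sub_nonneg.2 hτμ.le) hτ0.le (fun ξ => (hG ξ).contract)
      (fun ξ => (hG ξ).hess_lip) ξH x x' y y' (Nat.lt_succ_iff.1 (Finset.mem_range.1 hk))).trans ?_)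
  rw [← Finset.sum_mul]
  refine mul_le_mul_of_nonneg_right ?_ (by positivity)
  refine (sum_natCast_mul_pow_le (sub_nonneg.2 hτμ.le) (by nlinarith [mul_pos hτ0 hμ]) _).trans ?_
  rw [sub_sub_cancel]

theorem hyperEst_eq (ξF : Ξf) (ξG : Ξg) (ξH : ℕ → Ξg) (x : E p) (y : E d) :
    hyperEst τ Q F G ξF ξG ξH x y = gradX (F ξF) x y - τ • jacXY (G ξG) x y
      ((∑ k ∈ Finset.range (Q + 1), neumannProd τ Q G ξH x y k) (gradY (F ξF) x y)) := by
  rw [hyperEst, sum_apply]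

/-- The prefactor `τ` cancels the `τ` in the geometric sum `1 / (τ μ)`, so the bound depends neither
on `τ` nor on `Q`. It serves as the noise level of the hypergradient estimator and bounds the part
of the momentum updates that drives the clients apart. -/
theorem norm_hyperEst_le (hτ0 : 0 < τ) (hμ : 0 < μ) (hτμ : τ * μ < 1) (hL : 0 < K.L)
    (hF : ∀ ξ, UpperBounds K (F ξ)) (hG : ∀ ξ, LowerBounds K μ τ (G ξ))
    (ξF : Ξf) (ξG : Ξg) (ξH : ℕ → Ξg) (x : E p) (y : E d) :
    ‖hyperEst τ Q F G ξF ξG ξH x y‖ ≤ (1 + K.L / μ) * K.Cf := by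
  rw [hyperEst_eq]
  have hS := norm_neumannSum_le (Q := Q) hτ0 hμ hτμ hG ξH x y
  set S := ∑ k ∈ Finset.range (Q + 1), neumannProd τ Q G ξH x y k
  calc _ ≤ ‖gradX (F ξF) x y‖ + ‖τ • jacXY (G ξG) x y (S (gradY (F ξF) x y))‖ := norm_sub_le _ _
    _ ≤ K.Cf + τ * (K.L * (1 / (τ * μ) * K.Cf)) := by
        rw [norm_smul, Real.norm_eq_abs, abs_of_pos hτ0]
        gcongr
        · exact (hF ξF).normX x y
        · refine (ContinuousLinearMap.le_opNorm _ _).trans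
            (mul_le_mul ((hG ξG).jac_bound x y) ?_ (norm_nonneg _) hL.le)
          exact (ContinuousLinearMap.le_opNorm _ _).trans
            (mul_le_mul hS ((hF ξF).normY x y) (norm_nonneg _) (by positivity))
    _ = _ := by field_simp

/-- Product rule for `∇_{xy} g`, the Neumann sum and `∇_y f`. The Neumann sum has norm at most `1 /
(τ μ)` and Lipschitz constant at most `τ Lyy / (τ μ)²`, so once more all powers of `τ` cancel. -/
theorem hyperEst_lipschitz (hτ0 : 0 < τ) (hμ : 0 < μ) (hτμ : τ * μ < 1) (hK : K.Valid)
    (hF : ∀ ξ, UpperBounds K (F ξ)) (hG : ∀ ξ, LowerBounds K μ τ (G ξ))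
    (ξF : Ξf) (ξG : Ξg) (ξH : ℕ → Ξg) :
    PairLipschitz (K.L + K.L ^ 2 / μ + K.Lxy * K.Cf / μ + K.L * K.Lyy * K.Cf / μ ^ 2)
      (hyperEst τ Q F G ξF ξG ξH) := by
  intro x y x' y'
  have hL := hK.L_pos
  have hCf := hK.Cf_nonneg
  have hLyy := hK.Lyy_nonneg
  have hLxy := hK.Lxy_nonneg
  rw [hyperEst_eq, hyperEst_eq]
  have hS := norm_neumannSum_le (Q := Q) hτ0 hμ hτμ hG ξH x y
  have hSS := norm_neumannSum_sub_le (Q := Q) hτ0 hμ hτμ hLyy hG ξH x x' y y'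
  have hS' := norm_neumannSum_le (Q := Q) hτ0 hμ hτμ hG ξH x' y'
  set S := ∑ k ∈ Finset.range (Q + 1), neumannProd τ Q G ξH x y k
  set S' := ∑ k ∈ Finset.range (Q + 1), neumannProd τ Q G ξH x' y' k
  have hv := (hF ξF).lip.gradY x y x' y'
  have ha := (hF ξF).lip.gradX x y x' y'
  have hv1 := (hF ξF).normY x y
  have hv2 := (hF ξF).normY x' y'
  have hJ := (hG ξG).jac_lip x y x' y'
  have hJ1 := (hG ξG).jac_bound x y
  have hJ2 := (hG ξG).jac_bound x' y'
  set v := gradY (F ξF) x y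
  set v' := gradY (F ξF) x' y'
  set J := jacXY (G ξG) x y
  set J' := jacXY (G ξG) x' y'
  set δ := ‖pair x y - pair x' y'‖
  have hδ : 0 ≤ δ := norm_nonneg _
  have e : gradX (F ξF) x y - τ • J (S v) - (gradX (F ξF) x' y' - τ • J' (S' v')) =
      (gradX (F ξF) x y - gradX (F ξF) x' y') -
        τ • ((J - J') (S v) + J' ((S - S') v) + J' (S' (v - v'))) := by
    simp only [sub_apply, map_sub, smul_add, smul_sub]; abel
  have b1 : ‖(J - J') (S v)‖ ≤ (K.Lxy * δ) * (1 / (τ * μ) * K.Cf) :=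
    (ContinuousLinearMap.le_opNorm _ _).trans (mul_le_mul hJ
      ((ContinuousLinearMap.le_opNorm _ _).trans (mul_le_mul hS hv1 (norm_nonneg _) (by positivity)))
      (norm_nonneg _) (by positivity))
  have b2 : ‖J' ((S - S') v)‖ ≤ K.L * ((1 / (τ * μ) ^ 2 * (τ * K.Lyy * δ)) * K.Cf) :=
    (ContinuousLinearMap.le_opNorm _ _).trans (mul_le_mul hJ2
      ((ContinuousLinearMap.le_opNorm _ _).trans (mul_le_mul hSS hv1 (norm_nonneg _) (by positivity)))
      (norm_nonneg _) (by positivity))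
  have b3 : ‖J' (S' (v - v'))‖ ≤ K.L * (1 / (τ * μ) * (K.L * δ)) :=
    (ContinuousLinearMap.le_opNorm _ _).trans (mul_le_mul hJ2
      ((ContinuousLinearMap.le_opNorm _ _).trans (mul_le_mul hS' hv (norm_nonneg _) (by positivity)))
      (norm_nonneg _) (by positivity))
  rw [e]
  calc _ ≤ ‖gradX (F ξF) x y - gradX (F ξF) x' y'‖ +
        ‖τ • ((J - J') (S v) + J' ((S - S') v) + J' (S' (v - v')))‖ := norm_sub_le _ _
    _ ≤ K.L * δ + τ * ((K.Lxy * δ) * (1 / (τ * μ) * K.Cf) +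
        K.L * ((1 / (τ * μ) ^ 2 * (τ * K.Lyy * δ)) * K.Cf) + K.L * (1 / (τ * μ) * (K.L * δ))) := by
        rw [norm_smul, Real.norm_eq_abs, abs_of_pos hτ0]
        gcongr
        exact (norm_add_le _ _).trans (add_le_add ((norm_add_le _ _).trans (add_le_add b1 b2)) b3)
    _ = _ := by field_simp; ring

end Neumann

/-! ### The exact hypergradient formula and its truncation -/

section Hypergradient

variable {p d : ℕ}

/-- The hypergradient formula with a truncated Neumann series. -/
noncomputable def meanEst (τ : ℝ) (Q : ℕ) (f g : E p → E d → ℝ) (x : E p) (y : E d) : E p :=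
  hyperEst τ Q (fun _ : Unit => f) (fun _ : Unit => g) () () (fun _ => ()) x y

/-- A solution `q` of `∇_{y²} g(x, y) q = ∇_y f(x, y)`. -/
noncomputable def hessSolve (f g : E p → E d → ℝ) (x : E p) (y : E d) : E d :=
  Classical.epsilon fun q => hessYY g x y q = gradY f x y

/-- The exact hypergradient formula `∇ₓ f - ∇_{xy} g (∇_{y²} g)⁻¹ ∇_y f`. -/
noncomputable def hypGrad (f g : E p → E d → ℝ) (x : E p) (y : E d) : E p :=
  gradX f x y - jacXY g x y (hessSolve f g x y)

namespace MeanRegular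

variable {K : Constants} {μ τ : ℝ} {Q : ℕ} {f g : E p → E d → ℝ}

theorem upperBounds (h : MeanRegular K μ f g) : UpperBounds K f := ⟨h.f_lip, h.f_bound⟩

theorem lowerBounds (h : MeanRegular K μ f g) (hL : 0 < K.L) (hμL : μ ≤ K.L) (hτ0 : 0 < τ)
    (hτ1 : τ < 1 / K.L) : LowerBounds K μ τ g :=
  ⟨h.jac_lip, h.jac_bound, h.hess_lip, fun x y => norm_one_sub_smul_le hL hμL hτ0 hτ1
    (h.hess_symm x y) (h.hess_coercive x y) (h.hess_bound x y)⟩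

theorem norm_le_of_coercive {V : Type*} [NormedAddCommGroup V] [InnerProductSpace ℝ V]
    {H : V →L[ℝ] V} (hc : ∀ w, μ * ‖w‖ ^ 2 ≤ ⟪H w, w⟫) (w : V) : μ * ‖w‖ ≤ ‖H w‖ := by
  rcases (norm_nonneg w).eq_or_lt with h0 | h0
  · rw [← h0, mul_zero]; exact norm_nonneg _
  · refine le_of_mul_le_mul_right ?_ h0
    rw [mul_assoc, ← pow_two]
    exact (hc w).trans (real_inner_le_norm _ _)

/-- Coercivity makes the Hessian injective, hence surjective in finite dimension. -/
theorem hessSolve_spec (h : MeanRegular K μ f g) (hμ : 0 < μ) (x : E p) (y : E d) :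
    hessYY g x y (hessSolve f g x y) = gradY f x y := by
  have hinj : Function.Injective (hessYY g x y : E d →ₗ[ℝ] E d) := by
    rw [← LinearMap.ker_eq_bot, LinearMap.ker_eq_bot']
    intro v hv
    have h1 := norm_le_of_coercive (h.hess_coercive x y) v
    have h2 : hessYY g x y v = 0 := hv
    rw [h2, norm_zero] at h1
    have := norm_nonneg v
    exact norm_eq_zero.1 (le_antisymm (by nlinarith) this)
  obtain ⟨q, hq⟩ := LinearMap.injective_iff_surjective.1 hinj (gradY f x y)
  exact Classical.epsilon_spec (p := fun q => hessYY g x y q = gradY f x y) ⟨q, hq⟩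

theorem norm_hessSolve_le (h : MeanRegular K μ f g) (hμ : 0 < μ) (x : E p) (y : E d) :
    ‖hessSolve f g x y‖ ≤ K.Cf / μ := by
  have h1 := norm_le_of_coercive (h.hess_coercive x y) (hessSolve f g x y)
  rw [h.hessSolve_spec hμ] at h1
  rw [le_div_iff₀ hμ, mul_comm]
  exact h1.trans (h.upperBounds.normY x y)

/-- With `∇_y f = H q` the Neumann sum telescopes: `τ ∑ (1 - τ H)^k H q = q - (1 - τ H)^(Q+1) q`.
The bias is therefore `∇_{xy} g` applied to the last term, with `‖q‖ ≤ C_f / μ`. -/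
theorem norm_meanEst_sub_hypGrad_le (h : MeanRegular K μ f g) (hL : 0 < K.L) (hμ : 0 < μ)
    (hμL : μ ≤ K.L) (hτ0 : 0 < τ) (hτ1 : τ < 1 / K.L) (x : E p) (y : E d) :
    ‖meanEst τ Q f g x y - hypGrad f g x y‖ ≤ K.L / μ * (1 - τ * μ) ^ (Q + 1) * K.Cf := by
  have hc := (h.lowerBounds hL hμL hτ0 hτ1).contract x y
  rw [meanEst, hyperEst_eq, hypGrad]
  simp only [neumannProd_const]
  rw [← h.hessSolve_spec hμ]
  set q := hessSolve f g x y
  set H := hessYY g x y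
  have hgeo : τ • (∑ k ∈ Finset.range (Q + 1), (1 - τ • H) ^ k) (H q) =
      q - ((1 - τ • H) ^ (Q + 1)) q := by
    have := congrArg (fun T : E d →L[ℝ] E d => T q) (geom_sum_mul_neg (1 - τ • H) (Q + 1))
    simpa [sum_apply] using this
  rw [← map_smul, hgeo, map_sub, sub_sub_sub_cancel_left, sub_sub_cancel]
  have hρ : 0 ≤ 1 - τ * μ := (norm_nonneg _).trans hc
  have h1 : ‖((1 - τ • H) ^ (Q + 1)) q‖ ≤ (1 - τ * μ) ^ (Q + 1) * (K.Cf / μ) := by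
    refine (ContinuousLinearMap.le_opNorm _ _).trans (mul_le_mul ?_ (h.norm_hessSolve_le hμ x y)
      (norm_nonneg _) (by positivity))
    exact (norm_pow_le' _ (Nat.succ_pos _)).trans (pow_le_pow_left₀ (norm_nonneg _) hc _)
  calc _ ≤ K.L * ((1 - τ * μ) ^ (Q + 1) * (K.Cf / μ)) :=
        (ContinuousLinearMap.le_opNorm _ _).trans
          (mul_le_mul (h.jac_bound x y) h1 (norm_nonneg _) hL.le)
    _ = _ := by ring

theorem meanEst_lipschitz (h : MeanRegular K μ f g) (hK : K.Valid) (hμ : 0 < μ)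
    (hμL : μ ≤ K.L) (hτ0 : 0 < τ) (hτ1 : τ < 1 / K.L) :
    PairLipschitz (K.L + K.L ^ 2 / μ + K.Lxy * K.Cf / μ + K.L * K.Lyy * K.Cf / μ ^ 2)
      (meanEst τ Q f g) := by
  have hτL : τ * K.L < 1 := by rwa [lt_div_iff₀ hK.L_pos] at hτ1
  exact hyperEst_lipschitz hτ0 hμ (lt_of_le_of_lt (by gcongr) hτL) hK
    (fun _ => h.upperBounds) (fun _ => h.lowerBounds hK.L_pos hμL hτ0 hτ1) () () _

/-- The truncations are Lipschitz with a constant independent of `Q` and converge to `hypGrad` as `Q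
→ ∞`, so the constant survives in the limit; no resolvent identity for the inverse Hessian is
needed. -/
theorem hypGrad_lipschitz (h : MeanRegular K μ f g) (hK : K.Valid) (hμ : 0 < μ)
    (hμL : μ ≤ K.L) :
    PairLipschitz (K.L + K.L ^ 2 / μ + K.Lxy * K.Cf / μ + K.L * K.Lyy * K.Cf / μ ^ 2)
      (hypGrad f g) := by
  intro x y x' y'
  have hL := hK.L_pos
  -- An auxiliary value, unrelated to the `τ` of the algorithm: any number strictly between `0` and
  -- `1 / L` would do.
  set τ := 1 / (2 * K.L) with hτ
  have hτ0 : 0 < τ := by positivity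
  have hτ1 : τ < 1 / K.L := one_div_lt_one_div_of_lt hL (by linarith)
  have hτμ : τ * μ < 1 := by
    rw [hτ, div_mul_eq_mul_div, div_lt_one (by positivity)]; linarith
  have hlim : Filter.Tendsto (fun Q : ℕ =>
      (K.L + K.L ^ 2 / μ + K.Lxy * K.Cf / μ + K.L * K.Lyy * K.Cf / μ ^ 2) *
        ‖pair x y - pair x' y'‖ + 2 * (K.L / μ * (1 - τ * μ) ^ (Q + 1) * K.Cf)) Filter.atTop
      (nhds ((K.L + K.L ^ 2 / μ + K.Lxy * K.Cf / μ + K.L * K.Lyy * K.Cf / μ ^ 2) *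
        ‖pair x y - pair x' y'‖ + 2 * (K.L / μ * 0 * K.Cf))) := by
    refine tendsto_const_nhds.add ((((Filter.Tendsto.const_mul _ ?_).mul_const _)).const_mul _)
    exact (tendsto_pow_atTop_nhds_zero_of_lt_one (by linarith)
      (by nlinarith [mul_pos hτ0 hμ])).comp (Filter.tendsto_add_atTop_nat 1)
  rw [mul_zero, zero_mul, mul_zero, add_zero] at hlim
  refine ge_of_tendsto hlim (Filter.Eventually.of_forall fun Q => ?_)
  have h1 := h.norm_meanEst_sub_hypGrad_le (Q := Q) hL hμ hμL hτ0 hτ1 x y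
  have h2 := h.norm_meanEst_sub_hypGrad_le (Q := Q) hL hμ hμL hτ0 hτ1 x' y'
  have h3 := h.meanEst_lipschitz (Q := Q) hK hμ hμL hτ0 hτ1 x y x' y'
  have e : hypGrad f g x y - hypGrad f g x' y' =
      (meanEst τ Q f g x y - meanEst τ Q f g x' y') -
      (meanEst τ Q f g x y - hypGrad f g x y) +
      (meanEst τ Q f g x' y' - hypGrad f g x' y') := by abel
  rw [e]
  refine (norm_add_le _ _).trans ((add_le_add (norm_sub_le _ _) le_rfl).trans ?_)
  linarith

end MeanRegular

end Hypergradient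

/-! ### Gradients from quadratic remainders, and the lower-level minimizers -/

section General

variable {V : Type*} [NormedAddCommGroup V] [InnerProductSpace ℝ V] [CompleteSpace V]

/-- The criterion by which both `∇_y g` of the mean objective and `∇h` are recognized as gradients.
-/
theorem hasGradientAt_of_quadratic {u : V → ℝ} {a x : V} {C : ℝ}
    (h : ∀ x', |u x' - u x - ⟪a, x' - x⟫| ≤ C * ‖x' - x‖ ^ 2) : HasGradientAt u a x := by
  rw [hasGradientAt_iff_isLittleO]
  refine Asymptotics.IsBigO.trans_isLittleO (g := fun x' => ‖x' - x‖ ^ 2) ?_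
    (Asymptotics.isLittleO_pow_sub_sub x one_lt_two)
  refine Asymptotics.IsBigO.of_bound C (Filter.Eventually.of_forall fun x' => ?_)
  rw [Real.norm_eq_abs, norm_pow, norm_norm]
  exact h x'

theorem le_taylor_of_lipschitz_gradient {u : V → ℝ} {g : V → V} {L : ℝ}
    (hu : ∀ x, HasGradientAt u (g x) x) (hL : ∀ x x', ‖g x - g x'‖ ≤ L * ‖x - x'‖) (x x' : V) :
    u x' ≤ u x + ⟪g x, x' - x⟫ + L / 2 * ‖x' - x‖ ^ 2 := by
  have hl : ∀ t : ℝ, HasDerivAt (fun t : ℝ => x + t • (x' - x)) (x' - x) t := fun t => by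
    simpa using ((hasDerivAt_id t).smul_const (x' - x)).const_add x
  have hder : ∀ t : ℝ, HasDerivAt (fun t : ℝ => u (x + t • (x' - x)))
      ⟪g (x + t • (x' - x)), x' - x⟫ t := fun t => by
    refine ((hu (x + t • (x' - x))).hasFDerivAt.comp_hasDerivAt t (hl t)).congr_deriv ?_
    simp
  have key := norm_sub_sub_le_of_deriv_lipschitz (K := L * ‖x' - x‖ ^ 2) hder ?_
  · simp only [one_smul, add_sub_cancel, zero_smul, add_zero, Real.norm_eq_abs] at key
    have := (abs_le.1 key).2
    linarith
  · intro t ht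
    simp only [zero_smul, add_zero]
    rw [← inner_sub_left]
    refine (norm_inner_le_norm _ _).trans ?_
    have h1 := hL (x + t • (x' - x)) x
    rw [add_sub_cancel_left, norm_smul, Real.norm_eq_abs, abs_of_nonneg ht.1] at h1
    calc _ ≤ L * (t * ‖x' - x‖) * ‖x' - x‖ := by gcongr
      _ = _ := by ring

end General

namespace MeanRegular

variable {p d : ℕ} {K : Constants} {μ : ℝ} {f g : E p → E d → ℝ}

theorem hasGradientAt_lower (h : MeanRegular K μ f g) (x : E p) (y : E d) :
    HasGradientAt (g x) (gradY g x y) y := by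
  refine hasGradientAt_of_quadratic (C := K.L / 2) fun y' => ?_
  have := h.g_taylor x x y y'
  rwa [sub_self, inner_zero_right, zero_add, pair_sub_pair, sub_self, norm_pair_zero_left] at this

theorem exists_min (h : MeanRegular K μ f g) (hμ : 0 < μ) (x : E p) :
    ∃ y, ∀ y', g x y ≤ g x y' := by
  have hc : Continuous (g x) := continuous_iff_continuousAt.2 fun y =>
    (h.hasGradientAt_lower x y).continuousAt
  refine hc.exists_forall_le ?_
  -- Strong convexity beats any linear term. The coefficient `‖∇_y g(x, 0)‖ + 1` leaves a surplus
  -- `‖y‖` after the linear part of the lower bound has been absorbed, which gives coercivity.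
  have hlim : Filter.Tendsto (fun y : E d => ‖y‖ + (g x 0 - (‖gradY g x 0‖ + 1) ^ 2 / (2 * μ)))
      (Filter.cocompact (E d)) Filter.atTop :=
    Filter.tendsto_atTop_add_const_right _ _ (tendsto_norm_cocompact_atTop)
  refine Filter.tendsto_atTop_mono (fun y => ?_) hlim
  have h1 := h.g_lower x 0 y
  rw [sub_zero] at h1
  have h2 := (abs_le.1 (abs_real_inner_le_norm (gradY g x 0) y)).1
  have h3 : (‖gradY g x 0‖ + 1) * ‖y‖ ≤
      μ / 2 * ‖y‖ ^ 2 + (‖gradY g x 0‖ + 1) ^ 2 / (2 * μ) := by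
    have h4 : 0 ≤ (μ * ‖y‖ - (‖gradY g x 0‖ + 1)) ^ 2 / (2 * μ) := by positivity
    have h5 : (μ * ‖y‖ - (‖gradY g x 0‖ + 1)) ^ 2 / (2 * μ) =
        μ / 2 * ‖y‖ ^ 2 + (‖gradY g x 0‖ + 1) ^ 2 / (2 * μ) - (‖gradY g x 0‖ + 1) * ‖y‖ := by
      field_simp; ring
    linarith
  linarith

theorem argminPt_le (h : MeanRegular K μ f g) (hμ : 0 < μ) (x : E p) (y : E d) :
    g x (argminPt (g x)) ≤ g x y :=
  Classical.epsilon_spec (p := fun y => ∀ y', g x y ≤ g x y') (h.exists_min hμ x) y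

/-- A gradient step of length `1 / L` lowers `g` by at least `‖∇_y g‖² / (2L)`, and it cannot get
below the minimum. -/
theorem sq_norm_gradY_le (h : MeanRegular K μ f g) (hL : 0 < K.L) (hμ : 0 < μ) (x : E p)
    (y : E d) : 1 / (2 * K.L) * ‖gradY g x y‖ ^ 2 ≤ g x y - g x (argminPt (g x)) := by
  have h1 := h.g_taylor x x y (y - (1 / K.L) • gradY g x y)
  rw [sub_self, inner_zero_right, zero_add, pair_sub_pair, sub_self, norm_pair_zero_left,
    sub_sub_cancel_left, inner_neg_right, inner_smul_right, real_inner_self_eq_norm_sq, norm_neg,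
    norm_smul, mul_pow, Real.norm_eq_abs, sq_abs] at h1
  have h2 := h.argminPt_le hμ x (y - (1 / K.L) • gradY g x y)
  have h3 := (abs_le.1 h1).2
  have h4 : K.L / 2 * ((1 / K.L) ^ 2 * ‖gradY g x y‖ ^ 2) = 1 / (2 * K.L) * ‖gradY g x y‖ ^ 2 := by
    field_simp
  have h5 : 1 / K.L * ‖gradY g x y‖ ^ 2 = 2 * (1 / (2 * K.L) * ‖gradY g x y‖ ^ 2) := by
    field_simp
  linarith

theorem gradY_argminPt (h : MeanRegular K μ f g) (hL : 0 < K.L) (hμ : 0 < μ) (x : E p) :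
    gradY g x (argminPt (g x)) = 0 := by
  have h1 := h.sq_norm_gradY_le hL hμ x (argminPt (g x))
  rw [sub_self] at h1
  have h2 : 0 < 1 / (2 * K.L) := by positivity
  have h3 : ‖gradY g x (argminPt (g x))‖ ^ 2 ≤ 0 := by
    by_contra hc
    have := mul_pos h2 (not_le.1 hc)
    linarith
  exact norm_eq_zero.1 (pow_eq_zero_iff two_ne_zero |>.1 (le_antisymm h3 (sq_nonneg _)))

/-- Strong convexity tested at the minimizer supplies the distance term, the descent estimate
`sq_norm_gradY_le` the gradient term. The latter is what later becomes the negative multiple of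
`‖ω‖²`. -/
theorem inner_gradY_ge (h : MeanRegular K μ f g) (hL : 0 < K.L) (hμ : 0 < μ) (x : E p) (y : E d) :
    μ / 2 * ‖y - argminPt (g x)‖ ^ 2 + 1 / (2 * K.L) * ‖gradY g x y‖ ^ 2 ≤
      ⟪gradY g x y, y - argminPt (g x)⟫ := by
  have h1 := h.g_lower x y (argminPt (g x))
  have h2 := h.sq_norm_gradY_le hL hμ x y
  rw [norm_sub_rev, ← neg_sub y, inner_neg_right] at h1
  linarith

theorem strong_monotone (h : MeanRegular K μ f g) (x : E p) (y y' : E d) :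
    μ * ‖y' - y‖ ^ 2 ≤ ⟪gradY g x y' - gradY g x y, y' - y⟫ := by
  have h1 := h.g_lower x y y'
  have h2 := h.g_lower x y' y
  rw [norm_sub_rev, ← neg_sub y' y, inner_neg_right] at h2
  rw [inner_sub_left]
  linarith

/-- Strong monotonicity at `x` bounds the distance of the minimizers by `1/μ` times the size of `∇_y
g(x, y')`. At `x'` this gradient vanishes, so its size at `x` is at most `L ‖x - x'‖`. -/
theorem argminPt_lipschitz (h : MeanRegular K μ f g) (hL : 0 < K.L) (hμ : 0 < μ) (x x' : E p) :
    ‖argminPt (g x) - argminPt (g x')‖ ≤ K.L / μ * ‖x - x'‖ := by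
  set y := argminPt (g x)
  set y' := argminPt (g x')
  have h1 := h.strong_monotone x y' y
  rw [h.gradY_argminPt hL hμ x] at h1
  have h2 : ‖gradY g x y' - gradY g x' y'‖ ≤ K.L * ‖x - x'‖ := by
    have := h.g_lip.gradY x y' x' y'
    rwa [pair_sub_pair, sub_self, norm_pair_zero_right] at this
  rw [h.gradY_argminPt hL hμ x', sub_zero] at h2
  have h3 : ⟪0 - gradY g x y', y - y'⟫ ≤ ‖gradY g x y'‖ * ‖y - y'‖ := by
    refine (real_inner_le_norm _ _).trans ?_
    rw [zero_sub, norm_neg]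
  rw [div_mul_eq_mul_div, le_div_iff₀ hμ, mul_comm]
  rcases (norm_nonneg (y - y')).eq_or_lt with h0 | h0
  · rw [← h0, mul_zero]; positivity
  · refine le_of_mul_le_mul_right ?_ h0
    nlinarith [mul_le_mul_of_nonneg_right h2 h0.le]

/-- One gradient step with step size `γ a` on the lower-level objective. -/
theorem lower_step (h : MeanRegular K μ f g) (hL : 0 < K.L) (hμ : 0 < μ) (hμL : μ ≤ K.L) {γ a : ℝ}
    (hγ0 : 0 < γ) (hγ1 : γ ≤ 1 / (2 * K.L)) (ha0 : 0 ≤ a) (ha1 : a ≤ 1 / 16) (x : E p)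
    (y ω : E d) :
    ‖y - (γ * a) • ω - argminPt (g x)‖ ^ 2 ≤
      (1 - γ * a * μ / 2) * ‖y - argminPt (g x)‖ ^ 2 - 15 / 16 * γ ^ 2 * a * ‖ω‖ ^ 2 +
        3 * γ * a / μ * ‖ω - gradY g x y‖ ^ 2 := by
  set z := y - argminPt (g x) with hz
  set e := ω - gradY g x y with he
  have h1 := h.inner_gradY_ge hL hμ x y
  rw [← hz] at h1
  have hG : gradY g x y = ω - e := by rw [he]; abel
  rw [hG] at h1
  have e1 : y - (γ * a) • ω - argminPt (g x) = z - (γ * a) • ω := by rw [hz]; abel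
  rw [e1, norm_sub_sq_real, inner_smul_right, norm_smul, mul_pow, Real.norm_eq_abs, sq_abs]
  -- The gradient term is kept and converted into `‖ω‖²`: the resulting negative term pays for the
  -- displacement of `y` in the momentum and drift recursions.
  have h2 : γ * ‖ω - e‖ ^ 2 ≤ 1 / (2 * K.L) * ‖ω - e‖ ^ 2 := by gcongr
  have h3 : ‖ω‖ ^ 2 ≤ 2 * ‖ω - e‖ ^ 2 + 2 * ‖e‖ ^ 2 := by
    have h4 : ‖ω‖ ≤ ‖ω - e‖ + ‖e‖ := by simpa using norm_add_le (ω - e) e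
    nlinarith [norm_nonneg ω, sq_nonneg (‖ω - e‖ - ‖e‖)]
  have h4 : -⟪e, z⟫ ≤ μ / 4 * ‖z‖ ^ 2 + 1 / μ * ‖e‖ ^ 2 := by
    have h5 := (abs_le.1 (abs_real_inner_le_norm e z)).1
    have h6 : ‖e‖ * ‖z‖ ≤ μ / 4 * ‖z‖ ^ 2 + 1 / μ * ‖e‖ ^ 2 := by
      have h7 : 0 ≤ (μ * ‖z‖ / 2 - ‖e‖) ^ 2 / μ := by positivity
      have h8 : (μ * ‖z‖ / 2 - ‖e‖) ^ 2 / μ =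
        μ / 4 * ‖z‖ ^ 2 + 1 / μ * ‖e‖ ^ 2 - ‖e‖ * ‖z‖ := by field_simp; ring
      linarith
    linarith
  rw [inner_sub_left, real_inner_comm] at h1
  have h9 : γ ≤ 1 / (2 * μ) := hγ1.trans (one_div_le_one_div_of_le (by positivity) (by linarith))
  have h10 : γ / 2 * ‖ω‖ ^ 2 - γ * ‖e‖ ^ 2 + μ / 4 * ‖z‖ ^ 2 - 1 / μ * ‖e‖ ^ 2 ≤ ⟪z, ω⟫ := by
    nlinarith [mul_le_mul_of_nonneg_left h3 hγ0.le]
  have h11 : 0 ≤ γ * a := by positivity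
  have h12 := mul_le_mul_of_nonneg_left h10 h11
  have h13 : γ * ‖e‖ ^ 2 ≤ 1 / (2 * μ) * ‖e‖ ^ 2 := by gcongr
  have h14 := mul_le_mul_of_nonneg_left h13 h11
  -- The square of the step itself uses up `1/16` of the gain, since `a ≤ 1/16`; hence the factor
  -- `15/16`.
  have h15 : (γ * a) ^ 2 * ‖ω‖ ^ 2 ≤ 1 / 16 * (γ ^ 2 * a * ‖ω‖ ^ 2) := by
    have : (γ * a) ^ 2 * ‖ω‖ ^ 2 = a * (γ ^ 2 * a * ‖ω‖ ^ 2) := by ring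
    rw [this]; gcongr
  have h16 : 3 * γ * a / μ * ‖e‖ ^ 2 =
    2 * (γ * a * (1 / μ * ‖e‖ ^ 2)) + 2 * (γ * a * (1 / (2 * μ) * ‖e‖ ^ 2)) := by field_simp; ring
  rw [h16]
  linarith

/-- First-order expansion of `x ↦ f(x, y_x)` with a quadratic remainder. -/
theorem abs_value_taylor_le (h : MeanRegular K μ f g) (hK : K.Valid) (hμ : 0 < μ) (x x' : E p) :
    |f x' (argminPt (g x')) - f x (argminPt (g x)) -
        ⟪hypGrad f g x (argminPt (g x)), x' - x⟫| ≤
      (K.L / 2 + (K.Lxy + K.Lyy) * (K.Cf / μ) / 2) * (1 + (K.L / μ) ^ 2) * ‖x' - x‖ ^ 2 := by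
  have hL := hK.L_pos
  set y := argminPt (g x)
  set y' := argminPt (g x')
  set q := hessSolve f g x y with hq
  have h1 := h.f_taylor x x' y y'
  have h2 := h.gradY_taylor x x' y y' q
  -- `∇_y g` vanishes at both minimizers, so its expansion says that `⟪J q, x' - x⟫ + ⟪H (y' - y),
  -- q⟫` is quadratically small. By symmetry and `H q = ∇_y f` the second term is `⟪∇_y f, y' - y⟫`,
  -- which eliminates `y' - y` from the expansion of `f`.
  rw [h.gradY_argminPt hL hμ x, h.gradY_argminPt hL hμ x', inner_zero_left, h.hess_symm,
    h.hessSolve_spec hμ] at h2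
  have h3 : ‖pair x' y' - pair x y‖ ^ 2 ≤ (1 + (K.L / μ) ^ 2) * ‖x' - x‖ ^ 2 := by
    rw [norm_pair_sub_sq, add_mul, one_mul, ← mul_pow]
    have := h.argminPt_lipschitz hL hμ x' x
    gcongr
  have h4 := h.norm_hessSolve_le hμ x y
  rw [← hq] at h4
  have hS : 0 ≤ K.Lxy + K.Lyy := add_nonneg hK.Lxy_nonneg hK.Lyy_nonneg
  have hC := hK.Cf_nonneg
  have h5 : (K.Lxy + K.Lyy) * ‖pair x' y' - pair x y‖ ^ 2 * ‖q‖ / 2 ≤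
      (K.Lxy + K.Lyy) * ((1 + (K.L / μ) ^ 2) * ‖x' - x‖ ^ 2) * (K.Cf / μ) / 2 := by gcongr
  have h6 : K.L / 2 * ‖pair x' y' - pair x y‖ ^ 2 ≤
      K.L / 2 * ((1 + (K.L / μ) ^ 2) * ‖x' - x‖ ^ 2) := by gcongr
  rw [hypGrad, ← hq, inner_sub_left]
  rw [real_inner_comm (gradY f x y)] at h2
  have e : f x' y' - f x y - (⟪gradX f x y, x' - x⟫ - ⟪jacXY g x y q, x' - x⟫) =
      (f x' y' - f x y - (⟪gradX f x y, x' - x⟫ + ⟪gradY f x y, y' - y⟫)) -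
      (0 - 0 - (⟪jacXY g x y q, x' - x⟫ + ⟪gradY f x y, y' - y⟫)) := by ring
  rw [e]
  refine (abs_sub _ _).trans ((add_le_add (h1.trans h6) (h2.trans h5)).trans (le_of_eq (by ring)))

/-- The point `(x, y_x)` moves by at most `√(1 + κ²) ≤ 1 + κ` times the displacement of `x`; this is
the factor between `L̂` and `L̄`. -/
theorem hypGrad_argmin_lipschitz (h : MeanRegular K μ f g) (hK : K.Valid) (hμ : 0 < μ)
    (hμL : μ ≤ K.L) {Λ : ℝ}
    (hΛ : K.L + K.L ^ 2 / μ + K.Lxy * K.Cf / μ + K.L * K.Lyy * K.Cf / μ ^ 2 ≤ Λ) (x x' : E p) :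
    ‖hypGrad f g x (argminPt (g x)) - hypGrad f g x' (argminPt (g x'))‖ ≤
      (1 + K.L / μ) * Λ * ‖x - x'‖ := by
  have hL := hK.L_pos
  have h1 := h.hypGrad_lipschitz hK hμ hμL x (argminPt (g x)) x' (argminPt (g x'))
  have h2 : ‖pair x (argminPt (g x)) - pair x' (argminPt (g x'))‖ ≤ (1 + K.L / μ) * ‖x - x'‖ := by
    refine abs_le_of_sq_le_sq' ?_ (by positivity) |>.2
    rw [norm_pair_sub_sq]
    have h3 := h.argminPt_lipschitz hL hμ x x'
    have h4 := pow_le_pow_left₀ (norm_nonneg _) h3 2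
    have h5 : 0 ≤ K.L / μ * ‖x - x'‖ ^ 2 := by positivity
    nlinarith
  have h0 : 0 ≤ K.L + K.L ^ 2 / μ + K.Lxy * K.Cf / μ + K.L * K.Lyy * K.Cf / μ ^ 2 := by
    have := hK.Cf_nonneg; have := hK.Lxy_nonneg; have := hK.Lyy_nonneg
    positivity
  calc _ ≤ _ := h1
    _ ≤ Λ * ((1 + K.L / μ) * ‖x - x'‖) := mul_le_mul hΛ h2 (norm_nonneg _) (h0.trans hΛ)
    _ = _ := by ring

end MeanRegular

/-! ### Differentiability of `h` and Lipschitz continuity of its gradient -/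

section Upper

variable {p d M : ℕ} {Ξf Ξg : Type*} [MeasurableSpace Ξf] [MeasurableSpace Ξg]
  {K : Constants} {μ : ℝ} {P : Problem p d M Ξf Ξg}

/-- The gradient of `h`. -/
noncomputable def hGrad (P : Problem p d M Ξf Ξg) (x : E p) : E p :=
  avg fun m => hypGrad (P.f m) (P.g m) x (P.yStar m x)

theorem norm_avg_le {c : ℝ} (hc : 0 ≤ c) {v : Fin M → E p} (h : ∀ m, ‖v m‖ ≤ c) : ‖avg v‖ ≤ c := by
  rcases Nat.eq_zero_or_pos M with rfl | hM
  · simpa [avg] using hc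
  have hM' : (0 : ℝ) < M := by exact_mod_cast hM
  rw [avg, norm_smul, Real.norm_eq_abs, abs_of_pos (by positivity), one_div, inv_mul_le_iff₀ hM']
  refine (norm_sum_le _ _).trans ((Finset.sum_le_sum fun m _ => h m).trans ?_)
  simp

theorem avg_sub (v w : Fin M → E p) : avg v - avg w = avg fun m => v m - w m := by
  simp [avg, smul_sub]

theorem Assumptions.hasGradientAt_h (hK : K.Valid) (hA : Assumptions K μ P) (hμ : 0 < μ)
    (x : E p) : HasGradientAt P.h (hGrad P x) x := by
  refine hasGradientAt_of_quadratic (C := (K.L / 2 + (K.Lxy + K.Lyy) * (K.Cf / μ) / 2) *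
    (1 + (K.L / μ) ^ 2)) fun x' => ?_
  have hL := hK.L_pos
  have hC := hK.Cf_nonneg
  have h1 := hK.Lxy_nonneg
  have h2 := hK.Lyy_nonneg
  rcases Nat.eq_zero_or_pos M with rfl | hM
  · simp only [Problem.h, hGrad, avg, Finset.univ_eq_empty, Finset.sum_empty, mul_zero, smul_zero,
      inner_zero_left, sub_zero, abs_zero]
    positivity
  have hM' : (0 : ℝ) < M := by exact_mod_cast hM
  have e : P.h x' - P.h x - ⟪hGrad P x, x' - x⟫ = (1 / (M : ℝ)) * ∑ m, (P.f m x' (P.yStar m x') -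
      P.f m x (P.yStar m x) - ⟪hypGrad (P.f m) (P.g m) x (P.yStar m x), x' - x⟫) := by
    simp only [Problem.h, hGrad, avg, Finset.sum_sub_distrib, inner_smul_left, sum_inner, mul_sub,
      conj_trivial]
  rw [e, abs_mul, abs_of_pos (by positivity), one_div, inv_mul_le_iff₀ hM']
  refine (Finset.abs_sum_le_sum_abs _ _).trans ((Finset.sum_le_sum fun m _ =>
    (hA.meanRegular hK m).abs_value_taylor_le hK hμ x x').trans ?_)
  simp

theorem Lhat_ge (K : Constants) (s : Config) :
    K.L + K.L ^ 2 / s.μ + K.Lxy * K.Cf / s.μ + K.L * K.Lyy * K.Cf / s.μ ^ 2 ≤ Lhat K s :=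
  le_max_right _ _

theorem one_le_Lhat (K : Constants) (s : Config) : 1 ≤ Lhat K s := le_max_left _ _

variable {s : Config} {P : Problem p d s.M Ξf Ξg}

theorem Assumptions.hGrad_lipschitz (hK : K.Valid) (hA : Assumptions K s.μ P) (hμ : 0 < s.μ)
    (hμL : s.μ ≤ K.L) (x x' : E p) : ‖hGrad P x - hGrad P x'‖ ≤ Lbar K s * ‖x - x'‖ := by
  have hL := hK.L_pos
  have := one_le_Lhat K s
  rw [hGrad, hGrad, avg_sub]
  have h1 : 0 ≤ Lbar K s := by unfold Lbar kappa; positivity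
  exact norm_avg_le (by positivity) fun m =>
    (hA.meanRegular hK m).hypGrad_argmin_lipschitz hK hμ hμL (Lhat_ge K s) x x'

end Upper

/-! ### Measurability of sampled derivatives at random points -/

section Measurability

variable {p d : ℕ} {Ξ : Type*} [MeasurableSpace Ξ]

theorem measurable_of_inner {Ω : Type*} {m : MeasurableSpace Ω} {n : ℕ} {u : Ω → E n}
    (h : ∀ v, Measurable[m] fun ω => ⟪u ω, v⟫) : Measurable[m] u := by
  have e : u = fun ω => ∑ i, ⟪u ω, EuclideanSpace.basisFun (Fin n) ℝ i⟫ •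
      EuclideanSpace.basisFun (Fin n) ℝ i := by
    ext1 ω
    conv_lhs => rw [← (EuclideanSpace.basisFun (Fin n) ℝ).sum_repr' (u ω)]
    exact Finset.sum_congr rfl fun i _ => by rw [real_inner_comm]
  rw [e]
  exact Finset.measurable_fun_sum _ fun i _ => (h _).smul_const _

/-- A directional derivative is the limit of the difference quotients with steps `1/k`, each of them
measurable in the sample. -/
theorem measurable_fderiv_apply {n : ℕ} {V : Type*} [NormedAddCommGroup V] [NormedSpace ℝ V]
    [MeasurableSpace V] [BorelSpace V] [SecondCountableTopology V]
    {u : Ξ → E n → V} {u' : Ξ → E n →L[ℝ] V} {x : E n}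
    (hd : ∀ ξ, HasFDerivAt (u ξ) (u' ξ) x) (hu : ∀ x, Measurable fun ξ => u ξ x) (v : E n) :
    Measurable fun ξ => u' ξ v := by
  refine measurable_of_tendsto_metrizable
    (f := fun (k : ℕ) ξ => (k : ℝ) • (u ξ (x + (k : ℝ)⁻¹ • v) - u ξ x)) (fun k => ?_) ?_
  · exact ((hu _).sub (hu _)).const_smul _
  · rw [tendsto_pi_nhds]
    intro ξ
    exact ((hd ξ).lim_real v).comp tendsto_natCast_atTop_atTop

variable {φ : Ξ → E p → E d → ℝ}

theorem measurable_gradX (hm : ∀ x y, Measurable fun ξ => φ ξ x y)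
    (hd : ∀ ξ, Differentiable ℝ fun z : E p × E d => φ ξ z.1 z.2) (x : E p) (y : E d) :
    Measurable fun ξ => gradX (φ ξ) x y := by
  refine measurable_of_inner fun v => ?_
  have h1 : ∀ ξ, HasFDerivAt (fun x' => φ ξ x' y)
      (InnerProductSpace.toDual ℝ (E p) (gradX (φ ξ) x y)) x := fun ξ => by
    rw [← hasGradientAt_iff_hasFDerivAt]
    refine DifferentiableAt.hasGradientAt ?_
    exact (hd ξ (x, y)).comp (f := fun x' : E p => (x', y)) x
      (differentiableAt_id.prodMk (differentiableAt_const y))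
  simpa using measurable_fderiv_apply h1 (fun x' => hm x' y) v

theorem measurable_gradY (hm : ∀ x y, Measurable fun ξ => φ ξ x y)
    (hd : ∀ ξ, Differentiable ℝ fun z : E p × E d => φ ξ z.1 z.2) (x : E p) (y : E d) :
    Measurable fun ξ => gradY (φ ξ) x y := by
  refine measurable_of_inner fun v => ?_
  have h1 : ∀ ξ, HasFDerivAt (fun y' => φ ξ x y')
      (InnerProductSpace.toDual ℝ (E d) (gradY (φ ξ) x y)) y := fun ξ => by
    rw [← hasGradientAt_iff_hasFDerivAt]
    refine DifferentiableAt.hasGradientAt ?_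
    exact (hd ξ (x, y)).comp (f := fun y' : E d => (x, y')) y
      ((differentiableAt_const x).prodMk differentiableAt_id)
  simpa using measurable_fderiv_apply h1 (fun y' => hm x y') v

variable {Ω : Type*} {mΩ : MeasurableSpace Ω} {ξ : Ω → Ξ} {X : Ω → E p} {Y : Ω → E d}

/-- Carathéodory functions: continuity in `(x, y)` and measurability in the sample give joint
measurability, so random points may be inserted. -/
theorem measurable_pairLipschitz_comp {V : Type*} [NormedAddCommGroup V] [MeasurableSpace V]
    [BorelSpace V] [SecondCountableTopology V] {A : Ξ → E p → E d → V} {L : ℝ}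
    (hm : ∀ x y, Measurable fun ξ => A ξ x y) (hL : ∀ ξ, PairLipschitz L (A ξ))
    (hξ : Measurable ξ) (hX : Measurable X) (hY : Measurable Y) :
    Measurable fun ω => A (ξ ω) (X ω) (Y ω) := by
  have h := measurable_uncurry_of_continuous_of_measurable
    (u := fun (z : E p × E d) ξ => A ξ z.1 z.2) (fun ξ => (hL ξ).continuous)
    (fun z => hm z.1 z.2)
  exact h.comp ((hX.prodMk hY).prodMk hξ)

/-- Operators are only handled through their values on vectors, with the vector treated as a further
continuous variable; no measurability in the operator space is used. -/
theorem measurable_clm_pairLipschitz_comp {n : ℕ} {A : Ξ → E p → E d → E d →L[ℝ] E n} {L : ℝ}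
    (hm : ∀ x y v, Measurable fun ξ => A ξ x y v) (hL : ∀ ξ, PairLipschitz L (A ξ))
    {v : Ω → E d} (hξ : Measurable ξ) (hX : Measurable X) (hY : Measurable Y) (hv : Measurable v) :
    Measurable fun ω => A (ξ ω) (X ω) (Y ω) (v ω) := by
  have h := measurable_uncurry_of_continuous_of_measurable
    (u := fun (z : (E p × E d) × E d) ξ => A ξ z.1.1 z.1.2 z.2)
    (fun ξ => ((hL ξ).continuous.comp continuous_fst).clm_apply continuous_snd)
    (fun z => hm z.1.1 z.1.2 z.2)
  exact h.comp (((hX.prodMk hY).prodMk hv).prodMk hξ)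

end Measurability

section HyperMeasurability

variable {p d M : ℕ} {Ξf Ξg : Type*} [MeasurableSpace Ξf] [MeasurableSpace Ξg]
  {K : Constants} {μ : ℝ} {P : Problem p d M Ξf Ξg}
  {Ω : Type*} {mΩ : MeasurableSpace Ω} {X : Ω → E p} {Y : Ω → E d}

theorem Assumptions.measurable_gradX_comp (hA : Assumptions K μ P) (m : Fin M) {ξ : Ω → Ξf}
    (hξ : Measurable ξ) (hX : Measurable X) (hY : Measurable Y) :
    Measurable fun ω => gradX (P.F m (ξ ω)) (X ω) (Y ω) :=
  measurable_pairLipschitz_comp (A := fun ξ => gradX (P.F m ξ)) (measurable_gradX (hA.measF m)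
    fun ξ => (hA.upper m ξ).contDiff.differentiable one_ne_zero)
    (fun ξ => (hA.upper m ξ).smooth.gradX) hξ hX hY

theorem Assumptions.measurable_gradY_comp (hA : Assumptions K μ P) (m : Fin M) {ξ : Ω → Ξf}
    (hξ : Measurable ξ) (hX : Measurable X) (hY : Measurable Y) :
    Measurable fun ω => gradY (P.F m (ξ ω)) (X ω) (Y ω) :=
  measurable_pairLipschitz_comp (A := fun ξ => gradY (P.F m ξ)) (measurable_gradY (hA.measF m)
    fun ξ => (hA.upper m ξ).contDiff.differentiable one_ne_zero)
    (fun ξ => (hA.upper m ξ).smooth.gradY) hξ hX hY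

theorem Assumptions.measurable_lower_comp (hA : Assumptions K μ P) (m : Fin M) {ξ : Ω → Ξg}
    (hξ : Measurable ξ) (hX : Measurable X) (hY : Measurable Y) :
    Measurable fun ω => gradY (P.G m (ξ ω)) (X ω) (Y ω) :=
  measurable_pairLipschitz_comp (A := fun ξ => gradY (P.G m ξ)) (measurable_gradY (hA.measG m)
    fun ξ => (hA.lower m ξ).contDiff.differentiable two_ne_zero)
    (fun ξ => (hA.lower m ξ).smooth.gradY) hξ hX hY

theorem Assumptions.measurable_hess_comp (hA : Assumptions K μ P) (m : Fin M) {ξ : Ω → Ξg}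
    {v : Ω → E d} (hξ : Measurable ξ) (hX : Measurable X) (hY : Measurable Y) (hv : Measurable v) :
    Measurable fun ω => hessYY (P.G m (ξ ω)) (X ω) (Y ω) (v ω) := by
  refine measurable_clm_pairLipschitz_comp (A := fun ξ => hessYY (P.G m ξ)) (fun x y v => ?_)
    (fun ξ => (hA.lower m ξ).lip_yy) hξ hX hY hv
  exact measurable_fderiv_apply (fun ξ => hasFDerivAt_hessYY (hA.lower m ξ).contDiff x y)
    (fun y' => measurable_gradY (hA.measG m)
      (fun ξ => (hA.lower m ξ).contDiff.differentiable two_ne_zero) x y') v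

theorem Assumptions.measurable_jac_comp (hA : Assumptions K μ P) (m : Fin M) {ξ : Ω → Ξg}
    {v : Ω → E d} (hξ : Measurable ξ) (hX : Measurable X) (hY : Measurable Y) (hv : Measurable v) :
    Measurable fun ω => jacXY (P.G m (ξ ω)) (X ω) (Y ω) (v ω) := by
  refine measurable_clm_pairLipschitz_comp (A := fun ξ => jacXY (P.G m ξ)) (fun x y v => ?_)
    (fun ξ => (hA.lower m ξ).lip_xy) hξ hX hY hv
  exact measurable_fderiv_apply (fun ξ => hasFDerivAt_jacXY (hA.lower m ξ).contDiff x y)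
    (fun y' => measurable_gradX (hA.measG m)
      (fun ξ => (hA.lower m ξ).contDiff.differentiable two_ne_zero) x y') v

theorem Assumptions.measurable_neumann_comp (hA : Assumptions K μ P) (m : Fin M) {τ : ℝ} {Q : ℕ}
    {ξH : Ω → ℕ → Ξg} {v : Ω → E d} (hX : Measurable X) (hY : Measurable Y) (hv : Measurable v)
    {k : ℕ} (hk : k ≤ Q) (hξ : ∀ j, Q - k < j → j ≤ Q → Measurable fun ω => ξH ω j) :
    Measurable fun ω => neumannProd τ Q (P.G m) (ξH ω) (X ω) (Y ω) k (v ω) := by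
  induction k with
  | zero => simpa [neumannProd_zero] using hv
  | succ k ih =>
    simp only [neumannProd_succ _ _ _ hk, mul_apply_eq_comp, sub_apply,
      one_apply_eq_self, smul_apply]
    have h1 := ih (by omega) fun j h1 h2 => hξ j (by omega) h2
    exact h1.sub ((hA.measurable_hess_comp m (hξ (Q - k) (by omega) (by omega)) hX hY
      h1).const_smul τ)

theorem Assumptions.measurable_hyperEst_comp (hA : Assumptions K μ P) (m : Fin M) {τ : ℝ} {Q : ℕ}
    {ξF : Ω → Ξf} {ξG : Ω → Ξg} {ξH : Ω → ℕ → Ξg} (hF : Measurable ξF) (hG : Measurable ξG)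
    (hH : ∀ j, Measurable fun ω => ξH ω j) (hX : Measurable X) (hY : Measurable Y) :
    Measurable fun ω => hyperEst τ Q (P.F m) (P.G m) (ξF ω) (ξG ω) (ξH ω) (X ω) (Y ω) := by
  unfold hyperEst
  refine (hA.measurable_gradX_comp m hF hX hY).sub ((hA.measurable_jac_comp m hG hX hY
    (Finset.measurable_fun_sum _ fun k hk => ?_)).const_smul τ)
  exact hA.measurable_neumann_comp m hX hY (hA.measurable_gradY_comp m hF hX hY)
    (Nat.lt_succ_iff.1 (Finset.mem_range.1 hk)) fun j _ _ => hH j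

end HyperMeasurability

/-! ### Independence of disjoint groups of samples -/

section Independence

variable {p d M : ℕ} {Ξf Ξg Ω : Type*} [MeasurableSpace Ξf] [MeasurableSpace Ξg]
  {ξf : ℕ × Fin M × ℕ → Ω → Ξf} {ξg : GIndex M → Ω → Ξg}

/-- The σ-algebra of one sample. -/
abbrev sampleSigma (ξf : ℕ × Fin M × ℕ → Ω → Ξf) (ξg : GIndex M → Ω → Ξg) :
    (ℕ × Fin M × ℕ) ⊕ GIndex M → MeasurableSpace Ω :=
  Sum.elim (fun i => MeasurableSpace.comap (ξf i) inferInstance)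
    (fun i => MeasurableSpace.comap (ξg i) inferInstance)

/-- The σ-algebra generated by the samples with index in `S`. -/
abbrev sigmaOf (ξf : ℕ × Fin M × ℕ → Ω → Ξf) (ξg : GIndex M → Ω → Ξg)
    (S : Set ((ℕ × Fin M × ℕ) ⊕ GIndex M)) : MeasurableSpace Ω :=
  ⨆ i ∈ S, sampleSigma ξf ξg i

theorem sigmaOf_mono {S T : Set ((ℕ × Fin M × ℕ) ⊕ GIndex M)} (h : S ⊆ T) :
    sigmaOf ξf ξg S ≤ sigmaOf ξf ξg T := biSup_mono fun _ hi => h hi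

theorem measurable_sigmaOf_f {S : Set ((ℕ × Fin M × ℕ) ⊕ GIndex M)} {i : ℕ × Fin M × ℕ}
    (h : Sum.inl i ∈ S) : Measurable[sigmaOf ξf ξg S] (ξf i) := by
  rw [measurable_iff_comap_le]
  exact le_biSup (sampleSigma ξf ξg) h

theorem measurable_sigmaOf_g {S : Set ((ℕ × Fin M × ℕ) ⊕ GIndex M)} {i : GIndex M}
    (h : Sum.inr i ∈ S) : Measurable[sigmaOf ξf ξg S] (ξg i) := by
  rw [measurable_iff_comap_le]
  exact le_biSup (sampleSigma ξf ξg) h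

variable [MeasurableSpace Ω] {P : Problem p d M Ξf Ξg} {Pr : Measure Ω}

theorem IsSampling.sampleSigma_le (h : IsSampling P Pr ξf ξg) (i : (ℕ × Fin M × ℕ) ⊕ GIndex M) :
    sampleSigma ξf ξg i ≤ ‹MeasurableSpace Ω› := by
  rcases i with i | i
  · exact (h.meas_f i).comap_le
  · exact (h.meas_g i).comap_le

theorem IsSampling.sigmaOf_le (h : IsSampling P Pr ξf ξg)
    (S : Set ((ℕ × Fin M × ℕ) ⊕ GIndex M)) : sigmaOf ξf ξg S ≤ ‹MeasurableSpace Ω› :=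
  iSup₂_le fun i _ => h.sampleSigma_le i

/-- A finite intersection of events splits into its `f`-part and its `g`-part. Independence of the
two families from each other separates these, and independence within each family finishes. -/
theorem IsSampling.iIndep_sampleSigma (h : IsSampling P Pr ξf ξg) :
    iIndep (sampleSigma ξf ξg) Pr := by
  classical
  rw [iIndep_iff]
  intro s A hA
  have hf := (iIndepFun_iff_iIndep _ _ _).1 h.indep_f
  have hg := (iIndepFun_iff_iIndep _ _ _).1 h.indep_g
  rw [iIndep_iff] at hf hg
  have h1 := hf s.toLeft (f := fun i => A (Sum.inl i)) fun i hi =>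
    hA (Sum.inl i) (Finset.mem_toLeft.1 hi)
  have h2 := hg s.toRight (f := fun i => A (Sum.inr i)) fun i hi =>
    hA (Sum.inr i) (Finset.mem_toRight.1 hi)
  have e1 : ⋂ i ∈ s, A i = (⋂ i ∈ s.toLeft, A (Sum.inl i)) ∩ ⋂ i ∈ s.toRight, A (Sum.inr i) := by
    ext ω
    simp [Finset.mem_toLeft, Finset.mem_toRight]
  have e2 : ∏ i ∈ s, Pr (A i) =
      (∏ i ∈ s.toLeft, Pr (A (Sum.inl i))) * ∏ i ∈ s.toRight, Pr (A (Sum.inr i)) := by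
    conv_lhs => rw [← Finset.toLeft_disjSum_toRight (u := s)]
    rw [Finset.prod_disjSum]
  rw [e1, e2, ← h1, ← h2]
  refine (Indep_iff _ _ _).1 h.indep_fg _ _ ?_ ?_
  · refine Finset.measurableSet_biInter _ fun i hi => ?_
    obtain ⟨B, hB, hBA⟩ := hA (Sum.inl i) (Finset.mem_toLeft.1 hi)
    exact ⟨(fun u => u i) ⁻¹' B, measurable_pi_apply i hB, hBA⟩
  · refine Finset.measurableSet_biInter _ fun i hi => ?_
    obtain ⟨B, hB, hBA⟩ := hA (Sum.inr i) (Finset.mem_toRight.1 hi)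
    exact ⟨(fun u => u i) ⁻¹' B, measurable_pi_apply i hB, hBA⟩

theorem IsSampling.indepFun (h : IsSampling P Pr ξf ξg)
    {S T : Set ((ℕ × Fin M × ℕ) ⊕ GIndex M)} (hST : Disjoint S T)
    {W W' : Type*} [MeasurableSpace W] [MeasurableSpace W'] {X : Ω → W} {Y : Ω → W'}
    (hX : Measurable[sigmaOf ξf ξg S] X) (hY : Measurable[sigmaOf ξf ξg T] Y) :
    IndepFun X Y Pr :=
  indep_of_indep_of_le_right (indep_of_indep_of_le_left
    (indep_iSup_of_disjoint h.sampleSigma_le h.iIndep_sampleSigma hST) hX.comap_le) hY.comap_le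

end Independence

/-! ### The mean of the hypergradient estimator -/

section Expectation

variable {p d M : ℕ} {Ξf Ξg Ω : Type*} [MeasurableSpace Ξf] [MeasurableSpace Ξg]
  [MeasurableSpace Ω] {P : Problem p d M Ξf Ξg} {Pr : Measure Ω}
  {ξf : ℕ × Fin M × ℕ → Ω → Ξf} {ξg : GIndex M → Ω → Ξg} {K : Constants} {μ : ℝ}

theorem integral_clm_apply_of_indep {F₁ F₂ Ξ : Type*} [NormedAddCommGroup F₁] [NormedSpace ℝ F₁]
    [CompleteSpace F₁] [MeasurableSpace F₁] [BorelSpace F₁] [SecondCountableTopology F₁]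
    [NormedAddCommGroup F₂] [NormedSpace ℝ F₂] [CompleteSpace F₂]
    [MeasurableSpace Ξ] {X : Ω → Ξ} {Y : Ω → F₁} (hXY : IndepFun X Y Pr) (hX : Measurable X)
    (hY : Measurable Y) {A : Ξ → F₁ →L[ℝ] F₂} (hA : Integrable A (Measure.map X Pr))
    (hYi : Integrable Y Pr) :
    ∫ ω, A (X ω) (Y ω) ∂Pr = (∫ ξ, A ξ ∂(Measure.map X Pr)) (∫ ω, Y ω ∂Pr) := by
  have := hXY.integral_bilin_comp_comp (f := A) (g := id) hX.aemeasurable hY.aemeasurable hA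
    ((integrable_map_measure aestronglyMeasurable_id hY.aemeasurable).2 hYi)
    (ContinuousLinearMap.id ℝ (F₁ →L[ℝ] F₂))
  rw [integral_map hX.aemeasurable hA.1]
  simpa using this

/-- The samples in the hypergradient estimator of client `m` at time `t`, batch element `i`. -/
def hyperIdx (t : ℕ) (m : Fin M) (i : ℕ) : Set ((ℕ × Fin M × ℕ) ⊕ GIndex M) :=
  {Sum.inl (t, m, i), Sum.inr (.jac t m i)} ∪ Set.range fun j => Sum.inr (.hess t m i j)

theorem integrable_of_norm_le [IsFiniteMeasure Pr] {V : Type*} [NormedAddCommGroup V]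
    [MeasurableSpace V] [BorelSpace V] [SecondCountableTopology V] {u : Ω → V} (hu : Measurable u)
    {c : ℝ} (hc : ∀ ω, ‖u ω‖ ≤ c) : Integrable u Pr :=
  Integrable.of_bound hu.aestronglyMeasurable c (Filter.Eventually.of_forall hc)

theorem Assumptions.lowerBounds (hK : K.Valid) (hA : Assumptions K μ P) (hμL : μ ≤ K.L) {τ : ℝ}
    (hτ0 : 0 < τ) (hτ1 : τ < 1 / K.L) (m : Fin M) (ξ : Ξg) : LowerBounds K μ τ (P.G m ξ) where
  jac_lip := (hA.lower m ξ).lip_xy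
  jac_bound := norm_jacXY_le hK.L_pos.le (hA.lower m ξ).smooth
  hess_lip := (hA.lower m ξ).lip_yy
  contract x y := norm_one_sub_smul_le hK.L_pos hμL hτ0 hτ1 (hessYY_symm (hA.lower m ξ).contDiff x y)
      (inner_hessYY_ge (hA.lower m ξ).contDiff x ((hA.lower m ξ).strongConvex x) y)
      (norm_hessYY_le hK.L_pos.le (hA.lower m ξ).smooth x y)

theorem Assumptions.upperBounds (hA : Assumptions K μ P) (m : Fin M) (ξ : Ξf) :
    UpperBounds K (P.F m ξ) := ⟨(hA.upper m ξ).smooth, (hA.upper m ξ).grad_le⟩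

/-- Unbiasedness is assumed for the pair of partial gradients; testing with `(w, 0)` and `(0, w)`
extracts the two components. -/
theorem integral_grad_comp {φ : Ξf → E p → E d → ℝ} {f : E p → E d → ℝ} {D : Measure Ξf} {σ : ℝ}
    {x : E p} {y : E d} {X : Ω → Ξf} (hX : Measurable X) (hD : Measure.map X Pr = D)
    (h : UnbiasedOracle D (fun ξ => fullGrad (φ ξ) x y) (fullGrad f x y) σ)
    (h1 : Integrable (fun ω => gradX (φ (X ω)) x y) Pr)
    (h2 : Integrable (fun ω => gradY (φ (X ω)) x y) Pr) :
    ∫ ω, gradX (φ (X ω)) x y ∂Pr = gradX f x y ∧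
      ∫ ω, gradY (φ (X ω)) x y ∂Pr = gradY f x y := by
  have e := integral_map (μ := Pr) hX.aemeasurable (f := fun ξ => fullGrad (φ ξ) x y)
    (by rw [hD]; exact h.1.1)
  rw [hD, h.2.1] at e
  have h3 : Integrable (fun ω => fullGrad (φ (X ω)) x y) Pr := by
    refine Integrable.comp_measurable (f := X) (g := fun ξ => fullGrad (φ ξ) x y) ?_ hX
    rw [hD]; exact h.1
  constructor
  · refine ext_inner_left ℝ fun w => ?_
    rw [← integral_inner h1]
    have h4 := integral_inner (𝕜 := ℝ) h3 (pair w 0)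
    rw [← e] at h4
    simpa only [fullGrad, inner_pair, inner_zero_left, add_zero] using h4
  · refine ext_inner_left ℝ fun w => ?_
    rw [← integral_inner h2]
    have h4 := integral_inner (𝕜 := ℝ) h3 (pair 0 w)
    rw [← e] at h4
    simpa only [fullGrad, inner_pair, inner_zero_left, zero_add] using h4

/-- The samples in the product of `k` Neumann factors, applied to the sampled `∇_y f`. -/
def neumannIdx (Q t : ℕ) (m : Fin M) (i k : ℕ) : Set ((ℕ × Fin M × ℕ) ⊕ GIndex M) :=
  {Sum.inl (t, m, i)} ∪ {l | ∃ j, Q - k < j ∧ l = Sum.inr (.hess t m i j)}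

variable (P ξf ξg) in
/-- The product of `k` Neumann factors, applied to the sampled `∇_y f`. -/
noncomputable def neumannVec (τ : ℝ) (Q t : ℕ) (m : Fin M) (i : ℕ) (x : E p) (y : E d) (k : ℕ) (ω : Ω) : E d :=
  neumannProd τ Q (P.G m) (fun j => ξg (.hess t m i j) ω) x y k
    (gradY (P.F m (ξf (t, m, i) ω)) x y)

theorem Assumptions.measurable_neumannVec (hA : Assumptions K μ P) (τ : ℝ) (Q t : ℕ) (m : Fin M)
    (i : ℕ) (x : E p) (y : E d) {k : ℕ} (hk : k ≤ Q) :
    Measurable[sigmaOf ξf ξg (neumannIdx Q t m i k)] (neumannVec P ξf ξg τ Q t m i x y k) :=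
  hA.measurable_neumann_comp m (mΩ := sigmaOf ξf ξg (neumannIdx Q t m i k))
    measurable_const measurable_const
    (hA.measurable_gradY_comp m (measurable_sigmaOf_f (by simp [neumannIdx])) measurable_const
      measurable_const) hk fun j h1 _ => measurable_sigmaOf_g (by simp [neumannIdx, h1])

theorem Assumptions.integrable_neumannVec (hK : K.Valid) (hA : Assumptions K μ P)
    (hμL : μ ≤ K.L) [IsProbabilityMeasure Pr] (hS : IsSampling P Pr ξf ξg) {τ : ℝ} {Q : ℕ}
    (hτ0 : 0 < τ) (hτ1 : τ < 1 / K.L) (t : ℕ) (m : Fin M) (i : ℕ) (x : E p) (y : E d)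
    {k : ℕ} (hk : k ≤ Q) : Integrable (neumannVec P ξf ξg τ Q t m i x y k) Pr := by
  have hρ : 0 ≤ 1 - τ * μ := by
    have hτL : τ * K.L < 1 := by rwa [lt_div_iff₀ hK.L_pos] at hτ1
    exact sub_nonneg.2 ((mul_le_mul_of_nonneg_left hμL hτ0.le).trans hτL.le)
  refine integrable_of_norm_le ((hA.measurable_neumannVec τ Q t m i x y hk).mono
    (hS.sigmaOf_le _) le_rfl) (c := (1 - τ * μ) ^ k * K.Cf) fun ω => ?_
  exact (ContinuousLinearMap.le_opNorm _ _).trans (mul_le_mul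
      (norm_neumannProd_le hρ (fun ξ => (hA.lowerBounds hK hμL hτ0 hτ1 m ξ).contract) _ x y hk)
      ((hA.upperBounds m _).normY x y) (norm_nonneg _) (pow_nonneg hρ _))

/-- By induction on `k`: the leftmost factor is independent of the rest, including the sampled `∇_y
f`, so its expectation can be taken separately. -/
theorem Assumptions.integral_neumannVec (hK : K.Valid) (hA : Assumptions K μ P)
    (hμL : μ ≤ K.L) [IsProbabilityMeasure Pr] (hS : IsSampling P Pr ξf ξg) {τ : ℝ} {Q : ℕ}
    (hτ0 : 0 < τ) (hτ1 : τ < 1 / K.L) (t : ℕ) (m : Fin M) (i : ℕ) (x : E p) (y : E d)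
    {k : ℕ} (hk : k ≤ Q) : ∫ ω, neumannVec P ξf ξg τ Q t m i x y k ω ∂Pr =
      ((1 - τ • hessYY (P.g m) x y) ^ k) (gradY (P.f m) x y) := by
  have := hA.probG m
  induction k with
  | zero =>
    simp only [neumannVec, neumannProd_zero, pow_zero, one_apply_eq_self]
    exact (integral_grad_comp (hS.meas_f _) (hS.law_f _) (hA.oracle_f m x y)
      (integrable_of_norm_le (hA.measurable_gradX_comp m (hS.meas_f _) measurable_const
        measurable_const) fun ω => (hA.upperBounds m _).normX x y)
      (integrable_of_norm_le (hA.measurable_gradY_comp m (hS.meas_f _) measurable_const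
        measurable_const) fun ω => (hA.upperBounds m _).normY x y)).2
  | succ k ih =>
    have h1 := ih (by omega)
    have hm := hA.measurable_neumannVec (ξf := ξf) (ξg := ξg) τ Q t m i x y (k := k) (by omega)
    -- The shorter product only involves Hessian samples with index greater than `Q - k`.
    have h2 : IndepFun (ξg (.hess t m i (Q - k))) (neumannVec P ξf ξg τ Q t m i x y k) Pr := by
      refine hS.indepFun (S := {Sum.inr (.hess t m i (Q - k))}) (T := neumannIdx Q t m i k) ?_
        (measurable_sigmaOf_g (Set.mem_singleton _)) hm
      simp [neumannIdx]
    have hHi : Integrable (fun ξ => τ • hessYY (P.G m ξ) x y) (P.Dg m) :=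
      (hA.oracle_yy m x y).1.smul τ
    have h3 := integral_clm_apply_of_indep h2 (hS.meas_g _) (hm.mono (hS.sigmaOf_le _) le_rfl)
      (A := fun ξ => 1 - τ • hessYY (P.G m ξ) x y)
      (by rw [hS.law_g, GIndex.client]; exact (integrable_const _).sub hHi)
      (hA.integrable_neumannVec hK hμL hS hτ0 hτ1 t m i x y (by omega))
    have h4 : ∫ ξ, (1 - τ • hessYY (P.G m ξ) x y) ∂(P.Dg m) = 1 - τ • hessYY (P.g m) x y := by
      rw [integral_sub (integrable_const _) hHi, integral_smul,
        (hA.oracle_yy m x y).2.1]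
      simp
    rw [hS.law_g, GIndex.client, h4, h1] at h3
    rw [pow_succ', mul_apply_eq_comp, ← h3]
    simp only [neumannVec, neumannProd_succ _ _ _ hk, mul_apply_eq_comp]

end Expectation

section Expectation

variable {p d M : ℕ} {Ξf Ξg Ω : Type*} [MeasurableSpace Ξf] [MeasurableSpace Ξg]
  [MeasurableSpace Ω] {P : Problem p d M Ξf Ξg} {Pr : Measure Ω}
  {ξf : ℕ × Fin M × ℕ → Ω → Ξf} {ξg : GIndex M → Ω → Ξg} {K : Constants} {μ : ℝ}

/-- The estimator is unbiased for the truncated formula, not for the hypergradient itself. The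
sample of `f` occurs in both terms, which linearity of the expectation permits; only the Jacobian
sample has to be independent of the vector it acts on. -/
theorem Assumptions.integral_hyperEst (hK : K.Valid) (hA : Assumptions K μ P)
    (hμL : μ ≤ K.L) [IsProbabilityMeasure Pr] (hS : IsSampling P Pr ξf ξg) {τ : ℝ} {Q : ℕ}
    (hτ0 : 0 < τ) (hτ1 : τ < 1 / K.L) (t : ℕ) (m : Fin M) (i : ℕ) (x : E p) (y : E d) :
    ∫ ω, hyperEst τ Q (P.F m) (P.G m) (ξf (t, m, i) ω) (ξg (.jac t m i) ω)
      (fun j => ξg (.hess t m i j) ω) x y ∂Pr = meanEst τ Q (P.f m) (P.g m) x y := by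
  obtain ⟨u, hu⟩ : ∃ u : Ω → E d, u = fun ω =>
    ∑ k ∈ Finset.range (Q + 1), neumannVec P ξf ξg τ Q t m i x y k ω := ⟨_, rfl⟩
  have hle : ∀ k ∈ Finset.range (Q + 1), k ≤ Q := fun k hk =>
    Nat.lt_succ_iff.1 (Finset.mem_range.1 hk)
  have hsum : ∫ ω, u ω ∂Pr =
      ∑ k ∈ Finset.range (Q + 1), ((1 - τ • hessYY (P.g m) x y) ^ k) (gradY (P.f m) x y) := by
    rw [hu, integral_finsetSum _ fun k hk =>
      hA.integrable_neumannVec hK hμL hS hτ0 hτ1 t m i x y (hle k hk)]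
    exact Finset.sum_congr rfl fun k hk =>
      hA.integral_neumannVec hK hμL hS hτ0 hτ1 t m i x y (hle k hk)
  have hsi : Integrable u Pr := by
    rw [hu]
    exact integrable_finsetSum _ fun k hk =>
      hA.integrable_neumannVec hK hμL hS hτ0 hτ1 t m i x y (hle k hk)
  have hsub : ∀ k, neumannIdx Q t m i k ⊆ {Sum.inr (.jac t m i)}ᶜ := fun k l hl => by
    rcases hl with hl | ⟨j, _, hl⟩
    · rw [Set.mem_singleton_iff.1 hl]; simp
    · rw [hl]; simp
  have hsm : Measurable[sigmaOf ξf ξg {Sum.inr (.jac t m i)}ᶜ] u := by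
    rw [hu]
    exact Finset.measurable_fun_sum _ fun k hk =>
      (hA.measurable_neumannVec τ Q t m i x y (hle k hk)).mono (sigmaOf_mono (hsub k)) le_rfl
  have hjm : Measurable[sigmaOf ξf ξg {Sum.inr (.jac t m i)}] (ξg (.jac t m i)) :=
    measurable_sigmaOf_g (Set.mem_singleton _)
  have hind : IndepFun (ξg (.jac t m i)) u Pr :=
    hS.indepFun (Set.disjoint_compl_right_iff_subset.2 subset_rfl) hjm hsm
  have hsm' : Measurable u := hsm.mono (hS.sigmaOf_le _) le_rfl
  have hjac := integral_clm_apply_of_indep hind (hS.meas_g _) hsm'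
    (A := fun ξ => jacXY (P.G m ξ) x y) (by rw [hS.law_g]; exact (hA.oracle_xy m x y).1) hsi
  rw [hS.law_g, GIndex.client, (hA.oracle_xy m x y).2.1, hsum] at hjac
  have hXi : Integrable (fun ω => gradX (P.F m (ξf (t, m, i) ω)) x y) Pr :=
    integrable_of_norm_le (hA.measurable_gradX_comp m (hS.meas_f _) measurable_const
      measurable_const) fun ω => (hA.upperBounds m _).normX x y
  have hX := (integral_grad_comp (hS.meas_f (t, m, i)) (hS.law_f _) (hA.oracle_f m x y) hXi
      (integrable_of_norm_le (hA.measurable_gradY_comp m (hS.meas_f _) measurable_const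
        measurable_const) fun ω => (hA.upperBounds m _).normY x y)).1
  have hJi : Integrable (fun ω => τ • jacXY (P.G m (ξg (.jac t m i) ω)) x y (u ω)) Pr := by
    refine Integrable.smul τ ((hsi.norm.const_mul K.L).mono' (hA.measurable_jac_comp m
      (hS.meas_g _) measurable_const measurable_const hsm').aestronglyMeasurable ?_)
    refine Filter.Eventually.of_forall fun ω => (ContinuousLinearMap.le_opNorm _ _).trans ?_
    gcongr
    exact norm_jacXY_le hK.L_pos.le (hA.lower m _).smooth x y
  have e : meanEst τ Q (P.f m) (P.g m) x y = gradX (P.f m) x y - τ • jacXY (P.g m) x y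
      (∑ k ∈ Finset.range (Q + 1), ((1 - τ • hessYY (P.g m) x y) ^ k) (gradY (P.f m) x y)) := by
    simp only [meanEst, hyperEst, neumannProd_const]
  rw [e, ← hjac, ← hX, ← integral_smul, ← integral_sub hXi hJi]
  simp only [hyperEst, hu, neumannVec]

end Expectation

/-! ### Orthogonality of fresh noise to the past -/

section Noise

variable {Ω W 𝒳 : Type*} [mΩ : MeasurableSpace Ω] [MeasurableSpace W] [MeasurableSpace 𝒳]
  {Pr : Measure Ω} [IsProbabilityMeasure Pr]

/-- Fubini for an independent pair: the past `X` is frozen while the fresh sample is averaged. It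
plays the role of conditional expectation. -/
theorem integral_comp_of_indep {F : Type*} [NormedAddCommGroup F] [NormedSpace ℝ F]
    [MeasurableSpace F] [BorelSpace F] [SecondCountableTopology F]
    {X : Ω → W} {ξ : Ω → 𝒳} (hX : Measurable X) (hξ : Measurable ξ) (hi : IndepFun X ξ Pr)
    {u : W → 𝒳 → F} (hu : Measurable (Function.uncurry u))
    (hint : Integrable (fun ω => u (X ω) (ξ ω)) Pr) :
    Integrable (fun ω => ∫ ω', u (X ω) (ξ ω') ∂Pr) Pr ∧
    ∫ ω, u (X ω) (ξ ω) ∂Pr = ∫ ω, (∫ ω', u (X ω) (ξ ω') ∂Pr) ∂Pr := by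
  have h1 := hi.map_prod_eq_prod_map_map hX.aemeasurable hξ.aemeasurable
  have : IsProbabilityMeasure (Measure.map X Pr) := Measure.isProbabilityMeasure_map hX.aemeasurable
  have : IsProbabilityMeasure (Measure.map ξ Pr) := Measure.isProbabilityMeasure_map hξ.aemeasurable
  have h2 : Integrable (Function.uncurry u) ((Measure.map X Pr).prod (Measure.map ξ Pr)) := by
    rw [← h1, integrable_map_measure hu.aestronglyMeasurable (hX.prodMk hξ).aemeasurable]
    exact hint
  have h3 : ∀ w, ∫ z, u w z ∂(Measure.map ξ Pr) = ∫ ω', u w (ξ ω') ∂Pr := fun w =>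
    integral_map hξ.aemeasurable (hu.comp measurable_prodMk_left).aestronglyMeasurable
  have h4 : Integrable (fun w => ∫ ω', u w (ξ ω') ∂Pr) (Measure.map X Pr) := by
    simp_rw [← h3]; exact h2.integral_prod_left
  refine ⟨h4.comp_measurable hX, ?_⟩
  rw [← integral_map (f := fun w => ∫ ω', u w (ξ ω') ∂Pr) hX.aemeasurable h4.1]
  simp_rw [← h3]
  have h5 := integral_prod _ h2
  simp only [Function.uncurry_apply_pair] at h5
  rw [← h5, ← h1, integral_map (hX.prodMk hξ).aemeasurable hu.aestronglyMeasurable]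
  rfl

variable {V : Type*} [NormedAddCommGroup V] [InnerProductSpace ℝ V] [CompleteSpace V]
  [MeasurableSpace V] [BorelSpace V] [SecondCountableTopology V]

theorem integrable_inner_of_memLp {X Y : Ω → V} (hX : MemLp X 2 Pr) (hY : MemLp Y 2 Pr) :
    Integrable (fun ω => ⟪X ω, Y ω⟫) Pr := by
  refine Integrable.mono' (g := fun ω => ‖X ω‖ ^ 2 + ‖Y ω‖ ^ 2)
    (((memLp_two_iff_integrable_sq_norm hX.1).1 hX).add
      ((memLp_two_iff_integrable_sq_norm hY.1).1 hY)) (hX.1.inner hY.1)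
    (Filter.Eventually.of_forall fun ω => (norm_inner_le_norm _ _).trans ?_)
  nlinarith [sq_nonneg (‖X ω‖ - ‖Y ω‖), norm_nonneg (X ω), norm_nonneg (Y ω), sq_nonneg ‖X ω‖, sq_nonneg ‖Y ω‖]

/-- For frozen `(Z, X)` the noise is centred, so its inner product with `Z` averages to zero. -/
theorem integral_inner_eq_zero_of_indep {Z : Ω → V} {X : Ω → W} {ξ : Ω → 𝒳} {N : W → 𝒳 → V}
    (hZ : Measurable Z) (hX : Measurable X) (hξ : Measurable ξ)
    (hi : IndepFun (fun ω => (Z ω, X ω)) ξ Pr) (hN : Measurable (Function.uncurry N))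
    (h0 : ∀ w, Integrable (fun ω => N w (ξ ω)) Pr ∧ ∫ ω, N w (ξ ω) ∂Pr = 0)
    (hZ2 : MemLp Z 2 Pr) (hN2 : MemLp (fun ω => N (X ω) (ξ ω)) 2 Pr) :
    ∫ ω, ⟪Z ω, N (X ω) (ξ ω)⟫ ∂Pr = 0 := by
  have hu : Measurable (Function.uncurry fun (q : V × W) (z : 𝒳) => ⟪q.1, N q.2 z⟫) := by
    refine Measurable.inner (measurable_fst.comp measurable_fst) ?_
    exact hN.comp ((measurable_snd.comp measurable_fst).prodMk measurable_snd)
  rw [(integral_comp_of_indep (u := fun (q : V × W) (z : 𝒳) => ⟪q.1, N q.2 z⟫) (hZ.prodMk hX) hξ hi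
    hu (integrable_inner_of_memLp hZ2 hN2)).2]
  have : ∀ ω, ∫ ω', ⟪Z ω, N (X ω) (ξ ω')⟫ ∂Pr = 0 := fun ω => by
    rw [integral_inner (h0 _).1, (h0 _).2, inner_zero_right]
  simp [this]

theorem integral_norm_sq_add_of_orthogonal {X Y : Ω → V} (hX : MemLp X 2 Pr) (hY : MemLp Y 2 Pr)
    (h : ∫ ω, ⟪X ω, Y ω⟫ ∂Pr = 0) :
    ∫ ω, ‖X ω + Y ω‖ ^ 2 ∂Pr = ∫ ω, ‖X ω‖ ^ 2 ∂Pr + ∫ ω, ‖Y ω‖ ^ 2 ∂Pr := by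
  have h1 := (memLp_two_iff_integrable_sq_norm hX.1).1 hX
  have h2 := (memLp_two_iff_integrable_sq_norm hY.1).1 hY
  have h3 := (integrable_inner_of_memLp hX hY).const_mul 2
  simp_rw [norm_add_sq_real]
  rw [integral_add (h1.fun_add h3) h2, integral_add h1 h3, integral_const_mul, h]
  ring

theorem integral_norm_sq_add_sum_of_orthogonal {ι : Type*} (s : Finset ι) {U : Ω → V}
    {Y : ι → Ω → V} (hU : MemLp U 2 Pr) (hY : ∀ i ∈ s, MemLp (Y i) 2 Pr)
    (h0 : ∀ i ∈ s, ∫ ω, ⟪U ω, Y i ω⟫ ∂Pr = 0)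
    (h : ∀ i ∈ s, ∀ j ∈ s, j ≠ i → ∫ ω, ⟪Y j ω, Y i ω⟫ ∂Pr = 0) :
    ∫ ω, ‖U ω + ∑ i ∈ s, Y i ω‖ ^ 2 ∂Pr = ∫ ω, ‖U ω‖ ^ 2 ∂Pr + ∑ i ∈ s, ∫ ω, ‖Y i ω‖ ^ 2 ∂Pr := by
  classical
  induction s using Finset.induction_on with
  | empty => simp
  | insert i s hi ih =>
    have hs : ∀ j ∈ s, j ∈ insert i s := fun j hj => Finset.mem_insert_of_mem hj
    have hii := Finset.mem_insert_self i s
    have hsum : MemLp (fun ω => U ω + ∑ j ∈ s, Y j ω) 2 Pr :=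
      hU.add (memLp_finsetSum s fun j hj => hY j (hs j hj))
    have e : ∀ ω, U ω + ∑ j ∈ insert i s, Y j ω = (U ω + ∑ j ∈ s, Y j ω) + Y i ω := fun ω => by
      rw [Finset.sum_insert hi]; abel
    simp_rw [e]
    rw [integral_norm_sq_add_of_orthogonal hsum (hY i hii), Finset.sum_insert hi,
      ih (fun j hj => hY j (hs j hj)) (fun j hj => h0 j (hs j hj))
        (fun j hj l hl => h j (hs j hj) l (hs l hl))]
    · ring
    · simp_rw [inner_add_left, sum_inner]
      rw [integral_add (integrable_inner_of_memLp hU (hY i hii))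
        (integrable_finsetSum _ fun j hj => integrable_inner_of_memLp (hY j (hs j hj)) (hY i hii)),
        integral_finsetSum _ fun j hj => integrable_inner_of_memLp (hY j (hs j hj)) (hY i hii),
        h0 i hii, Finset.sum_eq_zero fun j hj => h i hii j (hs j hj) fun e => hi (e ▸ hj), add_zero]

/-- Second moment of the sum of a past variable and fresh centred noises. -/
theorem integral_norm_sq_add_noise_le {ι : Type*} (s : Finset ι) {U : Ω → V} {X : ι → Ω → W}
    {ξ : ι → Ω → 𝒳} {N : ι → W → 𝒳 → V} {v : ι → W → ℝ} {𝓖 : ι → MeasurableSpace Ω}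
    (h𝓖 : ∀ i, 𝓖 i ≤ mΩ)
    (hind : ∀ i ∈ s, Indep (𝓖 i) (MeasurableSpace.comap (ξ i) inferInstance) Pr)
    (hξ : ∀ i, Measurable (ξ i)) (hU : ∀ i ∈ s, Measurable[𝓖 i] U)
    (hX : ∀ i ∈ s, Measurable[𝓖 i] (X i)) (hN : ∀ i, Measurable (Function.uncurry (N i)))
    (hcross : ∀ i ∈ s, ∀ j ∈ s, j ≠ i → Measurable[𝓖 i] fun ω => N j (X j ω) (ξ j ω))
    (h0 : ∀ i ∈ s, ∀ w, Integrable (fun ω => N i w (ξ i ω)) Pr ∧ ∫ ω, N i w (ξ i ω) ∂Pr = 0)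
    (hvar : ∀ i ∈ s, ∀ w, ∫ ω, ‖N i w (ξ i ω)‖ ^ 2 ∂Pr ≤ v i w)
    (hU2 : MemLp U 2 Pr) (hN2 : ∀ i ∈ s, MemLp (fun ω => N i (X i ω) (ξ i ω)) 2 Pr)
    (hv : ∀ i ∈ s, Integrable (fun ω => v i (X i ω)) Pr) :
    ∫ ω, ‖U ω + ∑ i ∈ s, N i (X i ω) (ξ i ω)‖ ^ 2 ∂Pr ≤
      ∫ ω, ‖U ω‖ ^ 2 ∂Pr + ∑ i ∈ s, ∫ ω, v i (X i ω) ∂Pr := by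
  -- Any square-integrable variable measurable for `𝓖 i` is orthogonal to the `i`-th noise. It is
  -- applied both to `U` and to the other noises.
  have key : ∀ i ∈ s, ∀ Z : Ω → V, Measurable[𝓖 i] Z → MemLp Z 2 Pr →
      ∫ ω, ⟪Z ω, N i (X i ω) (ξ i ω)⟫ ∂Pr = 0 := fun i hi Z hZ hZ2 => by
    refine integral_inner_eq_zero_of_indep (hZ.mono (h𝓖 i) le_rfl) ((hX i hi).mono (h𝓖 i) le_rfl)
      (hξ i) ?_ (hN i) (h0 i hi) hZ2 (hN2 i hi)
    exact indep_of_indep_of_le_left (hind i hi) (hZ.prodMk (hX i hi)).comap_le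
  rw [integral_norm_sq_add_sum_of_orthogonal s hU2 hN2 (fun i hi => key i hi U (hU i hi) hU2)
    (fun i hi j hj hij => key i hi _ (hcross i hi j hj hij) (hN2 j hj))]
  refine add_le_add le_rfl (Finset.sum_le_sum fun i hi => ?_)
  have h1 : IndepFun (X i) (ξ i) Pr := indep_of_indep_of_le_left (hind i hi) (hX i hi).comap_le
  obtain ⟨h2, h3⟩ := integral_comp_of_indep (u := fun w z => ‖N i w z‖ ^ 2)
    ((hX i hi).mono (h𝓖 i) le_rfl) (hξ i) h1 ((hN i).norm.pow_const 2)
    ((memLp_two_iff_integrable_sq_norm (hN2 i hi).1).1 (hN2 i hi))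
  rw [h3]
  exact integral_mono h2 (hv i hi) fun ω => hvar i hi (X i ω)

theorem integral_norm_sq_sub_integral_le {Y : Ω → V} (hY : MemLp Y 2 Pr) :
    ∫ ω, ‖Y ω - ∫ ω', Y ω' ∂Pr‖ ^ 2 ∂Pr ≤ ∫ ω, ‖Y ω‖ ^ 2 ∂Pr := by
  set c := ∫ ω', Y ω' ∂Pr with hc
  have hYi : Integrable Y Pr := hY.integrable (by norm_num)
  have h1 := (memLp_two_iff_integrable_sq_norm hY.1).1 hY
  have h2 : Integrable (fun ω => 2 * ⟪Y ω, c⟫) Pr := (hYi.inner_const c).const_mul 2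
  have h3 : ∫ ω, ⟪Y ω, c⟫ ∂Pr = ‖c‖ ^ 2 := by
    simp_rw [fun ω => real_inner_comm c (Y ω)]
    rw [integral_inner hYi, ← hc, real_inner_self_eq_norm_sq]
  simp_rw [norm_sub_sq_real]
  rw [integral_add (show Integrable (fun ω => ‖Y ω‖ ^ 2 - 2 * ⟪Y ω, c⟫) Pr from h1.sub h2)
    (integrable_const _), integral_sub h1 h2, integral_const_mul, h3]
  simp
  nlinarith [sq_nonneg ‖c‖]

end Noise

/-! ### Stochastic oracles and the noise of a momentum update -/

section Oracle

variable {p d n : ℕ} {Ω 𝒳 : Type*} [mΩ : MeasurableSpace Ω] [MeasurableSpace 𝒳]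
  {Pr : Measure Ω}

/-- `S (ξ ω) x y` is an unbiased estimator of `s x y` with variance at most `ς²`, Lipschitz in
`(x, y)` for each sample. -/
structure IsOracle (Pr : Measure Ω) (ξ : Ω → 𝒳) (S : 𝒳 → E p → E d → E n) (s : E p → E d → E n)
    (L ς : ℝ) : Prop where
  meas : Measurable ξ
  joint : Measurable fun q : 𝒳 × E p × E d => S q.1 q.2.1 q.2.2
  lip : ∀ z, PairLipschitz L (S z)
  memLp : ∀ x y, MemLp (fun ω => S (ξ ω) x y) 2 Pr
  mean : ∀ x y, ∫ ω, S (ξ ω) x y ∂Pr = s x y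
  var : ∀ x y, ∫ ω, ‖S (ξ ω) x y - s x y‖ ^ 2 ∂Pr ≤ ς ^ 2

/-- The noise of the momentum update between the points `w.2` and `w.1`. -/
noncomputable def momentumNoise (S : 𝒳 → E p → E d → E n) (s : E p → E d → E n) (c : ℝ)
    (w : (E p × E d) × (E p × E d)) (z : 𝒳) : E n :=
  (S z w.1.1 w.1.2 - s w.1.1 w.1.2) - (1 - c) • (S z w.2.1 w.2.2 - s w.2.1 w.2.2)

variable [IsProbabilityMeasure Pr] {ξ : Ω → 𝒳} {S : 𝒳 → E p → E d → E n} {s : E p → E d → E n}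
  {L ς : ℝ}

theorem IsOracle.integrable (h : IsOracle Pr ξ S s L ς) (x : E p) (y : E d) :
    Integrable (fun ω => S (ξ ω) x y) Pr := (h.memLp x y).integrable (by norm_num)

theorem IsOracle.lip_mean (h : IsOracle Pr ξ S s L ς) : PairLipschitz L s := fun x y x' y' => by
  rw [← h.mean, ← h.mean, ← integral_sub (h.integrable x y) (h.integrable x' y')]
  exact norm_integral_le_of_forall_norm_le fun ω => h.lip _ x y x' y'

theorem IsOracle.measurable_comp (h : IsOracle Pr ξ S s L ς) {Ω' : Type*}
    {m : MeasurableSpace Ω'} {ζ : Ω' → 𝒳} {X : Ω' → E p} {Y : Ω' → E d} (hζ : Measurable ζ)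
    (hX : Measurable X) (hY : Measurable Y) : Measurable fun ω => S (ζ ω) (X ω) (Y ω) :=
  h.joint.comp (hζ.prodMk (hX.prodMk hY))

theorem IsOracle.measurable_mean_comp (h : IsOracle Pr ξ S s L ς) {Ω' : Type*}
    {m : MeasurableSpace Ω'} {X : Ω' → E p} {Y : Ω' → E d}
    (hX : Measurable X) (hY : Measurable Y) : Measurable fun ω => s (X ω) (Y ω) :=
  h.lip_mean.continuous.measurable.comp (hX.prodMk hY)

theorem IsOracle.measurable_noise (h : IsOracle Pr ξ S s L ς) (c : ℝ) :
    Measurable (Function.uncurry (momentumNoise S s c)) := by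
  unfold momentumNoise Function.uncurry
  have h1 : Measurable fun a : ((E p × E d) × (E p × E d)) × 𝒳 => a.1.1.1 :=
    measurable_fst.fst.fst
  have h2 : Measurable fun a : ((E p × E d) × (E p × E d)) × 𝒳 => a.1.1.2 :=
    measurable_fst.fst.snd
  have h3 : Measurable fun a : ((E p × E d) × (E p × E d)) × 𝒳 => a.1.2.1 :=
    measurable_fst.snd.fst
  have h4 : Measurable fun a : ((E p × E d) × (E p × E d)) × 𝒳 => a.1.2.2 :=
    measurable_fst.snd.snd
  exact ((h.measurable_comp measurable_snd h1 h2).sub (h.measurable_mean_comp h1 h2)).sub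
    (((h.measurable_comp measurable_snd h3 h4).sub (h.measurable_mean_comp h3 h4)).const_smul (1 - c))

theorem IsOracle.integral_noise (h : IsOracle Pr ξ S s L ς) (c : ℝ)
    (w : (E p × E d) × (E p × E d)) :
    Integrable (fun ω => momentumNoise S s c w (ξ ω)) Pr ∧
      ∫ ω, momentumNoise S s c w (ξ ω) ∂Pr = 0 := by
  have h1 : ∀ x y, Integrable (fun ω => S (ξ ω) x y - s x y) Pr := fun x y =>
    (h.integrable x y).sub (integrable_const _)
  have h2 : ∀ x y, ∫ ω, (S (ξ ω) x y - s x y) ∂Pr = 0 := fun x y => by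
    rw [integral_sub (h.integrable x y) (integrable_const _), h.mean]; simp
  have h3 : Integrable (fun ω => (1 - c) • (S (ξ ω) w.2.1 w.2.2 - s w.2.1 w.2.2)) Pr :=
    (h1 _ _).smul (1 - c)
  refine ⟨(h1 _ _).sub h3, ?_⟩
  unfold momentumNoise
  rw [integral_sub (h1 _ _) h3, integral_smul, h2, h2]
  simp

theorem norm_add_sq_le_two {V : Type*} [NormedAddCommGroup V] (a b : V) :
    ‖a + b‖ ^ 2 ≤ 2 * ‖a‖ ^ 2 + 2 * ‖b‖ ^ 2 := by
  have := norm_add_le a b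
  nlinarith [norm_nonneg (a + b), sq_nonneg (‖a‖ - ‖b‖), norm_nonneg a, norm_nonneg b]

/-- Second moment of the noise of a momentum update. -/
theorem IsOracle.integral_norm_noise_sq_le (h : IsOracle Pr ξ S s L ς) (c : ℝ)
    (w : (E p × E d) × (E p × E d)) :
    ∫ ω, ‖momentumNoise S s c w (ξ ω)‖ ^ 2 ∂Pr ≤
      2 * L ^ 2 * (‖w.1.1 - w.2.1‖ ^ 2 + ‖w.1.2 - w.2.2‖ ^ 2) + 2 * c ^ 2 * ς ^ 2 := by
  obtain ⟨⟨x', y'⟩, ⟨x, y⟩⟩ := w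
  -- The variance reduction: the noise is the centred difference of one sample at two points, plus
  -- `c` times the noise at the old point. Centring does not increase the second moment, so the
  -- first part is bounded by `L²` times the squared displacement, and only `c` multiplies the full
  -- variance.
  have e : ∀ ω, momentumNoise S s c ((x', y'), (x, y)) (ξ ω) =
      ((S (ξ ω) x' y' - S (ξ ω) x y) - ∫ ω', (S (ξ ω') x' y' - S (ξ ω') x y) ∂Pr) +
        c • (S (ξ ω) x y - s x y) := fun ω => by
    rw [integral_sub (h.integrable x' y') (h.integrable x y), h.mean, h.mean, momentumNoise]
    module
  have hD : MemLp (fun ω => S (ξ ω) x' y' - S (ξ ω) x y) 2 Pr := (h.memLp x' y').sub (h.memLp x y)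
  have hDc : MemLp (fun ω => (S (ξ ω) x' y' - S (ξ ω) x y) -
      ∫ ω', (S (ξ ω') x' y' - S (ξ ω') x y) ∂Pr) 2 Pr := hD.sub (memLp_const _)
  have hV : MemLp (fun ω => S (ξ ω) x y - s x y) 2 Pr := (h.memLp x y).sub (memLp_const _)
  have i1 := ((memLp_two_iff_integrable_sq_norm hDc.1).1 hDc).const_mul 2
  have i2 := ((memLp_two_iff_integrable_sq_norm hV.1).1 hV).const_mul (2 * c ^ 2)
  have i3 := (memLp_two_iff_integrable_sq_norm hD.1).1 hD
  have b1 : ∫ ω, ‖S (ξ ω) x' y' - S (ξ ω) x y‖ ^ 2 ∂Pr ≤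
      L ^ 2 * (‖x' - x‖ ^ 2 + ‖y' - y‖ ^ 2) := by
    refine (integral_mono i3 (integrable_const (L ^ 2 * (‖x' - x‖ ^ 2 + ‖y' - y‖ ^ 2)))
      fun ω => ?_).trans_eq (by simp)
    rw [← norm_pair_sub_sq, ← mul_pow]
    exact pow_le_pow_left₀ (norm_nonneg _) (h.lip _ _ _ _ _) 2
  have b2 := integral_norm_sq_sub_integral_le hD
  calc ∫ ω, ‖momentumNoise S s c ((x', y'), (x, y)) (ξ ω)‖ ^ 2 ∂Pr
      ≤ ∫ ω, (2 * ‖(S (ξ ω) x' y' - S (ξ ω) x y) -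
          ∫ ω', (S (ξ ω') x' y' - S (ξ ω') x y) ∂Pr‖ ^ 2 +
            2 * c ^ 2 * ‖S (ξ ω) x y - s x y‖ ^ 2) ∂Pr := by
        refine integral_mono_of_nonneg (Filter.Eventually.of_forall fun _ => by positivity)
          (i1.add i2) (Filter.Eventually.of_forall fun ω => ?_)
        simp only [e]
        refine (norm_add_sq_le_two _ _).trans_eq ?_
        rw [norm_smul, mul_pow, Real.norm_eq_abs, sq_abs]
        ring
    _ = _ := integral_add i1 i2
    _ ≤ _ := by
      rw [integral_const_mul, integral_const_mul]
      have := mul_le_mul_of_nonneg_left (h.var x y) (by positivity : 0 ≤ 2 * c ^ 2)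
      simp only
      linarith

theorem PairLipschitz.norm_le_add {A : E p → E d → E n} (h : PairLipschitz L A) (x : E p)
    (y : E d) : ‖A x y‖ ≤ ‖A 0 0‖ + |L| * (‖x‖ + ‖y‖) := by
  have h1 := h x y 0 0
  have h2 : ‖pair x y - pair 0 0‖ ≤ ‖x‖ + ‖y‖ := by
    refine le_of_sq_le_sq ?_ (by positivity)
    rw [norm_pair_sub_sq]
    simp only [sub_zero]
    nlinarith [mul_nonneg (norm_nonneg x) (norm_nonneg y)]
  have h3 := norm_le_norm_add_norm_sub' (A x y) (A 0 0)
  have h4 : L * ‖pair x y - pair 0 0‖ ≤ |L| * (‖x‖ + ‖y‖) :=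
    mul_le_mul (le_abs_self L) h2 (norm_nonneg _) (abs_nonneg _)
  linarith

theorem IsOracle.memLp_mean_comp (h : IsOracle Pr ξ S s L ς) {X : Ω → E p} {Y : Ω → E d}
    (hXm : Measurable X) (hYm : Measurable Y) (hX : MemLp X 2 Pr) (hY : MemLp Y 2 Pr) :
    MemLp (fun ω => s (X ω) (Y ω)) 2 Pr := by
  have hg : MemLp (fun ω => ‖s 0 0‖ + |L| * (‖X ω‖ + ‖Y ω‖)) 2 Pr :=
    (memLp_const ‖s 0 0‖).add ((hX.norm.add hY.norm).const_mul |L|)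
  refine hg.of_le
    (h.measurable_mean_comp hXm hYm).aestronglyMeasurable
    (Filter.Eventually.of_forall fun ω => ?_)
  exact (h.lip_mean.norm_le_add _ _).trans (le_abs_self _)

theorem IsOracle.memLp_comp (h : IsOracle Pr ξ S s L ς) {X : Ω → E p} {Y : Ω → E d}
    (hXm : Measurable X) (hYm : Measurable Y) (hX : MemLp X 2 Pr) (hY : MemLp Y 2 Pr) :
    MemLp (fun ω => S (ξ ω) (X ω) (Y ω)) 2 Pr := by
  have hg : MemLp (fun ω => ‖S (ξ ω) 0 0‖ + |L| * (‖X ω‖ + ‖Y ω‖)) 2 Pr :=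
    (h.memLp 0 0).norm.add ((hX.norm.add hY.norm).const_mul |L|)
  refine hg.of_le
    (h.measurable_comp h.meas hXm hYm).aestronglyMeasurable
    (Filter.Eventually.of_forall fun ω => ?_)
  exact ((h.lip _).norm_le_add _ _).trans (le_abs_self _)

theorem IsOracle.memLp_noise_comp (h : IsOracle Pr ξ S s L ς) (c : ℝ) {X' X : Ω → E p}
    {Y' Y : Ω → E d} (hXm' : Measurable X') (hYm' : Measurable Y') (hXm : Measurable X)
    (hYm : Measurable Y) (hX' : MemLp X' 2 Pr) (hY' : MemLp Y' 2 Pr) (hX : MemLp X 2 Pr)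
    (hY : MemLp Y 2 Pr) :
    MemLp (fun ω => momentumNoise S s c ((X' ω, Y' ω), (X ω, Y ω)) (ξ ω)) 2 Pr :=
  ((h.memLp_comp hXm' hYm' hX' hY').sub (h.memLp_mean_comp hXm' hYm' hX' hY')).sub
    (((h.memLp_comp hXm hYm hX hY).sub (h.memLp_mean_comp hXm hYm hX hY)).const_smul (1 - c))

set_option maxHeartbeats 400000 in
/-- Second moment of a past variable plus the noise of a minibatch momentum update. -/
theorem integral_norm_sq_add_momentumNoise_le {ι : Type*} (t : Finset ι) {U : Ω → E n}
    {X' X : ι → Ω → E p} {Y' Y : ι → Ω → E d} {ξ : ι → Ω → 𝒳} {S : ι → 𝒳 → E p → E d → E n}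
    {s : ι → E p → E d → E n} {𝓖 : ι → MeasurableSpace Ω} (r c : ℝ)
    (hO : ∀ i, IsOracle Pr (ξ i) (S i) (s i) L ς)
    (h𝓖 : ∀ i, 𝓖 i ≤ mΩ)
    (hind : ∀ i ∈ t, Indep (𝓖 i) (MeasurableSpace.comap (ξ i) inferInstance) Pr)
    (hcross : ∀ i ∈ t, ∀ j ∈ t, j ≠ i → Measurable[𝓖 i] (ξ j))
    (hU : ∀ i ∈ t, Measurable[𝓖 i] U)
    (hX' : ∀ i ∈ t, ∀ j, Measurable[𝓖 i] (X' j)) (hY' : ∀ i ∈ t, ∀ j, Measurable[𝓖 i] (Y' j))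
    (hX : ∀ i ∈ t, ∀ j, Measurable[𝓖 i] (X j)) (hY : ∀ i ∈ t, ∀ j, Measurable[𝓖 i] (Y j))
    (hU2 : MemLp U 2 Pr) (hX2' : ∀ i, MemLp (X' i) 2 Pr) (hY2' : ∀ i, MemLp (Y' i) 2 Pr)
    (hX2 : ∀ i, MemLp (X i) 2 Pr) (hY2 : ∀ i, MemLp (Y i) 2 Pr) :
    ∫ ω, ‖U ω + ∑ i ∈ t, r • momentumNoise (S i) (s i) c ((X' i ω, Y' i ω), (X i ω, Y i ω))
        (ξ i ω)‖ ^ 2 ∂Pr ≤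
      ∫ ω, ‖U ω‖ ^ 2 ∂Pr + ∑ i ∈ t, r ^ 2 * (2 * L ^ 2 * (∫ ω, ‖X' i ω - X i ω‖ ^ 2 ∂Pr +
        ∫ ω, ‖Y' i ω - Y i ω‖ ^ 2 ∂Pr) + 2 * c ^ 2 * ς ^ 2) := by
  have iX : ∀ i, Integrable (fun ω => ‖X' i ω - X i ω‖ ^ 2) Pr := fun i =>
    (memLp_two_iff_integrable_sq_norm ((hX2' i).sub (hX2 i)).1).1 ((hX2' i).sub (hX2 i))
  have iY : ∀ i, Integrable (fun ω => ‖Y' i ω - Y i ω‖ ^ 2) Pr := fun i =>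
    (memLp_two_iff_integrable_sq_norm ((hY2' i).sub (hY2 i)).1).1 ((hY2' i).sub (hY2 i))
  have hw : ∀ i ∈ t, ∀ j, Measurable[𝓖 i] fun ω => ((X' j ω, Y' j ω), (X j ω, Y j ω)) :=
    fun i hi j => ((hX' i hi j).prodMk (hY' i hi j)).prodMk ((hX i hi j).prodMk (hY i hi j))
  have hN2 : ∀ i ∈ t, MemLp (fun ω => r • momentumNoise (S i) (s i) c
      ((X' i ω, Y' i ω), (X i ω, Y i ω)) (ξ i ω)) 2 Pr := fun i hi =>
    ((hO i).memLp_noise_comp c ((hX' i hi i).mono (h𝓖 i) le_rfl)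
      ((hY' i hi i).mono (h𝓖 i) le_rfl) ((hX i hi i).mono (h𝓖 i) le_rfl)
      ((hY i hi i).mono (h𝓖 i) le_rfl) (hX2' i) (hY2' i) (hX2 i) (hY2 i)).const_smul r
  have hv : ∀ i ∈ t, Integrable (fun ω => r ^ 2 * (2 * L ^ 2 * (‖X' i ω - X i ω‖ ^ 2 +
      ‖Y' i ω - Y i ω‖ ^ 2) + 2 * c ^ 2 * ς ^ 2)) Pr := fun i _ =>
    ((((iX i).add (iY i)).const_mul (2 * L ^ 2)).add (integrable_const _)).const_mul (r ^ 2)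
  have hvar : ∀ i ∈ t, ∀ w, ∫ ω, ‖r • momentumNoise (S i) (s i) c w (ξ i ω)‖ ^ 2 ∂Pr ≤
      r ^ 2 * (2 * L ^ 2 * (‖w.1.1 - w.2.1‖ ^ 2 + ‖w.1.2 - w.2.2‖ ^ 2) +
        2 * c ^ 2 * ς ^ 2) := fun i _ w => by
    simp_rw [norm_smul, mul_pow, Real.norm_eq_abs, sq_abs]
    rw [integral_const_mul]
    exact mul_le_mul_of_nonneg_left ((hO i).integral_norm_noise_sq_le c w) (sq_nonneg _)
  have hNm : ∀ i, Measurable (Function.uncurry fun w z => r • momentumNoise (S i) (s i) c w z) :=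
    fun i => by
      have := ((hO i).measurable_noise c).const_smul r
      exact this
  have hcr : ∀ i ∈ t, ∀ j ∈ t, j ≠ i → Measurable[𝓖 i] fun ω => r • momentumNoise (S j) (s j) c
      ((X' j ω, Y' j ω), (X j ω, Y j ω)) (ξ j ω) := fun i hi j hj hij => by
    have h1 := (hw i hi j).prodMk (hcross i hi j hj hij)
    have h2 := Measurable.comp (hNm j) h1
    exact h2
  have h0 : ∀ i ∈ t, ∀ w, Integrable (fun ω => r • momentumNoise (S i) (s i) c w (ξ i ω)) Pr ∧
      ∫ ω, r • momentumNoise (S i) (s i) c w (ξ i ω) ∂Pr = 0 := fun i _ w =>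
    ⟨((hO i).integral_noise c w).1.smul r, by
      rw [integral_smul, ((hO i).integral_noise c w).2, smul_zero]⟩
  refine (integral_norm_sq_add_noise_le t (Pr := Pr) (U := U) (ξ := ξ) (𝓖 := 𝓖)
    (X := fun i ω => ((X' i ω, Y' i ω), (X i ω, Y i ω)))
    (N := fun i w z => r • momentumNoise (S i) (s i) c w z)
    (v := fun i w => r ^ 2 * (2 * L ^ 2 * (‖w.1.1 - w.2.1‖ ^ 2 + ‖w.1.2 - w.2.2‖ ^ 2) +
      2 * c ^ 2 * ς ^ 2)) h𝓖 hind (fun i => (hO i).meas) hU (fun i hi => hw i hi i)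
    hNm hcr h0 hvar hU2 hN2 hv).trans_eq (congrArg _ (Finset.sum_congr rfl fun i _ => ?_))
  have hi : Integrable (fun ω => 2 * L ^ 2 * (‖X' i ω - X i ω‖ ^ 2 + ‖Y' i ω - Y i ω‖ ^ 2)) Pr :=
    ((iX i).add (iY i)).const_mul _
  simp only
  rw [integral_const_mul, integral_add hi (integrable_const _), integral_const_mul,
    integral_add (iX i) (iY i)]
  simp

end Oracle

/-- The time at which a sample of `g` is drawn. -/
def GIndex.time {M : ℕ} : GIndex M → ℕ
  | .lower t _ _ => t
  | .jac t _ _ => t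
  | .hess t _ _ _ => t

/-- The samples drawn up to time `T`. -/
def pastIdx (M T : ℕ) : Set ((ℕ × Fin M × ℕ) ⊕ GIndex M) :=
  {l | Sum.elim (fun i => i.1) GIndex.time l ≤ T}

theorem pastIdx_mono {M S T : ℕ} (h : S ≤ T) : pastIdx M S ⊆ pastIdx M T :=
  fun _ hl => le_trans hl h

/-! ### The samples of the algorithm as oracles -/

section Oracles

variable {p d M : ℕ} {Ξf Ξg Ω : Type*} [MeasurableSpace Ξf] [MeasurableSpace Ξg]
  [MeasurableSpace Ω] {P : Problem p d M Ξf Ξg} {Pr : Measure Ω}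
  {ξf : ℕ × Fin M × ℕ → Ω → Ξf} {ξg : GIndex M → Ω → Ξg} {K : Constants} {μ : ℝ}

theorem IsSampling.indep_sigmaOf (h : IsSampling P Pr ξf ξg)
    {S T : Set ((ℕ × Fin M × ℕ) ⊕ GIndex M)} (hST : Disjoint S T) :
    Indep (sigmaOf ξf ξg S) (sigmaOf ξf ξg T) Pr :=
  indep_iSup_of_disjoint h.sampleSigma_le h.iIndep_sampleSigma hST

theorem Assumptions.isOracle_lower (hA : Assumptions K μ P) [IsProbabilityMeasure Pr]
    (hS : IsSampling P Pr ξf ξg) (t : ℕ) (m : Fin M) (i : ℕ) :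
    IsOracle Pr (ξg (.lower t m i)) (fun ξ => gradY (P.G m ξ)) (gradY (P.g m)) K.L K.σ := by
  have hξ := hS.meas_g (.lower t m i)
  have hlaw : Measure.map (ξg (.lower t m i)) Pr = P.Dg m := hS.law_g _
  have hm : ∀ x y, Measurable fun ω => gradY (P.G m (ξg (.lower t m i) ω)) x y := fun x y =>
    hA.measurable_lower_comp m hξ measurable_const measurable_const
  have h1 : ∀ x y, Integrable (fun ω => ‖fullGrad (P.G m (ξg (.lower t m i) ω)) x y -
      fullGrad (P.g m) x y‖ ^ 2) Pr := fun x y => by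
    have := (hA.oracle_g m x y).2.2.1
    rw [← hlaw] at this
    exact this.comp_measurable hξ
  have h2 : ∀ x y, Integrable (fun ω => fullGrad (P.G m (ξg (.lower t m i) ω)) x y) Pr :=
    fun x y => by
    have := (hA.oracle_g m x y).1
    rw [← hlaw] at this
    exact this.comp_measurable hξ
  have hle : ∀ x y ω, ‖gradY (P.G m (ξg (.lower t m i) ω)) x y - gradY (P.g m) x y‖ ≤
      ‖fullGrad (P.G m (ξg (.lower t m i) ω)) x y - fullGrad (P.g m) x y‖ := fun x y ω => by
    rw [fullGrad, fullGrad, pair_sub_pair]; exact norm_le_norm_pair_right _ _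
  have h3 : ∀ x y, MemLp (fun ω => gradY (P.G m (ξg (.lower t m i) ω)) x y -
      gradY (P.g m) x y) 2 Pr := fun x y => by
    have hmm := ((hm x y).sub_const (gradY (P.g m) x y)).aestronglyMeasurable (μ := Pr)
    refine (memLp_two_iff_integrable_sq_norm hmm).2 ((h1 x y).mono' (hmm.norm.pow 2)
      (Filter.Eventually.of_forall fun ω => ?_))
    rw [Real.norm_eq_abs, abs_of_nonneg (sq_nonneg _)]
    exact pow_le_pow_left₀ (norm_nonneg _) (hle x y ω) 2
  have h4 : ∀ x y, MemLp (fun ω => gradY (P.G m (ξg (.lower t m i) ω)) x y) 2 Pr := fun x y => by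
    have := (h3 x y).add (memLp_const (gradY (P.g m) x y))
    refine this.congr_norm (hm x y).aestronglyMeasurable (Filter.Eventually.of_forall fun ω => ?_)
    simp
  exact
  { meas := hξ
    joint := hA.measurable_lower_comp m measurable_fst measurable_snd.fst measurable_snd.snd
    lip := fun ξ => (hA.lower m ξ).smooth.gradY
    memLp := h4
    mean := fun x y => by
      refine ext_inner_left ℝ fun w => ?_
      rw [← integral_inner ((h4 x y).integrable (by norm_num))]
      have e := integral_map (μ := Pr) hξ.aemeasurable (f := fun ξ => fullGrad (P.G m ξ) x y)
        (by rw [hlaw]; exact (hA.oracle_g m x y).1.1)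
      rw [hlaw, (hA.oracle_g m x y).2.1] at e
      have h5 := integral_inner (𝕜 := ℝ) (h2 x y) (pair 0 w)
      rw [← e] at h5
      simpa only [fullGrad, inner_pair, inner_zero_left, zero_add] using h5
    var := fun x y => by
      have e := integral_map (μ := Pr) hξ.aemeasurable
        (f := fun ξ => ‖fullGrad (P.G m ξ) x y - fullGrad (P.g m) x y‖ ^ 2)
        (by rw [hlaw]; exact (hA.oracle_g m x y).2.2.1.1)
      rw [hlaw] at e
      refine (integral_mono ((memLp_two_iff_integrable_sq_norm (h3 x y).1).1 (h3 x y)) (h1 x y)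
        fun ω => pow_le_pow_left₀ (norm_nonneg _) (hle x y ω) 2).trans ?_
      rw [← e]
      exact (hA.oracle_g m x y).2.2.2 }

end Oracles

/-- The variance of a bounded estimator is at most the square of its bound. For the hypergradient
estimator this avoids propagating `σ` through the Neumann products. -/
theorem IsOracle.of_bound {p d n : ℕ} {Ω 𝒳 : Type*} [MeasurableSpace Ω] [MeasurableSpace 𝒳]
    {Pr : Measure Ω} [IsProbabilityMeasure Pr] {ξ : Ω → 𝒳} {S : 𝒳 → E p → E d → E n}
    {s : E p → E d → E n} {L G : ℝ} (hξ : Measurable ξ)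
    (hj : Measurable fun q : 𝒳 × E p × E d => S q.1 q.2.1 q.2.2) (hL : ∀ z, PairLipschitz L (S z))
    (hb : ∀ z x y, ‖S z x y‖ ≤ G) (hmean : ∀ x y, ∫ ω, S (ξ ω) x y ∂Pr = s x y) :
    IsOracle Pr ξ S s L G := by
  have h2 : ∀ x y, MemLp (fun ω => S (ξ ω) x y) 2 Pr := fun x y =>
    MemLp.of_bound (hj.comp (hξ.prodMk (measurable_const.prodMk
      measurable_const))).aestronglyMeasurable G (Filter.Eventually.of_forall fun ω => hb _ x y)
  refine ⟨hξ, hj, hL, h2, hmean, fun x y => ?_⟩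
  rw [← hmean]
  refine (integral_norm_sq_sub_integral_le (h2 x y)).trans ?_
  refine (integral_mono ((memLp_two_iff_integrable_sq_norm (h2 x y).1).1 (h2 x y))
    (integrable_const (G ^ 2)) fun ω => ?_).trans_eq (by simp)
  exact pow_le_pow_left₀ (norm_nonneg _) (hb _ x y) 2

section HyperSample

variable {M : ℕ} {Ξf Ξg Ω : Type*} [MeasurableSpace Ξf] [MeasurableSpace Ξg]
  {ξf : ℕ × Fin M × ℕ → Ω → Ξf} {ξg : GIndex M → Ω → Ξg}

/-- The samples of one hypergradient estimate. -/
def hyperSample (ξf : ℕ × Fin M × ℕ → Ω → Ξf) (ξg : GIndex M → Ω → Ξg) (t : ℕ) (m : Fin M)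
    (i : ℕ) (ω : Ω) : Ξf × Ξg × (ℕ → Ξg) :=
  (ξf (t, m, i) ω, ξg (.jac t m i) ω, fun j => ξg (.hess t m i j) ω)

theorem measurable_hyperSample {S : Set ((ℕ × Fin M × ℕ) ⊕ GIndex M)} {t : ℕ} {m : Fin M}
    {i : ℕ} (h : hyperIdx t m i ⊆ S) : Measurable[sigmaOf ξf ξg S] (hyperSample ξf ξg t m i) := by
  have h1 : Measurable[sigmaOf ξf ξg S] (ξf (t, m, i)) :=
    measurable_sigmaOf_f (h (by simp [hyperIdx]))
  have h2 : Measurable[sigmaOf ξf ξg S] (ξg (.jac t m i)) :=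
    measurable_sigmaOf_g (h (by simp [hyperIdx]))
  have h3 : ∀ j, Measurable[sigmaOf ξf ξg S] (ξg (.hess t m i j)) := fun j =>
    measurable_sigmaOf_g (h (by simp [hyperIdx]))
  let _ := sigmaOf ξf ξg S
  exact h1.prodMk (h2.prodMk (measurable_pi_lambda _ h3))

end HyperSample

/-! ### Minibatch estimates at points determined by the past -/

section Batches

variable {p d : ℕ} {s : Config} {Ξf Ξg Ω : Type*} [MeasurableSpace Ξf] [MeasurableSpace Ξg]
  [MeasurableSpace Ω] {P : Problem p d s.M Ξf Ξg} {Pr : Measure Ω}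
  {ξf : ℕ × Fin s.M × ℕ → Ω → Ξf} {ξg : GIndex s.M → Ω → Ξg} {K : Constants} {c₀ : ℝ}

theorem Assumptions.isOracle_hyper (hK : K.Valid) (hs : s.Admissible K c₀)
    (hA : Assumptions K s.μ P) [IsProbabilityMeasure Pr]
    (hS : IsSampling P Pr ξf ξg) (t : ℕ) (m : Fin s.M) (i : ℕ) :
    IsOracle Pr (hyperSample ξf ξg t m i)
      (fun q => hyperEst s.τ s.Q (P.F m) (P.G m) q.1 q.2.1 q.2.2)
      (meanEst s.τ s.Q (P.f m) (P.g m)) (Lhat K s) ((1 + kappa K s) * K.Cf) := by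
  have hτμ : s.τ * s.μ < 1 := by
    have := (lt_div_iff₀ hK.L_pos).1 hs.τ_lt
    exact (mul_le_mul_of_nonneg_left hs.μ_le hs.τ_pos.le).trans_lt this
  have hl := fun ξ => hA.lowerBounds hK hs.μ_le hs.τ_pos hs.τ_lt m ξ
  refine IsOracle.of_bound ?_ ?_ ?_ ?_ ?_
  · exact (measurable_hyperSample (S := Set.univ) (Set.subset_univ _)).mono (hS.sigmaOf_le _) le_rfl
  · exact hA.measurable_hyperEst_comp m measurable_fst.fst measurable_fst.snd.fst
      (fun j => (measurable_pi_apply j).comp measurable_fst.snd.snd) measurable_snd.fst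
      measurable_snd.snd
  · exact fun q x y x' y' => (hyperEst_lipschitz hs.τ_pos hs.μ_pos hτμ hK
      (fun ξ => hA.upperBounds m ξ) hl q.1 q.2.1 q.2.2 x y x' y').trans
        (mul_le_mul_of_nonneg_right (le_max_right _ _) (norm_nonneg _))
  · exact fun q x y => norm_hyperEst_le hs.τ_pos hs.μ_pos hτμ hK.L_pos
      (fun ξ => hA.upperBounds m ξ) hl q.1 q.2.1 q.2.2 x y
  · exact fun x y => hA.integral_hyperEst hK hs.μ_le hS hs.τ_pos hs.τ_lt t m i x y

/-- The `k` batch elements carry weight `1/k` and uncorrelated noises, so the noise variance is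
divided by `k`. The points are random but determined before time `t`, hence independent of the
batch. -/
theorem Assumptions.lower_batch_step (hA : Assumptions K s.μ P) [IsProbabilityMeasure Pr]
    (hS : IsSampling P Pr ξf ξg) {T t k : ℕ} (hT : T < t) (hk : 0 < k) (m : Fin s.M) (c : ℝ)
    {U Y' Y : Ω → E d} {X' X : Ω → E p}
    (hU : Measurable[sigmaOf ξf ξg (pastIdx s.M T)] U)
    (hX' : Measurable[sigmaOf ξf ξg (pastIdx s.M T)] X')
    (hY' : Measurable[sigmaOf ξf ξg (pastIdx s.M T)] Y')
    (hX : Measurable[sigmaOf ξf ξg (pastIdx s.M T)] X)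
    (hY : Measurable[sigmaOf ξf ξg (pastIdx s.M T)] Y)
    (hU2 : MemLp U 2 Pr) (hX2' : MemLp X' 2 Pr) (hY2' : MemLp Y' 2 Pr) (hX2 : MemLp X 2 Pr)
    (hY2 : MemLp Y 2 Pr) :
    ∫ ω, ‖U ω + ((lowerBatch s P (fun i => ξg i ω) k t m (X' ω) (Y' ω) -
        gradY (P.g m) (X' ω) (Y' ω)) - (1 - c) • (lowerBatch s P (fun i => ξg i ω) k t m (X ω) (Y ω)
        - gradY (P.g m) (X ω) (Y ω)))‖ ^ 2 ∂Pr ≤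
      ∫ ω, ‖U ω‖ ^ 2 ∂Pr + 1 / k * (2 * K.L ^ 2 * (∫ ω, ‖X' ω - X ω‖ ^ 2 ∂Pr +
        ∫ ω, ‖Y' ω - Y ω‖ ^ 2 ∂Pr) + 2 * c ^ 2 * K.σ ^ 2) := by
  have hsub : ∀ i, pastIdx s.M T ⊆ {Sum.inr (.lower t m i)}ᶜ := fun i l hl hl' => by
    rw [Set.mem_singleton_iff.1 hl'] at hl
    exact absurd hl (not_le.2 hT)
  have hle : ∀ i, sigmaOf ξf ξg (pastIdx s.M T) ≤ sigmaOf ξf ξg {Sum.inr (.lower t m i)}ᶜ :=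
    fun i => sigmaOf_mono (hsub i)
  -- The σ-algebra attached to element `i` is generated by all other samples. It contains the past
  -- and the rest of the batch, so `U` and the other noises are both orthogonal to the `i`-th noise.
  have hind : ∀ i ∈ Finset.range k, Indep (sigmaOf ξf ξg {Sum.inr (.lower t m i)}ᶜ)
      (MeasurableSpace.comap (ξg (.lower t m i)) inferInstance) Pr := fun i _ => by
    have h1 : Measurable[sigmaOf ξf ξg {Sum.inr (.lower t m i)}] (ξg (.lower t m i)) :=
      measurable_sigmaOf_g (Set.mem_singleton _)
    exact indep_of_indep_of_le_right (hS.indep_sigmaOf disjoint_compl_left) h1.comap_le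
  have hcross : ∀ i ∈ Finset.range k, ∀ j ∈ Finset.range k, j ≠ i →
      Measurable[sigmaOf ξf ξg {Sum.inr (.lower t m i)}ᶜ] (ξg (.lower t m j)) :=
    fun i _ j _ hij => measurable_sigmaOf_g (by simp [hij])
  have key := integral_norm_sq_add_momentumNoise_le (Finset.range k) (U := U) (X' := fun _ => X')
    (X := fun _ => X) (Y' := fun _ => Y') (Y := fun _ => Y) (ξ := fun i => ξg (.lower t m i))
    (S := fun _ ξ => gradY (P.G m ξ)) (s := fun _ => gradY (P.g m))
    (𝓖 := fun i => sigmaOf ξf ξg {Sum.inr (.lower t m i)}ᶜ) (1 / (k : ℝ)) c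
    (fun i => hA.isOracle_lower hS t m i) (fun i => hS.sigmaOf_le _) hind hcross
    (fun i _ => hU.mono (hle i) le_rfl) (fun i _ _ => hX'.mono (hle i) le_rfl)
    (fun i _ _ => hY'.mono (hle i) le_rfl) (fun i _ _ => hX.mono (hle i) le_rfl)
    (fun i _ _ => hY.mono (hle i) le_rfl) hU2 (fun _ => hX2') (fun _ => hY2') (fun _ => hX2)
    (fun _ => hY2)
  have hk' : (k : ℝ) ≠ 0 := by positivity
  refine (le_of_eq ?_).trans (key.trans_eq ?_)
  · congr 1
    ext ω
    congr 3
    simp only [momentumNoise, lowerBatch, ← Finset.smul_sum, Finset.sum_sub_distrib,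
      Finset.sum_const, Finset.card_range, smul_sub, ← Nat.cast_smul_eq_nsmul ℝ, smul_smul]
    have : 1 / (k : ℝ) * k = 1 := by field_simp
    have h2 : (1 - c) * (1 / (k : ℝ)) * k = 1 - c := by field_simp
    simp only [this, h2, one_smul, mul_comm (1 / (k : ℝ)) (1 - c)]
  · rw [Finset.sum_const, Finset.card_range, nsmul_eq_mul]
    congr 1
    field_simp

/-- The average over clients and batch elements consists of `k M` uncorrelated noises with weight `1
/ (k M)`: this is the source of the speedup in the number of clients. -/
theorem Assumptions.hyper_batch_step (hK : K.Valid) (hs : s.Admissible K c₀)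
    (hA : Assumptions K s.μ P) [IsProbabilityMeasure Pr]
    (hS : IsSampling P Pr ξf ξg) {T t k : ℕ} (hT : T < t) (hk : 0 < k) (c : ℝ)
    {U : Ω → E p} {Y' Y : Fin s.M → Ω → E d} {X' X : Fin s.M → Ω → E p}
    (hU : Measurable[sigmaOf ξf ξg (pastIdx s.M T)] U)
    (hX' : ∀ m, Measurable[sigmaOf ξf ξg (pastIdx s.M T)] (X' m))
    (hY' : ∀ m, Measurable[sigmaOf ξf ξg (pastIdx s.M T)] (Y' m))
    (hX : ∀ m, Measurable[sigmaOf ξf ξg (pastIdx s.M T)] (X m))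
    (hY : ∀ m, Measurable[sigmaOf ξf ξg (pastIdx s.M T)] (Y m))
    (hU2 : MemLp U 2 Pr) (hX2' : ∀ m, MemLp (X' m) 2 Pr) (hY2' : ∀ m, MemLp (Y' m) 2 Pr)
    (hX2 : ∀ m, MemLp (X m) 2 Pr) (hY2 : ∀ m, MemLp (Y m) 2 Pr) :
    ∫ ω, ‖U ω + avg fun m => ((hyperBatch s P (fun i => ξf i ω) (fun i => ξg i ω) k t m (X' m ω)
        (Y' m ω) - meanEst s.τ s.Q (P.f m) (P.g m) (X' m ω) (Y' m ω)) - (1 - c) •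
        (hyperBatch s P (fun i => ξf i ω) (fun i => ξg i ω) k t m (X m ω) (Y m ω)
        - meanEst s.τ s.Q (P.f m) (P.g m) (X m ω) (Y m ω)))‖ ^ 2 ∂Pr ≤
      ∫ ω, ‖U ω‖ ^ 2 ∂Pr + 1 / (k * s.M) * (2 * Lhat K s ^ 2 * (1 / s.M * ∑ m,
        (∫ ω, ‖X' m ω - X m ω‖ ^ 2 ∂Pr + ∫ ω, ‖Y' m ω - Y m ω‖ ^ 2 ∂Pr)) +
        2 * c ^ 2 * ((1 + kappa K s) * K.Cf) ^ 2) := by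
  have hdisj : ∀ q : Fin s.M × ℕ, Disjoint (pastIdx s.M T) (hyperIdx t q.1 q.2) := fun q => by
    rw [Set.disjoint_left]
    intro l hl hl'
    have : Sum.elim (fun i => i.1) GIndex.time l = t := by
      rcases hl' with hl' | ⟨j, rfl⟩
      · rcases hl' with rfl | hl'
        · rfl
        · rw [Set.mem_singleton_iff.1 hl']; rfl
      · rfl
    have h2 : Sum.elim (fun i => i.1) GIndex.time l ≤ T := hl
    omega
  have hle : ∀ q : Fin s.M × ℕ, sigmaOf ξf ξg (pastIdx s.M T) ≤
      sigmaOf ξf ξg (hyperIdx t q.1 q.2)ᶜ :=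
    fun q => sigmaOf_mono (Set.subset_compl_iff_disjoint_right.2 (hdisj q))
  have hind : ∀ q ∈ Finset.univ ×ˢ Finset.range k, Indep (sigmaOf ξf ξg (hyperIdx t q.1 q.2)ᶜ)
      (MeasurableSpace.comap (hyperSample ξf ξg t q.1 q.2) inferInstance) Pr :=
    fun (q : Fin s.M × ℕ) _ => by
    have h1 : Measurable[sigmaOf ξf ξg (hyperIdx t q.1 q.2)] (hyperSample ξf ξg t q.1 q.2) :=
      measurable_hyperSample subset_rfl
    exact indep_of_indep_of_le_right (hS.indep_sigmaOf disjoint_compl_left) h1.comap_le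
  have hcross : ∀ q ∈ Finset.univ ×ˢ Finset.range k, ∀ r ∈ Finset.univ ×ˢ Finset.range k, r ≠ q →
      Measurable[sigmaOf ξf ξg (hyperIdx t q.1 q.2)ᶜ] (hyperSample ξf ξg t r.1 r.2) :=
    fun (q : Fin s.M × ℕ) _ (r : Fin s.M × ℕ) _ hqr => by
    refine measurable_hyperSample ?_
    rw [Set.subset_compl_iff_disjoint_right, Set.disjoint_left]
    have hne : ¬ (r.1 = q.1 ∧ r.2 = q.2) := fun h => hqr (Prod.ext h.1 h.2)
    rintro l (hl | ⟨j, rfl⟩)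
    · rcases hl with rfl | hl
      · simpa [hyperIdx, Prod.ext_iff] using hne
      · rw [Set.mem_singleton_iff.1 hl]; simpa [hyperIdx] using hne
    · simp only [hyperIdx, Set.mem_union, Set.mem_insert_iff, Set.mem_singleton_iff, reduceCtorEq,
        Sum.inr.injEq, Set.mem_range, GIndex.hess.injEq, false_or, not_exists]
      exact fun j' h => hne ⟨h.2.1.symm, h.2.2.1.symm⟩
  have key := integral_norm_sq_add_momentumNoise_le (Finset.univ ×ˢ Finset.range k) (U := U)
    (X' := fun q => X' q.1) (X := fun q => X q.1) (Y' := fun q => Y' q.1) (Y := fun q => Y q.1)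
    (ξ := fun q : Fin s.M × ℕ => hyperSample ξf ξg t q.1 q.2)
    (S := fun q z => hyperEst s.τ s.Q (P.F q.1) (P.G q.1) z.1 z.2.1 z.2.2)
    (s := fun q => meanEst s.τ s.Q (P.f q.1) (P.g q.1))
    (𝓖 := fun q => sigmaOf ξf ξg (hyperIdx t q.1 q.2)ᶜ) (1 / (s.M : ℝ) * (1 / (k : ℝ))) c
    (fun q => hA.isOracle_hyper hK hs hS t q.1 q.2) (fun q => hS.sigmaOf_le _) hind hcross
    (fun i _ => hU.mono (hle i) le_rfl) (fun i _ j => (hX' j.1).mono (hle i) le_rfl)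
    (fun i _ j => (hY' j.1).mono (hle i) le_rfl) (fun i _ j => (hX j.1).mono (hle i) le_rfl)
    (fun i _ j => (hY j.1).mono (hle i) le_rfl) hU2 (fun q => hX2' q.1) (fun q => hY2' q.1)
    (fun q => hX2 q.1) (fun q => hY2 q.1)
  have hk' : (k : ℝ) ≠ 0 := by positivity
  have hM : (s.M : ℝ) ≠ 0 := by have := hs.M_pos; positivity
  refine (le_of_eq ?_).trans (key.trans_eq ?_)
  · congr 1
    ext ω
    congr 3
    rw [avg, Finset.sum_product, Finset.smul_sum]
    refine Finset.sum_congr rfl fun m _ => ?_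
    simp only [momentumNoise, hyperBatch, hyperSample, ← Finset.smul_sum, Finset.sum_sub_distrib,
      Finset.sum_const, Finset.card_range, smul_sub, ← Nat.cast_smul_eq_nsmul ℝ, smul_smul]
    have h1 : 1 / (s.M : ℝ) * (1 / (k : ℝ)) * k = 1 / (s.M : ℝ) := by field_simp
    have h2 : 1 / (s.M : ℝ) * ((1 - c) * (1 / (k : ℝ))) =
      1 / (s.M : ℝ) * (1 / (k : ℝ)) * (1 - c) := by ring
    have h3 : 1 / (s.M : ℝ) * (1 / (k : ℝ)) * (1 - c) * k = 1 / (s.M : ℝ) * (1 - c) := by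
      field_simp
    simp only [h1, h2, h3]
  · rw [Finset.sum_product]
    simp only [Finset.sum_const, Finset.card_range, nsmul_eq_mul]
    congr 1
    simp only [← Finset.mul_sum, Finset.sum_add_distrib, Finset.sum_const, Finset.card_univ,
      Fintype.card_fin, nsmul_eq_mul, mul_add]
    field_simp

end Batches

/-! ### Square-integrable variables determined by the past -/

section Past

variable {M : ℕ} {Ξf Ξg Ω : Type*} [MeasurableSpace Ξf] [MeasurableSpace Ξg]
  [MeasurableSpace Ω]

/-- `Z` is square integrable and depends only on the samples drawn up to time `T`. -/
def IsPast (Pr : Measure Ω) (ξf : ℕ × Fin M × ℕ → Ω → Ξf) (ξg : GIndex M → Ω → Ξg) (T : ℕ) {n : ℕ}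
    (Z : Ω → E n) : Prop :=
  Measurable[sigmaOf ξf ξg (pastIdx M T)] Z ∧ MemLp Z 2 Pr

variable {Pr : Measure Ω} {ξf : ℕ × Fin M × ℕ → Ω → Ξf} {ξg : GIndex M → Ω → Ξg} {n T T' : ℕ}
  {Z Z' : Ω → E n}

theorem IsPast.mono (h : IsPast Pr ξf ξg T Z) (hT : T ≤ T') : IsPast Pr ξf ξg T' Z :=
  ⟨h.1.mono (sigmaOf_mono (pastIdx_mono hT)) le_rfl, h.2⟩

theorem isPast_const [IsFiniteMeasure Pr] (z : E n) : IsPast Pr ξf ξg T fun _ => z :=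
  ⟨measurable_const, memLp_const z⟩

theorem IsPast.add (h : IsPast Pr ξf ξg T Z) (h' : IsPast Pr ξf ξg T Z') :
    IsPast Pr ξf ξg T fun ω => Z ω + Z' ω := ⟨h.1.add h'.1, h.2.add h'.2⟩

theorem IsPast.sub (h : IsPast Pr ξf ξg T Z) (h' : IsPast Pr ξf ξg T Z') :
    IsPast Pr ξf ξg T fun ω => Z ω - Z' ω := ⟨h.1.sub h'.1, h.2.sub h'.2⟩

theorem IsPast.smul (h : IsPast Pr ξf ξg T Z) (c : ℝ) : IsPast Pr ξf ξg T fun ω => c • Z ω :=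
  ⟨h.1.const_smul c, h.2.const_smul c⟩

theorem IsPast.sum {ι : Type*} {t : Finset ι} {Z : ι → Ω → E n}
    (h : ∀ i ∈ t, IsPast Pr ξf ξg T (Z i)) : IsPast Pr ξf ξg T fun ω => ∑ i ∈ t, Z i ω :=
  ⟨Finset.measurable_fun_sum _ fun i hi => (h i hi).1, memLp_finsetSum t fun i hi => (h i hi).2⟩

theorem IsPast.avg {k : ℕ} {Z : Fin k → Ω → E n} (h : ∀ i, IsPast Pr ξf ξg T (Z i)) :
    IsPast Pr ξf ξg T fun ω => avg fun i => Z i ω := (IsPast.sum fun i _ => h i).smul _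

theorem IsPast.integrable_sq (h : IsPast Pr ξf ξg T Z) : Integrable (fun ω => ‖Z ω‖ ^ 2) Pr :=
  (memLp_two_iff_integrable_sq_norm h.2.1).1 h.2

theorem IsOracle.isPast_mean [IsProbabilityMeasure Pr] {p d k t : ℕ} {P : Problem p d M Ξf Ξg}
    (hS : IsSampling P Pr ξf ξg) {𝒳 : Type*} [MeasurableSpace 𝒳] {ξ : Ω → 𝒳}
    {S : 𝒳 → E p → E d → E k} {s : E p → E d → E k} {L ς : ℝ} (h : IsOracle Pr ξ S s L ς)
    {X : Ω → E p} {Y : Ω → E d} (hX : IsPast Pr ξf ξg t X) (hY : IsPast Pr ξf ξg t Y) :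
    IsPast Pr ξf ξg t fun ω => s (X ω) (Y ω) :=
  ⟨h.measurable_mean_comp hX.1 hY.1, h.memLp_mean_comp (hX.1.mono (hS.sigmaOf_le _) le_rfl)
    (hY.1.mono (hS.sigmaOf_le _) le_rfl) hX.2 hY.2⟩

end Past

/-! ### The trajectory is adapted to the samples -/

section Run

variable {p d : ℕ} {s : Config} {Ξf Ξg Ω : Type*} [MeasurableSpace Ξf] [MeasurableSpace Ξg]
  [MeasurableSpace Ω] {P : Problem p d s.M Ξf Ξg} {Pr : Measure Ω}
  {ξf : ℕ × Fin s.M × ℕ → Ω → Ξf} {ξg : GIndex s.M → Ω → Ξg} {K : Constants} {c₀ : ℝ}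

theorem Assumptions.isPast_lowerBatch (hA : Assumptions K s.μ P) [IsProbabilityMeasure Pr]
    (hS : IsSampling P Pr ξf ξg) {T t : ℕ} (ht : t ≤ T) (k : ℕ) (m : Fin s.M) {X : Ω → E p}
    {Y : Ω → E d} (hX : IsPast Pr ξf ξg T X) (hY : IsPast Pr ξf ξg T Y) :
    IsPast Pr ξf ξg T fun ω => lowerBatch s P (fun i => ξg i ω) k t m (X ω) (Y ω) := by
  refine (IsPast.sum fun i _ => ⟨?_, ?_⟩).smul _
  · exact hA.measurable_lower_comp m (mΩ := sigmaOf ξf ξg (pastIdx s.M T))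
      (measurable_sigmaOf_g (show Sum.inr _ ∈ pastIdx s.M T from ht)) hX.1 hY.1
  · exact (hA.isOracle_lower hS t m i).memLp_comp (hX.1.mono (hS.sigmaOf_le _) le_rfl)
      (hY.1.mono (hS.sigmaOf_le _) le_rfl) hX.2 hY.2

theorem Assumptions.isPast_hyperBatch (hK : K.Valid) (hs : s.Admissible K c₀)
    (hA : Assumptions K s.μ P) [IsProbabilityMeasure Pr]
    (hS : IsSampling P Pr ξf ξg) {T t : ℕ} (ht : t ≤ T) (k : ℕ) (m : Fin s.M) {X : Ω → E p}
    {Y : Ω → E d} (hX : IsPast Pr ξf ξg T X) (hY : IsPast Pr ξf ξg T Y) :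
    IsPast Pr ξf ξg T fun ω => hyperBatch s P (fun i => ξf i ω) (fun i => ξg i ω) k t m (X ω)
      (Y ω) := by
  have hsub : ∀ i, hyperIdx t m i ⊆ pastIdx s.M T := fun i => by
    rintro l (hl | ⟨j, rfl⟩)
    · rcases hl with rfl | hl
      · exact ht
      · rw [Set.mem_singleton_iff.1 hl]; exact ht
    · exact ht
  have h1 : ∀ i, IsPast Pr ξf ξg T fun ω => hyperEst s.τ s.Q (P.F m) (P.G m)
      (hyperSample ξf ξg t m i ω).1 (hyperSample ξf ξg t m i ω).2.1
      (hyperSample ξf ξg t m i ω).2.2 (X ω) (Y ω) := fun i => by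
    have hO := hA.isOracle_hyper hK hs hS t m i
    have hmeas : Measurable[sigmaOf ξf ξg (pastIdx s.M T)] (hyperSample ξf ξg t m i) :=
      measurable_hyperSample (hsub i)
    have h2 := hO.measurable_comp hmeas hX.1 hY.1
    have h3 := hO.memLp_comp (hX.1.mono (hS.sigmaOf_le _) le_rfl)
      (hY.1.mono (hS.sigmaOf_le _) le_rfl) hX.2 hY.2
    exact ⟨h2, h3⟩
  have h4 := (IsPast.sum (t := Finset.range k) fun i _ => h1 i).smul (1 / (k : ℝ))
  exact h4

/-- The state depends only on past samples and is square integrable. -/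
structure StatePast (Pr : Measure Ω) (ξf : ℕ × Fin s.M × ℕ → Ω → Ξf) (ξg : GIndex s.M → Ω → Ξg)
    (T : ℕ) (R : Ω → State p d s.M) : Prop where
  x : ∀ m, IsPast Pr ξf ξg T fun ω => (R ω).x m
  y : ∀ m, IsPast Pr ξf ξg T fun ω => (R ω).y m
  om : ∀ m, IsPast Pr ξf ξg T fun ω => (R ω).om m
  nu : ∀ m, IsPast Pr ξf ξg T fun ω => (R ω).nu m

/-- The random state at time `n + 1`. -/
noncomputable def traj (K : Constants) (s : Config) (P : Problem p d s.M Ξf Ξg)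
    (ξf : ℕ × Fin s.M × ℕ → Ω → Ξf) (ξg : GIndex s.M → Ω → Ξg) (x₁ : E p) (y₁ : E d) (n : ℕ) (ω : Ω) : State p d s.M :=
  run K s P (fun i => ξf i ω) (fun i => ξg i ω) x₁ y₁ n

/-- The next iterate `x`. -/
noncomputable def nextX (K : Constants) (s : Config) (n : ℕ) (S : State p d s.M) (m : Fin s.M) : E p :=
  if (n + 1) % s.I = 0 then avg fun m => S.x m - (s.η * alpha K s (n + 1)) • S.nu m
  else S.x m - (s.η * alpha K s (n + 1)) • S.nu m

/-- The next iterate `y`. -/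
noncomputable def nextY (K : Constants) (s : Config) (n : ℕ) (S : State p d s.M) (m : Fin s.M) : E d :=
  S.y m - (s.γ * alpha K s (n + 1)) • S.om m

/-- The next momentum `ν` before averaging. -/
noncomputable def nextNuHat (K : Constants) (s : Config) (P : Problem p d s.M Ξf Ξg)
    (sf : ℕ × Fin s.M × ℕ → Ξf) (sg : GIndex s.M → Ξg) (n : ℕ) (S : State p d s.M)
    (m : Fin s.M) : E p :=
  hyperBatch s P sf sg s.b (n + 2) m (nextX K s n S m) (nextY K s n S m) +
    (1 - cNu K s * alpha K s (n + 1) ^ 2) •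
      (S.nu m - hyperBatch s P sf sg s.b (n + 2) m (S.x m) (S.y m))

variable {x₁ : E p} {y₁ : E d} {n : ℕ}

theorem traj_succ_x (m : Fin s.M) (ω : Ω) :
    (traj K s P ξf ξg x₁ y₁ (n + 1) ω).x m = nextX K s n (traj K s P ξf ξg x₁ y₁ n ω) m := rfl

theorem traj_succ_y (m : Fin s.M) (ω : Ω) :
    (traj K s P ξf ξg x₁ y₁ (n + 1) ω).y m = nextY K s n (traj K s P ξf ξg x₁ y₁ n ω) m := rfl

theorem traj_succ_om (m : Fin s.M) (ω : Ω) :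
    (traj K s P ξf ξg x₁ y₁ (n + 1) ω).om m =
      lowerBatch s P (fun i => ξg i ω) (s.b * s.M) (n + 2) m
        (nextX K s n (traj K s P ξf ξg x₁ y₁ n ω) m) (nextY K s n (traj K s P ξf ξg x₁ y₁ n ω) m) +
      (1 - cOmega K s * alpha K s (n + 1) ^ 2) • ((traj K s P ξf ξg x₁ y₁ n ω).om m -
        lowerBatch s P (fun i => ξg i ω) (s.b * s.M) (n + 2) m
          ((traj K s P ξf ξg x₁ y₁ n ω).x m) ((traj K s P ξf ξg x₁ y₁ n ω).y m)) := rfl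

theorem traj_succ_nu (m : Fin s.M) (ω : Ω) :
    (traj K s P ξf ξg x₁ y₁ (n + 1) ω).nu m =
      if (n + 1) % s.I = 0 then avg (nextNuHat K s P (fun i => ξf i ω) (fun i => ξg i ω) n
        (traj K s P ξf ξg x₁ y₁ n ω))
      else nextNuHat K s P (fun i => ξf i ω) (fun i => ξg i ω) n
        (traj K s P ξf ξg x₁ y₁ n ω) m := rfl

/-- The new iterates are fixed before the next batch is drawn: the batch of time `n + 2` is
evaluated only at points that depend on samples up to time `n + 1`. -/
theorem StatePast.nextX {T : ℕ} {R : Ω → State p d s.M} (h : StatePast Pr ξf ξg T R) (n : ℕ)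
    (m : Fin s.M) : IsPast Pr ξf ξg T fun ω => nextX K s n (R ω) m := by
  unfold FedBiOAccLocal.nextX
  split_ifs
  · exact IsPast.avg fun m => (h.x m).sub ((h.nu m).smul _)
  · exact (h.x m).sub ((h.nu m).smul _)

theorem StatePast.nextY {T : ℕ} {R : Ω → State p d s.M} (h : StatePast Pr ξf ξg T R) (n : ℕ)
    (m : Fin s.M) : IsPast Pr ξf ξg T fun ω => nextY K s n (R ω) m :=
  (h.y m).sub ((h.om m).smul _)

theorem Assumptions.statePast_traj (hK : K.Valid) (hs : s.Admissible K c₀)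
    (hA : Assumptions K s.μ P) [IsProbabilityMeasure Pr] (hS : IsSampling P Pr ξf ξg) (x₁ : E p)
    (y₁ : E d) (n : ℕ) : StatePast Pr ξf ξg (n + 1) (traj K s P ξf ξg x₁ y₁ n) := by
  induction n with
  | zero =>
    exact
    { x := fun m => isPast_const x₁
      y := fun m => isPast_const y₁
      om := fun m => hA.isPast_lowerBatch hS le_rfl _ m (isPast_const x₁) (isPast_const y₁)
      nu := fun m => IsPast.avg fun m => hA.isPast_hyperBatch hK hs hS le_rfl _ m (isPast_const x₁)
        (isPast_const y₁) }
  | succ n ih =>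
    have hX : ∀ m, IsPast Pr ξf ξg (n + 2) fun ω =>
      FedBiOAccLocal.nextX K s n (traj K s P ξf ξg x₁ y₁ n ω) m := fun m =>
      (ih.nextX n m).mono (Nat.le_succ _)
    have hY : ∀ m, IsPast Pr ξf ξg (n + 2) fun ω =>
      FedBiOAccLocal.nextY K s n (traj K s P ξf ξg x₁ y₁ n ω) m := fun m =>
      (ih.nextY n m).mono (Nat.le_succ _)
    have hx := fun m => (ih.x m).mono (Nat.le_succ (n + 1))
    have hy := fun m => (ih.y m).mono (Nat.le_succ (n + 1))
    have hν : ∀ m, IsPast Pr ξf ξg (n + 2) fun ω => nextNuHat K s P (fun i => ξf i ω)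
        (fun i => ξg i ω) n (traj K s P ξf ξg x₁ y₁ n ω) m := fun m =>
      (hA.isPast_hyperBatch hK hs hS le_rfl _ m (hX m) (hY m)).add
        ((((ih.nu m).mono (Nat.le_succ _)).sub
          (hA.isPast_hyperBatch hK hs hS le_rfl _ m (hx m) (hy m))).smul _)
    refine ⟨hX, hY, fun m => ?_, fun m => ?_⟩
    · exact (hA.isPast_lowerBatch hS le_rfl _ m (hX m) (hY m)).add
        ((((ih.om m).mono (Nat.le_succ _)).sub
          (hA.isPast_lowerBatch hS le_rfl _ m (hx m) (hy m))).smul _)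
    · simp only [traj_succ_nu]
      split_ifs
      · exact IsPast.avg hν
      · exact hν m

end Run

/-! ### Mean squares over the clients -/

section MeanSquare

variable {M n : ℕ}

/-- `(1/M) ∑ₘ ‖vₘ‖²`. -/
noncomputable def msq (v : Fin M → E n) : ℝ := 1 / (M : ℝ) * ∑ m, ‖v m‖ ^ 2

theorem msq_nonneg (v : Fin M → E n) : 0 ≤ msq v := by unfold msq; positivity

theorem msq_smul (c : ℝ) (v : Fin M → E n) : msq (fun m => c • v m) = c ^ 2 * msq v := by
  simp only [msq, norm_smul, mul_pow, Real.norm_eq_abs, sq_abs, ← Finset.mul_sum]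
  ring

theorem avg_const (hM : 0 < M) (v : E n) : avg (fun _ : Fin M => v) = v := by
  have : (M : ℝ) ≠ 0 := by positivity
  simp [avg, ← Nat.cast_smul_eq_nsmul ℝ, smul_smul, this]

theorem avg_add (v w : Fin M → E n) : avg (fun m => v m + w m) = avg v + avg w := by
  simp [avg, Finset.sum_add_distrib]

theorem avg_sub' (v w : Fin M → E n) : avg (fun m => v m - w m) = avg v - avg w := by
  simp [avg, smul_sub]

theorem avg_smul (c : ℝ) (v : Fin M → E n) : avg (fun m => c • v m) = c • avg v := by
  simp only [avg, ← Finset.smul_sum]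
  rw [smul_comm]

theorem msq_eq_add (hM : 0 < M) (v : Fin M → E n) :
    msq v = ‖avg v‖ ^ 2 + msq fun m => v m - avg v := by
  have hM' : (M : ℝ) ≠ 0 := by positivity
  have h1 : ∑ m, ⟪v m, avg v⟫ = M * ‖avg v‖ ^ 2 := by
    rw [← sum_inner, ← real_inner_self_eq_norm_sq]
    have : ∑ m, v m = (M : ℝ) • avg v := by
      rw [avg, smul_smul, mul_one_div_cancel hM', one_smul]
    rw [this, inner_smul_left]
    simp
  simp only [msq, norm_sub_sq_real, Finset.sum_add_distrib, Finset.sum_sub_distrib,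
    ← Finset.mul_sum, h1]
  simp
  field_simp
  ring

theorem norm_avg_sq_le_msq (v : Fin M → E n) : ‖avg v‖ ^ 2 ≤ msq v := by
  rcases Nat.eq_zero_or_pos M with rfl | hM
  · simp [avg, msq]
  · rw [msq_eq_add hM v]
    linarith [msq_nonneg fun m => v m - avg v]

theorem msq_sub_avg_le (v : Fin M → E n) : msq (fun m => v m - avg v) ≤ msq v := by
  rcases Nat.eq_zero_or_pos M with rfl | hM
  · simp [msq]
  · linarith [msq_eq_add hM v, sq_nonneg ‖avg v‖]

theorem norm_add_sq_le_young {V : Type*} [NormedAddCommGroup V] {r : ℝ} (hr : 0 < r) (a b : V) :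
    ‖a + b‖ ^ 2 ≤ (1 + r) * ‖a‖ ^ 2 + (1 + 1 / r) * ‖b‖ ^ 2 := by
  have h1 := norm_add_le a b
  have h2 : ‖a + b‖ ^ 2 ≤ (‖a‖ + ‖b‖) ^ 2 := pow_le_pow_left₀ (norm_nonneg _) h1 2
  have h3 : 0 ≤ (r * ‖a‖ - ‖b‖) ^ 2 / r := by positivity
  have h4 : (r * ‖a‖ - ‖b‖) ^ 2 / r = r * ‖a‖ ^ 2 - 2 * ‖a‖ * ‖b‖ + 1 / r * ‖b‖ ^ 2 := by
    field_simp; ring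
  nlinarith

theorem msq_add_le_young {r : ℝ} (hr : 0 < r) (v w : Fin M → E n) :
    msq (fun m => v m + w m) ≤ (1 + r) * msq v + (1 + 1 / r) * msq w := by
  have h : ∑ m, ‖v m + w m‖ ^ 2 ≤ ∑ m, ((1 + r) * ‖v m‖ ^ 2 + (1 + 1 / r) * ‖w m‖ ^ 2) :=
    Finset.sum_le_sum fun m _ => norm_add_sq_le_young hr _ _
  rw [Finset.sum_add_distrib, ← Finset.mul_sum, ← Finset.mul_sum] at h
  have := mul_le_mul_of_nonneg_left h (by positivity : (0 : ℝ) ≤ 1 / M)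
  unfold msq
  linarith

end MeanSquare

/-! ### Recursions for the momentum errors -/

section Recursions

variable {p d : ℕ} {s : Config} {Ξf Ξg Ω : Type*} [MeasurableSpace Ξf] [MeasurableSpace Ξg]
  [MeasurableSpace Ω] {P : Problem p d s.M Ξf Ξg} {Pr : Measure Ω}
  {ξf : ℕ × Fin s.M × ℕ → Ω → Ξf} {ξg : GIndex s.M → Ω → Ξg} {K : Constants} {c₀ : ℝ}

/-- Mean squared error of the lower-level momentum. -/
noncomputable def errOm (P : Problem p d s.M Ξf Ξg) (S : State p d s.M) : ℝ :=
  msq fun m => S.om m - gradY (P.g m) (S.x m) (S.y m)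

/-- Squared error of the averaged hypergradient momentum. -/
noncomputable def errNu (P : Problem p d s.M Ξf Ξg) (S : State p d s.M) : ℝ :=
  ‖avg S.nu - avg fun m => meanEst s.τ s.Q (P.f m) (P.g m) (S.x m) (S.y m)‖ ^ 2

/-- Mean squared displacement of the iterates in one step. -/
noncomputable def moveSq (K : Constants) (s : Config) (n : ℕ) (S : State p d s.M) : ℝ :=
  msq (fun m => nextX K s n S m - S.x m) + msq fun m => nextY K s n S m - S.y m

theorem Config.Admissible.b₁_pos (hK : K.Valid) (hs : s.Admissible K c₀) : 0 < s.b₁ := by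
  have h1 : 0 < kappa K s ^ (7 / 3 : ℝ) := Real.rpow_pos_of_pos (div_pos hK.L_pos hs.μ_pos) _
  have h2 : (0 : ℝ) < (s.I : ℝ) ^ (3 / 2 : ℝ) :=
    Real.rpow_pos_of_pos (by exact_mod_cast hs.I_pos) _
  have h3 : (0 : ℝ) < s.b := by exact_mod_cast hs.b_pos
  exact_mod_cast (by positivity : 0 < kappa K s ^ (7 / 3 : ℝ) * (s.b : ℝ) *
    (s.I : ℝ) ^ (3 / 2 : ℝ)).trans_le hs.b₁_ge

/-- Server averaging does not change the client mean, so the mean momentum follows the same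
recursion at every step, synchronizing or not. -/
theorem avg_nextNuHat (K : Constants) (P : Problem p d s.M Ξf Ξg) (hM : 0 < s.M)
    (n : ℕ) (x₁ : E p) (y₁ : E d) (ω : Ω) :
    avg (traj K s P ξf ξg x₁ y₁ (n + 1) ω).nu = avg (nextNuHat K s P (fun i => ξf i ω)
      (fun i => ξg i ω) n (traj K s P ξf ξg x₁ y₁ n ω)) := by
  have e : (traj K s P ξf ξg x₁ y₁ (n + 1) ω).nu = fun m => _ := funext fun m => traj_succ_nu m ω
  rw [e]
  split_ifs
  · exact avg_const hM _
  · rfl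

variable [IsProbabilityMeasure Pr]

theorem integral_msq {k : ℕ} {T : ℕ} {Z : Fin s.M → Ω → E k} (h : ∀ m, IsPast Pr ξf ξg T (Z m)) :
    Integrable (fun ω => msq fun m => Z m ω) Pr ∧
      ∫ ω, msq (fun m => Z m ω) ∂Pr = 1 / (s.M : ℝ) * ∑ m, ∫ ω, ‖Z m ω‖ ^ 2 ∂Pr := by
  unfold msq
  refine ⟨(integrable_finsetSum _ fun m _ => (h m).integrable_sq).const_mul _, ?_⟩
  rw [integral_const_mul, integral_finsetSum _ fun m _ => (h m).integrable_sq]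

theorem Assumptions.isPast_gradY (hA : Assumptions K s.μ P) (hS : IsSampling P Pr ξf ξg) {T : ℕ}
    (m : Fin s.M) {X : Ω → E p} {Y : Ω → E d} (hX : IsPast Pr ξf ξg T X)
    (hY : IsPast Pr ξf ξg T Y) : IsPast Pr ξf ξg T fun ω => gradY (P.g m) (X ω) (Y ω) :=
  (hA.isOracle_lower hS 0 m 0).isPast_mean hS hX hY

theorem Assumptions.isPast_meanEst (hK : K.Valid) (hs : s.Admissible K c₀)
    (hA : Assumptions K s.μ P) (hS : IsSampling P Pr ξf ξg) {T : ℕ}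
    (m : Fin s.M) {X : Ω → E p} {Y : Ω → E d} (hX : IsPast Pr ξf ξg T X)
    (hY : IsPast Pr ξf ξg T Y) :
    IsPast Pr ξf ξg T fun ω => meanEst s.τ s.Q (P.f m) (P.g m) (X ω) (Y ω) :=
  (hA.isOracle_hyper hK hs hS 0 m 0).isPast_mean hS hX hY

theorem Assumptions.integral_errOm_zero_le (hK : K.Valid) (hs : s.Admissible K c₀)
    (hA : Assumptions K s.μ P) (hS : IsSampling P Pr ξf ξg) (x₁ : E p) (y₁ : E d) :
    ∫ ω, errOm P (traj K s P ξf ξg x₁ y₁ 0 ω) ∂Pr ≤ 1 / (s.b₁ * s.M) * (2 * K.σ ^ 2) := by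
  have hM : 0 < s.M := hs.M_pos
  have hM' : (s.M : ℝ) ≠ 0 := by positivity
  have hk : 0 < s.b₁ * s.M := Nat.mul_pos (hs.b₁_pos hK) hM
  have h0 := hA.statePast_traj hK hs hS x₁ y₁ 0
  have key : ∀ m : Fin s.M, ∫ ω, ‖(traj K s P ξf ξg x₁ y₁ 0 ω).om m - gradY (P.g m)
      ((traj K s P ξf ξg x₁ y₁ 0 ω).x m) ((traj K s P ξf ξg x₁ y₁ 0 ω).y m)‖ ^ 2 ∂Pr ≤
      1 / (s.b₁ * s.M) * (2 * K.σ ^ 2) := fun m => by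
    -- With `c = 1`, `U = 0` and coinciding points the momentum noise is the plain error of the
    -- first batch.
    have h := hA.lower_batch_step hS (T := 0) (t := 1) one_pos hk m 1
      (U := fun _ => 0) (X' := fun _ => x₁) (X := fun _ => x₁) (Y' := fun _ => y₁)
      (Y := fun _ => y₁) measurable_const measurable_const measurable_const measurable_const
      measurable_const (memLp_const _) (memLp_const _) (memLp_const _) (memLp_const _)
      (memLp_const _)
    have h' : ∫ ω, ‖lowerBatch s P (fun i => ξg i ω) (s.b₁ * s.M) 1 m x₁ y₁ -
      gradY (P.g m) x₁ y₁‖ ^ 2 ∂Pr ≤ 1 / (s.b₁ * s.M) * (2 * K.σ ^ 2) := by simpa using h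
    exact h'
  unfold errOm
  rw [(integral_msq (T := 1) fun m => (h0.om m).sub (hA.isPast_gradY hS m (h0.x m) (h0.y m))).2,
    one_div, inv_mul_le_iff₀ (by positivity)]
  refine (Finset.sum_le_sum fun m _ => key m).trans_eq ?_
  simp

theorem Assumptions.integral_errNu_zero_le (hK : K.Valid) (hs : s.Admissible K c₀)
    (hA : Assumptions K s.μ P) (hS : IsSampling P Pr ξf ξg) (x₁ : E p) (y₁ : E d) :
    ∫ ω, errNu P (traj K s P ξf ξg x₁ y₁ 0 ω) ∂Pr ≤
      1 / (s.b₁ * s.M) * (2 * ((1 + kappa K s) * K.Cf) ^ 2) := by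
  have h := hA.hyper_batch_step hK hs hS (T := 0) (t := 1) one_pos (hs.b₁_pos hK) 1
      (U := fun _ => 0) (X' := fun _ _ => x₁) (X := fun _ _ => x₁) (Y' := fun _ _ => y₁)
      (Y := fun _ _ => y₁) measurable_const (fun _ => measurable_const) (fun _ => measurable_const)
      (fun _ => measurable_const) (fun _ => measurable_const) (memLp_const _)
      (fun _ => memLp_const _) (fun _ => memLp_const _) (fun _ => memLp_const _)
      (fun _ => memLp_const _)
  have e : ∀ ω, errNu P (traj K s P ξf ξg x₁ y₁ 0 ω) = ‖avg fun m => hyperBatch s P (fun i => ξf i ω)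
      (fun i => ξg i ω) s.b₁ 1 m x₁ y₁ - meanEst s.τ s.Q (P.f m) (P.g m) x₁ y₁‖ ^ 2 := fun ω => by
    have hn : avg (traj K s P ξf ξg x₁ y₁ 0 ω).nu = avg fun m => hyperBatch s P (fun i => ξf i ω)
        (fun i => ξg i ω) s.b₁ 1 m x₁ y₁ := avg_const hs.M_pos _
    rw [errNu, hn, ← avg_sub']
    rfl
  simp only [e]
  simpa using h

/-- The new error is `1 - c` times the old one plus the momentum noise of the fresh batch. They are
orthogonal, hence the square `(1 - c)²` without a cross term. -/
theorem Assumptions.integral_errOm_succ_le (hK : K.Valid) (hs : s.Admissible K c₀)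
    (hA : Assumptions K s.μ P) (hS : IsSampling P Pr ξf ξg) (x₁ : E p) (y₁ : E d) (n : ℕ) :
    ∫ ω, errOm P (traj K s P ξf ξg x₁ y₁ (n + 1) ω) ∂Pr ≤
      (1 - cOmega K s * alpha K s (n + 1) ^ 2) ^ 2 *
        ∫ ω, errOm P (traj K s P ξf ξg x₁ y₁ n ω) ∂Pr +
      1 / bM s * (2 * K.L ^ 2 * ∫ ω, moveSq K s n (traj K s P ξf ξg x₁ y₁ n ω) ∂Pr +
        2 * (cOmega K s * alpha K s (n + 1) ^ 2) ^ 2 * K.σ ^ 2) := by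
  have hM : 0 < s.M := hs.M_pos
  have hM' : (0 : ℝ) < s.M := by positivity
  have hk : 0 < s.b * s.M := Nat.mul_pos hs.b_pos hM
  have h0 := hA.statePast_traj hK hs hS x₁ y₁ n
  have h1 := hA.statePast_traj hK hs hS x₁ y₁ (n + 1)
  have hX := h0.nextX (K := K) n
  have hY := h0.nextY (K := K) n
  set c := cOmega K s * alpha K s (n + 1) ^ 2 with hc
  have hU : ∀ m, IsPast Pr ξf ξg (n + 1) fun ω => (traj K s P ξf ξg x₁ y₁ n ω).om m -
    gradY (P.g m) ((traj K s P ξf ξg x₁ y₁ n ω).x m) ((traj K s P ξf ξg x₁ y₁ n ω).y m) :=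
    fun m => (h0.om m).sub (hA.isPast_gradY hS m (h0.x m) (h0.y m))
  have key : ∀ m : Fin s.M, ∫ ω, ‖(traj K s P ξf ξg x₁ y₁ (n + 1) ω).om m - gradY (P.g m)
      ((traj K s P ξf ξg x₁ y₁ (n + 1) ω).x m) ((traj K s P ξf ξg x₁ y₁ (n + 1) ω).y m)‖ ^ 2 ∂Pr ≤
      (1 - c) ^ 2 * ∫ ω, ‖(traj K s P ξf ξg x₁ y₁ n ω).om m - gradY (P.g m)
        ((traj K s P ξf ξg x₁ y₁ n ω).x m) ((traj K s P ξf ξg x₁ y₁ n ω).y m)‖ ^ 2 ∂Pr +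
      1 / bM s * (2 * K.L ^ 2 * (∫ ω, ‖nextX K s n (traj K s P ξf ξg x₁ y₁ n ω) m -
          (traj K s P ξf ξg x₁ y₁ n ω).x m‖ ^ 2 ∂Pr +
        ∫ ω, ‖nextY K s n (traj K s P ξf ξg x₁ y₁ n ω) m -
          (traj K s P ξf ξg x₁ y₁ n ω).y m‖ ^ 2 ∂Pr) + 2 * c ^ 2 * K.σ ^ 2) := fun m => by
    have h := hA.lower_batch_step hS (T := n + 1) (t := n + 2) (Nat.lt_succ_self _) hk m c
      ((hU m).smul (1 - c)).1 (hX m).1 (hY m).1 (h0.x m).1 (h0.y m).1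
      ((hU m).smul (1 - c)).2 (hX m).2 (hY m).2 (h0.x m).2 (h0.y m).2
    refine (le_of_eq ?_).trans (h.trans_eq ?_)
    · congr 1
      ext ω
      congr 2
      rw [traj_succ_om, traj_succ_x, traj_succ_y, ← hc]
      module
    · simp only [norm_smul, mul_pow, Real.norm_eq_abs, sq_abs]
      rw [integral_const_mul, bM, Nat.cast_mul]
  have i1 := integral_msq fun m => (hX m).sub (h0.x m)
  have i2 := integral_msq fun m => (hY m).sub (h0.y m)
  have i3 := integral_msq hU
  have i4 := integral_msq fun m => (h1.om m).sub (hA.isPast_gradY hS m (h1.x m) (h1.y m))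
  unfold moveSq errOm
  rw [integral_add i1.1 i2.1, i1.2, i2.2, i3.2, i4.2]
  refine (mul_le_mul_of_nonneg_left (Finset.sum_le_sum fun m _ => key m)
    (by positivity)).trans_eq ?_
  simp only [Finset.sum_add_distrib, ← Finset.mul_sum, Finset.sum_const, Finset.card_univ,
    Fintype.card_fin, nsmul_eq_mul]
  field_simp

/-- Only the error of the client mean is tracked, because averaging is what divides the noise by
`M`. The scatter of the individual momenta is measured separately by `devNu`. -/
theorem Assumptions.integral_errNu_succ_le (hK : K.Valid) (hs : s.Admissible K c₀)
    (hA : Assumptions K s.μ P) (hS : IsSampling P Pr ξf ξg) (x₁ : E p) (y₁ : E d) (n : ℕ) :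
    ∫ ω, errNu P (traj K s P ξf ξg x₁ y₁ (n + 1) ω) ∂Pr ≤
      (1 - cNu K s * alpha K s (n + 1) ^ 2) ^ 2 *
        ∫ ω, errNu P (traj K s P ξf ξg x₁ y₁ n ω) ∂Pr +
      1 / bM s * (2 * Lhat K s ^ 2 * ∫ ω, moveSq K s n (traj K s P ξf ξg x₁ y₁ n ω) ∂Pr +
        2 * (cNu K s * alpha K s (n + 1) ^ 2) ^ 2 * ((1 + kappa K s) * K.Cf) ^ 2) := by
  have hM : 0 < s.M := hs.M_pos
  have hM' : (0 : ℝ) < s.M := by positivity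
  have h0 := hA.statePast_traj hK hs hS x₁ y₁ n
  have hX := h0.nextX (K := K) n
  have hY := h0.nextY (K := K) n
  set c := cNu K s * alpha K s (n + 1) ^ 2 with hc
  have hU : IsPast Pr ξf ξg (n + 1) fun ω => avg (traj K s P ξf ξg x₁ y₁ n ω).nu - avg fun m =>
      meanEst s.τ s.Q (P.f m) (P.g m) ((traj K s P ξf ξg x₁ y₁ n ω).x m)
        ((traj K s P ξf ξg x₁ y₁ n ω).y m) :=
    (IsPast.avg h0.nu).sub (IsPast.avg fun m => hA.isPast_meanEst hK hs hS m (h0.x m) (h0.y m))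
  have h := hA.hyper_batch_step hK hs hS (T := n + 1) (t := n + 2) (Nat.lt_succ_self _) hs.b_pos c
      (hU.smul (1 - c)).1 (fun m => (hX m).1) (fun m => (hY m).1) (fun m => (h0.x m).1)
      (fun m => (h0.y m).1) (hU.smul (1 - c)).2 (fun m => (hX m).2) (fun m => (hY m).2)
      (fun m => (h0.x m).2) (fun m => (h0.y m).2)
  have i1 := integral_msq fun m => (hX m).sub (h0.x m)
  have i2 := integral_msq fun m => (hY m).sub (h0.y m)
  refine (le_of_eq ?_).trans (h.trans_eq ?_)
  · congr 1
    ext ω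
    rw [errNu]
    congr 2
    rw [avg_nextNuHat K P hM, ← avg_sub', ← avg_sub', ← avg_smul, ← avg_add]
    congr 1
    ext1 m
    rw [nextNuHat, traj_succ_x, traj_succ_y, ← hc]
    module
  · unfold moveSq errNu
    rw [integral_add i1.1 i2.1, i1.2, i2.2]
    simp only [norm_smul, mul_pow, Real.norm_eq_abs, sq_abs]
    rw [integral_const_mul, bM, Finset.sum_add_distrib]
    ring

end Recursions

section MeanSquare

variable {M n : ℕ}

theorem msq_le_of_norm_le {v : Fin M → E n} {c : ℝ} (h : ∀ m, ‖v m‖ ≤ c) : msq v ≤ c ^ 2 := by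
  rcases Nat.eq_zero_or_pos M with rfl | hM
  · simpa [msq] using sq_nonneg c
  have hM' : (0 : ℝ) < M := by positivity
  unfold msq
  rw [one_div, inv_mul_le_iff₀ hM']
  refine (Finset.sum_le_sum fun m _ => pow_le_pow_left₀ (norm_nonneg _) (h m) 2).trans_eq ?_
  simp

theorem msq_sub_le_of_pairLipschitz {p d : ℕ} {L : ℝ} {A : Fin M → E p → E d → E n}
    (hA : ∀ m, PairLipschitz L (A m)) (x x' : Fin M → E p) (y y' : Fin M → E d) :
    msq (fun m => A m (x' m) (y' m) - A m (x m) (y m)) ≤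
      L ^ 2 * (msq (fun m => x' m - x m) + msq fun m => y' m - y m) := by
  have h : ∑ m, ‖A m (x' m) (y' m) - A m (x m) (y m)‖ ^ 2 ≤
      ∑ m, (L ^ 2 * ‖x' m - x m‖ ^ 2 + L ^ 2 * ‖y' m - y m‖ ^ 2) :=
    Finset.sum_le_sum fun m _ => by
      rw [← mul_add, ← norm_pair_sub_sq, ← mul_pow]
      exact pow_le_pow_left₀ (norm_nonneg _) (hA m _ _ _ _) 2
  rw [Finset.sum_add_distrib, ← Finset.mul_sum, ← Finset.mul_sum] at h
  have := mul_le_mul_of_nonneg_left h (by positivity : (0 : ℝ) ≤ 1 / M)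
  unfold msq
  linarith

theorem msq_neg (v : Fin M → E n) : msq (fun m => -v m) = msq v := by simp [msq]

theorem msq_add_le_two (v w : Fin M → E n) :
    msq (fun m => v m + w m) ≤ 2 * msq v + 2 * msq w := by
  have := msq_add_le_young one_pos v w
  norm_num at this
  exact this

theorem norm_mean_le {V : Type*} [NormedAddCommGroup V] [NormedSpace ℝ V] {k : ℕ} (hk : 0 < k)
    {v : ℕ → V} {c : ℝ} (h : ∀ i, ‖v i‖ ≤ c) : ‖(1 / (k : ℝ)) • ∑ i ∈ Finset.range k, v i‖ ≤ c := by
  have hk' : (0 : ℝ) < k := by positivity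
  rw [norm_smul, Real.norm_eq_abs, abs_of_pos (by positivity), one_div, inv_mul_le_iff₀ hk']
  refine (norm_sum_le _ _).trans ((Finset.sum_le_sum fun i _ => h i).trans ?_)
  simp

end MeanSquare

/-! ### One-step inequalities for displacement, client drift and lower-level error -/

section OneStep

variable {p d : ℕ} {s : Config} {Ξf Ξg : Type*} [MeasurableSpace Ξf] [MeasurableSpace Ξg]
  {P : Problem p d s.M Ξf Ξg} {K : Constants} {c₀ : ℝ}

theorem Config.Admissible.τμ_lt (hK : K.Valid) (hs : s.Admissible K c₀) : s.τ * s.μ < 1 :=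
  (mul_le_mul_of_nonneg_left hs.μ_le hs.τ_pos.le).trans_lt ((lt_div_iff₀ hK.L_pos).1 hs.τ_lt)

theorem Assumptions.norm_hyperBatch_le (hK : K.Valid) (hs : s.Admissible K c₀)
    (hA : Assumptions K s.μ P) (sf : ℕ × Fin s.M × ℕ → Ξf) (sg : GIndex s.M → Ξg) {k : ℕ}
    (hk : 0 < k) (t : ℕ) (m : Fin s.M) (x : E p) (y : E d) :
    ‖hyperBatch s P sf sg k t m x y‖ ≤ (1 + kappa K s) * K.Cf :=
  norm_mean_le hk fun i => norm_hyperEst_le hs.τ_pos hs.μ_pos (hs.τμ_lt hK) hK.L_pos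
      (fun ξ => hA.upperBounds m ξ) (fun ξ => hA.lowerBounds hK hs.μ_le hs.τ_pos hs.τ_lt m ξ)
      _ _ _ x y

theorem Assumptions.hyperBatch_lipschitz (hK : K.Valid) (hs : s.Admissible K c₀)
    (hA : Assumptions K s.μ P) (sf : ℕ × Fin s.M × ℕ → Ξf) (sg : GIndex s.M → Ξg) {k : ℕ}
    (hk : 0 < k) (t : ℕ) (m : Fin s.M) :
    PairLipschitz (Lhat K s) (hyperBatch s P sf sg k t m) := fun x y x' y' => by
  unfold hyperBatch
  rw [← smul_sub, ← Finset.sum_sub_distrib]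
  refine norm_mean_le hk fun i => (hyperEst_lipschitz hs.τ_pos hs.μ_pos (hs.τμ_lt hK) hK
      (fun ξ => hA.upperBounds m ξ) (fun ξ => hA.lowerBounds hK hs.μ_le hs.τ_pos hs.τ_lt m ξ)
      _ _ _ x y x' y').trans (mul_le_mul_of_nonneg_right (le_max_right _ _) (norm_nonneg _))

/-- Client drift of the iterates. -/
noncomputable def devX (S : State p d s.M) : ℝ := msq fun m => S.x m - avg S.x

/-- Client drift of the momentum. -/
noncomputable def devNu (S : State p d s.M) : ℝ := msq fun m => S.nu m - avg S.nu

/-- Mean squared distance to the lower-level minimizers at the averaged iterate. -/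
noncomputable def errY (P : Problem p d s.M Ξf Ξg) (S : State p d s.M) : ℝ :=
  msq fun m => S.y m - P.yStar m (avg S.x)

theorem avg_nextX (hM : 0 < s.M) (n : ℕ) (S : State p d s.M) :
    avg (nextX K s n S) = avg S.x - (s.η * alpha K s (n + 1)) • avg S.nu := by
  have e : avg (fun m => S.x m - (s.η * alpha K s (n + 1)) • S.nu m) =
      avg S.x - (s.η * alpha K s (n + 1)) • avg S.nu := by rw [avg_sub', avg_smul]
  by_cases h : (n + 1) % s.I = 0
  · have : nextX K s n S = fun _ => avg fun m => S.x m - (s.η * alpha K s (n + 1)) • S.nu m :=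
      funext fun m => if_pos h
    rw [this, avg_const hM, e]
  · have : nextX K s n S = fun m => S.x m - (s.η * alpha K s (n + 1)) • S.nu m :=
      funext fun m => if_neg h
    rw [this, e]

/-- At a synchronization every client jumps back to the mean, so its own deviation adds to its
displacement. The mean step and the deviations are orthogonal over the clients, which gives `devX`
with coefficient one. -/
theorem moveSq_le (hM : 0 < s.M) (n : ℕ) (S : State p d s.M) :
    moveSq K s n S ≤ (s.η * alpha K s (n + 1)) ^ 2 * (‖avg S.nu‖ ^ 2 + devNu S) +
      (s.γ * alpha K s (n + 1)) ^ 2 * msq S.om + if (n + 1) % s.I = 0 then devX S else 0 := by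
  have hy : msq (fun m => nextY K s n S m - S.y m) =
      (s.γ * alpha K s (n + 1)) ^ 2 * msq S.om := by
    rw [← neg_sq, ← msq_smul]
    congr 1
    ext1 m
    rw [nextY, neg_smul, sub_sub_cancel_left]
  have hν := msq_eq_add hM S.nu
  rw [moveSq, hy, devNu, ← hν]
  split_ifs with h
  · have e : (fun m => nextX K s n S m - S.x m) = fun m => -(S.x m - avg S.x) +
        -((s.η * alpha K s (n + 1)) • avg S.nu) := by
      ext1 m
      have : nextX K s n S m = avg S.x - (s.η * alpha K s (n + 1)) • avg S.nu := by
        rw [← avg_nextX hM, nextX, if_pos h]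
        have : nextX K s n S = fun _ => avg fun m => S.x m - (s.η * alpha K s (n + 1)) • S.nu m :=
          funext fun m => if_pos h
        rw [this, avg_const hM]
      rw [this]
      abel
    have h0 : avg (fun m => S.x m - avg S.x) = 0 := by
      rw [avg_sub', avg_const hM, sub_self]
    have h1 := msq_eq_add hM fun m => nextX K s n S m - S.x m
    have h2 : avg (fun m => nextX K s n S m - S.x m) = -((s.η * alpha K s (n + 1)) • avg S.nu) := by
      rw [avg_sub', avg_nextX hM]; abel
    have h3 : msq (fun m => nextX K s n S m - S.x m - avg fun m => nextX K s n S m - S.x m) =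
        devX S := by
      rw [h2, devX, ← msq_neg]
      congr 1
      ext1 m
      rw [congrFun e m]
      module
    rw [h1, h3, h2, norm_neg, norm_smul, mul_pow, Real.norm_eq_abs, sq_abs]
    have := mul_le_mul_of_nonneg_left (norm_avg_sq_le_msq S.nu)
      (sq_nonneg (s.η * alpha K s (n + 1)))
    linarith
  · have e : (fun m => nextX K s n S m - S.x m) = fun m =>
        (-(s.η * alpha K s (n + 1))) • S.nu m := by
      ext1 m
      rw [nextX, if_neg h, neg_smul, sub_sub_cancel_left]
    rw [e, msq_smul, neg_sq]
    linarith

/-- Young's inequality with parameter `1 / I`: over a round of `I` steps the factors `1 + 1 / I`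
multiply to at most `e`, at the price of the factor `1 + I` on the increments. -/
theorem devX_next_le (hM : 0 < s.M) (hI : 0 < s.I) (n : ℕ) (S : State p d s.M) :
    msq (fun m => nextX K s n S m - avg (nextX K s n S)) ≤ if (n + 1) % s.I = 0 then 0 else
      (1 + 1 / (s.I : ℝ)) * devX S + (1 + s.I) * ((s.η * alpha K s (n + 1)) ^ 2 * devNu S) := by
  split_ifs with h
  · have : nextX K s n S = fun _ => avg fun m => S.x m - (s.η * alpha K s (n + 1)) • S.nu m :=
      funext fun m => if_pos h
    rw [this, avg_const hM]
    simp [msq]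
  · have hI' : (0 : ℝ) < s.I := by positivity
    have e : (fun m => nextX K s n S m - avg (nextX K s n S)) = fun m => (S.x m - avg S.x) +
        (-(s.η * alpha K s (n + 1))) • (S.nu m - avg S.nu) := by
      ext1 m
      rw [avg_nextX hM, nextX, if_neg h]
      module
    have h1 := msq_add_le_young (r := 1 / (s.I : ℝ)) (by positivity) (fun m => S.x m - avg S.x)
      fun m => (-(s.η * alpha K s (n + 1))) • (S.nu m - avg S.nu)
    rw [msq_smul, neg_sq, one_div_one_div] at h1
    rw [e]
    exact h1

/-- The update is `(1 - c) ν` plus a vector `u` consisting of a difference of estimates at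
neighbouring points and `c` times an estimate. Both parts are bounded for every realization, by the
Lipschitz constant and by the uniform bound on the estimates, so disagreement between clients needs
no probabilistic argument. -/
theorem Assumptions.devNu_next_le (hK : K.Valid) (hs : s.Admissible K c₀)
    (hA : Assumptions K s.μ P) (sf : ℕ × Fin s.M × ℕ → Ξf) (sg : GIndex s.M → Ξg) (n : ℕ)
    (hc0 : 0 ≤ cNu K s * alpha K s (n + 1) ^ 2) (hc1 : cNu K s * alpha K s (n + 1) ^ 2 ≤ 1)
    (S : State p d s.M) :
    msq (fun m => nextNuHat K s P sf sg n S m - avg (nextNuHat K s P sf sg n S)) ≤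
      (1 + 1 / (s.I : ℝ)) * devNu S + (1 + s.I) * (2 * Lhat K s ^ 2 * moveSq K s n S +
        2 * (cNu K s * alpha K s (n + 1) ^ 2) ^ 2 * ((1 + kappa K s) * K.Cf) ^ 2) := by
  have hM : 0 < s.M := hs.M_pos
  have hI : (0 : ℝ) < s.I := by exact_mod_cast hs.I_pos
  set c := cNu K s * alpha K s (n + 1) ^ 2 with hc
  set u : Fin s.M → E p := fun m => (hyperBatch s P sf sg s.b (n + 2) m (nextX K s n S m)
    (nextY K s n S m) - hyperBatch s P sf sg s.b (n + 2) m (S.x m) (S.y m)) +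
    c • hyperBatch s P sf sg s.b (n + 2) m (S.x m) (S.y m) with hu
  have e : nextNuHat K s P sf sg n S = fun m => (1 - c) • S.nu m + u m := by
    ext1 m
    simp only [nextNuHat, hu, ← hc]
    module
  have e2 : (fun m => nextNuHat K s P sf sg n S m - avg (nextNuHat K s P sf sg n S)) =
      fun m => (1 - c) • (S.nu m - avg S.nu) + (u m - avg u) := by
    ext1 m
    rw [e, avg_add, avg_smul]
    module
  have h1 := msq_add_le_young (r := 1 / (s.I : ℝ)) (by positivity)
    (fun m => (1 - c) • (S.nu m - avg S.nu)) fun m => u m - avg u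
  rw [msq_smul, one_div_one_div] at h1
  have h2 : msq u ≤ 2 * Lhat K s ^ 2 * moveSq K s n S + 2 * c ^ 2 * ((1 + kappa K s) * K.Cf) ^ 2 := by
    have h3 := msq_add_le_two (fun m => hyperBatch s P sf sg s.b (n + 2) m (nextX K s n S m)
      (nextY K s n S m) - hyperBatch s P sf sg s.b (n + 2) m (S.x m) (S.y m))
      fun m => c • hyperBatch s P sf sg s.b (n + 2) m (S.x m) (S.y m)
    have h4 := msq_sub_le_of_pairLipschitz
      (fun m => hA.hyperBatch_lipschitz hK hs sf sg hs.b_pos (n + 2) m) S.x (nextX K s n S) S.y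
      (nextY K s n S)
    have h5 := msq_le_of_norm_le fun m =>
      hA.norm_hyperBatch_le hK hs sf sg hs.b_pos (n + 2) m (S.x m) (S.y m)
    rw [msq_smul] at h3
    have h6 := mul_le_mul_of_nonneg_left h5 (sq_nonneg c)
    unfold moveSq
    simp only [hu]
    linarith
  have h3 := (msq_sub_avg_le u).trans h2
  have h4 : (1 - c) ^ 2 * devNu S ≤ devNu S :=
    mul_le_of_le_one_left (msq_nonneg _) (by nlinarith)
  rw [e2]
  refine h1.trans (add_le_add (mul_le_mul_of_nonneg_left h4 (by positivity))
    (mul_le_mul_of_nonneg_left h3 (by positivity)))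

set_option maxHeartbeats 800000 in
theorem Assumptions.errY_next_le (hK : K.Valid) (hc : 0 < c₀) (hs : s.Admissible K c₀)
    (hA : Assumptions K s.μ P) (n : ℕ) (ha0 : 0 < alpha K s (n + 1))
    (ha1 : alpha K s (n + 1) ≤ 1 / 16) (S : State p d s.M) :
    msq (fun m => nextY K s n S m - P.yStar m (avg (nextX K s n S))) ≤
      (1 - s.γ * s.μ * alpha K s (n + 1) / 4) * errY P S -
        15 / 16 * s.γ ^ 2 * alpha K s (n + 1) * msq S.om +
        31 / 5 * s.γ * alpha K s (n + 1) / s.μ * errOm P S +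
        31 / 5 * s.γ * alpha K s (n + 1) * K.L ^ 2 / s.μ * devX S +
        5 * kappa K s ^ 2 * s.η ^ 2 * alpha K s (n + 1) / (s.γ * s.μ) * ‖avg S.nu‖ ^ 2 := by
  have hM : 0 < s.M := hs.M_pos
  have hL := hK.L_pos
  have hμ := hs.μ_pos
  have hγ : 0 < s.γ := lt_of_lt_of_le (by positivity) hs.γ_ge
  set a := alpha K s (n + 1) with ha
  have hγL : s.γ * K.L ≤ 1 / 2 := by
    have := hs.γ_le
    rw [le_div_iff₀ (by positivity)] at this
    linarith
  have hγμ : s.γ * s.μ ≤ 1 / 2 := (mul_le_mul_of_nonneg_left hs.μ_le hγ.le).trans hγL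
  set ρ := s.γ * s.μ * a / 4 with hρ
  have hρ0 : 0 < ρ := by positivity
  have hρ1 : ρ ≤ 1 / 128 := by
    have : s.γ * s.μ * a ≤ 1 / 2 * (1 / 16) := mul_le_mul hγμ ha1 ha0.le (by norm_num)
    linarith
  have hρ2 : (1 + 1 / ρ) * a ^ 2 ≤ 5 * a / (s.γ * s.μ) := by
    have e : (1 + 1 / ρ) * a ^ 2 = a ^ 2 + 4 * a / (s.γ * s.μ) := by rw [hρ]; field_simp
    have h1 : a ^ 2 ≤ a / (s.γ * s.μ) := by
      rw [le_div_iff₀ (by positivity)]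
      nlinarith [mul_pos hγ hμ, mul_pos (mul_pos ha0 ha0) (mul_pos hγ hμ)]
    rw [e]
    have h2 : 5 * a / (s.γ * s.μ) = a / (s.γ * s.μ) + 4 * a / (s.γ * s.μ) := by ring
    linarith
  have key : ∀ m, ‖nextY K s n S m - P.yStar m (avg (nextX K s n S))‖ ^ 2 ≤
      (1 - ρ) * ‖S.y m - P.yStar m (avg S.x)‖ ^ 2 -
        15 / 16 * s.γ ^ 2 * a * ‖S.om m‖ ^ 2 +
        31 / 5 * s.γ * a / s.μ * ‖S.om m - gradY (P.g m) (S.x m) (S.y m)‖ ^ 2 +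
        31 / 5 * s.γ * a * K.L ^ 2 / s.μ * ‖S.x m - avg S.x‖ ^ 2 +
        5 * kappa K s ^ 2 * s.η ^ 2 * a / (s.γ * s.μ) * ‖avg S.nu‖ ^ 2 := fun m => by
    have hR := hA.meanRegular hK m
    have h1 := hR.lower_step hL hμ hs.μ_le hγ hs.γ_le ha0.le ha1 (avg S.x) (S.y m) (S.om m)
    have hys : argminPt (P.g m (avg S.x)) = P.yStar m (avg S.x) := rfl
    rw [hys] at h1
    -- The momentum estimates `∇_y g` at the client's own `x`, whereas the minimizer belongs to the
    -- mean iterate; the mismatch costs `L²` times the drift.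
    have h2 : ‖S.om m - gradY (P.g m) (avg S.x) (S.y m)‖ ^ 2 ≤
        2 * ‖S.om m - gradY (P.g m) (S.x m) (S.y m)‖ ^ 2 + 2 * (K.L ^ 2 * ‖S.x m - avg S.x‖ ^ 2) := by
      have h3 := norm_add_sq_le_two (S.om m - gradY (P.g m) (S.x m) (S.y m))
        (gradY (P.g m) (S.x m) (S.y m) - gradY (P.g m) (avg S.x) (S.y m))
      rw [sub_add_sub_cancel] at h3
      have h4 := pow_le_pow_left₀ (norm_nonneg _)
        (hR.g_lip.gradY (S.x m) (S.y m) (avg S.x) (S.y m)) 2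
      rw [mul_pow, norm_pair_sub_sq, sub_self, norm_zero] at h4
      norm_num at h4
      linarith
    have h3 := norm_add_sq_le_young hρ0 (nextY K s n S m - P.yStar m (avg S.x))
      (P.yStar m (avg S.x) - P.yStar m (avg (nextX K s n S)))
    rw [sub_add_sub_cancel] at h3
    have h4 : ‖P.yStar m (avg S.x) - P.yStar m (avg (nextX K s n S))‖ ^ 2 ≤
        kappa K s ^ 2 * (s.η ^ 2 * a ^ 2 * ‖avg S.nu‖ ^ 2) := by
      have h5 := pow_le_pow_left₀ (norm_nonneg _)
        (hR.argminPt_lipschitz hL hμ (avg S.x) (avg (nextX K s n S))) 2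
      rw [avg_nextX hM, sub_sub_cancel, norm_smul, mul_pow, mul_pow, Real.norm_eq_abs, sq_abs,
        mul_pow] at h5
      rw [avg_nextX hM]
      exact h5
    set B := ‖S.y m - P.yStar m (avg S.x)‖ ^ 2
    set W := ‖S.om m‖ ^ 2
    set Om := ‖S.om m - gradY (P.g m) (S.x m) (S.y m)‖ ^ 2
    set D := ‖S.x m - avg S.x‖ ^ 2
    set V := ‖avg S.nu‖ ^ 2
    have hB : 0 ≤ B := sq_nonneg _
    have hW : 0 ≤ W := sq_nonneg _
    have hO : 0 ≤ Om := sq_nonneg _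
    have hD : 0 ≤ D := sq_nonneg _
    have hV : 0 ≤ V := sq_nonneg _
    have h5 : ‖nextY K s n S m - P.yStar m (avg S.x)‖ ^ 2 ≤ (1 - 2 * ρ) * B -
        15 / 16 * s.γ ^ 2 * a * W + 3 * s.γ * a / s.μ * (2 * Om + 2 * (K.L ^ 2 * D)) := by
      refine (h1.trans (add_le_add le_rfl (mul_le_mul_of_nonneg_left h2 (by positivity)))).trans_eq ?_
      rw [hρ]; ring
    have h6 := mul_le_mul_of_nonneg_left h5 (by linarith : 0 ≤ 1 + ρ)
    have h7 := mul_le_mul_of_nonneg_left h4 (by positivity : 0 ≤ 1 + 1 / ρ)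
    have h8 : (1 + 1 / ρ) * (kappa K s ^ 2 * (s.η ^ 2 * a ^ 2 * V)) ≤
        5 * kappa K s ^ 2 * s.η ^ 2 * a / (s.γ * s.μ) * V := by
      have := mul_le_mul_of_nonneg_right hρ2 (by positivity : 0 ≤ kappa K s ^ 2 * s.η ^ 2 * V)
      refine (le_of_eq ?_).trans (this.trans_eq ?_) <;> ring
    have h9 : (1 + ρ) * ((1 - 2 * ρ) * B) ≤ (1 - ρ) * B := by
      have : 0 ≤ ρ ^ 2 * B := by positivity
      nlinarith
    -- `31/5` is a round upper bound for `3 · 2 · (1 + ρ)` with `ρ ≤ 1/128`.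
    have h10 : (1 + ρ) * (3 * s.γ * a / s.μ * (2 * Om + 2 * (K.L ^ 2 * D))) ≤
        31 / 5 * s.γ * a / s.μ * Om + 31 / 5 * s.γ * a * K.L ^ 2 / s.μ * D := by
      have h11 : 0 ≤ s.γ * a / s.μ * (Om + K.L ^ 2 * D) := by positivity
      have h12 : (1 + ρ) * 6 ≤ 31 / 5 := by linarith
      refine (le_of_eq ?_).trans ((mul_le_mul_of_nonneg_right h12 h11).trans_eq ?_) <;> ring
    have h11 : 0 ≤ ρ * (15 / 16 * s.γ ^ 2 * a * W) := by positivity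
    have h12 := h3.trans (add_le_add h6 (h7.trans h8))
    have h13 : (1 + ρ) * ((1 - 2 * ρ) * B - 15 / 16 * s.γ ^ 2 * a * W +
        3 * s.γ * a / s.μ * (2 * Om + 2 * (K.L ^ 2 * D))) = (1 + ρ) * ((1 - 2 * ρ) * B) -
        15 / 16 * s.γ ^ 2 * a * W - ρ * (15 / 16 * s.γ ^ 2 * a * W) +
        (1 + ρ) * (3 * s.γ * a / s.μ * (2 * Om + 2 * (K.L ^ 2 * D))) := by ring
    rw [h13] at h12
    linarith only [h12, h9, h10, h11]
  have h := mul_le_mul_of_nonneg_left (Finset.sum_le_sum fun m (_ : m ∈ Finset.univ) => key m)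
    (by positivity : (0 : ℝ) ≤ 1 / s.M)
  have hM' : (s.M : ℝ) ≠ 0 := by positivity
  simp only [Finset.sum_add_distrib, Finset.sum_sub_distrib, ← Finset.mul_sum, Finset.sum_const,
    Finset.card_univ, Fintype.card_fin, nsmul_eq_mul] at h
  unfold msq errY errOm devX msq
  refine h.trans_eq ?_
  field_simp

end OneStep

/-! ### Descent of `h` along the averaged momentum -/

section Descent

variable {p d : ℕ} {s : Config} {Ξf Ξg : Type*} [MeasurableSpace Ξf] [MeasurableSpace Ξg]
  {P : Problem p d s.M Ξf Ξg} {K : Constants} {c₀ : ℝ}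

theorem norm_sq_add_three {V : Type*} [NormedAddCommGroup V] (a b c : V) :
    ‖a + b + c‖ ^ 2 ≤ 3 * ‖a‖ ^ 2 + 3 * ‖b‖ ^ 2 + 3 * ‖c‖ ^ 2 := by
  have h1 := norm_add₃_le (a := a) (b := b) (c := c)
  have h2 := pow_le_pow_left₀ (norm_nonneg _) h1 2
  nlinarith [sq_nonneg (‖a‖ - ‖b‖), sq_nonneg (‖b‖ - ‖c‖), sq_nonneg (‖a‖ - ‖c‖)]

/-- Three sources of error, one for each summand: the momentum error, the evaluation at `(x⁽ᵐ⁾,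
y⁽ᵐ⁾)` instead of the mean iterate and its minimizers, and the truncation of the Neumann series. -/
theorem Assumptions.norm_avg_nu_sub_hGrad_sq_le (hK : K.Valid) (hs : s.Admissible K c₀)
    (hA : Assumptions K s.μ P) (S : State p d s.M) :
    ‖avg S.nu - hGrad P (avg S.x)‖ ^ 2 ≤ 3 * errNu P S +
      3 * (Lhat K s ^ 2 * (devX S + errY P S)) + 3 * G1 K s ^ 2 := by
  have e : avg S.nu - hGrad P (avg S.x) =
      (avg S.nu - avg fun m => meanEst s.τ s.Q (P.f m) (P.g m) (S.x m) (S.y m)) +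
      (avg fun m => meanEst s.τ s.Q (P.f m) (P.g m) (S.x m) (S.y m) -
        meanEst s.τ s.Q (P.f m) (P.g m) (avg S.x) (P.yStar m (avg S.x))) +
      avg fun m => meanEst s.τ s.Q (P.f m) (P.g m) (avg S.x) (P.yStar m (avg S.x)) -
        hypGrad (P.f m) (P.g m) (avg S.x) (P.yStar m (avg S.x)) := by
    rw [hGrad, avg_sub', avg_sub']
    abel
  rw [e]
  refine (norm_sq_add_three _ _ _).trans ?_
  have hlip : ∀ m, PairLipschitz (Lhat K s) (meanEst s.τ s.Q (P.f m) (P.g m)) :=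
    fun m x y x' y' => ((hA.meanRegular hK m).meanEst_lipschitz hK hs.μ_pos hs.μ_le hs.τ_pos
      hs.τ_lt x y x' y').trans (mul_le_mul_of_nonneg_right (le_max_right _ _) (norm_nonneg _))
  have h1 := (norm_avg_sq_le_msq fun m => meanEst s.τ s.Q (P.f m) (P.g m) (S.x m) (S.y m) -
    meanEst s.τ s.Q (P.f m) (P.g m) (avg S.x) (P.yStar m (avg S.x))).trans
    (msq_sub_le_of_pairLipschitz hlip (fun _ => avg S.x) S.x (fun m => P.yStar m (avg S.x)) S.y)
  have hτμ := hs.τμ_lt hK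
  have hG1 : 0 ≤ G1 K s := by
    have hL := hK.L_pos
    have hC := hK.Cf_nonneg
    have hμ := hs.μ_pos
    have : 0 ≤ 1 - s.τ * s.μ := by linarith
    unfold G1 kappa
    positivity
  have h2 := pow_le_pow_left₀ (norm_nonneg _) (norm_avg_le hG1 fun m =>
    (hA.meanRegular hK m).norm_meanEst_sub_hypGrad_le (Q := s.Q) hK.L_pos hs.μ_pos hs.μ_le hs.τ_pos
      hs.τ_lt (avg S.x) (P.yStar m (avg S.x))) 2
  unfold errNu devX errY
  linarith

/-- The descent lemma, with `-⟪∇h, ν⟫` written as half of `‖ν - ∇h‖² - ‖∇h‖² - ‖ν‖²`. The negative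
`‖ν‖²` is kept, since it has to pay for displacements. -/
theorem Assumptions.h_next_le (hK : K.Valid) (hs : s.Admissible K c₀)
    (hA : Assumptions K s.μ P) (n : ℕ) (hη : 0 ≤ s.η) (hηL : s.η * Lbar K s ≤ 1 / 2)
    (ha0 : 0 ≤ alpha K s (n + 1)) (ha1 : alpha K s (n + 1) ≤ 1 / 16) (S : State p d s.M) :
    P.h (avg (nextX K s n S)) ≤ P.h (avg S.x) -
      s.η * alpha K s (n + 1) / 2 * ‖hGrad P (avg S.x)‖ ^ 2 -
      31 / 64 * (s.η * alpha K s (n + 1)) * ‖avg S.nu‖ ^ 2 +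
      s.η * alpha K s (n + 1) * (3 / 2 * errNu P S +
        3 / 2 * (Lhat K s ^ 2 * (devX S + errY P S)) + 3 / 2 * G1 K s ^ 2) := by
  have h1 := le_taylor_of_lipschitz_gradient (fun x => hA.hasGradientAt_h hK hs.μ_pos x)
    (hA.hGrad_lipschitz hK hs.μ_pos hs.μ_le) (avg S.x) (avg (nextX K s n S))
  have h2 := hA.norm_avg_nu_sub_hGrad_sq_le hK hs S
  rw [avg_nextX hs.M_pos, sub_sub_cancel_left, inner_neg_right, inner_smul_right, norm_neg,
    norm_smul, mul_pow, Real.norm_eq_abs, sq_abs] at h1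
  rw [avg_nextX hs.M_pos]
  rw [norm_sub_sq_real, real_inner_comm] at h2
  set a := alpha K s (n + 1)
  have ha : 0 ≤ s.η * a := mul_nonneg hη ha0
  have h3 := mul_le_mul_of_nonneg_left h2 (by positivity : 0 ≤ s.η * a / 2)
  -- The quadratic term of the descent lemma takes at most `1/64` of the available `1/2`; this
  -- leaves `31/64`.
  have h4 : Lbar K s / 2 * ((s.η * a) ^ 2 * ‖avg S.nu‖ ^ 2) ≤
      s.η * a / 64 * ‖avg S.nu‖ ^ 2 := by
    have h5 : s.η * Lbar K s * a ≤ 1 / 2 * (1 / 16) := mul_le_mul hηL ha1 ha0 (by norm_num)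
    have h6 := mul_le_mul_of_nonneg_right h5
      (by positivity : 0 ≤ s.η * a / 2 * ‖avg S.nu‖ ^ 2)
    refine (le_of_eq ?_).trans (h6.trans_eq ?_) <;> ring
  nlinarith

end Descent

/-! ### Integrability of the quantities in the recursions -/

section Expectation

variable {p d : ℕ} {s : Config} {Ξf Ξg Ω : Type*} [MeasurableSpace Ξf] [MeasurableSpace Ξg]
  [MeasurableSpace Ω] {P : Problem p d s.M Ξf Ξg} {Pr : Measure Ω} [IsProbabilityMeasure Pr]
  {ξf : ℕ × Fin s.M × ℕ → Ω → Ξf} {ξg : GIndex s.M → Ω → Ξg} {K : Constants} {c₀ : ℝ}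

theorem IsPast.lipschitz {T n k : ℕ} {X : Ω → E n} (hS : IsSampling P Pr ξf ξg)
    (hX : IsPast Pr ξf ξg T X) {u : E n → E k}
    {C : ℝ} (hu : ∀ x x', ‖u x - u x'‖ ≤ C * ‖x - x'‖) : IsPast Pr ξf ξg T fun ω => u (X ω) := by
  have hc : Continuous u := by
    refine (LipschitzWith.of_dist_le_mul (K := C.toNNReal) fun x x' => ?_).continuous
    rw [dist_eq_norm, dist_eq_norm]
    exact (hu x x').trans (mul_le_mul_of_nonneg_right (Real.le_coe_toNNReal C) (norm_nonneg _))
  have hm := hc.measurable.comp hX.1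
  have hg : MemLp (fun ω => ‖u 0‖ + |C| * ‖X ω‖) 2 Pr :=
    (memLp_const ‖u 0‖).add (hX.2.norm.const_mul |C|)
  refine ⟨hm, hg.of_le (hm.mono (hS.sigmaOf_le _) le_rfl).aestronglyMeasurable
    (Filter.Eventually.of_forall fun ω => ?_)⟩
  have h1 := hu (X ω) 0
  rw [sub_zero] at h1
  have h2 := norm_le_norm_add_norm_sub' (u (X ω)) (u 0)
  have h3 : C * ‖X ω‖ ≤ |C| * ‖X ω‖ := mul_le_mul_of_nonneg_right (le_abs_self C) (norm_nonneg _)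
  refine le_trans ?_ (le_abs_self _)
  linarith

variable {x₁ : E p} {y₁ : E d}

theorem Assumptions.integrable_hGrad_sq (hK : K.Valid) (hs : s.Admissible K c₀)
    (hA : Assumptions K s.μ P) (hS : IsSampling P Pr ξf ξg) (n : ℕ) :
    Integrable (fun ω => ‖hGrad P (avg (traj K s P ξf ξg x₁ y₁ n ω).x)‖ ^ 2) Pr :=
  ((IsPast.avg (hA.statePast_traj hK hs hS x₁ y₁ n).x).lipschitz hS
    (hA.hGrad_lipschitz hK hs.μ_pos hs.μ_le)).integrable_sq

/-- `h` is bounded below by the gap hypothesis and grows at most quadratically, while the iterates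
are square integrable. -/
theorem Assumptions.integrable_h (hK : K.Valid) (hs : s.Admissible K c₀)
    (hA : Assumptions K s.μ P) (hS : IsSampling P Pr ξf ξg)
    (hlow : ∀ x, P.h x₁ - P.h x ≤ K.Δ) (n : ℕ) :
    Integrable (fun ω => P.h (avg (traj K s P ξf ξg x₁ y₁ n ω).x)) Pr := by
  have hx := IsPast.avg (hA.statePast_traj hK hs hS x₁ y₁ n).x
  have hd : Continuous P.h := continuous_iff_continuousAt.2 fun x =>
    (hA.hasGradientAt_h hK hs.μ_pos x).continuousAt
  have hm := (hd.measurable.comp hx.1).mono (hS.sigmaOf_le _) le_rfl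
  have hX2 := hx.integrable_sq
  have hX1 : Integrable (fun ω => ‖avg (traj K s P ξf ξg x₁ y₁ n ω).x‖) Pr :=
    (hx.2.integrable (by norm_num)).norm
  have hg : Integrable (fun ω => (|P.h x₁ - K.Δ| + |P.h 0|) +
      (‖hGrad P 0‖ * ‖avg (traj K s P ξf ξg x₁ y₁ n ω).x‖ +
        |Lbar K s| / 2 * ‖avg (traj K s P ξf ξg x₁ y₁ n ω).x‖ ^ 2)) Pr :=
    (integrable_const _).add ((hX1.const_mul _).add (hX2.const_mul _))
  refine hg.mono' hm.aestronglyMeasurable (Filter.Eventually.of_forall fun ω => ?_)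
  set x := avg (traj K s P ξf ξg x₁ y₁ n ω).x
  have h1 := le_taylor_of_lipschitz_gradient (fun x => hA.hasGradientAt_h hK hs.μ_pos x)
    (hA.hGrad_lipschitz hK hs.μ_pos hs.μ_le) 0 x
  rw [sub_zero] at h1
  have h2 := real_inner_le_norm (hGrad P 0) x
  have h3 : Lbar K s / 2 * ‖x‖ ^ 2 ≤ |Lbar K s| / 2 * ‖x‖ ^ 2 := by
    gcongr; exact le_abs_self _
  have h4 := hlow x
  have h5 := neg_abs_le (P.h x₁ - K.Δ)
  have h6 := le_abs_self (P.h 0)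
  have h7 := abs_nonneg (P.h x₁ - K.Δ)
  have h8 := abs_nonneg (P.h 0)
  have h9 : 0 ≤ ‖hGrad P 0‖ * ‖x‖ := by positivity
  have h10 : 0 ≤ |Lbar K s| / 2 * ‖x‖ ^ 2 := by positivity
  rw [Real.norm_eq_abs, abs_le]
  constructor <;> linarith

theorem Assumptions.isPast_yStar (hK : K.Valid) (hs : s.Admissible K c₀)
    (hA : Assumptions K s.μ P) (hS : IsSampling P Pr ξf ξg) {T : ℕ} {X : Ω → E p}
    (hX : IsPast Pr ξf ξg T X) (m : Fin s.M) : IsPast Pr ξf ξg T fun ω => P.yStar m (X ω) :=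
  hX.lipschitz hS ((hA.meanRegular hK m).argminPt_lipschitz hK.L_pos hs.μ_pos)

/-- All quantities in the one-step inequalities are integrable. -/
theorem Assumptions.integrable_quantities (hK : K.Valid) (hs : s.Admissible K c₀)
    (hA : Assumptions K s.μ P) (hS : IsSampling P Pr ξf ξg) (x₁ : E p) (y₁ : E d) (n : ℕ) :
    Integrable (fun ω => errNu P (traj K s P ξf ξg x₁ y₁ n ω)) Pr ∧
    Integrable (fun ω => errOm P (traj K s P ξf ξg x₁ y₁ n ω)) Pr ∧
    Integrable (fun ω => errY P (traj K s P ξf ξg x₁ y₁ n ω)) Pr ∧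
    Integrable (fun ω => devX (traj K s P ξf ξg x₁ y₁ n ω)) Pr ∧
    Integrable (fun ω => devNu (traj K s P ξf ξg x₁ y₁ n ω)) Pr ∧
    Integrable (fun ω => msq (traj K s P ξf ξg x₁ y₁ n ω).om) Pr ∧
    Integrable (fun ω => ‖avg (traj K s P ξf ξg x₁ y₁ n ω).nu‖ ^ 2) Pr ∧
    Integrable (fun ω => moveSq K s n (traj K s P ξf ξg x₁ y₁ n ω)) Pr := by
  have h := hA.statePast_traj hK hs hS x₁ y₁ n
  have hX := h.nextX (K := K) n
  have hY := h.nextY (K := K) n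
  refine ⟨?_, ?_, ?_, ?_, ?_, ?_, ?_, ?_⟩
  · exact ((IsPast.avg h.nu).sub (IsPast.avg fun m => hA.isPast_meanEst hK hs hS m (h.x m)
      (h.y m))).integrable_sq
  · exact (integral_msq fun m => (h.om m).sub (hA.isPast_gradY hS m (h.x m) (h.y m))).1
  · exact (integral_msq fun m => (h.y m).sub (hA.isPast_yStar hK hs hS (IsPast.avg h.x) m)).1
  · exact (integral_msq fun m => (h.x m).sub (IsPast.avg h.x)).1
  · exact (integral_msq fun m => (h.nu m).sub (IsPast.avg h.nu)).1
  · exact (integral_msq h.om).1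
  · exact (IsPast.avg h.nu).integrable_sq
  · exact (integral_msq fun m => (hX m).sub (h.x m)).1.add
      (integral_msq fun m => (hY m).sub (h.y m)).1

end Expectation

/-! ### The learning rates and the step sizes -/

section StepSizes

variable {K : Constants} {s : Config} {c : ℝ}

theorem one_le_bM (hs : s.Admissible K c) : 1 ≤ bM s := by
  have h1 : (1 : ℝ) ≤ s.b := by exact_mod_cast hs.b_pos
  have h2 : (1 : ℝ) ≤ s.M := by exact_mod_cast hs.M_pos
  unfold bM
  nlinarith

theorem one_le_I (hs : s.Admissible K c) : (1 : ℝ) ≤ s.I := by exact_mod_cast hs.I_pos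

theorem one_le_kappa (hs : s.Admissible K c) : 1 ≤ kappa K s :=
  (one_le_div hs.μ_pos).2 hs.μ_le

theorem two_le_uBar (K : Constants) (s : Config) : 2 ≤ uBar K s :=
  (le_max_left _ _).trans (le_max_left _ _)

theorem Lhat_pos (K : Constants) (s : Config) : 0 < Lhat K s := one_pos.trans_le (one_le_Lhat K s)

theorem cNu_pos (hs : s.Admissible K c) : 0 < cNu K s := by
  have := one_le_bM hs
  have := Lhat_pos K s
  have := one_le_I hs
  unfold cNu
  positivity

theorem cOmega_pos (hs : s.Admissible K c) : 0 < cOmega K s := by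
  have := one_le_bM hs
  have := Lhat_pos K s
  have := one_le_I hs
  have := hs.μ_pos
  unfold cOmega
  positivity

theorem rpow_third_cube {x : ℝ} (hx : 0 ≤ x) : (x ^ (1 / 3 : ℝ)) ^ 3 = x := by
  rw [← Real.rpow_natCast, ← Real.rpow_mul hx]; norm_num

theorem rpow_two_third_cube {x : ℝ} (hx : 0 ≤ x) : (x ^ (2 / 3 : ℝ)) ^ 3 = x ^ 2 := by
  rw [← Real.rpow_natCast, ← Real.rpow_mul hx]; norm_num

theorem rpow_three_half_sq {x : ℝ} (hx : 0 ≤ x) : (x ^ (3 / 2 : ℝ)) ^ 2 = x ^ 3 := by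
  rw [← Real.rpow_natCast, ← Real.rpow_natCast, ← Real.rpow_mul hx]; norm_num

theorem rpow_nine_half_eq {x : ℝ} (hx : 0 ≤ x) : x ^ (9 / 2 : ℝ) = (x ^ (3 / 2 : ℝ)) ^ 3 := by
  rw [← Real.rpow_natCast, ← Real.rpow_mul hx]; norm_num

theorem alpha_pos (hK : K.Valid) (hs : s.Admissible K c) (t : ℕ) : 0 < alpha K s t := by
  have := one_le_bM hs
  have := Lhat_pos K s
  have := hK.σ_pos
  have := two_le_uBar K s
  have : 0 < bM s * K.σ := by positivity
  unfold alpha delta uConst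
  positivity

/-- The noise level `σ` cancels: `1 / α_t³` is affine in `t` with slope `L̂² / (bM)²`. The estimates
on the schedule are obtained by comparing cubes. -/
theorem alpha_cube (hK : K.Valid) (hs : s.Admissible K c) (t : ℕ) :
    alpha K s t ^ 3 * (Lhat K s ^ 2 * (uBar K s + t / bM s ^ 2)) = 1 := by
  have hb := one_le_bM hs
  have hΛ := Lhat_pos K s
  have hσ := hK.σ_pos
  have hu := two_le_uBar K s
  have hbσ : 0 < bM s * K.σ := by positivity
  have hU : 0 < uConst K s + K.σ ^ 2 * t := by unfold uConst; positivity
  rw [alpha, delta, div_pow, div_pow, rpow_third_cube hU.le, rpow_two_third_cube hbσ.le,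
    rpow_two_third_cube hΛ.le, uConst]
  have : bM s ^ 2 * uBar K s + t ≠ 0 := by positivity
  have h2 : (bM s * K.σ) ^ 2 * uBar K s + K.σ ^ 2 * t ≠ 0 := by positivity
  field_simp

/-- This is what the entry `16³ I^{9/2} L̂` of `ū` is for: it keeps the drift over a round under
control. -/
theorem alpha_mul_le (hK : K.Valid) (hs : s.Admissible K c) (t : ℕ) :
    16 * (s.I : ℝ) ^ (3 / 2 : ℝ) * Lhat K s * alpha K s t ≤ 1 := by
  have hb := one_le_bM hs
  have hΛ := Lhat_pos K s
  have ha := alpha_pos hK hs t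
  have hI : (0 : ℝ) ≤ s.I := by positivity
  have h1 := alpha_cube hK hs t
  have h2 : 16 ^ 3 * ((s.I : ℝ) ^ (3 / 2 : ℝ)) ^ 3 * Lhat K s ≤ uBar K s := by
    rw [← rpow_nine_half_eq hI]
    exact (le_max_right _ _).trans (le_max_left _ _)
  have h3 : (16 * (s.I : ℝ) ^ (3 / 2 : ℝ) * Lhat K s * alpha K s t) ^ 3 ≤ 1 ^ 3 := by
    rw [one_pow, ← h1]
    have h4 : 16 ^ 3 * ((s.I : ℝ) ^ (3 / 2 : ℝ)) ^ 3 * Lhat K s ≤ uBar K s + t / bM s ^ 2 :=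
      h2.trans (le_add_of_nonneg_right (by positivity))
    have h5 := mul_le_mul_of_nonneg_left h4 (by positivity : 0 ≤ alpha K s t ^ 3 * Lhat K s ^ 2)
    refine (le_of_eq ?_).trans (h5.trans_eq ?_) <;> ring
  exact le_of_pow_le_pow_left₀ three_ne_zero zero_le_one h3

/-- The entries `c_ν^{3/2}` and `c_ω^{3/2}` of `ū` make `1 - c α²` a genuine contraction factor: `(r
α²)³ ≤ (ū α³)² ≤ 1`. -/
theorem c_mul_alpha_sq_le (hK : K.Valid) (hs : s.Admissible K c) (t : ℕ) {r : ℝ} (hr : 0 ≤ r)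
    (h : r ^ (3 / 2 : ℝ) ≤ uBar K s) : r * alpha K s t ^ 2 ≤ 1 := by
  have hb := one_le_bM hs
  have hΛ := one_le_Lhat K s
  have ha := alpha_pos hK hs t
  have hu := two_le_uBar K s
  have h1 := alpha_cube hK hs t
  have h2 : alpha K s t ^ 3 * uBar K s ≤ 1 := by
    rw [← h1]
    gcongr
    have h3 : 0 ≤ (t : ℝ) / bM s ^ 2 := by positivity
    have : 1 ≤ Lhat K s ^ 2 := one_le_pow₀ hΛ
    nlinarith
  have h3 : (r * alpha K s t ^ 2) ^ 3 ≤ 1 ^ 3 := by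
    have h4 : r ^ 3 ≤ uBar K s ^ 2 := by
      rw [← rpow_three_half_sq hr]
      exact pow_le_pow_left₀ (by positivity) h 2
    calc (r * alpha K s t ^ 2) ^ 3 = r ^ 3 * alpha K s t ^ 6 := by ring
      _ ≤ uBar K s ^ 2 * alpha K s t ^ 6 := by gcongr
      _ = (alpha K s t ^ 3 * uBar K s) ^ 2 := by ring
      _ ≤ 1 ^ 2 := pow_le_pow_left₀ (by positivity) h2 2
      _ = 1 ^ 3 := by norm_num
  exact le_of_pow_le_pow_left₀ three_ne_zero zero_le_one h3

theorem cNu_mul_alpha_sq_le (hK : K.Valid) (hs : s.Admissible K c) (t : ℕ) :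
    cNu K s * alpha K s t ^ 2 ≤ 1 :=
  c_mul_alpha_sq_le hK hs t (cNu_pos hs).le ((le_max_left _ _).trans (le_max_right _ _))

theorem cOmega_mul_alpha_sq_le (hK : K.Valid) (hs : s.Admissible K c) (t : ℕ) :
    cOmega K s * alpha K s t ^ 2 ≤ 1 :=
  c_mul_alpha_sq_le hK hs t (cOmega_pos hs).le ((le_max_right _ _).trans (le_max_right _ _))

theorem inv_alpha_cube (hK : K.Valid) (hs : s.Admissible K c) (t : ℕ) :
    (1 / alpha K s t) ^ 3 = Lhat K s ^ 2 * (uBar K s + t / bM s ^ 2) := by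
  have ha := alpha_pos hK hs t
  rw [div_pow, one_pow, div_eq_iff (by positivity), mul_comm, alpha_cube hK hs t]

theorem alpha_succ_le (hK : K.Valid) (hs : s.Admissible K c) (t : ℕ) :
    alpha K s (t + 1) ≤ alpha K s t := by
  have hb := one_le_bM hs
  have hΛ := Lhat_pos K s
  have ha := alpha_pos hK hs t
  have ha' := alpha_pos hK hs (t + 1)
  rw [← one_div_le_one_div ha ha']
  refine le_of_pow_le_pow_left₀ three_ne_zero (by positivity) ?_
  rw [inv_alpha_cube hK hs, inv_alpha_cube hK hs]
  push_cast
  gcongr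
  linarith

theorem alpha_antitone (hK : K.Valid) (hs : s.Admissible K c) : Antitone (alpha K s) :=
  antitone_nat_of_succ_le (alpha_succ_le hK hs)

/-- `1 / α_t` is the cube root of an affine function; by concavity its increment is at most the
derivative at `t`. Here the cube of the right-hand side is expanded and its higher terms are
dropped. -/
theorem inv_alpha_succ_le (hK : K.Valid) (hs : s.Admissible K c) (t : ℕ) :
    1 / alpha K s (t + 1) ≤ 1 / alpha K s t + alpha K s t ^ 2 * Lhat K s ^ 2 / (3 * bM s ^ 2) := by
  have hb := one_le_bM hs
  have hΛ := Lhat_pos K s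
  have ha := alpha_pos hK hs t
  refine le_of_pow_le_pow_left₀ three_ne_zero (by positivity) ?_
  rw [inv_alpha_cube hK hs]
  have h1 := inv_alpha_cube hK hs t
  set e := alpha K s t ^ 2 * Lhat K s ^ 2 / (3 * bM s ^ 2) with he
  have he0 : 0 ≤ e := by positivity
  have h2 : 3 * (1 / alpha K s t) ^ 2 * e = Lhat K s ^ 2 / bM s ^ 2 := by
    rw [he]; field_simp
  have h3 : (1 / alpha K s t + e) ^ 3 = (1 / alpha K s t) ^ 3 + 3 * (1 / alpha K s t) ^ 2 * e +
    (3 * (1 / alpha K s t) * e ^ 2 + e ^ 3) := by ring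
  have h4 : 0 ≤ 3 * (1 / alpha K s t) * e ^ 2 + e ^ 3 := by positivity
  rw [h3, h2, h1]
  push_cast
  have h5 : Lhat K s ^ 2 * (uBar K s + (t + 1) / bM s ^ 2) =
    Lhat K s ^ 2 * (uBar K s + t / bM s ^ 2) + Lhat K s ^ 2 / bM s ^ 2 := by ring
  linarith

theorem alpha_cube_le (hK : K.Valid) (hs : s.Admissible K c) (t : ℕ) :
    alpha K s t ^ 3 ≤ bM s ^ 2 / Lhat K s ^ 2 * (1 / (t + 1)) := by
  have hb := one_le_bM hs
  have hΛ := Lhat_pos K s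
  have hu := two_le_uBar K s
  have ha := alpha_pos hK hs t
  have h1 := alpha_cube hK hs t
  rw [← eq_div_iff (by positivity)] at h1
  rw [h1, div_mul_div_comm, mul_one, div_le_div_iff₀ (by positivity) (by positivity)]
  have h2 : bM s ^ 2 * (Lhat K s ^ 2 * (uBar K s + t / bM s ^ 2)) =
      Lhat K s ^ 2 * (bM s ^ 2 * uBar K s + t) := by field_simp
  rw [h2, one_mul]
  refine mul_le_mul_of_nonneg_left ?_ (sq_nonneg _)
  have : 1 ≤ bM s ^ 2 := one_le_pow₀ hb
  nlinarith

theorem sum_inv_le_log (T : ℕ) :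
    ∑ n ∈ Finset.range T, 1 / (((n + 1 : ℕ) : ℝ) + 1) ≤ Real.log ((T : ℝ) + 1) := by
  induction T with
  | zero => simp
  | succ T ih =>
    rw [Finset.sum_range_succ]
    have h1 : (0 : ℝ) < (T : ℝ) + 1 := by positivity
    have h2 : (0 : ℝ) < ((T + 1 : ℕ) : ℝ) + 1 := by positivity
    have h3 := Real.log_le_sub_one_of_pos (div_pos h1 h2)
    rw [Real.log_div h1.ne' h2.ne'] at h3
    have h4 : ((T : ℝ) + 1) / (((T + 1 : ℕ) : ℝ) + 1) - 1 = -(1 / (((T + 1 : ℕ) : ℝ) + 1)) := by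
      push_cast; field_simp; ring
    linarith

theorem sum_alpha_cube_le (hK : K.Valid) (hs : s.Admissible K c) (T : ℕ) :
    ∑ n ∈ Finset.range T, alpha K s (n + 1) ^ 3 ≤
      bM s ^ 2 / Lhat K s ^ 2 * Real.log ((T : ℝ) + 1) := by
  have hb := one_le_bM hs
  refine (Finset.sum_le_sum fun n _ => alpha_cube_le hK hs (n + 1)).trans ?_
  rw [← Finset.mul_sum]
  exact mul_le_mul_of_nonneg_left (sum_inv_le_log T) (by positivity)

/-- The inductive step for `sum_alpha_le`: the shift `1/3` is exact there, because `3/2 · 1/3 + 1 =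
3/2`. The resulting bound on `∑ α` is what keeps the bias from being amplified. -/
theorem mul_alpha_le_succ (hK : K.Valid) (hs : s.Admissible K c) (t : ℕ) :
    (t : ℝ) * alpha K s t ≤ (t + 1 / 3) * alpha K s (t + 1) := by
  have hb := one_le_bM hs
  have hΛ := Lhat_pos K s
  have hu := two_le_uBar K s
  have ha := alpha_pos hK hs t
  have ha' := alpha_pos hK hs (t + 1)
  refine le_of_pow_le_pow_left₀ three_ne_zero (by positivity) ?_
  have h1 := alpha_cube hK hs t
  have h2 := alpha_cube hK hs (t + 1)
  rw [← eq_div_iff (by positivity)] at h1 h2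
  rw [mul_pow, mul_pow, h1, h2, mul_one_div, mul_one_div, div_le_div_iff₀ (by positivity)
    (by positivity)]
  have h3 : (t : ℝ) ^ 3 * (uBar K s + (t + 1 : ℕ) / bM s ^ 2) ≤
      (t + 1 / 3) ^ 3 * (uBar K s + t / bM s ^ 2) := by
    push_cast
    have h4 : (t : ℝ) ^ 3 ≤ (t + 1 / 3) ^ 3 := by gcongr; linarith
    have h5 : (t : ℝ) ^ 3 * (t + 1) ≤ (t + 1 / 3) ^ 3 * t := by
      have : (0 : ℝ) ≤ t := by positivity
      nlinarith [sq_nonneg (t : ℝ)]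
    have h6 := mul_le_mul_of_nonneg_right h4 (by linarith : 0 ≤ uBar K s)
    have h7 := div_le_div_of_nonneg_right h5 (by positivity : 0 ≤ bM s ^ 2)
    have e1 : (t : ℝ) ^ 3 * (uBar K s + (t + 1) / bM s ^ 2) =
      t ^ 3 * uBar K s + t ^ 3 * (t + 1) / bM s ^ 2 := by ring
    have e2 : ((t : ℝ) + 1 / 3) ^ 3 * (uBar K s + t / bM s ^ 2) =
      (t + 1 / 3) ^ 3 * uBar K s + (t + 1 / 3) ^ 3 * t / bM s ^ 2 := by ring
    linarith
  have := mul_le_mul_of_nonneg_left h3 (sq_nonneg (Lhat K s))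
  refine (le_of_eq ?_).trans (this.trans_eq ?_) <;> ring

theorem sum_alpha_le (hK : K.Valid) (hs : s.Admissible K c) (T : ℕ) :
    ∑ n ∈ Finset.range T, alpha K s (n + 1) ≤ 3 / 2 * (T * alpha K s T) := by
  induction T with
  | zero => simp
  | succ T ih =>
    rw [Finset.sum_range_succ]
    have h := mul_alpha_le_succ hK hs T
    push_cast
    linarith

theorem gamma_pos (hK : K.Valid) (hc : 0 < c) (hs : s.Admissible K c) : 0 < s.γ := by
  have := hK.L_pos
  exact lt_of_lt_of_le (by positivity) hs.γ_ge

theorem gamma_mul_L_le (hK : K.Valid) (hs : s.Admissible K c) : s.γ * K.L ≤ 1 / 2 := by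
  have := hs.γ_le
  have hL := hK.L_pos
  rw [le_div_iff₀ (by positivity)] at this
  linarith

theorem C1_pos (hs : s.Admissible K c) : 0 < C1 K s := by
  have := one_le_kappa hs
  have := Lhat_pos K s
  unfold C1
  positivity

theorem etaMax_pos (hK : K.Valid) (hc : 0 < c) (hs : s.Admissible K c) : 0 < etaMax K s := by
  have h1 := one_le_kappa hs
  have h2 := Lhat_pos K s
  have h3 := gamma_pos hK hc hs
  have h4 := cNu_pos hs
  have h5 := C1_pos hs
  have h6 := hs.μ_pos
  have h7 : 0 < Lbar K s := by unfold Lbar; positivity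
  unfold etaMax
  simp only [lt_min_iff]
  refine ⟨?_, ?_, ?_, ?_, ?_, ?_, ?_⟩ <;> positivity

theorem eta_pos (hK : K.Valid) (hc : 0 < c) (hs : s.Admissible K c) : 0 < s.η :=
  (mul_pos hc (etaMax_pos hK hc hs)).trans_le hs.η_ge

theorem eta_mul_Lhat_le (hs : s.Admissible K c) :
    s.η * Lhat K s * kappa K s ≤ s.μ * s.γ / 144 := by
  have h1 := one_le_kappa hs
  have h2 := Lhat_pos K s
  have h3 : s.η ≤ s.μ * s.γ / (144 * kappa K s * Lhat K s) := hs.η_lt.le.trans (min_le_left _ _)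
  rw [le_div_iff₀ (by positivity)] at h3
  linarith

theorem eta_mul_Lbar_le (hs : s.Admissible K c) : s.η * Lbar K s ≤ 1 / 2 := by
  have h1 := one_le_kappa hs
  have h2 := Lhat_pos K s
  have h7 : 0 < Lbar K s := by unfold Lbar; positivity
  have h3 : s.η ≤ 1 / (2 * Lbar K s) := by
    refine hs.η_lt.le.trans ?_
    unfold etaMax
    exact (min_le_right _ _).trans ((min_le_right _ _).trans ((min_le_right _ _).trans
      ((min_le_right _ _).trans ((min_le_right _ _).trans (min_le_left _ _)))))
  rw [le_div_iff₀ (by positivity)] at h3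
  linarith

theorem eta_le_one (hs : s.Admissible K c) : s.η ≤ 1 := by
  refine hs.η_lt.le.trans ?_
  unfold etaMax
  exact (min_le_right _ _).trans ((min_le_right _ _).trans ((min_le_right _ _).trans
      ((min_le_right _ _).trans ((min_le_right _ _).trans (min_le_right _ _)))))

end StepSizes

/-! ### The weights of the potential and the balance of one step -/

section Potential

/-- The relations between the parameters that the potential argument uses: `β = bM`, `Λ = L̂`,
`ι = I`; `a`, `a'` are consecutive learning rates. -/
structure StepParams (L μ κ Λ γ η β ι a a' cω cν : ℝ) : Prop where
  L_pos : 0 < L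
  μ_pos : 0 < μ
  κ_eq : κ = L / μ
  κ_ge : 1 ≤ κ
  Λ_ge : 1 ≤ Λ
  γ_pos : 0 < γ
  γL : γ * L ≤ 1 / 2
  η_pos : 0 < η
  ηΛκ : η * Λ * κ ≤ μ * γ / 144
  β_ge : 1 ≤ β
  ι_ge : 1 ≤ ι
  a_pos : 0 < a
  a'_pos : 0 < a'
  a'_le : a' ≤ a
  inv_le : 1 / a' ≤ 1 / a + a ^ 2 * Λ ^ 2 / (3 * β ^ 2)
  a_le : 256 * (ι ^ 3 * Λ ^ 2 * a ^ 2) ≤ 1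
  cω_ge : 144 * κ ^ 2 / β + Λ / (24 * ι * β ^ 2) ≤ cω
  cν_ge : 32 / (9 * β) + Λ / (24 * ι * β ^ 2) ≤ cν
  cω_le : cω * a ^ 2 ≤ 1
  cν_le : cν * a ^ 2 ≤ 1

variable {L μ κ Λ γ η β ι a a' cω cν : ℝ}

namespace StepParams

theorem aι (h : StepParams L μ κ Λ γ η β ι a a' cω cν) : 16 * (a * Λ * ι) ≤ 1 := by
  have := h.ι_ge
  have := h.Λ_ge
  have := h.a_pos
  have h1 : (16 * (a * Λ * ι)) ^ 2 ≤ 1 ^ 2 := by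
    have h2 : ι ^ 2 ≤ ι ^ 3 := pow_le_pow_right₀ h.ι_ge (by norm_num)
    have h3 := mul_le_mul_of_nonneg_right h2 (by positivity : 0 ≤ 256 * (Λ ^ 2 * a ^ 2))
    have := h.a_le
    nlinarith
  exact le_of_pow_le_pow_left₀ two_ne_zero zero_le_one h1

theorem aΛ (h : StepParams L μ κ Λ γ η β ι a a' cω cν) : 16 * (a * Λ) ≤ 1 := by
  have := h.ι_ge
  have := h.Λ_ge
  have := h.a_pos
  have h1 : a * Λ * 1 ≤ a * Λ * ι := by gcongr
  linarith [h.aι]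

/-- The weights `1 / a` grow by a relative amount at most `1 / (10000 ι)` per step, negligible
against the growth `1 / ι` of the drift. -/
theorem inv_le' (h : StepParams L μ κ Λ γ η β ι a a' cω cν) :
    1 / a' ≤ 1 / a * (1 + 1 / (10000 * ι)) := by
  have hι := h.ι_ge
  have hΛ := h.Λ_ge
  have ha := h.a_pos
  have hβ := h.β_ge
  refine h.inv_le.trans ?_
  rw [mul_add, mul_one]
  gcongr 1 / a + ?_
  rw [div_mul_div_comm, div_le_div_iff₀ (by positivity) (by positivity)]
  have h1 : 4096 * (a * Λ * ι) * (a * Λ) ^ 2 ≤ 1 := by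
    have e1 := h.aι
    have e2 := h.aΛ
    have e3 : (16 * (a * Λ)) ^ 2 ≤ 1 := pow_le_one₀ (by positivity) e2
    have := mul_le_mul e1 e3 (by positivity) zero_le_one
    nlinarith
  have h2 : a ^ 3 * Λ ^ 2 * ι ≤ a ^ 3 * Λ ^ 3 * ι := by
    have : Λ ^ 2 ≤ Λ ^ 3 := pow_le_pow_right₀ hΛ (by norm_num)
    gcongr
  have h3 : 1 ≤ β ^ 2 := one_le_pow₀ hβ
  nlinarith

theorem inv_le_two (h : StepParams L μ κ Λ γ η β ι a a' cω cν) :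
    1 / a' ≤ 1 / a * (10001 / 10000) := by
  have hι := h.ι_ge
  have ha := h.a_pos
  refine h.inv_le'.trans (mul_le_mul_of_nonneg_left ?_ (by positivity))
  have : 1 / (10000 * ι) ≤ 1 / 10000 := by
    apply one_div_le_one_div_of_le <;> linarith
  linarith

/-- The summand `Λ / (24 ι β²)` of the momentum parameters absorbs the increase of `1 / a`; the
remaining part `r` becomes a decay of order `r a` of the weighted error. -/
theorem momentum_coeff (h : StepParams L μ κ Λ γ η β ι a a' cω cν) {r e : ℝ}
    (hr : r + Λ / (24 * ι * β ^ 2) ≤ e) (he : e * a ^ 2 ≤ 1) (hr0 : 0 ≤ r) :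
    1 / a' * (1 - e * a ^ 2) ≤ 1 / a - r * a := by
  have hι := h.ι_ge
  have hΛ := h.Λ_ge
  have ha := h.a_pos
  have hβ := h.β_ge
  have h1 := mul_le_mul_of_nonneg_right h.inv_le (by linarith : 0 ≤ 1 - e * a ^ 2)
  have h2 : a ^ 2 * Λ ^ 2 / (3 * β ^ 2) ≤ a * (Λ / (24 * ι * β ^ 2)) := by
    rw [← mul_div_assoc, div_le_div_iff₀ (by positivity) (by positivity)]
    have := h.aι
    have h3 : 0 ≤ a * Λ * β ^ 2 := by positivity
    nlinarith
  have h4 : 0 ≤ e := le_trans (by positivity) hr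
  have h5 : (1 / a + a ^ 2 * Λ ^ 2 / (3 * β ^ 2)) * (1 - e * a ^ 2) =
      1 / a - e * a + a ^ 2 * Λ ^ 2 / (3 * β ^ 2) * (1 - e * a ^ 2) := by
    field_simp
  have h6 : a ^ 2 * Λ ^ 2 / (3 * β ^ 2) * (1 - e * a ^ 2) ≤ a ^ 2 * Λ ^ 2 / (3 * β ^ 2) :=
    mul_le_of_le_one_right (by positivity) (by nlinarith [mul_nonneg h4 (sq_nonneg a)])
  have h7 := mul_le_mul_of_nonneg_left hr ha.le
  linarith

/-- The weight `3/10 β η Λ² / L²` turns `144 κ² / β` into the decay `216/5`, more than the `186/5`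
that the lower-level inequality charges for the momentum error. The displacement enters with `3/5`,
rounded up. -/
theorem omega_step (h : StepParams L μ κ Λ γ η β ι a a' cω cν) {O O' S σ : ℝ} (hO : 0 ≤ O)
    (hS : 0 ≤ S) (hO' : O' ≤ (1 - cω * a ^ 2) ^ 2 * O +
      1 / β * (2 * L ^ 2 * S + 2 * (cω * a ^ 2) ^ 2 * σ ^ 2)) :
    3 / 10 * β * η * Λ ^ 2 / L ^ 2 / a' * O' ≤ 3 / 10 * β * η * Λ ^ 2 / L ^ 2 / a * O -
      216 / 5 * η * a * Λ ^ 2 / μ ^ 2 * O + 601 / 1000 * η * Λ ^ 2 / a * S +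
      η * Λ ^ 2 / L ^ 2 * (cω ^ 2 * a ^ 3 * σ ^ 2) := by
  have hL := h.L_pos
  have hμ := h.μ_pos
  have hΛ := h.Λ_ge
  have ha := h.a_pos
  have ha' := h.a'_pos
  have hβ := h.β_ge
  have hη := h.η_pos
  have hι := h.ι_ge
  have hκ : κ = L / μ := h.κ_eq
  have hcω : 0 ≤ cω := le_trans (by have := h.κ_ge; positivity) h.cω_ge
  set w := 3 / 10 * β * η * Λ ^ 2 / L ^ 2 with hw
  have hw0 : 0 < w := by positivity
  have h1 := h.momentum_coeff h.cω_ge h.cω_le (by positivity)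
  have h2 : (1 - cω * a ^ 2) ^ 2 ≤ 1 - cω * a ^ 2 := by
    have h3 := h.cω_le
    have h4 : 0 ≤ cω * a ^ 2 := by positivity
    nlinarith
  have h3 : O' ≤ (1 - cω * a ^ 2) * O +
      1 / β * (2 * L ^ 2 * S + 2 * (cω * a ^ 2) ^ 2 * σ ^ 2) :=
    hO'.trans (add_le_add (mul_le_mul_of_nonneg_right h2 hO) le_rfl)
  have h4 := mul_le_mul_of_nonneg_left h3 (by positivity : 0 ≤ w / a')
  have h5 := mul_le_mul_of_nonneg_right h1 (mul_nonneg hw0.le hO)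
  have h6 := mul_le_mul_of_nonneg_right h.inv_le_two (by positivity :
    0 ≤ w * (1 / β * (2 * L ^ 2 * S + 2 * (cω * a ^ 2) ^ 2 * σ ^ 2)))
  have e1 : w / a' * ((1 - cω * a ^ 2) * O + 1 / β * (2 * L ^ 2 * S + 2 * (cω * a ^ 2) ^ 2 * σ ^ 2)) =
      1 / a' * (1 - cω * a ^ 2) * (w * O) +
      1 / a' * (w * (1 / β * (2 * L ^ 2 * S + 2 * (cω * a ^ 2) ^ 2 * σ ^ 2))) := by ring
  have e2 : (1 / a - 144 * κ ^ 2 / β * a) * (w * O) = w / a * O -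
      216 / 5 * η * a * Λ ^ 2 / μ ^ 2 * O := by
    rw [hw, hκ]; field_simp; ring
  have e3 : 1 / a * (10001 / 10000) *
      (w * (1 / β * (2 * L ^ 2 * S + 2 * (cω * a ^ 2) ^ 2 * σ ^ 2))) =
      6 / 10 * (10001 / 10000) * (η * Λ ^ 2 / a * S) +
      6 / 10 * (10001 / 10000) * (η * Λ ^ 2 / L ^ 2 * (cω ^ 2 * a ^ 3 * σ ^ 2)) := by
    rw [hw]; field_simp; ring
  have e4 : 0 ≤ η * Λ ^ 2 / a * S := by positivity
  have e5 : 0 ≤ η * Λ ^ 2 / L ^ 2 * (cω ^ 2 * a ^ 3 * σ ^ 2) := by positivity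
  rw [e1] at h4
  rw [e2] at h5
  rw [e3] at h6
  have e6 : 601 / 1000 * η * Λ ^ 2 / a * S = 601 / 1000 * (η * Λ ^ 2 / a * S) := by ring
  rw [e6]
  linarith

/-- The weight `β η / 2` turns `32 / (9 β)` into the decay `16/9`, more than the `3/2` charged by
the descent of `h`. The displacement enters with `1`, rounded up. -/
theorem nu_step (h : StepParams L μ κ Λ γ η β ι a a' cω cν) {A A' S G : ℝ} (hA : 0 ≤ A)
    (hS : 0 ≤ S) (hA' : A' ≤ (1 - cν * a ^ 2) ^ 2 * A +
      1 / β * (2 * Λ ^ 2 * S + 2 * (cν * a ^ 2) ^ 2 * G ^ 2)) :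
    β * η / 2 / a' * A' ≤ β * η / 2 / a * A - 16 / 9 * η * a * A +
      1001 / 1000 * η * Λ ^ 2 / a * S + 1001 / 1000 * η * (cν ^ 2 * a ^ 3 * G ^ 2) := by
  have hΛ := h.Λ_ge
  have ha := h.a_pos
  have ha' := h.a'_pos
  have hβ := h.β_ge
  have hη := h.η_pos
  have hι := h.ι_ge
  have hcν : 0 ≤ cν := le_trans (by positivity) h.cν_ge
  set w := β * η / 2 with hw
  have hw0 : 0 < w := by positivity
  have h1 := h.momentum_coeff h.cν_ge h.cν_le (by positivity)
  have h2 : (1 - cν * a ^ 2) ^ 2 ≤ 1 - cν * a ^ 2 := by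
    have h3 := h.cν_le
    have h4 : 0 ≤ cν * a ^ 2 := by positivity
    nlinarith
  have h3 : A' ≤ (1 - cν * a ^ 2) * A +
      1 / β * (2 * Λ ^ 2 * S + 2 * (cν * a ^ 2) ^ 2 * G ^ 2) :=
    hA'.trans (add_le_add (mul_le_mul_of_nonneg_right h2 hA) le_rfl)
  have h4 := mul_le_mul_of_nonneg_left h3 (by positivity : 0 ≤ w / a')
  have h5 := mul_le_mul_of_nonneg_right h1 (mul_nonneg hw0.le hA)
  have h6 := mul_le_mul_of_nonneg_right h.inv_le_two (by positivity :
    0 ≤ w * (1 / β * (2 * Λ ^ 2 * S + 2 * (cν * a ^ 2) ^ 2 * G ^ 2)))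
  have e1 : w / a' * ((1 - cν * a ^ 2) * A + 1 / β * (2 * Λ ^ 2 * S + 2 * (cν * a ^ 2) ^ 2 * G ^ 2)) =
      1 / a' * (1 - cν * a ^ 2) * (w * A) +
      1 / a' * (w * (1 / β * (2 * Λ ^ 2 * S + 2 * (cν * a ^ 2) ^ 2 * G ^ 2))) := by ring
  have e2 : (1 / a - 32 / (9 * β) * a) * (w * A) = w / a * A - 16 / 9 * η * a * A := by
    rw [hw]; field_simp; ring
  have e3 : 1 / a * (10001 / 10000) *
      (w * (1 / β * (2 * Λ ^ 2 * S + 2 * (cν * a ^ 2) ^ 2 * G ^ 2))) =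
      (10001 / 10000) * (η * Λ ^ 2 / a * S) +
      (10001 / 10000) * (η * (cν ^ 2 * a ^ 3 * G ^ 2)) := by
    rw [hw]; field_simp
  have e4 : 0 ≤ η * Λ ^ 2 / a * S := by positivity
  have e5 : 0 ≤ η * (cν ^ 2 * a ^ 3 * G ^ 2) := by positivity
  rw [e1] at h4
  rw [e2] at h5
  rw [e3] at h6
  have e6 : 1001 / 1000 * η * Λ ^ 2 / a * S = 1001 / 1000 * (η * Λ ^ 2 / a * S) := by ring
  rw [e6]
  linarith

theorem etaΛκ (h : StepParams L μ κ Λ γ η β ι a a' cω cν) : η * Λ * κ ^ 2 ≤ 1 / 288 := by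
  have hμ := h.μ_pos
  have hL := h.L_pos
  have hκ := h.κ_ge
  have h1 := mul_le_mul_of_nonneg_right h.ηΛκ (by linarith : 0 ≤ κ)
  have h2 : μ * γ / 144 * κ = γ * L / 144 := by rw [h.κ_eq]; field_simp
  have := h.γL
  nlinarith

/-- The weight is chosen so that the contraction `γ μ a / 4` gives exactly the `3/2 η a Λ² B`
charged by the descent of `h`. The bound on `η Λ κ` makes the motion of the minimizers cost only
`1/600` of `η a v`. -/
theorem y_step (h : StepParams L μ κ Λ γ η β ι a a' cω cν) {B B' W O D v : ℝ}
    (hv : 0 ≤ v) (hB' : B' ≤ (1 - γ * μ * a / 4) * B - 15 / 16 * γ ^ 2 * a * W +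
        31 / 5 * γ * a / μ * O + 31 / 5 * γ * a * L ^ 2 / μ * D +
        5 * κ ^ 2 * η ^ 2 * a / (γ * μ) * v) :
    6 * η * Λ ^ 2 / (γ * μ) * B' ≤ 6 * η * Λ ^ 2 / (γ * μ) * B - 3 / 2 * η * a * Λ ^ 2 * B -
      45 / 8 * (η * a * Λ ^ 2 * γ / μ * W) + 186 / 5 * η * a * Λ ^ 2 / μ ^ 2 * O +
      186 / 5 * η * a * Λ ^ 2 * κ ^ 2 * D + 1 / 600 * (η * a) * v := by
  have hL := h.L_pos
  have hμ := h.μ_pos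
  have hΛ := h.Λ_ge
  have hκ := h.κ_ge
  have ha := h.a_pos
  have hη := h.η_pos
  have hγ := h.γ_pos
  have h1 := mul_le_mul_of_nonneg_left hB' (by positivity : 0 ≤ 6 * η * Λ ^ 2 / (γ * μ))
  have e1 : 6 * η * Λ ^ 2 / (γ * μ) * ((1 - γ * μ * a / 4) * B - 15 / 16 * γ ^ 2 * a * W +
        31 / 5 * γ * a / μ * O + 31 / 5 * γ * a * L ^ 2 / μ * D +
        5 * κ ^ 2 * η ^ 2 * a / (γ * μ) * v) =
      6 * η * Λ ^ 2 / (γ * μ) * B - 3 / 2 * η * a * Λ ^ 2 * B -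
      45 / 8 * (η * a * Λ ^ 2 * γ / μ * W) + 186 / 5 * η * a * Λ ^ 2 / μ ^ 2 * O +
      186 / 5 * η * a * Λ ^ 2 * (L / μ) ^ 2 * D +
      30 * (η * Λ * κ) ^ 2 / (γ * μ) ^ 2 * (η * a) * v := by
    field_simp
    ring
  have h2 : 30 * (η * Λ * κ) ^ 2 / (γ * μ) ^ 2 ≤ 1 / 600 := by
    rw [div_le_div_iff₀ (by positivity) (by positivity)]
    have h3 := pow_le_pow_left₀ (by positivity) h.ηΛκ 2
    have h4 : (μ * γ / 144) ^ 2 = (γ * μ) ^ 2 / 20736 := by ring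
    have h5 : 0 ≤ (γ * μ) ^ 2 := sq_nonneg _
    linarith
  have h3 := mul_le_mul_of_nonneg_right h2 (by positivity : 0 ≤ η * a * v)
  rw [← h.κ_eq] at e1
  rw [e1] at h1
  linarith

end StepParams

end Potential

namespace StepParams

variable {L μ κ Λ γ η β ι a a' cω cν : ℝ}

theorem etaΛ (h : StepParams L μ κ Λ γ η β ι a a' cω cν) : η * Λ ≤ 1 / 288 := by
  have := h.κ_ge
  have := h.Λ_ge
  have := h.η_pos
  have h1 : η * Λ * 1 ≤ η * Λ * κ ^ 2 := by
    gcongr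
    exact one_le_pow₀ h.κ_ge
  linarith [h.etaΛκ]

/-- Both `η Λ` and `η κ` are at most `1/288`, and `3 / 288² = 1 / 27648`. -/
theorem eta_sq_le (h : StepParams L μ κ Λ γ η β ι a a' cω cν) :
    η ^ 2 * (2 * Λ ^ 2 + κ ^ 2) ≤ 1 / 27648 := by
  have hκ := h.κ_ge
  have hΛ := h.Λ_ge
  have hη := h.η_pos
  have h1 : η * κ ≤ η * Λ * κ ^ 2 := by
    have : 1 * κ ≤ Λ * κ ^ 2 := by nlinarith [mul_le_mul hΛ hκ zero_le_one (by linarith)]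
    nlinarith
  have h2 := pow_le_pow_left₀ (by positivity) (h1.trans h.etaΛκ) 2
  have h3 := pow_le_pow_left₀ (by positivity) h.etaΛ 2
  nlinarith

theorem gamma_sq_le (h : StepParams L μ κ Λ γ η β ι a a' cω cν) : γ ^ 2 ≤ γ / μ / 2 := by
  have hμ := h.μ_pos
  have hγ := h.γ_pos
  have hμL : μ ≤ L := by
    have := h.κ_ge
    rwa [h.κ_eq, one_le_div hμ] at this
  rw [div_div, le_div_iff₀ (by positivity)]
  have h1 : γ * μ ≤ γ * L := by gcongr
  have := h.γL
  nlinarith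

/-- The growth factor `1 + 1/ι` and the increase of `1 / a` together stay below `1 + 11 / (10 ι)`.
-/
theorem drift_x_step (h : StepParams L μ κ Λ γ η β ι a a' cω cν) {q w D D' N : ℝ}
    (hq : η * κ ^ 2 ≤ q) (hw1 : 1 ≤ w) (hD : 0 ≤ D) (hN : 0 ≤ N)
    (hD' : D' ≤ (1 + 1 / ι) * D + (1 + ι) * ((η * a) ^ 2 * N)) :
    q * w / a' * D' ≤ q * w / a * D + 11 / 10 * (1 / ι) * (q * w / a * D) +
      21 / 10 * (ι * η ^ 2 * q * w * a * N) := by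
  have ha := h.a_pos
  have ha' := h.a'_pos
  have hη := h.η_pos
  have hι := h.ι_ge
  have hκ := h.κ_ge
  have hw0 : 0 < w := by linarith
  have hq0 : 0 < q := lt_of_lt_of_le (by positivity) hq
  have hι1 : 1 + ι ≤ 2 * ι := by linarith
  have hιinv : 1 / ι ≤ 1 := by rw [div_le_one (by linarith)]; exact hι
  have d1 : D' ≤ (1 + 1 / ι) * D + 2 * ι * ((η * a) ^ 2 * N) :=
    hD'.trans (add_le_add le_rfl (mul_le_mul_of_nonneg_right hι1 (by positivity)))
  have d2 := mul_le_mul_of_nonneg_left d1 (by positivity : 0 ≤ q * w / a')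
  have d3 := mul_le_mul_of_nonneg_right h.inv_le' (by positivity :
    0 ≤ q * w * ((1 + 1 / ι) * D + 2 * ι * ((η * a) ^ 2 * N)))
  have d4 : q * w / a' * ((1 + 1 / ι) * D + 2 * ι * ((η * a) ^ 2 * N)) =
    1 / a' * (q * w * ((1 + 1 / ι) * D + 2 * ι * ((η * a) ^ 2 * N))) := by ring
  have d5 : 1 / a * (1 + 1 / (10000 * ι)) * (q * w * ((1 + 1 / ι) * D + 2 * ι * ((η * a) ^ 2 * N))) =
      (1 + 1 / 10000 * (1 / ι)) * (1 + 1 / ι) * (q * w / a * D) +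
      (1 + 1 / 10000 * (1 / ι)) * 2 * (ι * η ^ 2 * q * w * a * N) := by
    field_simp
  have hιp : 0 ≤ 1 / ι := by positivity
  have d6 : (1 + 1 / 10000 * (1 / ι)) * (1 + 1 / ι) ≤ 1 + 11 / 10 * (1 / ι) := by
    nlinarith
  have d7 := mul_le_mul_of_nonneg_right d6 (by positivity : 0 ≤ q * w / a * D)
  have d8 : (1 + 1 / 10000 * (1 / ι)) * 2 ≤ 21 / 10 := by linarith
  have d9 := mul_le_mul_of_nonneg_right d8 (by positivity : 0 ≤ ι * η ^ 2 * q * w * a * N)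
  rw [d4] at d2
  rw [d5] at d3
  linarith only [d2, d3, d7, d9]

/-- The drift weight drops by the factor `1 + 3/ι` in each step. After the growth `11 / (10 ι)` has
been paid, `19 / (10 ι)` is left, and smallness of `ι³ Λ² a²` makes this enough for all other
charges on `D`. -/
theorem drift_x_supply (h : StepParams L μ κ Λ γ η β ι a a' cω cν) {q w D : ℝ}
    (hq : η * κ ^ 2 ≤ q) (hw1 : 1 ≤ w) (hD : 0 ≤ D) :
    39 * (η * a * Λ ^ 2 * κ ^ 2 * D) ≤ 19 / 10 * (1 / ι) * (q * w / a * D) := by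
  have ha := h.a_pos
  have hη := h.η_pos
  have hι := h.ι_ge
  have hκ := h.κ_ge
  have hΛ := h.Λ_ge
  have hq0 : 0 < q := lt_of_lt_of_le (by positivity) hq
  have e1 : η * κ ^ 2 ≤ q * w := hq.trans (le_mul_of_one_le_right hq0.le hw1)
  have e2 : 39 * (ι * Λ ^ 2 * a ^ 2) ≤ 19 / 10 := by
    have e3 : ι ≤ ι ^ 3 := le_self_pow₀ hι (by norm_num)
    have e4 := mul_le_mul_of_nonneg_right e3 (by positivity : 0 ≤ Λ ^ 2 * a ^ 2)
    have := h.a_le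
    linarith
  have e3 := mul_le_mul e2 e1 (by positivity) (by norm_num)
  have e4 := mul_le_mul_of_nonneg_right e3 (by positivity : 0 ≤ 1 / ι * (1 / a) * D)
  refine (le_of_eq ?_).trans (e4.trans_eq ?_)
  · field_simp
  · ring

/-- With the weight `8 ι² η² q w a`, Young's growth costs `8 ι` units and the feedback of `N`
through the displacement another `1/8`. The drop of the weight supplies `24 ι` units, which also
covers the `21/10` charged by the drift of `x`. -/
theorem drift_nu_step (h : StepParams L μ κ Λ γ η β ι a a' cω cν) (hη1 : η ≤ 1)
    {q w N N' S v W G : ℝ} (hq0 : 0 < q) (hqη : η * q ≤ 1 / 27648) (hw1 : 1 ≤ w) (hw2 : w ≤ 21)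
    (hN : 0 ≤ N) (hv : 0 ≤ v) (hW : 0 ≤ W)
    (hN' : N' ≤ (1 + 1 / ι) * N + (1 + ι) * (2 * Λ ^ 2 * S + 2 * (cν * a ^ 2) ^ 2 * G ^ 2))
    (hS : S ≤ (η * a) ^ 2 * (v + N) + (γ * a) ^ 2 * W) :
    8 * ι ^ 2 * η ^ 2 * q * w * a' * N' ≤
      8 * ι ^ 2 * η ^ 2 * q * w * a * N + 65 / 8 * (ι * η ^ 2 * q * w * a * N) +
        1 / 100 * (η * a * v) + 1 / 100 * (η * a * Λ ^ 2 * γ / μ * W) +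
        1 / 10 * (η * (cν ^ 2 * a ^ 3 * G ^ 2)) := by
  have hμ := h.μ_pos
  have hΛ := h.Λ_ge
  have ha := h.a_pos
  have ha' := h.a'_pos
  have hη := h.η_pos
  have hγ := h.γ_pos
  have hι := h.ι_ge
  have hw0 : 0 < w := by linarith
  have hx := h.a_le
  have hι1 : 1 + ι ≤ 2 * ι := by linarith
  have n0 := mul_le_mul_of_nonneg_left hS (by positivity : 0 ≤ 2 * Λ ^ 2)
  have n1 : N' ≤ (1 + 1 / ι) * N + 2 * ι * (2 * Λ ^ 2 * ((η * a) ^ 2 * (v + N) + (γ * a) ^ 2 * W) +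
      2 * (cν * a ^ 2) ^ 2 * G ^ 2) := by
    have e1 := mul_le_mul_of_nonneg_left (add_le_add_left n0 (2 * (cν * a ^ 2) ^ 2 * G ^ 2))
      (by positivity : 0 ≤ 1 + ι)
    have e2 := mul_le_mul_of_nonneg_right hι1 (by positivity :
      0 ≤ 2 * Λ ^ 2 * ((η * a) ^ 2 * (v + N) + (γ * a) ^ 2 * W) + 2 * (cν * a ^ 2) ^ 2 * G ^ 2)
    linarith only [e1, e2, hN']
  obtain ⟨R, hR⟩ : ∃ R, R = (1 + 1 / ι) * N + 2 * ι * (2 * Λ ^ 2 *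
    ((η * a) ^ 2 * (v + N) + (γ * a) ^ 2 * W) + 2 * (cν * a ^ 2) ^ 2 * G ^ 2) := ⟨_, rfl⟩
  rw [← hR] at n1
  have hR0 : 0 ≤ R := by rw [hR]; positivity
  have n2 : 8 * ι ^ 2 * η ^ 2 * q * w * a' * N' ≤ 8 * ι ^ 2 * η ^ 2 * q * w * a * R :=
    (mul_le_mul_of_nonneg_left n1 (by positivity)).trans
      (mul_le_mul_of_nonneg_right (mul_le_mul_of_nonneg_left h.a'_le (by positivity)) hR0)
  obtain ⟨X, hX⟩ : ∃ X, X = 256 * (ι ^ 3 * Λ ^ 2 * a ^ 2) := ⟨_, rfl⟩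
  have n3 : 8 * ι ^ 2 * η ^ 2 * q * w * a * R =
      8 * ι ^ 2 * η ^ 2 * q * w * a * N + 8 * (ι * η ^ 2 * q * w * a * N) +
      1 / 8 * X * η ^ 2 * (η ^ 2 * q * w * a * N) +
      1 / 8 * w * X * (η * q) * η ^ 2 * (η * a * v) +
      1 / 8 * w * X * (η * q) * (η * a * γ ^ 2 * W) +
      1 / 8 * w * (256 * (ι ^ 3 * a ^ 2)) * (η * q) * (η * (cν ^ 2 * a ^ 3 * G ^ 2)) := by
    rw [hR, hX]; field_simp; ring
  rw [← hX] at hx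
  have hX0 : 0 ≤ X := by rw [hX]; positivity
  have n4 : 1 / 8 * X * η ^ 2 * (η ^ 2 * q * w * a * N) ≤ 1 / 8 * (ι * η ^ 2 * q * w * a * N) := by
    have e1 : X * η ^ 2 ≤ 1 := mul_le_one₀ hx (by positivity) (pow_le_one₀ hη.le hη1)
    have e2 : X * η ^ 2 ≤ ι := e1.trans hι
    have := mul_le_mul_of_nonneg_right e2 (by positivity : 0 ≤ 1 / 8 * (η ^ 2 * q * w * a * N))
    refine (le_of_eq ?_).trans (this.trans_eq ?_) <;> ring
  have wX : 1 / 8 * w * X * (η * q) ≤ 1 / 100 := by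
    have e1 : w * X ≤ 21 * 1 := mul_le_mul hw2 hx hX0 (by norm_num)
    have e2 := mul_le_mul e1 hqη (by positivity) (by norm_num)
    linarith only [e2]
  have n5 : 1 / 8 * w * X * (η * q) * η ^ 2 * (η * a * v) ≤ 1 / 100 * (η * a * v) := by
    refine mul_le_mul_of_nonneg_right ?_ (by positivity)
    exact (mul_le_of_le_one_right (by positivity) (pow_le_one₀ hη.le hη1)).trans wX
  have n6 : 1 / 8 * w * X * (η * q) * (η * a * γ ^ 2 * W) ≤
      1 / 100 * (η * a * Λ ^ 2 * γ / μ * W) := by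
    refine mul_le_mul wX ?_ (by positivity) (by norm_num)
    have e1 : γ ^ 2 ≤ Λ ^ 2 * (γ / μ) := by
      have e2 := h.gamma_sq_le
      have e3 : 0 ≤ γ / μ := by positivity
      have e4 : 1 * (γ / μ) ≤ Λ ^ 2 * (γ / μ) :=
        mul_le_mul_of_nonneg_right (one_le_pow₀ hΛ) e3
      linarith only [e2, e3, e4]
    have e2 := mul_le_mul_of_nonneg_left e1 (by positivity : 0 ≤ η * a * W)
    refine (le_of_eq ?_).trans (e2.trans_eq ?_) <;> ring
  have n7 : 1 / 8 * w * (256 * (ι ^ 3 * a ^ 2)) * (η * q) * (η * (cν ^ 2 * a ^ 3 * G ^ 2)) ≤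
      1 / 10 * (η * (cν ^ 2 * a ^ 3 * G ^ 2)) := by
    refine mul_le_mul_of_nonneg_right ?_ (by positivity)
    have e1 : 256 * (ι ^ 3 * a ^ 2) ≤ X := by
      have := mul_le_mul_of_nonneg_right (one_le_pow₀ hΛ : 1 ≤ Λ ^ 2)
        (by positivity : 0 ≤ 256 * (ι ^ 3 * a ^ 2))
      rw [hX]; linarith only [this]
    have e2 : 1 / 8 * w * (256 * (ι ^ 3 * a ^ 2)) * (η * q) ≤ 1 / 8 * w * X * (η * q) := by gcongr
    linarith only [e2, wX]
  rw [n3] at n2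
  linarith only [n2, n4, n5, n6, n7]

theorem drift_step (h : StepParams L μ κ Λ γ η β ι a a' cω cν) (hη1 : η ≤ 1)
    {q w D D' N N' S v W G : ℝ} (hq1 : η * κ ^ 2 ≤ q) (hq2 : 2 * (η * Λ ^ 2) ≤ q)
    (hqη : η * q ≤ 1 / 27648) (hw1 : 1 ≤ w) (hw2 : w ≤ 21) (hD : 0 ≤ D) (hN : 0 ≤ N) (hv : 0 ≤ v)
    (hW : 0 ≤ W) (hD' : D' ≤ (1 + 1 / ι) * D + (1 + ι) * ((η * a) ^ 2 * N))
    (hN' : N' ≤ (1 + 1 / ι) * N + (1 + ι) * (2 * Λ ^ 2 * S + 2 * (cν * a ^ 2) ^ 2 * G ^ 2))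
    (hS : S ≤ (η * a) ^ 2 * (v + N) + (γ * a) ^ 2 * W) :
    q * w / a' * D' + 8 * ι ^ 2 * η ^ 2 * q * w * a' * N' ≤
      q * ((1 + 3 / ι) * w) / a * D + 8 * ι ^ 2 * η ^ 2 * q * ((1 + 3 / ι) * w) * a * N -
        39 * (η * a * Λ ^ 2 * κ ^ 2 * D) - 2 * (η ^ 3 * Λ ^ 2 * a * N) + 1 / 100 * (η * a * v) +
        1 / 100 * (η * a * Λ ^ 2 * γ / μ * W) + 1 / 10 * (η * (cν ^ 2 * a ^ 3 * G ^ 2)) := by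
  have hΛ := h.Λ_ge
  have ha := h.a_pos
  have hη := h.η_pos
  have hι := h.ι_ge
  have hw0 : 0 < w := by linarith
  have hq0 : 0 < q := lt_of_lt_of_le (by positivity) hq2
  have d1 := h.drift_x_step hq1 hw1 hD hN hD'
  have d2 := h.drift_x_supply hq1 hw1 hD
  have n1 := h.drift_nu_step hη1 hq0 hqη hw1 hw2 hN hv hW hN' hS
  have n8 : 2 * (η ^ 3 * Λ ^ 2 * a * N) ≤ ι * η ^ 2 * q * w * a * N := by
    have e2 : q * 1 ≤ q * (ι * w) :=
      mul_le_mul_of_nonneg_left (one_le_mul_of_one_le_of_one_le hι hw1) hq0.le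
    have e3 := mul_le_mul_of_nonneg_right (hq2.trans ((mul_one q).ge.trans e2))
      (by positivity : 0 ≤ η ^ 2 * a * N)
    refine (le_of_eq ?_).trans (e3.trans_eq ?_) <;> ring
  have n10 : 8 * ι ^ 2 * η ^ 2 * q * ((1 + 3 / ι) * w) * a * N =
    8 * ι ^ 2 * η ^ 2 * q * w * a * N + 24 * (ι * η ^ 2 * q * w * a * N) := by field_simp; ring
  have d11 : q * ((1 + 3 / ι) * w) / a * D = q * w / a * D + 3 * (1 / ι) * (q * w / a * D) := by
    ring
  have p0 : 0 ≤ ι * η ^ 2 * q * w * a * N := by positivity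
  rw [n10, d11]
  linarith only [d1, d2, n1, n8, p0]

/-- A synchronization wipes out both drifts and releases their whole weight. The part `2 Λ²` of `q`
pays for the jump to the mean, which enters the displacement; the part `κ²` pays for the drift in
the descent and lower-level inequalities. -/
theorem sync_step (h : StepParams L μ κ Λ γ η β ι a a' cω cν) {q w D D' N N' : ℝ}
    (hq : q = η * (2 * Λ ^ 2 + κ ^ 2)) (hw : 0 ≤ w) (hD : 0 ≤ D) (hN : 0 ≤ N) (hD' : D' ≤ 0)
    (hN' : N' ≤ 0) :
    q * w / a' * D' + 8 * ι ^ 2 * η ^ 2 * q * w * a' * N' ≤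
      q / a * D + 8 * ι ^ 2 * η ^ 2 * q * a * N - 39 * (η * a * Λ ^ 2 * κ ^ 2 * D) -
      2 * (η ^ 3 * Λ ^ 2 * a * N) - 2 * (η * Λ ^ 2 / a * D) := by
  have hΛ := h.Λ_ge
  have hκ := h.κ_ge
  have ha := h.a_pos
  have ha' := h.a'_pos
  have hη := h.η_pos
  have hι := h.ι_ge
  have hq0 : 0 < q := by rw [hq]; positivity
  have e1 : q * w / a' * D' ≤ 0 := mul_nonpos_of_nonneg_of_nonpos (by positivity) hD'
  have e2 : 8 * ι ^ 2 * η ^ 2 * q * w * a' * N' ≤ 0 :=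
    mul_nonpos_of_nonneg_of_nonpos (by positivity) hN'
  have e3 : 39 * (η * a * Λ ^ 2 * κ ^ 2 * D) ≤ η * κ ^ 2 / a * D := by
    have e4 := pow_le_pow_left₀ (by positivity) h.aΛ 2
    have e5 : 39 * (a * Λ) ^ 2 ≤ 1 := by linarith
    have := mul_le_mul_of_nonneg_right e5 (by positivity : 0 ≤ η * κ ^ 2 / a * D)
    refine (le_of_eq ?_).trans (this.trans_eq (one_mul _))
    field_simp
  have e4 : 2 * (η ^ 3 * Λ ^ 2 * a * N) ≤ 8 * ι ^ 2 * η ^ 2 * q * a * N := by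
    have e5 : 2 * (η * Λ ^ 2) ≤ q := by
      have : 0 ≤ η * κ ^ 2 := by positivity
      rw [hq]; linarith
    have e6 : q * 1 ≤ q * (8 * ι ^ 2) :=
      mul_le_mul_of_nonneg_left (by have := one_le_pow₀ hι (n := 2); linarith) hq0.le
    have := mul_le_mul_of_nonneg_right (e5.trans ((mul_one q).ge.trans e6))
      (by positivity : 0 ≤ η ^ 2 * a * N)
    refine (le_of_eq ?_).trans (this.trans_eq ?_) <;> ring
  have e5 : q / a * D = 2 * (η * Λ ^ 2 / a * D) + η * κ ^ 2 / a * D := by rw [hq]; ring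
  linarith only [e1, e2, e3, e4, e5]

/-- One step of the potential between two synchronizations. -/
theorem potential_step (h : StepParams L μ κ Λ γ η β ι a a' cω cν) {sync : Prop} [Decidable sync]
    {U U' g A A' O O' B B' D D' N N' S v W G σ b w w' : ℝ} (hη1 : η ≤ 1)
    (hw1 : 1 ≤ w') (hw2 : w' ≤ 21) (hw : w = if sync then 1 else (1 + 3 / ι) * w')
    (hA : 0 ≤ A) (hO : 0 ≤ O) (hB : 0 ≤ B) (hD : 0 ≤ D) (hN : 0 ≤ N) (hv : 0 ≤ v) (hW : 0 ≤ W)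
    (hS0 : 0 ≤ S)
    (hU : U' ≤ U - η * a / 2 * g - 31 / 64 * (η * a) * v +
      η * a * (3 / 2 * A + 3 / 2 * (Λ ^ 2 * (D + B)) + 3 / 2 * b ^ 2))
    (hO' : O' ≤ (1 - cω * a ^ 2) ^ 2 * O +
      1 / β * (2 * L ^ 2 * S + 2 * (cω * a ^ 2) ^ 2 * σ ^ 2))
    (hA' : A' ≤ (1 - cν * a ^ 2) ^ 2 * A +
      1 / β * (2 * Λ ^ 2 * S + 2 * (cν * a ^ 2) ^ 2 * G ^ 2))
    (hB' : B' ≤ (1 - γ * μ * a / 4) * B - 15 / 16 * γ ^ 2 * a * W +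
        31 / 5 * γ * a / μ * O + 31 / 5 * γ * a * L ^ 2 / μ * D +
        5 * κ ^ 2 * η ^ 2 * a / (γ * μ) * v)
    (hD' : D' ≤ if sync then 0 else (1 + 1 / ι) * D + (1 + ι) * ((η * a) ^ 2 * N))
    (hN' : N' ≤ if sync then 0 else
      (1 + 1 / ι) * N + (1 + ι) * (2 * Λ ^ 2 * S + 2 * (cν * a ^ 2) ^ 2 * G ^ 2))
    (hS : S ≤ (η * a) ^ 2 * (v + N) + (γ * a) ^ 2 * W + if sync then D else 0) :
    U' + 6 * η * Λ ^ 2 / (γ * μ) * B' + 3 / 10 * β * η * Λ ^ 2 / L ^ 2 / a' * O' +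
        β * η / 2 / a' * A' + (η * (2 * Λ ^ 2 + κ ^ 2) * w' / a' * D' +
        8 * ι ^ 2 * η ^ 2 * (η * (2 * Λ ^ 2 + κ ^ 2)) * w' * a' * N') ≤
      U + 6 * η * Λ ^ 2 / (γ * μ) * B + 3 / 10 * β * η * Λ ^ 2 / L ^ 2 / a * O +
        β * η / 2 / a * A + (η * (2 * Λ ^ 2 + κ ^ 2) * w / a * D +
        8 * ι ^ 2 * η ^ 2 * (η * (2 * Λ ^ 2 + κ ^ 2)) * w * a * N) -
      η * a / 2 * g + 3 / 2 * (η * a) * b ^ 2 + η * a ^ 3 * (Λ ^ 2 / L ^ 2 * cω ^ 2 * σ ^ 2 +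
        2 * cν ^ 2 * G ^ 2) := by
  have hL := h.L_pos
  have hμ := h.μ_pos
  have hΛ := h.Λ_ge
  have hκ := h.κ_ge
  have ha := h.a_pos
  have ha' := h.a'_pos
  have hη := h.η_pos
  have hγ := h.γ_pos
  have hι := h.ι_ge
  have s1 := h.omega_step hO hS0 hO'
  have s2 := h.nu_step hA hS0 hA'
  have s3 := h.y_step hv hB'
  have hN3 : 0 ≤ η ^ 3 * Λ ^ 2 * a * N := by positivity
  have hDk : 3 / 2 * (η * a * Λ ^ 2 * D) + 186 / 5 * (η * a * Λ ^ 2 * κ ^ 2 * D) ≤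
      387 / 10 * (η * a * Λ ^ 2 * κ ^ 2 * D) := by
    have : (1 : ℝ) ≤ κ ^ 2 := one_le_pow₀ hκ
    have h1 := mul_le_mul_of_nonneg_left this (by positivity : 0 ≤ η * a * Λ ^ 2 * D)
    linarith
  have hG : 0 ≤ η * (cν ^ 2 * a ^ 3 * G ^ 2) := by positivity
  have hWW : 0 ≤ η * a * Λ ^ 2 * γ / μ * W := by positivity
  have hvv : 0 ≤ η * a * v := by positivity
  -- cost of the displacement
  have c1 := mul_le_mul_of_nonneg_left hS (by positivity : 0 ≤ 1602 / 1000 * (η * Λ ^ 2 / a))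
  have c2 : 1602 / 1000 * (η * Λ ^ 2 / a) * ((η * a) ^ 2 * (v + N) + (γ * a) ^ 2 * W +
      if sync then D else 0) = 1602 / 1000 * ((η * Λ) ^ 2 * (η * a * v)) +
      1602 / 1000 * (η ^ 3 * Λ ^ 2 * a * N) + 1602 / 1000 * (η * a * Λ ^ 2 * γ ^ 2 * W) +
      1602 / 1000 * (η * Λ ^ 2 / a) * (if sync then D else 0) := by
    field_simp
  have c3 : (η * Λ) ^ 2 * (η * a * v) ≤ 1 / 10000 * (η * a * v) := by
    refine mul_le_mul_of_nonneg_right ?_ hvv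
    have := pow_le_pow_left₀ (by positivity) h.etaΛ 2
    linarith
  have c4 : η * a * Λ ^ 2 * γ ^ 2 * W ≤ 1 / 2 * (η * a * Λ ^ 2 * γ / μ * W) := by
    have := mul_le_mul_of_nonneg_left h.gamma_sq_le (by positivity : 0 ≤ η * a * Λ ^ 2 * W)
    refine (le_of_eq ?_).trans (this.trans_eq ?_) <;> ring
  rw [c2] at c1
  -- the drift terms
  have s4 : η * (2 * Λ ^ 2 + κ ^ 2) * w' / a' * D' +
        8 * ι ^ 2 * η ^ 2 * (η * (2 * Λ ^ 2 + κ ^ 2)) * w' * a' * N' ≤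
      η * (2 * Λ ^ 2 + κ ^ 2) * w / a * D +
        8 * ι ^ 2 * η ^ 2 * (η * (2 * Λ ^ 2 + κ ^ 2)) * w * a * N -
        39 * (η * a * Λ ^ 2 * κ ^ 2 * D) - 2 * (η ^ 3 * Λ ^ 2 * a * N) + 1 / 100 * (η * a * v) +
        1 / 100 * (η * a * Λ ^ 2 * γ / μ * W) + 1 / 10 * (η * (cν ^ 2 * a ^ 3 * G ^ 2)) -
        1602 / 1000 * (η * Λ ^ 2 / a) * (if sync then D else 0) := by
    obtain ⟨q, hq⟩ : ∃ q, q = η * (2 * Λ ^ 2 + κ ^ 2) := ⟨_, rfl⟩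
    rw [← hq]
    by_cases hs : sync
    · rw [if_pos hs] at hD' hN' hw ⊢
      have := h.sync_step (w := w') hq (by linarith) hD hN hD' hN'
      have e6 : 0 ≤ η * Λ ^ 2 / a * D := by positivity
      rw [hw, mul_one, mul_one]
      linarith only [this, e6, hG, hWW, hvv]
    · rw [if_neg hs] at hD' hN' hw hS ⊢
      rw [add_zero] at hS
      have hq1 : η * κ ^ 2 ≤ q := by
        have : 0 ≤ η * Λ ^ 2 := by positivity
        rw [hq]; linarith
      have hq2 : 2 * (η * Λ ^ 2) ≤ q := by
        have : 0 ≤ η * κ ^ 2 := by positivity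
        rw [hq]; linarith
      have hq3 : η * q ≤ 1 / 27648 := by
        have := h.eta_sq_le
        rw [hq]; linarith
      have := h.drift_step hη1 hq1 hq2 hq3 hw1 hw2 hD hN hv hW hD' hN' hS
      rw [hw, mul_zero, sub_zero]
      exact this
  have e1 : 601 / 1000 * η * Λ ^ 2 / a * S + 1001 / 1000 * η * Λ ^ 2 / a * S =
      1602 / 1000 * (η * Λ ^ 2 / a) * S := by ring
  have e2 : 1001 / 1000 * η * (cν ^ 2 * a ^ 3 * G ^ 2) =
    1001 / 1000 * (η * (cν ^ 2 * a ^ 3 * G ^ 2)) := by ring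
  have e3 : η * a ^ 3 * (Λ ^ 2 / L ^ 2 * cω ^ 2 * σ ^ 2 + 2 * cν ^ 2 * G ^ 2) =
    η * Λ ^ 2 / L ^ 2 * (cω ^ 2 * a ^ 3 * σ ^ 2) + 2 * (η * (cν ^ 2 * a ^ 3 * G ^ 2)) := by ring
  have e4 : 0 ≤ η * a * A := by positivity
  have e5 : 0 ≤ η * a * Λ ^ 2 / μ ^ 2 * O := by positivity
  have hD39 : 0 ≤ η * a * Λ ^ 2 * κ ^ 2 * D := by positivity
  have e6 : η * a * (3 / 2 * A + 3 / 2 * (Λ ^ 2 * (D + B)) + 3 / 2 * b ^ 2) =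
      3 / 2 * (η * a * A) + 3 / 2 * (η * a * Λ ^ 2 * D) + 3 / 2 * (η * a * Λ ^ 2 * B) +
      3 / 2 * (η * a) * b ^ 2 := by ring
  have hB0 : 0 ≤ η * a * Λ ^ 2 * B := by positivity
  have hO0 : 0 ≤ η * Λ ^ 2 / L ^ 2 * (cω ^ 2 * a ^ 3 * σ ^ 2) := by positivity
  obtain ⟨dr, hdr⟩ : ∃ r, r = η * (2 * Λ ^ 2 + κ ^ 2) * w' / a' * D' +
        8 * ι ^ 2 * η ^ 2 * (η * (2 * Λ ^ 2 + κ ^ 2)) * w' * a' * N' := ⟨_, rfl⟩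
  obtain ⟨dr0, hdr0⟩ : ∃ r, r = η * (2 * Λ ^ 2 + κ ^ 2) * w / a * D +
        8 * ι ^ 2 * η ^ 2 * (η * (2 * Λ ^ 2 + κ ^ 2)) * w * a * N := ⟨_, rfl⟩
  obtain ⟨tD, htD⟩ : ∃ r, r = (if sync then D else 0) := ⟨_, rfl⟩
  rw [← htD] at c1 s4
  rw [← hdr, ← hdr0] at s4 ⊢
  rw [e3]
  rw [e6] at hU
  -- The balance sheet; each coefficient is supply minus charge. For `W`: `45/8` against `1602/2000
  -- + 1/100`. For `v`: `31/64` against `1/600`, `1/100` and the displacement. For the momentum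
  -- errors: `16/9 - 3/2` and `216/5 - 186/5`. For `D`: `39 - 387/10`. For the noise: `2 - 1001/1000
  -- - 1/10`. For `N`: `2 - 1602/1000`. The `B` terms cancel exactly.
  linear_combination hU + s1 + s2 + s3 + s4 + c1 + 1602 / 1000 * c3 + 1602 / 1000 * c4 + hDk +
    (45 / 8 - 811 / 1000) * hWW + (31 / 64 - 1 / 600 - 1 / 100 - 1602 / 10000000) * hvv +
    (16 / 9 - 3 / 2) * e4 + 6 * e5 + 3 / 10 * hD39 + (2 - 1101 / 1000) * hG + 398 / 1000 * hN3

end StepParams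

/-! ### The one-step inequalities in expectation and the decrease of the potential -/

section ExpectedSystem

/-- Six functions are the most that a one-step inequality involves; superfluous slots receive the
coefficient zero. -/
theorem integral_le_of_le_lin {Ω : Type*} [MeasurableSpace Ω] {Pr : Measure Ω}
    [IsProbabilityMeasure Pr] {f f₁ f₂ f₃ f₄ f₅ f₆ : Ω → ℝ} {a₁ a₂ a₃ a₄ a₅ a₆ r : ℝ}
    (hf : Integrable f Pr) (h₁ : Integrable f₁ Pr) (h₂ : Integrable f₂ Pr) (h₃ : Integrable f₃ Pr)
    (h₄ : Integrable f₄ Pr) (h₅ : Integrable f₅ Pr) (h₆ : Integrable f₆ Pr)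
    (h : ∀ ω, f ω ≤ a₁ * f₁ ω + a₂ * f₂ ω + a₃ * f₃ ω + a₄ * f₄ ω + a₅ * f₅ ω + a₆ * f₆ ω + r) :
    ∫ ω, f ω ∂Pr ≤ a₁ * ∫ ω, f₁ ω ∂Pr + a₂ * ∫ ω, f₂ ω ∂Pr + a₃ * ∫ ω, f₃ ω ∂Pr +
      a₄ * ∫ ω, f₄ ω ∂Pr + a₅ * ∫ ω, f₅ ω ∂Pr + a₆ * ∫ ω, f₆ ω ∂Pr + r := by
  have i₂ := (h₁.const_mul a₁).add (h₂.const_mul a₂)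
  have i₃ := i₂.add (h₃.const_mul a₃)
  have i₄ := i₃.add (h₄.const_mul a₄)
  have i₅ := i₄.add (h₅.const_mul a₅)
  have i₆ := i₅.add (h₆.const_mul a₆)
  have i₇ := i₆.add (integrable_const r)
  refine (integral_mono hf i₇ h).trans_eq ?_
  rw [integral_add' i₆ (integrable_const r), integral_add' i₅ (h₆.const_mul a₆),
    integral_add' i₄ (h₅.const_mul a₅), integral_add' i₃ (h₄.const_mul a₄),
    integral_add' i₂ (h₃.const_mul a₃), integral_add' (h₁.const_mul a₁) (h₂.const_mul a₂)]
  simp only [integral_const_mul, integral_const, probReal_univ, one_smul]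

variable {p d : ℕ} {s : Config} {Ξf Ξg Ω : Type*} [MeasurableSpace Ξf] [MeasurableSpace Ξg]
  [MeasurableSpace Ω] {P : Problem p d s.M Ξf Ξg} {Pr : Measure Ω} [IsProbabilityMeasure Pr]
  {ξf : ℕ × Fin s.M × ℕ → Ω → Ξf} {ξg : GIndex s.M → Ω → Ξg} {K : Constants} {c₀ : ℝ}
  {x₁ : E p} {y₁ : E d}

theorem alpha_le_sixteenth (hK : K.Valid) (hs : s.Admissible K c₀) (t : ℕ) :
    alpha K s t ≤ 1 / 16 := by
  have h := alpha_mul_le hK hs t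
  have ha := alpha_pos hK hs t
  have h1 : 1 ≤ (s.I : ℝ) ^ (3 / 2 : ℝ) := Real.one_le_rpow (one_le_I hs) (by norm_num)
  have h2 : 1 * alpha K s t ≤ (s.I : ℝ) ^ (3 / 2 : ℝ) * Lhat K s * alpha K s t :=
    mul_le_mul_of_nonneg_right (one_le_mul_of_one_le_of_one_le h1 (one_le_Lhat K s)) ha.le
  linarith

theorem Assumptions.integral_h_succ_le (hK : K.Valid) (hc : 0 < c₀) (hs : s.Admissible K c₀)
    (hA : Assumptions K s.μ P) (hS : IsSampling P Pr ξf ξg)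
    (hlow : ∀ x, P.h x₁ - P.h x ≤ K.Δ) (n : ℕ) :
    ∫ ω, P.h (avg (traj K s P ξf ξg x₁ y₁ (n + 1) ω).x) ∂Pr ≤
      ∫ ω, P.h (avg (traj K s P ξf ξg x₁ y₁ n ω).x) ∂Pr -
      s.η * alpha K s (n + 1) / 2 *
        ∫ ω, ‖hGrad P (avg (traj K s P ξf ξg x₁ y₁ n ω).x)‖ ^ 2 ∂Pr -
      31 / 64 * (s.η * alpha K s (n + 1)) * ∫ ω, ‖avg (traj K s P ξf ξg x₁ y₁ n ω).nu‖ ^ 2 ∂Pr +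
      s.η * alpha K s (n + 1) * (3 / 2 * ∫ ω, errNu P (traj K s P ξf ξg x₁ y₁ n ω) ∂Pr +
        3 / 2 * (Lhat K s ^ 2 * (∫ ω, devX (traj K s P ξf ξg x₁ y₁ n ω) ∂Pr +
          ∫ ω, errY P (traj K s P ξf ξg x₁ y₁ n ω) ∂Pr)) + 3 / 2 * G1 K s ^ 2) := by
  obtain ⟨iA, -, iB, iD, -, -, iv, -⟩ := hA.integrable_quantities hK hs hS x₁ y₁ n
  have ih := hA.integrable_h (y₁ := y₁) hK hs hS hlow
  have ig := hA.integrable_hGrad_sq (x₁ := x₁) (y₁ := y₁) hK hs hS n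
  have h := integral_le_of_le_lin (ih (n + 1)) (ih n) ig iv iA iD iB (a₁ := 1)
    (a₂ := -(s.η * alpha K s (n + 1) / 2)) (a₃ := -(31 / 64 * (s.η * alpha K s (n + 1))))
    (a₄ := 3 / 2 * (s.η * alpha K s (n + 1))) (a₅ := 3 / 2 * (s.η * alpha K s (n + 1)) *
    Lhat K s ^ 2) (a₆ := 3 / 2 * (s.η * alpha K s (n + 1)) * Lhat K s ^ 2)
    (r := 3 / 2 * (s.η * alpha K s (n + 1)) * G1 K s ^ 2) fun ω => by
      have := hA.h_next_le hK hs n (eta_pos hK hc hs).le (eta_mul_Lbar_le hs)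
        (alpha_pos hK hs _).le (alpha_le_sixteenth hK hs _) (traj K s P ξf ξg x₁ y₁ n ω)
      exact this.trans (le_of_eq (by ring))
  exact h.trans (le_of_eq (by ring))

theorem Assumptions.integral_errY_succ_le (hK : K.Valid) (hc : 0 < c₀) (hs : s.Admissible K c₀)
    (hA : Assumptions K s.μ P) (hS : IsSampling P Pr ξf ξg) (n : ℕ) :
    ∫ ω, errY P (traj K s P ξf ξg x₁ y₁ (n + 1) ω) ∂Pr ≤
      (1 - s.γ * s.μ * alpha K s (n + 1) / 4) *
        ∫ ω, errY P (traj K s P ξf ξg x₁ y₁ n ω) ∂Pr -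
      15 / 16 * s.γ ^ 2 * alpha K s (n + 1) *
        ∫ ω, msq (traj K s P ξf ξg x₁ y₁ n ω).om ∂Pr +
      31 / 5 * s.γ * alpha K s (n + 1) / s.μ *
        ∫ ω, errOm P (traj K s P ξf ξg x₁ y₁ n ω) ∂Pr +
      31 / 5 * s.γ * alpha K s (n + 1) * K.L ^ 2 / s.μ *
        ∫ ω, devX (traj K s P ξf ξg x₁ y₁ n ω) ∂Pr +
      5 * kappa K s ^ 2 * s.η ^ 2 * alpha K s (n + 1) / (s.γ * s.μ) *
        ∫ ω, ‖avg (traj K s P ξf ξg x₁ y₁ n ω).nu‖ ^ 2 ∂Pr := by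
  obtain ⟨-, iO, iB, iD, -, iW, iv, -⟩ := hA.integrable_quantities hK hs hS x₁ y₁ n
  obtain ⟨-, -, iB', -⟩ := hA.integrable_quantities hK hs hS x₁ y₁ (n + 1)
  have h := integral_le_of_le_lin iB' iB iW iO iD iv iv
    (a₁ := 1 - s.γ * s.μ * alpha K s (n + 1) / 4)
    (a₂ := -(15 / 16 * s.γ ^ 2 * alpha K s (n + 1)))
    (a₃ := 31 / 5 * s.γ * alpha K s (n + 1) / s.μ)
    (a₄ := 31 / 5 * s.γ * alpha K s (n + 1) * K.L ^ 2 / s.μ)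
    (a₅ := 5 * kappa K s ^ 2 * s.η ^ 2 * alpha K s (n + 1) / (s.γ * s.μ)) (a₆ := 0) (r := 0)
    fun ω => by
      have := hA.errY_next_le hK hc hs n (alpha_pos hK hs _) (alpha_le_sixteenth hK hs _)
        (traj K s P ξf ξg x₁ y₁ n ω)
      exact this.trans (le_of_eq (by ring))
  exact h.trans (le_of_eq (by ring))

theorem Assumptions.integral_moveSq_le (hK : K.Valid) (hs : s.Admissible K c₀)
    (hA : Assumptions K s.μ P) (hS : IsSampling P Pr ξf ξg) (n : ℕ) :
    ∫ ω, moveSq K s n (traj K s P ξf ξg x₁ y₁ n ω) ∂Pr ≤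
      (s.η * alpha K s (n + 1)) ^ 2 * (∫ ω, ‖avg (traj K s P ξf ξg x₁ y₁ n ω).nu‖ ^ 2 ∂Pr +
        ∫ ω, devNu (traj K s P ξf ξg x₁ y₁ n ω) ∂Pr) +
      (s.γ * alpha K s (n + 1)) ^ 2 * ∫ ω, msq (traj K s P ξf ξg x₁ y₁ n ω).om ∂Pr +
      if (n + 1) % s.I = 0 then ∫ ω, devX (traj K s P ξf ξg x₁ y₁ n ω) ∂Pr else 0 := by
  obtain ⟨-, -, -, iD, iN, iW, iv, iS⟩ := hA.integrable_quantities hK hs hS x₁ y₁ n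
  have h := integral_le_of_le_lin iS iv iN iW iD iD iD (a₁ := (s.η * alpha K s (n + 1)) ^ 2)
    (a₂ := (s.η * alpha K s (n + 1)) ^ 2) (a₃ := (s.γ * alpha K s (n + 1)) ^ 2)
    (a₄ := if (n + 1) % s.I = 0 then 1 else 0) (a₅ := 0) (a₆ := 0) (r := 0) fun ω => by
      have := moveSq_le (K := K) hs.M_pos n (traj K s P ξf ξg x₁ y₁ n ω)
      refine this.trans (le_of_eq ?_)
      split_ifs <;> ring
  refine h.trans (le_of_eq ?_)
  split_ifs <;> ring

theorem Assumptions.integral_devX_succ_le (hK : K.Valid) (hs : s.Admissible K c₀)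
    (hA : Assumptions K s.μ P) (hS : IsSampling P Pr ξf ξg) (n : ℕ) :
    ∫ ω, devX (traj K s P ξf ξg x₁ y₁ (n + 1) ω) ∂Pr ≤ if (n + 1) % s.I = 0 then 0 else
      (1 + 1 / (s.I : ℝ)) * ∫ ω, devX (traj K s P ξf ξg x₁ y₁ n ω) ∂Pr +
      (1 + s.I) * ((s.η * alpha K s (n + 1)) ^ 2 *
        ∫ ω, devNu (traj K s P ξf ξg x₁ y₁ n ω) ∂Pr) := by
  obtain ⟨-, -, -, iD, iN, -⟩ := hA.integrable_quantities hK hs hS x₁ y₁ n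
  obtain ⟨-, -, -, iD', -⟩ := hA.integrable_quantities hK hs hS x₁ y₁ (n + 1)
  have h := integral_le_of_le_lin iD' iD iN iD iD iD iD
    (a₁ := if (n + 1) % s.I = 0 then 0 else 1 + 1 / (s.I : ℝ))
    (a₂ := if (n + 1) % s.I = 0 then 0 else (1 + s.I) * (s.η * alpha K s (n + 1)) ^ 2)
    (a₃ := 0) (a₄ := 0) (a₅ := 0) (a₆ := 0) (r := 0) fun ω => by
      have := devX_next_le (K := K) hs.M_pos hs.I_pos n (traj K s P ξf ξg x₁ y₁ n ω)
      refine this.trans (le_of_eq ?_)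
      split_ifs <;> ring
  refine h.trans (le_of_eq ?_)
  split_ifs <;> ring

theorem devNu_traj_sync (hM : 0 < s.M) {n : ℕ} (h : (n + 1) % s.I = 0) (ω : Ω) :
    devNu (traj K s P ξf ξg x₁ y₁ (n + 1) ω) = 0 := by
  have e : (traj K s P ξf ξg x₁ y₁ (n + 1) ω).nu = fun _ => avg (nextNuHat K s P
      (fun i => ξf i ω) (fun i => ξg i ω) n (traj K s P ξf ξg x₁ y₁ n ω)) :=
    funext fun m => (traj_succ_nu m ω).trans (if_pos h)
  rw [devNu, e, avg_const hM]
  simp [msq]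

theorem Assumptions.integral_devNu_succ_le (hK : K.Valid) (hs : s.Admissible K c₀)
    (hA : Assumptions K s.μ P) (hS : IsSampling P Pr ξf ξg) (n : ℕ) :
    ∫ ω, devNu (traj K s P ξf ξg x₁ y₁ (n + 1) ω) ∂Pr ≤ if (n + 1) % s.I = 0 then 0 else
      (1 + 1 / (s.I : ℝ)) * ∫ ω, devNu (traj K s P ξf ξg x₁ y₁ n ω) ∂Pr +
      (1 + s.I) * (2 * Lhat K s ^ 2 * ∫ ω, moveSq K s n (traj K s P ξf ξg x₁ y₁ n ω) ∂Pr +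
        2 * (cNu K s * alpha K s (n + 1) ^ 2) ^ 2 * ((1 + kappa K s) * K.Cf) ^ 2) := by
  split_ifs with hI
  · simp [devNu_traj_sync (Ω := Ω) hs.M_pos hI]
  obtain ⟨-, -, -, -, iN, -, -, iS⟩ := hA.integrable_quantities hK hs hS x₁ y₁ n
  obtain ⟨-, -, -, -, iN', -⟩ := hA.integrable_quantities hK hs hS x₁ y₁ (n + 1)
  have h := integral_le_of_le_lin iN' iN iS iN iN iN iN
    (a₁ := 1 + 1 / (s.I : ℝ)) (a₂ := (1 + s.I) * (2 * Lhat K s ^ 2))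
    (a₃ := 0) (a₄ := 0) (a₅ := 0) (a₆ := 0)
    (r := (1 + s.I) * (2 * (cNu K s * alpha K s (n + 1) ^ 2) ^ 2 *
      ((1 + kappa K s) * K.Cf) ^ 2)) fun ω => by
      have := hA.devNu_next_le hK hs (fun i => ξf i ω) (fun i => ξg i ω) n
        (mul_nonneg (cNu_pos hs).le (sq_nonneg _)) (cNu_mul_alpha_sq_le hK hs _)
        (traj K s P ξf ξg x₁ y₁ n ω)
      have e : (traj K s P ξf ξg x₁ y₁ (n + 1) ω).nu = nextNuHat K s P
          (fun i => ξf i ω) (fun i => ξg i ω) n (traj K s P ξf ξg x₁ y₁ n ω) :=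
        funext fun m => (traj_succ_nu m ω).trans (if_neg hI)
      rw [devNu, e]
      exact this.trans (le_of_eq (by ring))
  exact h.trans (le_of_eq (by ring))

theorem stepParams (hK : K.Valid) (hc : 0 < c₀) (hs : s.Admissible K c₀) (t : ℕ) :
    StepParams K.L s.μ (kappa K s) (Lhat K s) s.γ s.η (bM s) s.I (alpha K s t) (alpha K s (t + 1))
      (cOmega K s) (cNu K s) where
  L_pos := hK.L_pos
  μ_pos := hs.μ_pos
  κ_eq := rfl
  κ_ge := one_le_kappa hs
  Λ_ge := one_le_Lhat K s
  γ_pos := gamma_pos hK hc hs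
  γL := gamma_mul_L_le hK hs
  η_pos := eta_pos hK hc hs
  ηΛκ := eta_mul_Lhat_le hs
  β_ge := one_le_bM hs
  ι_ge := one_le_I hs
  a_pos := alpha_pos hK hs t
  a'_pos := alpha_pos hK hs _
  a'_le := alpha_succ_le hK hs t
  inv_le := inv_alpha_succ_le hK hs t
  a_le := by
    have h := alpha_mul_le hK hs t
    have h0 : 0 ≤ 16 * (s.I : ℝ) ^ (3 / 2 : ℝ) * Lhat K s * alpha K s t := by
      have := alpha_pos hK hs t
      have := Lhat_pos K s
      positivity
    have h1 := pow_le_one₀ h0 h (n := 2)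
    rw [mul_pow, mul_pow, mul_pow, rpow_three_half_sq (by positivity)] at h1
    linarith
  cω_ge := le_of_eq (by
    have := hs.μ_pos
    unfold cOmega kappa
    field_simp)
  cν_ge := le_of_eq (by unfold cNu; rfl)
  cω_le := cOmega_mul_alpha_sq_le hK hs t
  cν_le := cNu_mul_alpha_sq_le hK hs t

/-- Weight of the client drift at time `n + 1`: it decreases between two synchronizations. -/
noncomputable def driftWeight (s : Config) (n : ℕ) : ℝ :=
  (1 + 3 / (s.I : ℝ)) ^ (s.I - 1 - n % s.I)

theorem one_le_driftWeight (s : Config) (n : ℕ) : 1 ≤ driftWeight s n :=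
  one_le_pow₀ (le_add_of_nonneg_right (by positivity))

/-- `(1 + 3/I)^I ≤ e³ < 21`, so the weights stay comparable to one whatever the length of a round.
-/
theorem driftWeight_le (hs : s.Admissible K c₀) (n : ℕ) : driftWeight s n ≤ 21 := by
  have hI := one_le_I hs
  have h1 : driftWeight s n ≤ (1 + 3 / (s.I : ℝ)) ^ s.I :=
    pow_le_pow_right₀ (le_add_of_nonneg_right (by positivity)) (by omega)
  have h2 : (1 + 3 / (s.I : ℝ)) ^ s.I ≤ Real.exp (3 / s.I) ^ s.I := by
    gcongr
    have := Real.add_one_le_exp (3 / (s.I : ℝ))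
    linarith
  have h3 : Real.exp (3 / s.I) ^ s.I = Real.exp 1 ^ 3 := by
    rw [← Real.exp_nat_mul, ← Real.exp_nat_mul]
    congr 1
    field_simp
    norm_num
  have h4 : Real.exp 1 ^ 3 ≤ 2.7182818286 ^ 3 :=
    pow_le_pow_left₀ (Real.exp_pos _).le Real.exp_one_lt_d9.le 3
  have h5 : (2.7182818286 : ℝ) ^ 3 ≤ 21 := by norm_num
  linarith

/-- The exponent counts the steps left before the next synchronization. The state with index `n`
belongs to time `n + 1`, so the weight is one exactly when the coming step synchronizes. -/
theorem driftWeight_eq (hs : s.Admissible K c₀) (n : ℕ) : driftWeight s n =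
    if (n + 1) % s.I = 0 then 1 else (1 + 3 / (s.I : ℝ)) * driftWeight s (n + 1) := by
  have hI := hs.I_pos
  have hlt := Nat.mod_lt n hI
  unfold driftWeight
  rw [← pow_succ']
  have hmod : (n + 1) % s.I = if n % s.I + 1 = s.I then 0 else n % s.I + 1 := by
    rw [Nat.add_mod_eq_ite]
    rcases Nat.lt_or_ge 1 s.I with h1 | h1
    · rw [Nat.mod_eq_of_lt h1]
      split_ifs <;> omega
    · have : s.I = 1 := by omega
      rw [this]; simp [Nat.mod_one]
  rw [hmod]
  by_cases h : n % s.I + 1 = s.I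
  · rw [if_pos h, if_pos rfl, show s.I - 1 - n % s.I = 0 by omega, pow_zero]
  · rw [if_neg h, if_neg (Nat.succ_ne_zero _)]
    congr 1
    omega

/-- The potential at time `n + 1`. -/
noncomputable def potential (K : Constants) (s : Config) (P : Problem p d s.M Ξf Ξg)
    (Pr : Measure Ω) (ξf : ℕ × Fin s.M × ℕ → Ω → Ξf) (ξg : GIndex s.M → Ω → Ξg) (x₁ : E p)
    (y₁ : E d) (n : ℕ) : ℝ :=
  ∫ ω, P.h (avg (traj K s P ξf ξg x₁ y₁ n ω).x) ∂Pr +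
    6 * s.η * Lhat K s ^ 2 / (s.γ * s.μ) * ∫ ω, errY P (traj K s P ξf ξg x₁ y₁ n ω) ∂Pr +
    3 / 10 * bM s * s.η * Lhat K s ^ 2 / K.L ^ 2 / alpha K s (n + 1) *
      ∫ ω, errOm P (traj K s P ξf ξg x₁ y₁ n ω) ∂Pr +
    bM s * s.η / 2 / alpha K s (n + 1) * ∫ ω, errNu P (traj K s P ξf ξg x₁ y₁ n ω) ∂Pr +
    (s.η * (2 * Lhat K s ^ 2 + kappa K s ^ 2) * driftWeight s n / alpha K s (n + 1) *
        ∫ ω, devX (traj K s P ξf ξg x₁ y₁ n ω) ∂Pr +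
      8 * (s.I : ℝ) ^ 2 * s.η ^ 2 * (s.η * (2 * Lhat K s ^ 2 + kappa K s ^ 2)) *
        driftWeight s n * alpha K s (n + 1) *
        ∫ ω, devNu (traj K s P ξf ξg x₁ y₁ n ω) ∂Pr)

/-- The noise that enters the potential, up to the factor `η α_t³`. -/
noncomputable def noiseConst (K : Constants) (s : Config) : ℝ :=
  Lhat K s ^ 2 / K.L ^ 2 * cOmega K s ^ 2 * K.σ ^ 2 +
    2 * cNu K s ^ 2 * ((1 + kappa K s) * K.Cf) ^ 2

theorem Assumptions.potential_succ_le (hK : K.Valid) (hc : 0 < c₀) (hs : s.Admissible K c₀)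
    (hA : Assumptions K s.μ P) (hS : IsSampling P Pr ξf ξg)
    (hlow : ∀ x, P.h x₁ - P.h x ≤ K.Δ) (n : ℕ) :
    potential K s P Pr ξf ξg x₁ y₁ (n + 1) ≤ potential K s P Pr ξf ξg x₁ y₁ n -
      s.η * alpha K s (n + 1) / 2 *
        ∫ ω, ‖hGrad P (avg (traj K s P ξf ξg x₁ y₁ n ω).x)‖ ^ 2 ∂Pr +
      3 / 2 * (s.η * alpha K s (n + 1)) * G1 K s ^ 2 +
      s.η * alpha K s (n + 1) ^ 3 * noiseConst K s :=
  (stepParams hK hc hs (n + 1)).potential_step (sync := (n + 1) % s.I = 0) (eta_le_one hs)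
    (one_le_driftWeight s (n + 1)) (driftWeight_le hs (n + 1)) (driftWeight_eq hs n)
    (integral_nonneg fun _ => sq_nonneg _) (integral_nonneg fun _ => msq_nonneg _)
    (integral_nonneg fun _ => msq_nonneg _) (integral_nonneg fun _ => msq_nonneg _)
    (integral_nonneg fun _ => msq_nonneg _) (integral_nonneg fun _ => sq_nonneg _)
    (integral_nonneg fun _ => msq_nonneg _)
    (integral_nonneg fun _ => add_nonneg (msq_nonneg _) (msq_nonneg _))
    (hA.integral_h_succ_le hK hc hs hS hlow n)
    (hA.integral_errOm_succ_le hK hs hS x₁ y₁ n) (hA.integral_errNu_succ_le hK hs hS x₁ y₁ n)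
    (hA.integral_errY_succ_le hK hc hs hS n) (hA.integral_devX_succ_le hK hs hS n)
    (hA.integral_devNu_succ_le hK hs hS n) (hA.integral_moveSq_le hK hs hS n)

end ExpectedSystem

/-! ### Summation of the potential inequality -/

section Telescope

variable {p d : ℕ} {s : Config} {Ξf Ξg Ω : Type*} [MeasurableSpace Ξf] [MeasurableSpace Ξg]
  [MeasurableSpace Ω] {P : Problem p d s.M Ξf Ξg} {Pr : Measure Ω} [IsProbabilityMeasure Pr]
  {ξf : ℕ × Fin s.M × ℕ → Ω → Ξf} {ξg : GIndex s.M → Ω → Ξg} {K : Constants} {c₀ : ℝ}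
  {x₁ : E p} {y₁ : E d}

/-- All error terms of the potential are nonnegative, and the gap hypothesis bounds the remaining
expectation of `h`. -/
theorem Assumptions.le_potential (hK : K.Valid) (hc : 0 < c₀) (hs : s.Admissible K c₀)
    (hA : Assumptions K s.μ P) (hS : IsSampling P Pr ξf ξg)
    (hlow : ∀ x, P.h x₁ - P.h x ≤ K.Δ) (n : ℕ) :
    P.h x₁ - K.Δ ≤ potential K s P Pr ξf ξg x₁ y₁ n := by
  have h : P.h x₁ - K.Δ ≤ ∫ ω, P.h (avg (traj K s P ξf ξg x₁ y₁ n ω).x) ∂Pr := by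
    have := integral_mono (integrable_const (P.h x₁ - K.Δ))
      (hA.integrable_h (y₁ := y₁) hK hs hS hlow n) fun ω => by
        have := hlow (avg (traj K s P ξf ξg x₁ y₁ n ω).x)
        show P.h x₁ - K.Δ ≤ P.h (avg (traj K s P ξf ξg x₁ y₁ n ω).x)
        linarith
    simpa using this
  have hη := eta_pos hK hc hs
  have hγ := gamma_pos hK hc hs
  have hμ := hs.μ_pos
  have ha := alpha_pos hK hs (n + 1)
  have hβ := one_le_bM hs
  have hw := one_le_driftWeight s n
  have h1 : 0 ≤ ∫ ω, errY P (traj K s P ξf ξg x₁ y₁ n ω) ∂Pr :=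
    integral_nonneg fun _ => msq_nonneg _
  have h2 : 0 ≤ ∫ ω, errOm P (traj K s P ξf ξg x₁ y₁ n ω) ∂Pr :=
    integral_nonneg fun _ => msq_nonneg _
  have h3 : 0 ≤ ∫ ω, errNu P (traj K s P ξf ξg x₁ y₁ n ω) ∂Pr :=
    integral_nonneg fun _ => sq_nonneg _
  have h4 : 0 ≤ ∫ ω, devX (traj K s P ξf ξg x₁ y₁ n ω) ∂Pr :=
    integral_nonneg fun _ => msq_nonneg _
  have h5 : 0 ≤ ∫ ω, devNu (traj K s P ξf ξg x₁ y₁ n ω) ∂Pr :=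
    integral_nonneg fun _ => msq_nonneg _
  have g1 := mul_nonneg (by positivity : 0 ≤ 6 * s.η * Lhat K s ^ 2 / (s.γ * s.μ)) h1
  have g2 := mul_nonneg
    (by positivity : 0 ≤ 3 / 10 * bM s * s.η * Lhat K s ^ 2 / K.L ^ 2 / alpha K s (n + 1)) h2
  have g3 := mul_nonneg (by positivity : 0 ≤ bM s * s.η / 2 / alpha K s (n + 1)) h3
  have g4 := mul_nonneg (by positivity : 0 ≤ s.η * (2 * Lhat K s ^ 2 + kappa K s ^ 2) *
    driftWeight s n / alpha K s (n + 1)) h4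
  have g5 := mul_nonneg (by positivity : 0 ≤ 8 * (s.I : ℝ) ^ 2 * s.η ^ 2 *
    (s.η * (2 * Lhat K s ^ 2 + kappa K s ^ 2)) * driftWeight s n * alpha K s (n + 1)) h5
  unfold potential
  linarith

/-- The part of the initial potential that comes from the first estimates. -/
noncomputable def initNoise (K : Constants) (s : Config) : ℝ :=
  3 / 10 * bM s * Lhat K s ^ 2 / K.L ^ 2 * (1 / (s.b₁ * s.M) * (2 * K.σ ^ 2)) +
    bM s / 2 * (1 / (s.b₁ * s.M) * (2 * ((1 + kappa K s) * K.Cf) ^ 2))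

/-- All clients start from the same point with an averaged hypergradient momentum, so both drifts
vanish at time `1` and only the initial lower-level error and the errors of the first batches
remain. -/
theorem Assumptions.potential_zero_le (hK : K.Valid) (hc : 0 < c₀) (hs : s.Admissible K c₀)
    (hA : Assumptions K s.μ P) (hS : IsSampling P Pr ξf ξg) (hI : GoodInit K s P x₁ y₁) :
    potential K s P Pr ξf ξg x₁ y₁ 0 ≤ P.h x₁ +
      6 * s.η * Lhat K s ^ 2 / (s.γ * s.μ) * (K.Δy / kappa K s) +
      s.η * (1 / alpha K s 1) * initNoise K s := by
  have hη := eta_pos hK hc hs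
  have hγ := gamma_pos hK hc hs
  have hμ := hs.μ_pos
  have ha := alpha_pos hK hs 1
  have hβ := one_le_bM hs
  have ex : ∀ ω, avg (traj K s P ξf ξg x₁ y₁ 0 ω).x = x₁ := fun ω => avg_const hs.M_pos x₁
  have h0 : ∫ ω, P.h (avg (traj K s P ξf ξg x₁ y₁ 0 ω).x) ∂Pr = P.h x₁ := by simp [ex]
  have h1 : ∫ ω, errY P (traj K s P ξf ξg x₁ y₁ 0 ω) ∂Pr ≤ K.Δy / kappa K s := by
    have : ∀ ω, errY P (traj K s P ξf ξg x₁ y₁ 0 ω) =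
        1 / (s.M : ℝ) * ∑ m, ‖y₁ - P.yStar m x₁‖ ^ 2 := fun ω => by
      rw [errY, ex]; rfl
    simp only [this, integral_const, probReal_univ, one_smul]
    exact hI.lower
  have h4 : ∫ ω, devX (traj K s P ξf ξg x₁ y₁ 0 ω) ∂Pr = 0 := by
    have : ∀ ω, devX (traj K s P ξf ξg x₁ y₁ 0 ω) = 0 := fun ω => by
      rw [devX, ex]; simp [msq, traj, run]
    simp [this]
  have h5 : ∫ ω, devNu (traj K s P ξf ξg x₁ y₁ 0 ω) ∂Pr = 0 := by
    have : ∀ ω, devNu (traj K s P ξf ξg x₁ y₁ 0 ω) = 0 := fun ω => by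
      have e : (traj K s P ξf ξg x₁ y₁ 0 ω).nu = fun _ => avg fun m =>
        hyperBatch s P (fun i => ξf i ω) (fun i => ξg i ω) s.b₁ 1 m x₁ y₁ := rfl
      rw [devNu, e, avg_const hs.M_pos]; simp [msq]
    simp [this]
  have g1 := mul_le_mul_of_nonneg_left h1
    (by positivity : 0 ≤ 6 * s.η * Lhat K s ^ 2 / (s.γ * s.μ))
  have g2 := mul_le_mul_of_nonneg_left (hA.integral_errOm_zero_le hK hs hS x₁ y₁)
    (by positivity : 0 ≤ 3 / 10 * bM s * s.η * Lhat K s ^ 2 / K.L ^ 2 / alpha K s 1)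
  have g3 := mul_le_mul_of_nonneg_left (hA.integral_errNu_zero_le hK hs hS x₁ y₁)
    (by positivity : 0 ≤ bM s * s.η / 2 / alpha K s 1)
  have e : s.η * (1 / alpha K s 1) * initNoise K s =
      3 / 10 * bM s * s.η * Lhat K s ^ 2 / K.L ^ 2 / alpha K s 1 *
        (1 / (s.b₁ * s.M) * (2 * K.σ ^ 2)) +
      bM s * s.η / 2 / alpha K s 1 *
        (1 / (s.b₁ * s.M) * (2 * ((1 + kappa K s) * K.Cf) ^ 2)) := by
    unfold initNoise; ring
  unfold potential
  rw [h0, h4, h5, e, mul_zero, mul_zero, zero_add]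
  linarith

theorem Assumptions.sum_hGrad_sq_le (hK : K.Valid) (hc : 0 < c₀) (hs : s.Admissible K c₀)
    (hA : Assumptions K s.μ P) (hS : IsSampling P Pr ξf ξg) (hI : GoodInit K s P x₁ y₁) (T : ℕ) :
    ∑ n ∈ Finset.range T, s.η * alpha K s (n + 1) / 2 *
        ∫ ω, ‖hGrad P (avg (traj K s P ξf ξg x₁ y₁ n ω).x)‖ ^ 2 ∂Pr ≤
      K.Δ + 6 * s.η * Lhat K s ^ 2 / (s.γ * s.μ) * (K.Δy / kappa K s) +
      s.η * (1 / alpha K s 1) * initNoise K s +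
      3 / 2 * s.η * G1 K s ^ 2 * (3 / 2 * (T * alpha K s T)) +
      s.η * noiseConst K s * (bM s ^ 2 / Lhat K s ^ 2 * Real.log ((T : ℝ) + 1)) := by
  have key : ∀ N : ℕ, ∑ n ∈ Finset.range N, s.η * alpha K s (n + 1) / 2 *
      ∫ ω, ‖hGrad P (avg (traj K s P ξf ξg x₁ y₁ n ω).x)‖ ^ 2 ∂Pr ≤
      potential K s P Pr ξf ξg x₁ y₁ 0 - potential K s P Pr ξf ξg x₁ y₁ N +
      3 / 2 * s.η * G1 K s ^ 2 * ∑ n ∈ Finset.range N, alpha K s (n + 1) +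
      s.η * noiseConst K s * ∑ n ∈ Finset.range N, alpha K s (n + 1) ^ 3 := fun N => by
    induction N with
    | zero => simp
    | succ n ih =>
      have := hA.potential_succ_le (y₁ := y₁) hK hc hs hS hI.gap n
      rw [Finset.sum_range_succ, Finset.sum_range_succ, Finset.sum_range_succ]
      linarith
  have hη := eta_pos hK hc hs
  have hn : 0 ≤ noiseConst K s := by unfold noiseConst; positivity
  have h1 := mul_le_mul_of_nonneg_left (sum_alpha_le hK hs T)
    (by positivity : 0 ≤ 3 / 2 * s.η * G1 K s ^ 2)
  have h2 := mul_le_mul_of_nonneg_left (sum_alpha_cube_le hK hs T)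
    (by positivity : 0 ≤ s.η * noiseConst K s)
  have h3 := hA.potential_zero_le hK hc hs hS hI
  have h4 := hA.le_potential (y₁ := y₁) hK hc hs hS hI.gap T
  linarith [key T]

theorem Assumptions.gradSq_eq (hK : K.Valid) (hs : s.Admissible K c₀) (hA : Assumptions K s.μ P)
    (n : ℕ) (ω : Ω) : gradSq K s P (fun i => ξf i ω) (fun i => ξg i ω) x₁ y₁ n =
      ‖hGrad P (avg (traj K s P ξf ξg x₁ y₁ n ω).x)‖ ^ 2 := by
  rw [gradSq, (hA.hasGradientAt_h hK hs.μ_pos _).gradient]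
  rfl

/-- The convergence bound with all parameters explicit. -/
theorem Assumptions.avgGradSq_le (hK : K.Valid) (hc : 0 < c₀) (hs : s.Admissible K c₀)
    (hA : Assumptions K s.μ P) (hS : IsSampling P Pr ξf ξg) (hI : GoodInit K s P x₁ y₁) {T : ℕ}
    (hT : 1 ≤ T) :
    avgGradSq K s P Pr ξf ξg x₁ y₁ T ≤ 2 / T * (1 / alpha K s T) *
      (1 / s.η * K.Δ + 6 * Lhat K s ^ 2 / (s.γ * s.μ) * (K.Δy / kappa K s) +
      1 / alpha K s 1 * initNoise K s +
      noiseConst K s * (bM s ^ 2 / Lhat K s ^ 2 * Real.log ((T : ℝ) + 1))) +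
      9 / 2 * G1 K s ^ 2 := by
  have hη := eta_pos hK hc hs
  have ha := alpha_pos hK hs T
  have hT' : (0 : ℝ) < T := by exact_mod_cast hT
  obtain ⟨Sg, hSg⟩ : ∃ S, S = ∑ n ∈ Finset.range (T - 1),
    ∫ ω, ‖hGrad P (avg (traj K s P ξf ξg x₁ y₁ n ω).x)‖ ^ 2 ∂Pr := ⟨_, rfl⟩
  have e1 : avgGradSq K s P Pr ξf ξg x₁ y₁ T = 1 / T * Sg := by
    rw [avgGradSq, hSg]
    simp only [hA.gradSq_eq hK hs]
  have h1 := hA.sum_hGrad_sq_le hK hc hs hS hI T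
  -- The learning rates decrease, so each may be replaced by the smallest one, `α_T`. The telescoped
  -- sum has one nonnegative term more than the average.
  have h2 : s.η * alpha K s T / 2 * Sg ≤ ∑ n ∈ Finset.range T, s.η * alpha K s (n + 1) / 2 *
        ∫ ω, ‖hGrad P (avg (traj K s P ξf ξg x₁ y₁ n ω).x)‖ ^ 2 ∂Pr := by
    rw [hSg, Finset.mul_sum]
    refine (Finset.sum_le_sum fun n hn => ?_).trans (Finset.sum_le_sum_of_subset_of_nonneg
      (Finset.range_subset_range.2 (Nat.sub_le T 1)) fun n _ _ => ?_)
    · have hn' : n + 1 ≤ T := by have := Finset.mem_range.1 hn; omega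
      have := alpha_antitone hK hs hn'
      refine mul_le_mul_of_nonneg_right ?_ (integral_nonneg fun _ => sq_nonneg _)
      have := mul_le_mul_of_nonneg_left this hη.le
      linarith
    · have := alpha_pos hK hs (n + 1)
      exact mul_nonneg (by positivity) (integral_nonneg fun _ => sq_nonneg _)
  rw [e1]
  refine le_of_mul_le_mul_left ?_ (by positivity : 0 < s.η * alpha K s T / 2 * T)
  have e2 : s.η * alpha K s T / 2 * T * (1 / T * Sg) = s.η * alpha K s T / 2 * Sg := by
    field_simp
  rw [e2]
  -- The bias carries the factor `T α_T` on both sides; after cancellation it appears with the pure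
  -- constant `9/2 = 2 · 3/2 · 3/2`.
  refine (h2.trans h1).trans (le_of_eq ?_)
  field_simp
  ring

end Telescope

/-! ### Orders of the parameters in `κ` -/

section ParameterBounds

variable {K : Constants} {c : ℝ}

theorem exists_Lhat_le (hK : K.Valid) (c : ℝ) :
    ∃ C, 1 ≤ C ∧ ∀ s : Config, s.Admissible K c → Lhat K s ≤ C * kappa K s ^ 2 := by
  have hL := hK.L_pos
  have hCf := hK.Cf_nonneg
  have hxy := hK.Lxy_nonneg
  have hyy := hK.Lyy_nonneg
  refine ⟨1 + 2 * K.L + K.Lxy * K.Cf / K.L + K.Lyy * K.Cf / K.L, ?_, fun s hs => ?_⟩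
  · have h1 : 0 ≤ K.Lxy * K.Cf / K.L := by positivity
    have h2 : 0 ≤ K.Lyy * K.Cf / K.L := by positivity
    linarith
  have hμ := hs.μ_pos
  have hκ := one_le_kappa hs
  have hκ2 : kappa K s ≤ kappa K s ^ 2 := le_self_pow₀ hκ two_ne_zero
  have h0 : 1 ≤ kappa K s ^ 2 := hκ.trans hκ2
  have e : K.L + K.L ^ 2 / s.μ + K.Lxy * K.Cf / s.μ + K.L * K.Lyy * K.Cf / s.μ ^ 2 =
      K.L * 1 + K.L * kappa K s + K.Lxy * K.Cf / K.L * kappa K s +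
        K.Lyy * K.Cf / K.L * kappa K s ^ 2 := by
    unfold kappa; field_simp
  have g1 := mul_le_mul_of_nonneg_left h0 hL.le
  have g2 := mul_le_mul_of_nonneg_left hκ2 hL.le
  have g3 := mul_le_mul_of_nonneg_left hκ2 (by positivity : 0 ≤ K.Lxy * K.Cf / K.L)
  have g4 : 0 ≤ K.Lxy * K.Cf / K.L * kappa K s ^ 2 := by positivity
  have g5 : 0 ≤ K.Lyy * K.Cf / K.L * kappa K s ^ 2 := by positivity
  have g6 : 0 ≤ K.L * kappa K s ^ 2 := by positivity
  refine max_le ?_ ?_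
  · linarith
  · rw [e]; linarith

/-- Multiplication by `bM` removes all dependence on `b`, `M` and `I`; the learning rates later
provide exactly this factor. -/
theorem cNu_mul_bM_le (hs : s.Admissible K c) : cNu K s * bM s ≤ 4 * Lhat K s := by
  have hβ := one_le_bM hs
  have hI := one_le_I hs
  have hΛ := one_le_Lhat K s
  have e : cNu K s * bM s = 32 / 9 + Lhat K s * (1 / (24 * ((s.I : ℝ) * bM s))) := by
    unfold cNu; field_simp
  have h : 1 / (24 * ((s.I : ℝ) * bM s)) ≤ 1 / 24 := by
    have := one_le_mul_of_one_le_of_one_le hI hβ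
    exact one_div_le_one_div_of_le (by norm_num) (by linarith)
  have := mul_le_mul_of_nonneg_left h (zero_le_one.trans hΛ)
  rw [e]; linarith

theorem cNu_le (hs : s.Admissible K c) : cNu K s ≤ 4 * Lhat K s :=
  (le_mul_of_one_le_right (cNu_pos hs).le (one_le_bM hs)).trans (cNu_mul_bM_le hs)

theorem cOmega_mul_bM_le (hs : s.Admissible K c) :
    cOmega K s * bM s ≤ 144 * kappa K s ^ 2 + Lhat K s := by
  have hβ := one_le_bM hs
  have hI := one_le_I hs
  have hΛ := one_le_Lhat K s
  have hμ := hs.μ_pos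
  have e : cOmega K s * bM s =
      144 * kappa K s ^ 2 + Lhat K s * (1 / (24 * ((s.I : ℝ) * bM s))) := by
    unfold cOmega kappa; field_simp
  have h : 1 / (24 * ((s.I : ℝ) * bM s)) ≤ 1 := by
    have := one_le_mul_of_one_le_of_one_le hI hβ
    rw [div_le_one (by linarith)]; linarith
  have := mul_le_mul_of_nonneg_left h (zero_le_one.trans hΛ)
  rw [e]; linarith

theorem cOmega_le (hs : s.Admissible K c) : cOmega K s ≤ 144 * kappa K s ^ 2 + Lhat K s :=
  (le_mul_of_one_le_right (cOmega_pos hs).le (one_le_bM hs)).trans (cOmega_mul_bM_le hs)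

theorem inv_gamma_mul_le (hK : K.Valid) (hc : 0 < c) (hs : s.Admissible K c) :
    1 / (s.μ * s.γ) ≤ 2 / c * kappa K s := by
  have hγ := gamma_pos hK hc hs
  have hμ := hs.μ_pos
  have hL := hK.L_pos
  have h : c ≤ s.γ * (2 * K.L) := by
    have := mul_le_mul_of_nonneg_right hs.γ_ge (by positivity : 0 ≤ 2 * K.L)
    rwa [mul_assoc, one_div_mul_cancel (by positivity), mul_one] at this
  unfold kappa
  rw [div_mul_div_comm, div_le_div_iff₀ (by positivity) (by positivity)]
  have := mul_le_mul_of_nonneg_right h hμ.le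
  linarith

theorem sqrt_C1_le (hK : K.Valid) (hc : 0 < c) (hs : s.Admissible K c) :
    Real.sqrt (C1 K s) ≤ (5 + 51 / c) * (kappa K s ^ 2 * Lhat K s) := by
  have hκ := one_le_kappa hs
  have hΛ := one_le_Lhat K s
  have hμ := hs.μ_pos
  have hγ := gamma_pos hK hc hs
  refine Real.sqrt_le_iff.2 ⟨by positivity, ?_⟩
  -- `51` is the least integer whose square exceeds `648 · 4 = 2592`.
  have h1 : 648 * kappa K s ^ 2 * Lhat K s ^ 2 / (s.μ ^ 2 * s.γ ^ 2) ≤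
      (51 / c * (kappa K s ^ 2 * Lhat K s)) ^ 2 := by
    have := pow_le_pow_left₀ (by positivity) (inv_gamma_mul_le hK hc hs) 2
    have := mul_le_mul_of_nonneg_left this (by positivity : 0 ≤ 648 * kappa K s ^ 2 * Lhat K s ^ 2)
    have e : 648 * kappa K s ^ 2 * Lhat K s ^ 2 * (1 / (s.μ * s.γ)) ^ 2 =
      648 * kappa K s ^ 2 * Lhat K s ^ 2 / (s.μ ^ 2 * s.γ ^ 2) := by
      field_simp
    have e2 : 648 * kappa K s ^ 2 * Lhat K s ^ 2 * (2 / c * kappa K s) ^ 2 =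
      2592 * (1 / c * (kappa K s ^ 2 * Lhat K s)) ^ 2 := by ring
    have e3 : (51 / c * (kappa K s ^ 2 * Lhat K s)) ^ 2 =
      2601 * (1 / c * (kappa K s ^ 2 * Lhat K s)) ^ 2 := by ring
    have : 0 ≤ (1 / c * (kappa K s ^ 2 * Lhat K s)) ^ 2 := sq_nonneg _
    linarith
  have hκΛ : Lhat K s ≤ kappa K s ^ 2 * Lhat K s :=
    le_mul_of_one_le_left (by linarith) (one_le_pow₀ hκ)
  have hκΛ' : kappa K s ≤ kappa K s ^ 2 * Lhat K s :=
    (le_self_pow₀ hκ two_ne_zero).trans (le_mul_of_one_le_right (by positivity) hΛ)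
  have h2 := pow_le_pow_left₀ (by linarith) hκΛ 2
  have h3 := pow_le_pow_left₀ (by linarith) hκΛ' 2
  have h4 : 0 ≤ (kappa K s ^ 2 * Lhat K s) * (51 / c * (kappa K s ^ 2 * Lhat K s)) := by positivity
  have h5 : 0 ≤ (kappa K s ^ 2 * Lhat K s) ^ 2 := sq_nonneg _
  have e : ((5 + 51 / c) * (kappa K s ^ 2 * Lhat K s)) ^ 2 = 25 * (kappa K s ^ 2 * Lhat K s) ^ 2 +
    10 * ((kappa K s ^ 2 * Lhat K s) * (51 / c * (kappa K s ^ 2 * Lhat K s))) +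
    (51 / c * (kappa K s ^ 2 * Lhat K s)) ^ 2 := by ring
  unfold C1
  rw [e]
  linarith

/-- Each of the seven entries of `etaMax` has a reciprocal of order at most `κ² L̂`. The largest
constants come from the first entry, with `288 / c`, and from `√C1`, taken four times because `c_ν ≤
4 L̂`. -/
theorem inv_eta_le (hK : K.Valid) (hc : 0 < c) (hs : s.Admissible K c) :
    1 / s.η ≤ 1 / c * (300 + 300 / c) * (kappa K s ^ 2 * Lhat K s) := by
  have hκ := one_le_kappa hs
  have hΛ := one_le_Lhat K s
  have hμ := hs.μ_pos
  have hγ := gamma_pos hK hc hs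
  have hν := cNu_pos hs
  have hC := Real.sqrt_pos.2 (C1_pos hs)
  have hLb : 0 < Lbar K s := by unfold Lbar; positivity
  have hs1 := sqrt_C1_le hK hc hs
  have hκ2 : kappa K s ≤ kappa K s ^ 2 := le_self_pow₀ hκ two_ne_zero
  have hκΛ : kappa K s * Lhat K s ≤ kappa K s ^ 2 * Lhat K s :=
    mul_le_mul_of_nonneg_right hκ2 (by linarith)
  have hκΛ1 : 1 ≤ kappa K s ^ 2 * Lhat K s := one_le_mul_of_one_le_of_one_le (one_le_pow₀ hκ) hΛ
  have hκΛ2 : Lhat K s ≤ kappa K s ^ 2 * Lhat K s :=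
    le_mul_of_one_le_left (by linarith) (one_le_pow₀ hκ)
  have hκκ : kappa K s ≤ kappa K s ^ 2 * Lhat K s :=
    hκ2.trans (le_mul_of_one_le_right (by positivity) hΛ)
  obtain ⟨X, hX⟩ : ∃ X, X = kappa K s ^ 2 * Lhat K s := ⟨_, rfl⟩
  obtain ⟨q, hq⟩ : ∃ q, q = 1 / c := ⟨_, rfl⟩
  have hq0 : 0 < q := by rw [hq]; positivity
  have hq3 : 300 + 300 / c = 300 + 300 * q := by rw [hq]; ring
  have hq5 : 5 + 51 / c = 5 + 51 * q := by rw [hq]; ring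
  rw [← hX] at hκΛ hκΛ1 hκΛ2 hκκ hs1 ⊢
  rw [hq5] at hs1
  have hqX : 0 ≤ q * X := by positivity
  have hX0 : 0 < X := by linarith
  set B := (300 + 300 * q) * X with hB
  have hB0 : 0 < B := by positivity
  have hs2 : 4 * Real.sqrt (C1 K s) ≤ B := by rw [hB]; linarith
  have key : 1 / B ≤ etaMax K s := by
    have inv : ∀ {r t : ℝ}, 0 < t → t * r = 1 → t ≤ B → 1 / B ≤ r := fun {r t} ht hr hle => by
      rw [show r = 1 / t by rw [eq_div_iff ht.ne', mul_comm]; exact hr]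
      exact one_div_le_one_div_of_le ht hle
    unfold etaMax
    refine le_min ?_ (le_min ?_ (le_min ?_ (le_min ?_ (le_min ?_ (le_min ?_ ?_)))))
    · refine inv (t := 144 * kappa K s * Lhat K s * (1 / (s.μ * s.γ))) (by positivity)
        (by field_simp) ?_
      refine (mul_le_mul_of_nonneg_left (inv_gamma_mul_le hK hc hs) (by positivity)).trans ?_
      have : 144 * kappa K s * Lhat K s * (2 / c * kappa K s) = 288 * (q * X) := by
        rw [hX, hq]; ring
      rw [this, hB]; linarith
    · refine inv (t := kappa K s * cNu K s / Lhat K s ^ 2) (by positivity) (by field_simp) ?_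
      rw [div_le_iff₀ (by positivity)]
      have h1 := mul_le_mul_of_nonneg_left (cNu_le hs) (by linarith : 0 ≤ kappa K s)
      have h2 : 4 * kappa K s ≤ B := by rw [hB]; linarith
      have h3 := mul_le_mul_of_nonneg_right h2 (by positivity : 0 ≤ Lhat K s)
      have h4 : B * Lhat K s ≤ B * Lhat K s ^ 2 :=
        mul_le_mul_of_nonneg_left (le_self_pow₀ hΛ two_ne_zero) hB0.le
      linarith
    · refine inv (t := Real.sqrt (C1 K s) * cNu K s / Lhat K s ^ 2) (by positivity)
        (by field_simp) ?_
      rw [div_le_iff₀ (by positivity)]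
      have h1 := mul_le_mul_of_nonneg_left (cNu_le hs) hC.le
      have h3 := mul_le_mul_of_nonneg_right hs2 (by positivity : 0 ≤ Lhat K s)
      have h4 : B * Lhat K s ≤ B * Lhat K s ^ 2 :=
        mul_le_mul_of_nonneg_left (le_self_pow₀ hΛ two_ne_zero) hB0.le
      linarith
    · exact inv (t := Real.sqrt (C1 K s)) hC (by field_simp) (by linarith)
    · refine inv (t := Real.sqrt (C1 K s) / Lhat K s) (by positivity) (by field_simp) ?_
      exact (div_le_self hC.le hΛ).trans (by linarith)
    · refine inv (t := 2 * Lbar K s) (by positivity) (by field_simp) ?_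
      unfold Lbar
      rw [hB]; linarith
    · exact inv one_pos (by norm_num) (by rw [hB]; linarith)
  have h2 : c * (1 / B) ≤ s.η := (mul_le_mul_of_nonneg_left key hc.le).trans hs.η_ge
  have h3 := one_div_le_one_div_of_le (by positivity) h2
  refine h3.trans (le_of_eq ?_)
  rw [hq3, mul_assoc, ← hB]
  field_simp

end ParameterBounds

/-! ### The convergence rate -/

section Rates

variable {K : Constants} {c : ℝ}

theorem rpow_three_half_le {x y : ℝ} (hx : 0 ≤ x) (hy : 0 ≤ y) (h : x ≤ y ^ 2) :
    x ^ (3 / 2 : ℝ) ≤ y ^ 3 := by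
  refine le_of_sq_le_sq ?_ (by positivity)
  rw [rpow_three_half_sq hx]
  exact (pow_le_pow_left₀ hx h 3).trans (le_of_eq (by ring))

/-- In `1 / α³ = L̂² (ū + t / (bM)²)` the factor `L̂²` is of order `κ⁴` and `ū` is at most of order
`κ³ I^{9/2}`, the `κ³` being forced by `c^{3/2}` with `c` of order `κ²`. The cube root of the sum is
at most the sum of the cube roots. -/
theorem exists_inv_alpha_le (hK : K.Valid) (c : ℝ) : ∃ C, 1 ≤ C ∧
    ∀ s : Config, s.Admissible K c → ∀ t : ℕ, 1 / alpha K s t ≤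
      C * (kappa K s ^ (4 / 3 : ℝ) * (kappa K s * (s.I : ℝ) ^ (3 / 2 : ℝ) +
        (t : ℝ) ^ (1 / 3 : ℝ) / bM s ^ (2 / 3 : ℝ))) := by
  obtain ⟨CΛ, hC1, hΛC⟩ := exists_Lhat_le hK c
  obtain ⟨R, hR⟩ : ∃ R, R = 144 + 4 * CΛ := ⟨_, rfl⟩
  have hR1 : 148 ≤ R := by linarith
  refine ⟨R * R, one_le_mul_of_one_le_of_one_le (by linarith) (by linarith),
    fun s hs t => ?_⟩
  have hκ := one_le_kappa hs
  have hΛ := one_le_Lhat K s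
  have hI := one_le_I hs
  have hβ := one_le_bM hs
  have hΛs := hΛC s hs
  have hα := alpha_pos hK hs t
  have hJ3 : (s.I : ℝ) ^ (9 / 2 : ℝ) = ((s.I : ℝ) ^ (3 / 2 : ℝ)) ^ 3 :=
    rpow_nine_half_eq (by positivity)
  have hJ : 1 ≤ (s.I : ℝ) ^ (3 / 2 : ℝ) := Real.one_le_rpow hI (by norm_num)
  obtain ⟨J, hJd⟩ : ∃ J, J = (s.I : ℝ) ^ (3 / 2 : ℝ) := ⟨_, rfl⟩
  obtain ⟨κ, hκd⟩ : ∃ k, k = kappa K s := ⟨_, rfl⟩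
  obtain ⟨Λ, hΛd⟩ : ∃ k, k = Lhat K s := ⟨_, rfl⟩
  have hcν := cNu_le hs
  have hcω := cOmega_le hs
  have hν0 := cNu_pos hs
  have hω0 := cOmega_pos hs
  rw [← hJd] at hJ3 hJ ⊢
  rw [← hκd] at hκ hΛs hcω ⊢
  rw [← hΛd] at hΛ hΛs hcω hcν
  have hκ2 : 1 ≤ κ ^ 2 := one_le_pow₀ hκ
  have hJ3' : 1 ≤ J ^ 3 := one_le_pow₀ hJ
  have hκ3 : 1 ≤ κ ^ 3 := one_le_pow₀ hκ
  have hκ23 : κ ^ 2 ≤ κ ^ 3 := pow_le_pow_right₀ hκ (by norm_num)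
  have hRR : R ≤ R ^ 2 := le_self_pow₀ (by linarith) two_ne_zero
  have hR3 : 20000 * R ≤ R ^ 3 := by
    have := pow_le_pow_left₀ (by norm_num) hR1 2
    have := mul_le_mul_of_nonneg_right this (by linarith : 0 ≤ R)
    linarith
  have hRκ : R ^ 3 * κ ^ 3 ≤ (R * κ * J) ^ 3 :=
    (le_mul_of_one_le_right (by positivity) hJ3').trans (le_of_eq (by ring))
  have hsq : R * κ ^ 2 ≤ (R * κ) ^ 2 := by
    rw [mul_pow]; exact mul_le_mul_of_nonneg_right hRR (by positivity)
  have hu : uBar K s ≤ (R * κ * J) ^ 3 := by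
    unfold uBar
    rw [hJ3, ← hΛd]
    refine max_le (max_le ?_ ?_) (max_le ?_ ?_)
    · have : 2 * 1 ≤ R ^ 3 * κ ^ 3 := mul_le_mul (by linarith) hκ3 zero_le_one (by positivity)
      linarith
    · have h1 : 16 ^ 3 * J ^ 3 * Λ ≤ 16 ^ 3 * J ^ 3 * (CΛ * κ ^ 2) := by gcongr
      have h2 : 16 ^ 3 * J ^ 3 * (CΛ * κ ^ 2) ≤ 16 ^ 3 * J ^ 3 * (R * κ ^ 3) := by
        gcongr; linarith
      have h3 : 16 ^ 3 * R * (κ ^ 3 * J ^ 3) ≤ R ^ 3 * (κ ^ 3 * J ^ 3) := by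
        refine mul_le_mul_of_nonneg_right ?_ (by positivity); linarith
      rw [mul_pow, mul_pow]
      linarith
    · refine (rpow_three_half_le hν0.le (by positivity : 0 ≤ R * κ) ?_).trans
        (by rw [mul_pow]; exact hRκ)
      have : 4 * CΛ * κ ^ 2 ≤ R * κ ^ 2 := mul_le_mul_of_nonneg_right (by linarith) (by positivity)
      linarith
    · refine (rpow_three_half_le hω0.le (by positivity : 0 ≤ R * κ) ?_).trans
        (by rw [mul_pow]; exact hRκ)
      have : (144 + CΛ) * κ ^ 2 ≤ R * κ ^ 2 :=
        mul_le_mul_of_nonneg_right (by linarith) (by positivity)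
      linarith
  have hk4 : (κ ^ (4 / 3 : ℝ)) ^ 3 = κ ^ 4 := by
    rw [← Real.rpow_natCast, ← Real.rpow_mul (by positivity), ← Real.rpow_natCast]; norm_num
  have hθ := rpow_third_cube (Nat.cast_nonneg (α := ℝ) t)
  have hb := rpow_two_third_cube (x := bM s) (by positivity)
  have hk0 : 0 < κ ^ (4 / 3 : ℝ) := by positivity
  have hθ0 : 0 ≤ (t : ℝ) ^ (1 / 3 : ℝ) := by positivity
  have hb0 : 0 < bM s ^ (2 / 3 : ℝ) := by positivity
  obtain ⟨k, hk⟩ : ∃ k, k = κ ^ (4 / 3 : ℝ) := ⟨_, rfl⟩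
  obtain ⟨q, hq⟩ : ∃ q, q = (t : ℝ) ^ (1 / 3 : ℝ) / bM s ^ (2 / 3 : ℝ) := ⟨_, rfl⟩
  have hq3 : (t : ℝ) / bM s ^ 2 = q ^ 3 := by rw [hq, div_pow, hθ, hb]
  have hq0 : 0 ≤ q := by rw [hq]; positivity
  rw [← hk] at hk4 hk0 ⊢
  rw [← hq]
  have main : 1 / alpha K s t ≤ R * k * (R * κ * J + q) := by
    refine le_of_pow_le_pow_left₀ three_ne_zero (by positivity) ?_
    rw [inv_alpha_cube hK hs, ← hΛd, hq3]
    have h1 : Λ ^ 2 ≤ (R * k) ^ 3 := by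
      have h2 := pow_le_pow_left₀ (by linarith) hΛs 2
      have h3 : CΛ ^ 2 ≤ R ^ 3 :=
        (pow_le_pow_left₀ (by linarith) (by linarith : CΛ ≤ R) 2).trans
          (pow_le_pow_right₀ (by linarith) (by norm_num))
      rw [mul_pow, hk4]
      have := mul_le_mul_of_nonneg_right h3 (by positivity : 0 ≤ κ ^ 4)
      refine h2.trans (le_trans (le_of_eq (by ring)) this)
    have h4 : uBar K s + q ^ 3 ≤ (R * κ * J + q) ^ 3 := by
      have h5 : 0 ≤ R * κ * J := by positivity
      have h6 : 0 ≤ 3 * (R * κ * J) ^ 2 * q + 3 * (R * κ * J) * q ^ 2 := by positivity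
      have h7 : (R * κ * J + q) ^ 3 = (R * κ * J) ^ 3 + (3 * (R * κ * J) ^ 2 * q +
        3 * (R * κ * J) * q ^ 2) + q ^ 3 := by ring
      linarith
    have h8 : 0 ≤ uBar K s + q ^ 3 := add_nonneg (by linarith [two_le_uBar K s]) (by positivity)
    rw [mul_pow]
    exact mul_le_mul h1 h4 h8 (by positivity)
  refine main.trans ?_
  have h9 : q ≤ R * q := le_mul_of_one_le_left hq0 (by linarith)
  have h10 := mul_le_mul_of_nonneg_left (by linarith : R * κ * J + q ≤ R * (κ * J + q))
    (by positivity : 0 ≤ R * k)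
  exact h10.trans (le_of_eq (by ring))

/-- The factor `(bM)²` from the learning rates cancels the `1 / bM` in both momentum parameters:
`c_ω bM` is of order `κ²` and `c_ν bM / L̂` is bounded. -/
theorem exists_noise_le (hK : K.Valid) (c : ℝ) : ∃ C, 0 ≤ C ∧
    ∀ s : Config, s.Admissible K c →
      noiseConst K s * (bM s ^ 2 / Lhat K s ^ 2) ≤ C * kappa K s ^ 4 := by
  obtain ⟨CΛ, hC1, hΛC⟩ := exists_Lhat_le hK c
  have hL := hK.L_pos
  refine ⟨(144 + CΛ) ^ 2 * K.σ ^ 2 / K.L ^ 2 + 128 * K.Cf ^ 2, by positivity, fun s hs => ?_⟩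
  have hκ := one_le_kappa hs
  have hΛ := one_le_Lhat K s
  have hΛs := hΛC s hs
  have hν0 := cNu_pos hs
  have hω0 := cOmega_pos hs
  have hβ := one_le_bM hs
  have h1 : (cOmega K s * bM s) ^ 2 ≤ ((144 + CΛ) * kappa K s ^ 2) ^ 2 :=
    pow_le_pow_left₀ (by positivity) ((cOmega_mul_bM_le hs).trans (by linarith)) 2
  have h2 : (cNu K s * bM s / Lhat K s) ^ 2 ≤ 4 ^ 2 :=
    pow_le_pow_left₀ (by positivity) ((div_le_iff₀ (by linarith)).2 (cNu_mul_bM_le hs)) 2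
  have h3 : ((1 + kappa K s) * K.Cf) ^ 2 ≤ 4 * K.Cf ^ 2 * kappa K s ^ 4 := by
    have h4 : (1 + kappa K s) ^ 2 ≤ (2 * kappa K s) ^ 2 :=
      pow_le_pow_left₀ (by positivity) (by linarith) 2
    have h5 : kappa K s ^ 2 ≤ kappa K s ^ 4 := pow_le_pow_right₀ hκ (by norm_num)
    have h6 := mul_le_mul_of_nonneg_left (h4.trans (by linarith :
      (2 * kappa K s) ^ 2 ≤ 4 * kappa K s ^ 4)) (sq_nonneg K.Cf)
    rw [mul_pow]
    linarith
  have e : noiseConst K s * (bM s ^ 2 / Lhat K s ^ 2) =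
      K.σ ^ 2 / K.L ^ 2 * (cOmega K s * bM s) ^ 2 +
      2 * ((cNu K s * bM s / Lhat K s) ^ 2 * ((1 + kappa K s) * K.Cf) ^ 2) := by
    unfold noiseConst
    field_simp
  have g1 := mul_le_mul_of_nonneg_left h1 (by positivity : 0 ≤ K.σ ^ 2 / K.L ^ 2)
  have g2 := mul_le_mul h2 h3 (sq_nonneg _) (by norm_num)
  rw [e]
  have e2 : K.σ ^ 2 / K.L ^ 2 * ((144 + CΛ) * kappa K s ^ 2) ^ 2 =
    (144 + CΛ) ^ 2 * K.σ ^ 2 / K.L ^ 2 * kappa K s ^ 4 := by ring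
  linarith

/-- This is where the size of the first batch matters: `1 / α_1` is of order `κ^{7/3} I^{3/2}`, and
the lower bound on `b₁ / b` compensates precisely that. -/
theorem exists_initNoise_le (hK : K.Valid) (c : ℝ) : ∃ C, 0 ≤ C ∧
    ∀ s : Config, s.Admissible K c →
      1 / alpha K s 1 * initNoise K s ≤ C * kappa K s ^ 4 := by
  obtain ⟨CΛ, hC1, hΛC⟩ := exists_Lhat_le hK c
  obtain ⟨Cα, hCα, hα⟩ := exists_inv_alpha_le hK c
  have hL := hK.L_pos
  refine ⟨Cα * 2 * (3 / 5 * CΛ ^ 2 * K.σ ^ 2 / K.L ^ 2 + 4 * K.Cf ^ 2), by positivity,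
    fun s hs => ?_⟩
  have hκ := one_le_kappa hs
  have hΛ := one_le_Lhat K s
  have hΛs := hΛC s hs
  have hβ := one_le_bM hs
  have hI := one_le_I hs
  have hM : (1 : ℝ) ≤ s.M := by exact_mod_cast hs.M_pos
  have hb : (1 : ℝ) ≤ s.b := by exact_mod_cast hs.b_pos
  have hb₁ : (0 : ℝ) < s.b₁ := by exact_mod_cast hs.b₁_pos hK
  have hα1 := alpha_pos hK hs 1
  have hJ : 1 ≤ (s.I : ℝ) ^ (3 / 2 : ℝ) := Real.one_le_rpow hI (by norm_num)
  have h1 : 1 / alpha K s 1 ≤ Cα * 2 * (kappa K s ^ (7 / 3 : ℝ) * (s.I : ℝ) ^ (3 / 2 : ℝ)) := by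
    refine (hα s hs 1).trans ?_
    have h2 : ((1 : ℕ) : ℝ) ^ (1 / 3 : ℝ) / bM s ^ (2 / 3 : ℝ) ≤
        kappa K s * (s.I : ℝ) ^ (3 / 2 : ℝ) := by
      rw [Nat.cast_one, Real.one_rpow]
      exact (div_le_one_of_le₀ (Real.one_le_rpow hβ (by norm_num)) (by positivity)).trans
        (one_le_mul_of_one_le_of_one_le hκ hJ)
    have h3 : kappa K s ^ (7 / 3 : ℝ) = kappa K s ^ (4 / 3 : ℝ) * kappa K s := by
      rw [← Real.rpow_add_one (by positivity)]; norm_num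
    have h4 : 0 < kappa K s ^ (4 / 3 : ℝ) := by positivity
    rw [h3]
    have h5 := mul_le_mul_of_nonneg_left h2 (by positivity : 0 ≤ Cα * kappa K s ^ (4 / 3 : ℝ))
    linarith
  have h2 : initNoise K s ≤ (3 / 5 * CΛ ^ 2 * K.σ ^ 2 / K.L ^ 2 + 4 * K.Cf ^ 2) * kappa K s ^ 4 *
      (s.b / s.b₁) := by
    have e : initNoise K s = (3 / 5 * K.σ ^ 2 / K.L ^ 2 * Lhat K s ^ 2 +
        ((1 + kappa K s) * K.Cf) ^ 2) * (s.b / s.b₁) := by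
      unfold initNoise bM; field_simp; ring
    rw [e]
    refine mul_le_mul_of_nonneg_right ?_ (by positivity)
    have h3 := mul_le_mul_of_nonneg_left (pow_le_pow_left₀ (by linarith) hΛs 2)
      (by positivity : 0 ≤ 3 / 5 * K.σ ^ 2 / K.L ^ 2)
    have h4 : (1 + kappa K s) ^ 2 ≤ (2 * kappa K s) ^ 2 :=
      pow_le_pow_left₀ (by positivity) (by linarith) 2
    have h5 : kappa K s ^ 2 ≤ kappa K s ^ 4 := pow_le_pow_right₀ hκ (by norm_num)
    have h6 := mul_le_mul_of_nonneg_left (h4.trans (by linarith :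
      (2 * kappa K s) ^ 2 ≤ 4 * kappa K s ^ 4)) (sq_nonneg K.Cf)
    have e2 : 3 / 5 * K.σ ^ 2 / K.L ^ 2 * (CΛ * kappa K s ^ 2) ^ 2 =
      3 / 5 * CΛ ^ 2 * K.σ ^ 2 / K.L ^ 2 * kappa K s ^ 4 := by ring
    rw [mul_pow]
    linarith
  have h3 : kappa K s ^ (7 / 3 : ℝ) * (s.I : ℝ) ^ (3 / 2 : ℝ) * (s.b / s.b₁) ≤ 1 := by
    rw [← mul_div_assoc, div_le_one hb₁]
    refine le_trans (le_of_eq (by ring)) hs.b₁_ge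
  obtain ⟨X, hX⟩ : ∃ X, X = kappa K s ^ (7 / 3 : ℝ) * (s.I : ℝ) ^ (3 / 2 : ℝ) := ⟨_, rfl⟩
  have hX0 : 0 < X := by rw [hX]; positivity
  rw [← hX] at h1 h3
  have hD : 0 ≤ 3 / 5 * CΛ ^ 2 * K.σ ^ 2 / K.L ^ 2 + 4 * K.Cf ^ 2 := by positivity
  obtain ⟨Dn, hDn⟩ : ∃ D, D = 3 / 5 * CΛ ^ 2 * K.σ ^ 2 / K.L ^ 2 + 4 * K.Cf ^ 2 := ⟨_, rfl⟩
  rw [← hDn] at h2 hD ⊢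
  have h4 := mul_le_mul_of_nonneg_left h2 (by positivity : 0 ≤ 1 / alpha K s 1)
  have h5 := mul_le_mul_of_nonneg_right h1
    (by positivity : 0 ≤ Dn * kappa K s ^ 4 * (s.b / s.b₁))
  have h6 := mul_le_mul_of_nonneg_left h3 (by positivity : 0 ≤ Cα * 2 * Dn * kappa K s ^ 4)
  refine (h4.trans h5).trans (le_trans (le_of_eq ?_) (h6.trans (le_of_eq ?_))) <;> ring

/-- Every summand is of order `κ⁴`. For the lower-level term the factor `1 / (γ μ)` costs one `κ`,
which the initialization within `Δy / κ` gives back. The terms without `l` are absorbed using `l ≥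
1/2`. -/
theorem exists_bracket_le (hK : K.Valid) (hc : 0 < c) : ∃ C, 0 ≤ C ∧
    ∀ s : Config, s.Admissible K c → ∀ l : ℝ, 1 / 2 ≤ l →
      1 / s.η * K.Δ + 6 * Lhat K s ^ 2 / (s.γ * s.μ) * (K.Δy / kappa K s) +
      1 / alpha K s 1 * initNoise K s + noiseConst K s * (bM s ^ 2 / Lhat K s ^ 2 * l) ≤
      C * (kappa K s ^ 4 * l) := by
  obtain ⟨CΛ, hC1, hΛC⟩ := exists_Lhat_le hK c
  obtain ⟨Ci, hCi, hi⟩ := exists_initNoise_le hK c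
  obtain ⟨Cn, hCn, hn⟩ := exists_noise_le hK c
  refine ⟨2 * (1 / c * (300 + 300 / c) * CΛ * |K.Δ|) + 24 / c * CΛ ^ 2 * |K.Δy| + 2 * Ci + Cn,
    by positivity, fun s hs l hl => ?_⟩
  have hκ := one_le_kappa hs
  have hΛ := one_le_Lhat K s
  have hΛs := hΛC s hs
  have hη := eta_pos hK hc hs
  have hγ := gamma_pos hK hc hs
  have hμ := hs.μ_pos
  have h1 : 1 / s.η * K.Δ ≤ 1 / c * (300 + 300 / c) * CΛ * |K.Δ| * kappa K s ^ 4 := by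
    have g1 := mul_le_mul_of_nonneg_left (le_abs_self K.Δ) (by positivity : 0 ≤ 1 / s.η)
    have g2 := mul_le_mul_of_nonneg_right (inv_eta_le hK hc hs) (abs_nonneg K.Δ)
    have g3 := mul_le_mul_of_nonneg_left hΛs
      (by positivity : 0 ≤ 1 / c * (300 + 300 / c) * kappa K s ^ 2 * |K.Δ|)
    linarith
  have h2 : 6 * Lhat K s ^ 2 / (s.γ * s.μ) * (K.Δy / kappa K s) ≤
      12 / c * CΛ ^ 2 * |K.Δy| * kappa K s ^ 4 := by
    have g0 : K.Δy / kappa K s ≤ |K.Δy| / kappa K s := by gcongr; exact le_abs_self _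
    have g1 := mul_le_mul_of_nonneg_left g0
      (by positivity : 0 ≤ 6 * Lhat K s ^ 2 / (s.γ * s.μ))
    have g2 := mul_le_mul_of_nonneg_left (inv_gamma_mul_le hK hc hs)
      (by positivity : 0 ≤ 6 * Lhat K s ^ 2 * (|K.Δy| / kappa K s))
    have g3 := mul_le_mul_of_nonneg_left (pow_le_pow_left₀ (by linarith) hΛs 2)
      (by positivity : 0 ≤ 12 / c * |K.Δy|)
    have e1 : 6 * Lhat K s ^ 2 / (s.γ * s.μ) * (|K.Δy| / kappa K s) =
      6 * Lhat K s ^ 2 * (|K.Δy| / kappa K s) * (1 / (s.μ * s.γ)) := by field_simp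
    have e2 : 6 * Lhat K s ^ 2 * (|K.Δy| / kappa K s) * (2 / c * kappa K s) =
      12 / c * |K.Δy| * Lhat K s ^ 2 := by field_simp; ring
    linarith
  have h3 := hi s hs
  have h4 := mul_le_mul_of_nonneg_right (hn s hs) (by linarith : 0 ≤ l)
  have hκ4 : 0 < kappa K s ^ 4 := by positivity
  have h5 : kappa K s ^ 4 ≤ 2 * (kappa K s ^ 4 * l) := by
    have := mul_le_mul_of_nonneg_left hl hκ4.le
    linarith
  have g1 := mul_le_mul_of_nonneg_left h5 (by positivity :
    0 ≤ 1 / c * (300 + 300 / c) * CΛ * |K.Δ| + 12 / c * CΛ ^ 2 * |K.Δy| + Ci)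
  linear_combination h1 + h2 + h3 + h4 + g1

theorem half_le_log_succ {T : ℕ} (hT : 1 ≤ T) : 1 / 2 ≤ Real.log ((T : ℝ) + 1) := by
  have h1 : (1 : ℝ) ≤ T := by exact_mod_cast hT
  have h2 := Real.log_le_log (by norm_num) (by linarith : (2 : ℝ) ≤ T + 1)
  have := Real.log_two_gt_d9
  linarith

/-- The convergence rate, with the bias of the Neumann series unamplified. -/
theorem exists_rate (hK : K.Valid) (hc : 0 < c) : ∃ C, 0 < C ∧
    ∀ s : Config, s.Admissible K c →
    ∀ {p d : ℕ} {Ξf Ξg Ω : Type*} [MeasurableSpace Ξf] [MeasurableSpace Ξg]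
      [MeasurableSpace Ω] {P : Problem p d s.M Ξf Ξg}, Assumptions K s.μ P →
    ∀ {Pr : Measure Ω} [IsProbabilityMeasure Pr]
      {ξf : ℕ × Fin s.M × ℕ → Ω → Ξf} {ξg : GIndex s.M → Ω → Ξg}, IsSampling P Pr ξf ξg →
    ∀ {x₁ : E p} {y₁ : E d}, GoodInit K s P x₁ y₁ →
    ∀ T : ℕ, 1 ≤ T → avgGradSq K s P Pr ξf ξg x₁ y₁ T ≤
      C * (Real.log ((T : ℝ) + 1) *
        (kappa K s ^ (19 / 3 : ℝ) * (s.I : ℝ) ^ (3 / 2 : ℝ) / (T : ℝ)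
          + kappa K s ^ (16 / 3 : ℝ) / (bM s * (T : ℝ)) ^ (2 / 3 : ℝ)) + G1 K s ^ 2) := by
  obtain ⟨Cα, hCα, hα⟩ := exists_inv_alpha_le hK c
  obtain ⟨Cb, hCb, hb⟩ := exists_bracket_le hK hc
  refine ⟨2 * Cα * Cb + 9 / 2, by positivity, fun s hs p d Ξf Ξg Ω _ _ _ P hA Pr _ ξf ξg hS x₁ y₁
    hI T hT => ?_⟩
  have hκ := one_le_kappa hs
  have hβ := one_le_bM hs
  have hT' : (0 : ℝ) < T := by exact_mod_cast hT
  have hl := half_le_log_succ hT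
  obtain ⟨l, hld⟩ : ∃ l, l = Real.log ((T : ℝ) + 1) := ⟨_, rfl⟩
  have h1 := hA.avgGradSq_le hK hc hs hS hI hT
  rw [← hld] at hl h1 ⊢
  have hα0 := alpha_pos hK hs T
  have h2 := mul_le_mul_of_nonneg_left (hb s hs l hl)
    (by positivity : 0 ≤ 2 / (T : ℝ) * (1 / alpha K s T))
  have h3 := mul_le_mul_of_nonneg_left (hα s hs T)
    (by positivity : 0 ≤ 2 / (T : ℝ) * (Cb * (kappa K s ^ 4 * l)))
  -- `κ⁴` comes from the bracket, `κ^{4/3}` and the further `κ` from `1 / α_T`.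
  have e1 : kappa K s ^ (19 / 3 : ℝ) = kappa K s ^ 4 * kappa K s ^ (4 / 3 : ℝ) * kappa K s := by
    rw [← Real.rpow_natCast, ← Real.rpow_add (by positivity), ← Real.rpow_add_one (by positivity)]
    norm_num
  have e2 : kappa K s ^ (16 / 3 : ℝ) = kappa K s ^ 4 * kappa K s ^ (4 / 3 : ℝ) := by
    rw [← Real.rpow_natCast, ← Real.rpow_add (by positivity)]
    norm_num
  have e3 : (bM s * (T : ℝ)) ^ (2 / 3 : ℝ) = bM s ^ (2 / 3 : ℝ) * (T : ℝ) ^ (2 / 3 : ℝ) :=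
    Real.mul_rpow (by positivity) (by positivity)
  have e4 : (T : ℝ) = (T : ℝ) ^ (1 / 3 : ℝ) * (T : ℝ) ^ (2 / 3 : ℝ) := by
    rw [← Real.rpow_add hT']; norm_num
  have hθ0 : 0 < (T : ℝ) ^ (2 / 3 : ℝ) := by positivity
  have hθ1 : 0 < (T : ℝ) ^ (1 / 3 : ℝ) := by positivity
  have e5 : kappa K s ^ 4 * kappa K s ^ (4 / 3 : ℝ) / (bM s * (T : ℝ)) ^ (2 / 3 : ℝ) =
      kappa K s ^ 4 * kappa K s ^ (4 / 3 : ℝ) *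
        ((T : ℝ) ^ (1 / 3 : ℝ) / bM s ^ (2 / 3 : ℝ)) / T := by
    have e0 : (T : ℝ) ^ (1 / 3 : ℝ) / bM s ^ (2 / 3 : ℝ) *
        (bM s ^ (2 / 3 : ℝ) * (T : ℝ) ^ (2 / 3 : ℝ)) = T := by
      rw [← mul_assoc, div_mul_cancel₀ _ (by positivity), ← e4]
    rw [e3, div_eq_div_iff (by positivity) hT'.ne']
    linear_combination (-(kappa K s ^ 4 * kappa K s ^ (4 / 3 : ℝ))) * e0
  rw [e1, e2, e5]
  have hG : 0 ≤ 2 * Cα * Cb * G1 K s ^ 2 := by positivity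
  have hR : 0 ≤ 9 / 2 * (l * (kappa K s ^ 4 * kappa K s ^ (4 / 3 : ℝ) * kappa K s *
      (s.I : ℝ) ^ (3 / 2 : ℝ) / (T : ℝ) + kappa K s ^ 4 * kappa K s ^ (4 / 3 : ℝ) *
        ((T : ℝ) ^ (1 / 3 : ℝ) / bM s ^ (2 / 3 : ℝ)) / T)) := by positivity
  have e6 : 2 / (T : ℝ) * (Cb * (kappa K s ^ 4 * l)) * (Cα * (kappa K s ^ (4 / 3 : ℝ) *
      (kappa K s * (s.I : ℝ) ^ (3 / 2 : ℝ) + (T : ℝ) ^ (1 / 3 : ℝ) / bM s ^ (2 / 3 : ℝ)))) =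
      2 * Cα * Cb * (l * (kappa K s ^ 4 * kappa K s ^ (4 / 3 : ℝ) * kappa K s *
      (s.I : ℝ) ^ (3 / 2 : ℝ) / (T : ℝ) + kappa K s ^ 4 * kappa K s ^ (4 / 3 : ℝ) *
        ((T : ℝ) ^ (1 / 3 : ℝ) / bM s ^ (2 / 3 : ℝ)) / T)) := by ring
  linarith

end Rates

/-! ### Solving the rate for `T`, `I` and `Q` -/

section Complexity

variable {K : Constants} {c : ℝ}

/-- In the application `l = log (T + 1)`, `w² = log (κ / ε)` and `q³` is `T` divided by its scale
without logarithm. The rate is a multiple of `ε l / q²`, so a large `D` makes it a small multiple of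
`ε`. -/
theorem div_sq_le_of_le {D w q l : ℝ} (hD : 2 ≤ D) (hw : 1 / 2 ≤ w) (hq : D * w ≤ q)
    (hl : l ≤ 9 * w ^ 2 + 3 * q) : l / q ^ 2 ≤ 15 / D := by
  have h1 : D ≤ 2 * q := by
    have := mul_le_mul_of_nonneg_left hw (by linarith : 0 ≤ D)
    linarith
  have hq0 : 0 < q := by linarith
  have h2 : w ≤ q := by
    have := mul_le_mul_of_nonneg_right (by linarith : 1 ≤ D) (by linarith : 0 ≤ w)
    linarith
  rw [div_le_div_iff₀ (by positivity) (by linarith)]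
  have h3 := mul_le_mul_of_nonneg_right hl (by linarith : 0 ≤ D)
  have h4 := mul_le_mul_of_nonneg_left h1 hq0.le
  have h5 := mul_le_mul_of_nonneg_left hq (by linarith : 0 ≤ w)
  have h6 := mul_le_mul_of_nonneg_right h2 hq0.le
  linarith

/-- The exponent `10/9` of `κ` in the cap on `I` becomes `5/3`, which completes `19/3` to `8` in the
first term of the rate. -/
theorem rpow_mul_three_half {A κ β ε : ℝ} (hA : 0 < A) (hκ : 0 < κ) (hβ : 0 < β) (hε : 0 < ε) :
    (A * (κ ^ (10 / 9 : ℝ) * β ^ (-(2 / 3) : ℝ) * ε ^ (-(1 / 3) : ℝ))) ^ (3 / 2 : ℝ) =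
      A ^ (3 / 2 : ℝ) * (κ ^ (5 / 3 : ℝ) * β⁻¹ * ε ^ (-(1 / 2) : ℝ)) := by
  rw [Real.mul_rpow (by positivity) (by positivity), Real.mul_rpow (by positivity) (by positivity),
    Real.mul_rpow (by positivity) (by positivity), ← Real.rpow_mul hκ.le, ← Real.rpow_mul hβ.le,
    ← Real.rpow_mul hε.le, ← Real.rpow_neg_one β]
  norm_num

/-- The bias of the Neumann series is negligible if `Q` is of order `κ log (κ / (bMε))`. -/
theorem exists_G1_sq_le (hK : K.Valid) (hc : 0 < c) {A δ : ℝ} (hA : 0 < A) (hδ : 0 < δ) :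
    ∃ C, 0 < C ∧ ∀ ε : ℝ, 0 < ε → ∀ s : Config, s.Admissible K c → c / K.L ≤ s.τ →
      bM s * ε ≤ 1 / 2 →
      (s.I : ℝ) ≤
        A * (kappa K s ^ (10 / 9 : ℝ) * bM s ^ (-(2 / 3) : ℝ) * ε ^ (-(1 / 3) : ℝ)) →
      C * (kappa K s * Real.log (kappa K s / (bM s * ε))) ≤ (s.Q : ℝ) →
      G1 K s ^ 2 ≤ δ * ε := by
  -- `z = bM ε / κ` is at most `1/2`, so `z^(2N) ≤ 4^(-N)` supplies the small constant `δ`. The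
  -- three further powers of `z` in the exponent `N + 3` handle `κ` and `ε`. The summand `1` in the
  -- denominator covers `C_f = 0`.
  obtain ⟨N, hN⟩ := exists_pow_lt_of_lt_one
    (by positivity : 0 < δ / (K.Cf ^ 2 * A ^ 3 + 1)) (by norm_num : (1 / 4 : ℝ) < 1)
  refine ⟨(N + 3) / c, by positivity, fun ε hε s hs hτ hβε hI hQ => ?_⟩
  have hκ := one_le_kappa hs
  have hβ := one_le_bM hs
  have hI1 := one_le_I hs
  have hL := hK.L_pos
  have hμ := hs.μ_pos
  have hκ0 : 0 < kappa K s := by linarith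
  obtain ⟨z, hz⟩ : ∃ z, z = bM s * ε / kappa K s := ⟨_, rfl⟩
  have hz0 : 0 < z := by rw [hz]; positivity
  have hzκ : z * kappa K s ≤ 1 / 2 := by rw [hz, div_mul_cancel₀ _ hκ0.ne']; exact hβε
  have hz2 : z ≤ 1 / 2 := (le_mul_of_one_le_right hz0.le hκ).trans hzκ
  -- the power of the contraction factor
  have hlog : Real.log (kappa K s / (bM s * ε)) = -Real.log z := by
    rw [hz, ← Real.log_inv, inv_div]
  have hpow : (1 - s.τ * s.μ) ^ (s.Q + 1) ≤ z ^ (N + 3) := by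
    have h0 : 0 ≤ 1 - s.τ * s.μ := sub_nonneg.2 (hs.τμ_lt hK).le
    have h0' : 1 - s.τ * s.μ ≤ 1 := by have := mul_pos hs.τ_pos hμ; linarith
    have h1 : c / kappa K s ≤ s.τ * s.μ := by
      have := mul_le_mul_of_nonneg_right hτ hμ.le
      refine le_trans (le_of_eq ?_) this
      unfold kappa; field_simp
    have h2 : 1 - s.τ * s.μ ≤ Real.exp (-(c / kappa K s)) := by
      have := Real.add_one_le_exp (-(c / kappa K s))
      linarith
    have h3 : (1 - s.τ * s.μ) ^ (s.Q + 1) ≤ (1 - s.τ * s.μ) ^ s.Q :=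
      pow_le_pow_of_le_one h0 h0' (Nat.le_succ _)
    have h4 := pow_le_pow_left₀ h0 h2 s.Q
    have h5 : Real.exp (-(c / kappa K s)) ^ s.Q ≤ Real.exp ((N + 3 : ℕ) * Real.log z) := by
      rw [← Real.exp_nat_mul]
      refine Real.exp_le_exp.2 ?_
      rw [hlog] at hQ
      have h6 := mul_le_mul_of_nonneg_right hQ (by positivity : 0 ≤ c / kappa K s)
      have e : (N + 3) / c * (kappa K s * -Real.log z) * (c / kappa K s) =
        -((N + 3) * Real.log z) := by field_simp
      rw [e] at h6
      push_cast
      linarith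
    rw [Real.exp_nat_mul, Real.exp_log hz0] at h5
    exact h3.trans (h4.trans h5)
  have hp0 : 0 ≤ (1 - s.τ * s.μ) ^ (s.Q + 1) :=
    pow_nonneg (sub_nonneg.2 (hs.τμ_lt hK).le) _
  have h1 : G1 K s ^ 2 ≤ kappa K s ^ 2 * K.Cf ^ 2 * (z ^ (N + 3)) ^ 2 := by
    have := mul_le_mul_of_nonneg_left (pow_le_pow_left₀ hp0 hpow 2)
      (by positivity : 0 ≤ kappa K s ^ 2 * K.Cf ^ 2)
    refine le_trans (le_of_eq ?_) this
    unfold G1; ring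
  -- `z² ≤ A³ κ² ε`
  have hzz : z ^ 2 ≤ A ^ 3 * kappa K s ^ 2 * ε := by
    have h2 := pow_le_pow_left₀ zero_le_one (hI1.trans hI) 3
    -- Because `I ≥ 1`, the upper bound on `I` also yields `(bM)² ε ≤ A³ κ^{10/3}`. This trades one
    -- factor `z²` for a factor `ε`.
    have e1 : (kappa K s ^ (10 / 9 : ℝ)) ^ 3 = kappa K s ^ (10 / 3 : ℝ) := by
      rw [← Real.rpow_natCast, ← Real.rpow_mul hκ0.le]; norm_num
    have e2 : (bM s ^ (-(2 / 3) : ℝ)) ^ 3 = (bM s ^ 2)⁻¹ := by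
      rw [Real.rpow_neg (by positivity), inv_pow, rpow_two_third_cube (by positivity)]
    have e3 : (ε ^ (-(1 / 3) : ℝ)) ^ 3 = ε⁻¹ := by
      rw [Real.rpow_neg hε.le, inv_pow, rpow_third_cube hε.le]
    have h3 : kappa K s ^ (10 / 3 : ℝ) ≤ kappa K s ^ 4 := by
      rw [← Real.rpow_natCast]
      exact Real.rpow_le_rpow_of_exponent_le hκ (by norm_num)
    rw [mul_pow, mul_pow, mul_pow, e1, e2, e3] at h2
    have h4 := mul_le_mul_of_nonneg_left h3 (by positivity : 0 ≤ A ^ 3 * ((bM s ^ 2)⁻¹ * ε⁻¹))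
    have h5 : 1 ≤ A ^ 3 * ((bM s ^ 2)⁻¹ * ε⁻¹) * kappa K s ^ 4 := by linarith
    have h6 := mul_le_mul_of_nonneg_right h5 (by positivity : 0 ≤ z ^ 2)
    rw [one_mul] at h6
    refine h6.trans (le_of_eq ?_)
    rw [hz]; field_simp
  have h7 : (z * kappa K s) ^ 4 ≤ 1 := pow_le_one₀ (by positivity) (by linarith)
  have h8 : z ^ (2 * N) ≤ δ / (K.Cf ^ 2 * A ^ 3 + 1) := by
    rw [pow_mul]
    have : z ^ 2 ≤ 1 / 4 := by
      have := pow_le_pow_left₀ hz0.le hz2 2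
      linarith
    exact (pow_le_pow_left₀ (by positivity) this N).trans hN.le
  have h9 : K.Cf ^ 2 * A ^ 3 * z ^ (2 * N) ≤ δ := by
    have g := mul_le_mul_of_nonneg_left h8 (by positivity : 0 ≤ K.Cf ^ 2 * A ^ 3 + 1)
    rw [mul_div_cancel₀ _ (by positivity)] at g
    have : 0 < z ^ (2 * N) := by positivity
    linarith
  have g1 := mul_le_mul_of_nonneg_left hzz
    (by positivity : 0 ≤ kappa K s ^ 2 * K.Cf ^ 2 * (z ^ 4 * z ^ (2 * N)))
  have g2 := mul_le_mul_of_nonneg_right h7 (by positivity : 0 ≤ K.Cf ^ 2 * A ^ 3 * z ^ (2 * N) * ε)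
  have g3 := mul_le_mul_of_nonneg_right h9 hε.le
  have e1 : kappa K s ^ 2 * K.Cf ^ 2 * (z ^ (N + 3)) ^ 2 =
    kappa K s ^ 2 * K.Cf ^ 2 * (z ^ 4 * z ^ (2 * N)) * z ^ 2 := by ring
  have e2 : kappa K s ^ 2 * K.Cf ^ 2 * (z ^ 4 * z ^ (2 * N)) * (A ^ 3 * kappa K s ^ 2 * ε) =
    (z * kappa K s) ^ 4 * (K.Cf ^ 2 * A ^ 3 * z ^ (2 * N) * ε) := by ring
  linarith

/-- The rate is below `ε / 2` if `T` is of order `κ⁸ (bM)⁻¹ ε^{-3/2} log(κ/ε)^{3/2}`. -/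
theorem exists_rate_le {A C₀ : ℝ} (hA : 0 < A) (hC₀ : 0 < C₀) :
    ∃ C, 0 < C ∧ ∀ ε κ β ι : ℝ, 0 < ε → 1 ≤ κ → 1 ≤ β → 1 ≤ ι → β * ε ≤ 1 / 2 →
      ι ≤ A * (κ ^ (10 / 9 : ℝ) * β ^ (-(2 / 3) : ℝ) * ε ^ (-(1 / 3) : ℝ)) →
      ∀ T : ℕ, C * (κ ^ 8 * β⁻¹ * ε ^ (-(3 / 2) : ℝ) * Real.log (κ / ε) ^ (3 / 2 : ℝ)) ≤ (T : ℝ) →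
      1 ≤ T ∧ C₀ * (Real.log ((T : ℝ) + 1) * (κ ^ (19 / 3 : ℝ) * ι ^ (3 / 2 : ℝ) / (T : ℝ)
          + κ ^ (16 / 3 : ℝ) / (β * (T : ℝ)) ^ (2 / 3 : ℝ))) ≤ ε / 2 := by
  -- The bound `15 / D` of `div_sq_le_of_le` has to bring `C₀ (A^{3/2} + 1) ε` below `ε / 2`, hence
  -- the `30`; the `2` ensures `D ≥ 2`.
  obtain ⟨D, hD⟩ : ∃ D, D = 30 * C₀ * (A ^ (3 / 2 : ℝ) + 1) + 2 := ⟨_, rfl⟩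
  have hA3 : 0 < A ^ (3 / 2 : ℝ) := by positivity
  have hD2 : 2 ≤ D := by
    have : 0 ≤ 30 * C₀ * (A ^ (3 / 2 : ℝ) + 1) := by positivity
    linarith
  refine ⟨D ^ 3, by positivity, fun ε κ β ι hε hκ hβ hι hβε hιA T hT => ?_⟩
  have hε2 : ε ≤ 1 / 2 := (le_mul_of_one_le_left hε.le hβ).trans hβε
  have hκ0 : 0 < κ := by linarith
  have hκε : 2 ≤ κ / ε := by rw [le_div_iff₀ hε]; linarith
  obtain ⟨lam, hlam⟩ : ∃ l, l = Real.log (κ / ε) := ⟨_, rfl⟩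
  have hlog2 : Real.log 2 ≤ lam := by rw [hlam]; exact Real.log_le_log (by norm_num) hκε
  have hlam1 : 1 / 4 ≤ lam := by have := Real.log_two_gt_d9; linarith
  -- The scale of `T` without its logarithm. Writing `T = a q³` turns the hypothesis on `T` into `D
  -- w ≤ q`, with `w` the root of the logarithm.
  obtain ⟨a, ha⟩ : ∃ a, a = κ ^ 8 * β⁻¹ * ε ^ (-(3 / 2) : ℝ) := ⟨_, rfl⟩
  have ha0 : 0 < a := by rw [ha]; positivity
  rw [← ha, ← hlam] at hT
  obtain ⟨w, hw⟩ : ∃ w, w = Real.sqrt lam := ⟨_, rfl⟩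
  have hw2 : w ^ 2 = lam := by rw [hw]; exact Real.sq_sqrt (by linarith)
  have hw1 : 1 / 2 ≤ w := by
    rw [hw]; exact Real.le_sqrt_of_sq_le (by linarith)
  have hw3 : lam ^ (3 / 2 : ℝ) = w ^ 3 := by
    rw [hw, Real.sqrt_eq_rpow, ← Real.rpow_natCast, ← Real.rpow_mul (by linarith)]; norm_num
  rw [hw3] at hT
  have hT0 : (0 : ℝ) < T := lt_of_lt_of_le (by positivity) hT
  have hT1 : 1 ≤ T := by exact_mod_cast hT0
  have hT1' : (1 : ℝ) ≤ T := by exact_mod_cast hT1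
  refine ⟨hT1, ?_⟩
  obtain ⟨q, hq⟩ : ∃ q, q = ((T : ℝ) / a) ^ (1 / 3 : ℝ) := ⟨_, rfl⟩
  have hq0 : 0 < q := by rw [hq]; positivity
  have hq3 : q ^ 3 = T / a := by rw [hq]; exact rpow_third_cube (by positivity)
  have hTq : (T : ℝ) = a * q ^ 3 := by rw [hq3]; field_simp
  have hDq : D * w ≤ q := by
    refine le_of_pow_le_pow_left₀ three_ne_zero hq0.le ?_
    rw [hq3, le_div_iff₀ ha0, mul_pow]
    linarith
  have hq1 : 1 ≤ q := by
    have := mul_le_mul hD2 hw1 (by norm_num) (by linarith)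
    linarith
  -- `log (T + 1) ≤ log 2 + log a + 3 log q`, where `log 2 ≤ w²`, `log a ≤ 8 w²` because `a ≤ (κ /
  -- ε)⁸`, and `log q ≤ q`.
  have hl : Real.log ((T : ℝ) + 1) ≤ 9 * w ^ 2 + 3 * q := by
    have h1 : Real.log ((T : ℝ) + 1) ≤ Real.log (2 * (a * q ^ 3)) :=
      Real.log_le_log (by positivity) (by linarith)
    have h2 : Real.log (2 * (a * q ^ 3)) = Real.log 2 + (Real.log a + 3 * Real.log q) := by
      rw [Real.log_mul (by norm_num) (by positivity), Real.log_mul ha0.ne' (by positivity),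
        Real.log_pow]
      norm_num
    have h3 : Real.log q ≤ q := (Real.log_le_sub_one_of_pos hq0).trans (by linarith)
    have h4 : Real.log a ≤ 8 * lam := by
      have h5 : a ≤ (κ / ε) ^ 8 := by
        have g1 : β⁻¹ ≤ 1 := inv_le_one_of_one_le₀ hβ
        have g2 : ε ^ (-(3 / 2) : ℝ) ≤ (ε ^ 8)⁻¹ := by
          rw [Real.rpow_neg hε.le, ← Real.rpow_natCast]
          gcongr 1
          exact Real.rpow_le_rpow_of_exponent_ge hε (by linarith) (by norm_num)
        rw [ha, div_pow, div_eq_mul_inv]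
        refine mul_le_mul ?_ g2 (by positivity) (by positivity)
        exact mul_le_of_le_one_right (by positivity) g1
      have h6 := Real.log_le_log ha0 h5
      rw [Real.log_pow, ← hlam] at h6
      exact_mod_cast h6
    rw [hw2]; linarith
  have key := div_sq_le_of_le hD2 hw1 hDq hl
  have hl0 : 0 ≤ Real.log ((T : ℝ) + 1) := Real.log_nonneg (by linarith)
  obtain ⟨l, hld⟩ : ∃ l, l = Real.log ((T : ℝ) + 1) := ⟨_, rfl⟩
  rw [← hld] at key hl0 ⊢
  -- the two terms of the rate
  have t1 : κ ^ (19 / 3 : ℝ) * ι ^ (3 / 2 : ℝ) / (T : ℝ) ≤ A ^ (3 / 2 : ℝ) * ε / q ^ 2 := by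
    have h1 : ι ^ (3 / 2 : ℝ) ≤ A ^ (3 / 2 : ℝ) * (κ ^ (5 / 3 : ℝ) * β⁻¹ * ε ^ (-(1 / 2) : ℝ)) :=
      (Real.rpow_le_rpow (by linarith) hιA (by norm_num)).trans_eq
        (rpow_mul_three_half hA hκ0 (by linarith) hε)
    have h2 := mul_le_mul_of_nonneg_left h1 (by positivity : 0 ≤ κ ^ (19 / 3 : ℝ))
    have e1 : κ ^ (19 / 3 : ℝ) * κ ^ (5 / 3 : ℝ) = κ ^ 8 := by
      rw [← Real.rpow_add hκ0, ← Real.rpow_natCast]; norm_num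
    have e2 : ε ^ (-(1 / 2) : ℝ) = ε ^ (-(3 / 2) : ℝ) * ε := by
      rw [← Real.rpow_add_one hε.ne']; norm_num
    have e3 : κ ^ (19 / 3 : ℝ) * (A ^ (3 / 2 : ℝ) *
        (κ ^ (5 / 3 : ℝ) * β⁻¹ * ε ^ (-(1 / 2) : ℝ))) = A ^ (3 / 2 : ℝ) * ε * a := by
      rw [e2, ha, ← e1]; ring
    rw [e3] at h2
    have h3 : q ^ 2 ≤ q ^ 3 := pow_le_pow_right₀ hq1 (by norm_num)
    rw [div_le_div_iff₀ hT0 (by positivity), hTq]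
    have g1 := mul_le_mul_of_nonneg_right h2 (by positivity : 0 ≤ q ^ 2)
    have g2 := mul_le_mul_of_nonneg_left h3 (by positivity : 0 ≤ A ^ (3 / 2 : ℝ) * ε * a)
    linarith
  have t2 : κ ^ (16 / 3 : ℝ) / (β * (T : ℝ)) ^ (2 / 3 : ℝ) = ε / q ^ 2 := by
    have h1 : β * (T : ℝ) = κ ^ 8 * ε ^ (-(3 / 2) : ℝ) * q ^ 3 := by
      rw [hTq, ha]; field_simp
    have e1 : (κ ^ 8) ^ (2 / 3 : ℝ) = κ ^ (16 / 3 : ℝ) := by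
      rw [← Real.rpow_natCast, ← Real.rpow_mul hκ0.le]; norm_num
    have e2 : (ε ^ (-(3 / 2) : ℝ)) ^ (2 / 3 : ℝ) = ε⁻¹ := by
      rw [← Real.rpow_mul hε.le, ← Real.rpow_neg_one]; norm_num
    have e3 : (q ^ 3) ^ (2 / 3 : ℝ) = q ^ 2 := by
      rw [← Real.rpow_natCast, ← Real.rpow_mul hq0.le, ← Real.rpow_natCast]; norm_num
    rw [h1, Real.mul_rpow (by positivity) (by positivity),
      Real.mul_rpow (by positivity) (by positivity), e1, e2, e3]
    field_simp
  rw [t2]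
  have h1 := mul_le_mul_of_nonneg_left t1 (by positivity : 0 ≤ C₀ * l)
  have h2 := mul_le_mul_of_nonneg_left key
    (by positivity : 0 ≤ C₀ * ((A ^ (3 / 2 : ℝ) + 1) * ε))
  have h3 : C₀ * ((A ^ (3 / 2 : ℝ) + 1) * ε) * (15 / D) ≤ ε / 2 := by
    rw [← mul_div_assoc, div_le_div_iff₀ (by linarith) two_pos]
    have : 0 ≤ ε * 2 := by positivity
    have e : ε * D = ε * (30 * C₀ * (A ^ (3 / 2 : ℝ) + 1)) + ε * 2 := by rw [hD]; ring
    linarith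
  have e : C₀ * (l * (A ^ (3 / 2 : ℝ) * ε / q ^ 2 + ε / q ^ 2)) =
    C₀ * ((A ^ (3 / 2 : ℝ) + 1) * ε) * (l / q ^ 2) := by ring
  linarith

end Complexity

end FedBiOAccLocal

/-! ### The two assertions of the theorem -/

theorem mainTheorem2 (K : Constants) (hK : K.Valid) (c : ℝ) (hc0 : 0 < c) (hc1 : c < 1) :
    (∃ C : ℝ, 0 < C ∧
      ∀ s : Config, s.Admissible K c →
      ∀ (p d : ℕ) (Ξf Ξg Ω : Type*) [MeasurableSpace Ξf] [MeasurableSpace Ξg]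
        [MeasurableSpace Ω] (P : Problem p d s.M Ξf Ξg), Assumptions K s.μ P →
      ∀ (Pr : MeasureTheory.Measure Ω) [MeasureTheory.IsProbabilityMeasure Pr]
        (ξf : ℕ × Fin s.M × ℕ → Ω → Ξf) (ξg : GIndex s.M → Ω → Ξg), IsSampling P Pr ξf ξg →
      ∀ (x₁ : E p) (y₁ : E d), GoodInit K s P x₁ y₁ →
        Differentiable ℝ P.h ∧
        (∀ n, MeasureTheory.Integrable
          (fun ω => gradSq K s P (fun i => ξf i ω) (fun i => ξg i ω) x₁ y₁ n) Pr) ∧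
        ∀ T : ℕ, 1 ≤ T →
          avgGradSq K s P Pr ξf ξg x₁ y₁ T ≤
            C * (Real.log ((T : ℝ) + 1) *
                  (kappa K s ^ (19 / 3 : ℝ) * (s.I : ℝ) ^ (3 / 2 : ℝ) / (T : ℝ)
                    + kappa K s ^ (16 / 3 : ℝ) / (bM s * (T : ℝ)) ^ (2 / 3 : ℝ))
                + kappa K s ^ 3 * bM s ^ 2 * (s.I : ℝ) ^ (9 / 2 : ℝ) * G1 K s ^ 2)) ∧
    (∀ A : ℝ, 0 < A → ∃ C : ℝ, 0 < C ∧
      ∀ (ε : ℝ), 0 < ε →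
      ∀ s : Config, s.Admissible K c → c / K.L ≤ s.τ → bM s * ε ≤ 1 / 2 →
        (s.I : ℝ) ≤
          A * (kappa K s ^ (10 / 9 : ℝ) * bM s ^ (-(2 / 3) : ℝ) * ε ^ (-(1 / 3) : ℝ)) →
        C * (kappa K s * Real.log (kappa K s / (bM s * ε))) ≤ (s.Q : ℝ) →
      ∀ (p d : ℕ) (Ξf Ξg Ω : Type*) [MeasurableSpace Ξf] [MeasurableSpace Ξg]
        [MeasurableSpace Ω] (P : Problem p d s.M Ξf Ξg), Assumptions K s.μ P →
      ∀ (Pr : MeasureTheory.Measure Ω) [MeasureTheory.IsProbabilityMeasure Pr]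
        (ξf : ℕ × Fin s.M × ℕ → Ω → Ξf) (ξg : GIndex s.M → Ω → Ξg), IsSampling P Pr ξf ξg →
      ∀ (x₁ : E p) (y₁ : E d), GoodInit K s P x₁ y₁ →
      ∀ T : ℕ,
        C * (kappa K s ^ 8 * (bM s)⁻¹ * ε ^ (-(3 / 2) : ℝ)
            * Real.log (kappa K s / ε) ^ (3 / 2 : ℝ)) ≤ (T : ℝ) →
        avgGradSq K s P Pr ξf ξg x₁ y₁ T ≤ ε) := by
  refine ⟨?_, fun A hA => ?_⟩
  · obtain ⟨C₀, hC₀, hrate⟩ := exists_rate hK hc0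
    refine ⟨C₀, hC₀, fun s hs p d Ξf Ξg Ω _ _ _ P hA Pr _ ξf ξg hS x₁ y₁ hI => ⟨fun x =>
      (hA.hasGradientAt_h hK hs.μ_pos x).differentiableAt, fun n => ?_, fun T hT => ?_⟩⟩
    · simp only [hA.gradSq_eq hK hs]
      exact hA.integrable_hGrad_sq hK hs hS n
    refine (hrate s hs hA hS hI T hT).trans ?_
    have hκ := one_le_kappa hs
    have hβ := one_le_bM hs
    have h1 : 1 ≤ (s.I : ℝ) ^ (9 / 2 : ℝ) := Real.one_le_rpow (one_le_I hs) (by norm_num)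
    -- The factor of the bias in the statement is at least one, so the unamplified bound of
    -- `exists_rate` is stronger than what is asserted.
    have h2 : 1 ≤ kappa K s ^ 3 * bM s ^ 2 * (s.I : ℝ) ^ (9 / 2 : ℝ) :=
      one_le_mul_of_one_le_of_one_le
        (one_le_mul_of_one_le_of_one_le (one_le_pow₀ hκ) (one_le_pow₀ hβ)) h1
    gcongr
    exact le_mul_of_one_le_left (sq_nonneg _) h2
  · obtain ⟨C₀, hC₀, hrate⟩ := exists_rate hK hc0
    -- The choice `δ = 1 / (2 C₀)` gives the bias one half of `ε`; the other half is left for the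
    -- logarithmic terms.
    obtain ⟨C₁, hC₁, hG⟩ := exists_G1_sq_le hK hc0 hA (by positivity : 0 < 1 / (2 * C₀))
    obtain ⟨C₂, hC₂, hT⟩ := exists_rate_le hA hC₀
    refine ⟨max C₁ C₂, lt_max_of_lt_left hC₁, fun ε hε s hs hτ hβε hI hQ p d Ξf Ξg Ω _ _ _ P hP Pr
      _ ξf ξg hS x₁ y₁ hinit T hTle => ?_⟩
    have hκ := one_le_kappa hs
    have hβ := one_le_bM hs
    have hκε : 1 ≤ kappa K s / ε := by
      rw [le_div_iff₀ hε]
      linarith [le_mul_of_one_le_left hε.le hβ]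
    have hκβε : 1 ≤ kappa K s / (bM s * ε) := by
      rw [le_div_iff₀ (by positivity)]
      linarith
    have hl1 := Real.log_nonneg hκε
    have hl2 := Real.log_nonneg hκβε
    have h1 := hG ε hε s hs hτ hβε hI
      ((mul_le_mul_of_nonneg_right (le_max_left C₁ C₂) (by positivity)).trans hQ)
    obtain ⟨hT1, h2⟩ := hT ε (kappa K s) (bM s) s.I hε hκ hβ (one_le_I hs) hβε hI T
      ((mul_le_mul_of_nonneg_right (le_max_right C₁ C₂) (by positivity)).trans hTle)
    have h3 := hrate s hs hP hS hinit T hT1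
    have h4 := mul_le_mul_of_nonneg_left h1 hC₀.le
    have e : C₀ * (1 / (2 * C₀) * ε) = ε / 2 := by field_simp
    rw [mul_add] at h3
    linarith
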